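/- Let $X$ be a compact complex surface, $L_1,L_2$ holomorphic line bundles on $X$, $V=L_1\oplus L_2$ (total space) with projection $\pi:V\to X$, and let $f\in H^0(L_1^{\otimes 2})$, $g\in H^0(L_2^{\otimes 2})$ be such that the divisors $\{f=0\}$ and $\{g=0\}$ are smooth and intersect transversally in a set $M$ of $m$ points. For $C^\infty$ sections $\Phi$ of $L_1^{\otimes 2}\otimes L_2^{-1}$ and $\Psi$ of $L_2^{\otimes 2}\otimes L_1^{-1}$ let $$Z=\{(z,w)\in V:\ z^2=f+w\Phi,\ w^2=g+z\Psi\},\qquad R=\{(z,w)\in Z:\ 4zw=\Phi\Psi\},$$ let $\Delta\subset X$ be the set of critical values of $\pi|_Z$, and let $\delta$ be the section of $L_1^{\otimes4}\otimes L_2^{\otimes4}$ with $$-\tfrac1{16}\delta=-f^2g^2-\tfrac98fg(\Phi\Psi)^2+\Psi^2f^3+\Phi^2g^3+\tfrac{27}{16^2}(\Phi\Psi)^4 .$$ A trivial singularity is a point where $f=\Phi=0$ or $g=\Psi=0$. $Z$ is mildly general if $g\Psi\neq0$ wherever $f=\Phi=0$ and $f\Phi\ne0$ wherever $g=\Psi=0$.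 A singular point of $\Delta$ is a point of $\Delta$ at which $\delta$, read in a local trivialization, does not have surjective real differential. A cusp (node) of $\Delta$ is a point $x$ such that $\delta=h\cdot(u^2-v^3)$ (respectively $\delta=h\cdot uv$) near $x$, with $h$ smooth and nowhere zero and $(u,v)$ a smooth $\mathbb C^2$-valued local coordinate system centred at $x$. Fix a $C^1$ norm $\|\cdot\|$ on sections (defined by a finite cover of $X$ by compact sets lying in charts and trivializations, with $|\cdot|$ the corresponding absolute value), pairwise disjoint open neighbourhoods $U_x$ of the points $x\in M$, and $c>0$. Then there is $\varepsilon>0$ such that for all $\Phi,\Psi$ with $\|\Phi\|<\varepsilon$, $\|\Psi\|<\varepsilon$: (a) $Z$ is a smooth submanifold of $V$ of real dimension $4$; $\pi|_Z:Z\to X$ is a finite branched covering of degree $4$ (it is proper, its fibres are nonempty with at most $4$ points, and with exactly $4$ points precisely over $X\setminus\Delta$, which is dense and over which $\pi|_Z$ is a covering map); its critical set is $R$; and $\Delta=\{\delta=0\}$. (b) If $Z$ is mildly general, then all trivial singularities are singular points of $\Delta$; a point with $f=\Phi=0$ at which $\{f=0\}$ and $\{\Phi=0\}$ meet transversally is a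 node of $\Delta$, and so is a point with $g=\Psi=0$ at which $\{g=0\}$ and $\{\Psi=0\}$ meet transversally; all other singular points of $\Delta$ lie in $\bigcup_{x\in M}U_x$. (c) If $Z$ is mildly general and moreover $|\Phi|\ge c\|\Phi\|$ and $|\Psi|\ge c\|\Psi\|$ at the points of $M$, then $R$ is a smooth orientable submanifold of $V$ of real dimension $2$, and the singular points of $\Delta$ other than the trivial singularities are exactly $3m$ cusps, exactly three of them in each $U_x$, $x\in M$. (Mild generality forces $\Phi,\Psi\ne0$ on $M$, so for fixed $\Phi,\Psi$ with $Z$ mildly general the condition in (c) holds, with some $c>0$, for all multiples $s\Phi,t\Psi$ with $s,t\in\mathbb C\setminus\{0\}$; hence (a)-(c) hold for all sufficiently small nonzero multiples.) -/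

import Mathlib

open Bundle Set Topology Manifold
open scoped ContDiff TensorProduct

noncomputable section

namespace BidoubleCover

/-- The model space of a complex surface. -/
abbrev Model := EuclideanSpace ℂ (Fin 2)

/-! ### Embedded submanifolds, orientability, critical points -/

section Submanifold

variable {EV : Type*} [NormedAddCommGroup EV] [NormedSpace ℝ EV]
  {HV : Type*} [TopologicalSpace HV] (I : ModelWithCorners ℝ EV HV)
  {V : Type*} [TopologicalSpace V] [ChartedSpace HV V]

/-- A `k`-dimensional smooth chart of the subset `S` of the real manifold `V`: a homeomorphism from
a relatively open subset of `S` to an open subset of `ℝᵏ` whose inverse is a smooth immersion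
into `V`. -/
def IsSubmanifoldChart {k : ℕ} {S : Set V}
    (φ : OpenPartialHomeomorph S (EuclideanSpace ℝ (Fin k))) : Prop :=
  ContMDiffOn 𝓘(ℝ, EuclideanSpace ℝ (Fin k)) I ∞ (fun a => (φ.symm a : V)) φ.target ∧
    ∀ a ∈ φ.target, Function.Injective
      (mfderiv 𝓘(ℝ, EuclideanSpace ℝ (Fin k)) I (fun a => (φ.symm a : V)) a)

/-- `S` is a smooth embedded submanifold of `V` of real dimension `k`. -/
def IsSmoothSubmanifold (k : ℕ) (S : Set V) : Prop :=
  ∀ p : S, ∃ φ : OpenPartialHomeomorph S (EuclideanSpace ℝ (Fin k)),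
    IsSubmanifoldChart I φ ∧ p ∈ φ.source

/-- `S` is an orientable smooth embedded submanifold of `V` of real dimension `k`: it is covered by
smooth charts whose transition maps have positive Jacobian determinant. -/
def IsOrientableSubmanifold (k : ℕ) (S : Set V) : Prop :=
  ∃ A : Set (OpenPartialHomeomorph S (EuclideanSpace ℝ (Fin k))),
    (∀ φ ∈ A, IsSubmanifoldChart I φ) ∧
    (∀ p : S, ∃ φ ∈ A, p ∈ φ.source) ∧
    ∀ φ ∈ A, ∀ ψ ∈ A, ∀ p ∈ φ.source ∩ ψ.source,
      0 < (fderiv ℝ (fun a => ψ (φ.symm a)) (φ p)).det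

/-- The tangent vectors at `p` of the subset `S` of `V`: velocities of smooth curves in `S`
through `p`. For a submanifold this is its tangent space. -/
def tangentVectors (S : Set V) (p : V) : Set (TangentSpace I p) :=
  {v | ∃ (γ : ℝ → V) (r : ℝ), 0 < r ∧ ContMDiffOn 𝓘(ℝ, ℝ) I ∞ γ (Ioo (-r) r) ∧
    (∀ t ∈ Ioo (-r) r, γ t ∈ S) ∧ γ 0 = p ∧ (mfderiv 𝓘(ℝ, ℝ) I γ 0 (1 : ℝ) : EV) = v}

/-- The critical set of the restriction to `S` of a map `q : V → X`, where `dim S = dim X`: the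
points of `S` where the differential of the restriction is not an isomorphism. -/
def criticalSet {EX : Type*} [NormedAddCommGroup EX] [NormedSpace ℝ EX]
    {HX : Type*} [TopologicalSpace HX] (J : ModelWithCorners ℝ EX HX)
    {X : Type*} [TopologicalSpace X] [ChartedSpace HX X] (q : V → X) (S : Set V) : Set V :=
  {p | p ∈ S ∧ ¬ BijOn (mfderiv I J q p) (tangentVectors I S p) univ}

end Submanifold

/-! ### Complex valued functions on a surface and plane curve singularities -/

section Functions

variable {X : Type*} [TopologicalSpace X] [ChartedSpace Model X]

/-- The complex valued function `a` has surjective real differential at `x`. For a holomorphic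
function this says that the differential is nonzero. -/
def IsSubmersionAt (a : X → ℂ) (x : X) : Prop :=
  Function.Surjective (mfderiv 𝓘(ℝ, Model) 𝓘(ℝ, ℂ) a x)

/-- The real differential of `(a, b) : X → ℂ²` at `x` is an isomorphism. -/
def IsTransverseAt (a b : X → ℂ) (x : X) : Prop :=
  Function.Bijective (mfderiv 𝓘(ℝ, Model) 𝓘(ℝ, ℂ × ℂ) (fun y => (a y, b y)) x)

/-- Near `x` the function `D` is, up to a smooth nowhere vanishing factor, `P (u, v)`, where
`(u, v)` is a smooth `ℂ²`-valued local coordinate system centred at `x`. -/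
def HasNormalFormAt (P : ℂ → ℂ → ℂ) (D : X → ℂ) (x : X) : Prop :=
  ∃ (O : Set X) (u v h : X → ℂ), IsOpen O ∧ x ∈ O ∧
    ContMDiffOn 𝓘(ℝ, Model) 𝓘(ℝ, ℂ) ∞ u O ∧ ContMDiffOn 𝓘(ℝ, Model) 𝓘(ℝ, ℂ) ∞ v O ∧
    ContMDiffOn 𝓘(ℝ, Model) 𝓘(ℝ, ℂ) ∞ h O ∧
    u x = 0 ∧ v x = 0 ∧ IsTransverseAt u v x ∧ (∀ y ∈ O, h y ≠ 0) ∧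
    ∀ y ∈ O, D y = h y * P (u y) (v y)

/-- The curve with equation `D = 0` has a node (`u v = 0`) at `x`. -/
def HasNodeAt (D : X → ℂ) (x : X) : Prop :=
  HasNormalFormAt (fun u v => u * v) D x

/-- The curve with equation `D = 0` has an ordinary cusp (`u² = v³`) at `x`. -/
def HasCuspAt (D : X → ℂ) (x : X) : Prop :=
  HasNormalFormAt (fun u v => u ^ 2 - v ^ 3) D x

end Functions

/-! ### Sections of the line bundles `L ⊗ L` and `L ⊗ L ⊗ L'⁻¹` -/

section Sections

variable {X : Type*} [TopologicalSpace X]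
  (L : X → Type*) [∀ x, AddCommGroup (L x)] [∀ x, Module ℂ (L x)] [∀ x, TopologicalSpace (L x)]
  [TopologicalSpace (TotalSpace ℂ L)] [FiberBundle ℂ L] [VectorBundle ℂ ℂ L]
  (L' : X → Type*) [∀ x, AddCommGroup (L' x)] [∀ x, Module ℂ (L' x)]
  [∀ x, TopologicalSpace (L' x)]
  [TopologicalSpace (TotalSpace ℂ L')] [FiberBundle ℂ L'] [VectorBundle ℂ ℂ L']

/-- The domain of the distinguished trivialization of `L` around `x₀`. -/
abbrev baseSetAt (x₀ : X) : Set X := (trivializationAt ℂ L x₀).baseSet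

/-- The linear coordinate on the fibre of `L ⊗ L` at `y` induced by the distinguished
trivialization of `L` around `x₀`. -/
def sqCoord (x₀ y : X) : L y ⊗[ℂ] L y →ₗ[ℂ] ℂ :=
  LinearMap.mul' ℂ ℂ ∘ₗ TensorProduct.map
    ((trivializationAt ℂ L x₀).linearMapAt ℂ y) ((trivializationAt ℂ L x₀).linearMapAt ℂ y)

variable {L}

/-- The function representing a section `s` of `L ⊗ L` in the trivialization around `x₀`. -/
def sqRep (s : ∀ x, L x ⊗[ℂ] L x) (x₀ y : X) : ℂ := sqCoord L x₀ y (s y)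

variable {L'}

/-- The function representing a section `Φ` of `L ⊗ L ⊗ L'⁻¹ = Hom (L', L ⊗ L)` in the
trivializations of `L` and `L'` around `x₀`. -/
def homRep (Φ : ∀ x, L' x →ₗ[ℂ] L x ⊗[ℂ] L x) (x₀ y : X) : ℂ :=
  sqCoord L x₀ y (Φ y ((trivializationAt ℂ L' x₀).symm y 1))

variable [ChartedSpace Model X]

/-- `s` is a holomorphic section of `L ⊗ L`. -/
def IsHolomorphicSection (s : ∀ x, L x ⊗[ℂ] L x) : Prop :=
  ∀ x₀, ContMDiffOn 𝓘(ℂ, Model) 𝓘(ℂ, ℂ) ω (sqRep s x₀) (baseSetAt L x₀)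

/-- `Φ` is a differentiable (real `C^∞`) section of `L ⊗ L ⊗ L'⁻¹`. -/
def IsSmoothSection (Φ : ∀ x, L' x →ₗ[ℂ] L x ⊗[ℂ] L x) : Prop :=
  ∀ x₀, ContMDiffOn 𝓘(ℝ, Model) 𝓘(ℝ, ℂ) ∞ (homRep Φ x₀) (baseSetAt L x₀ ∩ baseSetAt L' x₀)

/-- The divisor `{s = 0}` is smooth. -/
def IsSmoothDivisor (s : ∀ x, L x ⊗[ℂ] L x) : Prop :=
  ∀ x, s x = 0 → IsSubmersionAt (sqRep s x) x

variable (L L')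

/-- Finitely many compact sets covering `X`, each inside the domain of a chart and of
trivializations of both line bundles; such a cover defines a `C¹` norm on sections. -/
structure C1Cover where
  /-- the number of compact sets -/
  n : ℕ
  /-- the points whose charts and trivializations are used -/
  pt : Fin n → X
  /-- the compact sets -/
  K : Fin n → Set X
  isCompact_K : ∀ j, IsCompact (K j)
  K_subset : ∀ j, K j ⊆ (chartAt Model (pt j)).source ∩ (baseSetAt L (pt j) ∩ baseSetAt L' (pt j))
  iUnion_K : ⋃ j, K j = univ

variable {L L'}

/-- The `C¹` norm, with respect to the cover `𝒦`, of a section with local representatives `rep` is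
at most `N`. -/
def C1Cover.NormLE (𝒦 : C1Cover L L') (rep : X → X → ℂ) (N : ℝ) : Prop :=
  ∀ j, ∀ y ∈ 𝒦.K j, ‖rep (𝒦.pt j) y‖ ≤ N ∧
    ‖fderiv ℝ (rep (𝒦.pt j) ∘ (chartAt Model (𝒦.pt j)).symm) (chartAt Model (𝒦.pt j) y)‖ ≤ N

/-- At all points of `S`, the absolute value, with respect to the cover `𝒦`, of a section with
local representatives `rep` is at least `r`. -/
def C1Cover.AbsGE (𝒦 : C1Cover L L') (rep : X → X → ℂ) (S : Set X) (r : ℝ) : Prop :=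
  ∀ j, ∀ y ∈ 𝒦.K j ∩ S, r ≤ ‖rep (𝒦.pt j) y‖

end Sections

/-! ### Perturbed simple bidouble covers -/

section Cover

variable {X : Type*} [TopologicalSpace X]
  {L₁ : X → Type*} [∀ x, AddCommGroup (L₁ x)] [∀ x, Module ℂ (L₁ x)]
  {L₂ : X → Type*} [∀ x, AddCommGroup (L₂ x)] [∀ x, Module ℂ (L₂ x)]

variable (L₁ L₂) in
/-- The total space of the rank two bundle `L₁ ⊕ L₂`. -/
abbrev TotalV := TotalSpace (ℂ × ℂ) (L₁ ×ᵇ L₂)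

/-- The set `Z ⊆ L₁ ⊕ L₂` of all `(z, w)` with `z² = f + w Φ` and `w² = g + z Ψ`. -/
def coverZ (f : ∀ x, L₁ x ⊗[ℂ] L₁ x) (g : ∀ x, L₂ x ⊗[ℂ] L₂ x)
    (Φ : ∀ x, L₂ x →ₗ[ℂ] L₁ x ⊗[ℂ] L₁ x) (Ψ : ∀ x, L₁ x →ₗ[ℂ] L₂ x ⊗[ℂ] L₂ x) :
    Set (TotalV L₁ L₂) :=
  {p | p.2.1 ⊗ₜ[ℂ] p.2.1 = f p.1 + Φ p.1 p.2.2 ∧ p.2.2 ⊗ₜ[ℂ] p.2.2 = g p.1 + Ψ p.1 p.2.1}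

/-- The set `R = {4 z w = Φ Ψ}` in `Z`. Both sides of the equation are elements of the fibre of
`L₁ ⊗ L₂`; they are compared after multiplication by arbitrary `z' ∈ L₁` and `w' ∈ L₂`. -/
def ramificationR (f : ∀ x, L₁ x ⊗[ℂ] L₁ x) (g : ∀ x, L₂ x ⊗[ℂ] L₂ x)
    (Φ : ∀ x, L₂ x →ₗ[ℂ] L₁ x ⊗[ℂ] L₁ x) (Ψ : ∀ x, L₁ x →ₗ[ℂ] L₂ x ⊗[ℂ] L₂ x) :
    Set (TotalV L₁ L₂) :=
  {p | p ∈ coverZ f g Φ Ψ ∧ ∀ (z' : L₁ p.1) (w' : L₂ p.1),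
    (4 : ℂ) • ((p.2.1 ⊗ₜ[ℂ] z') ⊗ₜ[ℂ] (p.2.2 ⊗ₜ[ℂ] w')) = Φ p.1 w' ⊗ₜ[ℂ] Ψ p.1 z'}

/-- The trivial singularities: the points with `f = Φ = 0` and the points with `g = Ψ = 0`. -/
def trivialSing (f : ∀ x, L₁ x ⊗[ℂ] L₁ x) (g : ∀ x, L₂ x ⊗[ℂ] L₂ x)
    (Φ : ∀ x, L₂ x →ₗ[ℂ] L₁ x ⊗[ℂ] L₁ x) (Ψ : ∀ x, L₁ x →ₗ[ℂ] L₂ x ⊗[ℂ] L₂ x) : Set X :=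
  {x | (f x = 0 ∧ Φ x = 0) ∨ (g x = 0 ∧ Ψ x = 0)}

/-- `Z` is mildly general. -/
def MildlyGeneral (f : ∀ x, L₁ x ⊗[ℂ] L₁ x) (g : ∀ x, L₂ x ⊗[ℂ] L₂ x)
    (Φ : ∀ x, L₂ x →ₗ[ℂ] L₁ x ⊗[ℂ] L₁ x) (Ψ : ∀ x, L₁ x →ₗ[ℂ] L₂ x ⊗[ℂ] L₂ x) : Prop :=
  ∀ x, (f x = 0 → Φ x = 0 → g x ≠ 0 ∧ Ψ x ≠ 0) ∧ (g x = 0 → Ψ x = 0 → f x ≠ 0 ∧ Φ x ≠ 0)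

variable [∀ x, TopologicalSpace (L₁ x)] [TopologicalSpace (TotalSpace ℂ L₁)] [FiberBundle ℂ L₁]
  [VectorBundle ℂ ℂ L₁]
  [∀ x, TopologicalSpace (L₂ x)] [TopologicalSpace (TotalSpace ℂ L₂)] [FiberBundle ℂ L₂]
  [VectorBundle ℂ ℂ L₂]

/-- The function representing, in the trivializations around `x₀`, the section `δ` of
`L₁^{⊗ 4} ⊗ L₂^{⊗ 4}` given by
`-δ / 16 = -f² g² - (9/8) f g (Φ Ψ)² + Ψ² f³ + Φ² g³ + (27 / 16²) (Φ Ψ)⁴`. -/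
def deltaRep (f : ∀ x, L₁ x ⊗[ℂ] L₁ x) (g : ∀ x, L₂ x ⊗[ℂ] L₂ x)
    (Φ : ∀ x, L₂ x →ₗ[ℂ] L₁ x ⊗[ℂ] L₁ x) (Ψ : ∀ x, L₁ x →ₗ[ℂ] L₂ x ⊗[ℂ] L₂ x) (x₀ y : X) : ℂ :=
  -16 * (-(sqRep f x₀ y) ^ 2 * (sqRep g x₀ y) ^ 2
    - 9 / 8 * (sqRep f x₀ y * sqRep g x₀ y) * (homRep Φ x₀ y * homRep Ψ x₀ y) ^ 2
    + (homRep Ψ x₀ y) ^ 2 * (sqRep f x₀ y) ^ 3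
    + (homRep Φ x₀ y) ^ 2 * (sqRep g x₀ y) ^ 3
    + 27 / 16 ^ 2 * (homRep Φ x₀ y * homRep Ψ x₀ y) ^ 4)

variable [ChartedSpace Model X]

/-- The real smooth structure of the total space of `L₁ ⊕ L₂`. -/
abbrev modelV : ModelWithCorners ℝ (Model × (ℂ × ℂ)) (ModelProd Model (ℂ × ℂ)) :=
  𝓘(ℝ, Model).prod 𝓘(ℝ, ℂ × ℂ)

/-- The critical set of the projection `Z → X`. -/
def criticalSetZ (f : ∀ x, L₁ x ⊗[ℂ] L₁ x) (g : ∀ x, L₂ x ⊗[ℂ] L₂ x)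
    (Φ : ∀ x, L₂ x →ₗ[ℂ] L₁ x ⊗[ℂ] L₁ x) (Ψ : ∀ x, L₁ x →ₗ[ℂ] L₂ x ⊗[ℂ] L₂ x) :
    Set (TotalV L₁ L₂) :=
  criticalSet modelV 𝓘(ℝ, Model) (fun p : TotalV L₁ L₂ => p.proj) (coverZ f g Φ Ψ)

/-- The branch curve `Δ`: the set of critical values of the projection `Z → X`. -/
def branchDelta (f : ∀ x, L₁ x ⊗[ℂ] L₁ x) (g : ∀ x, L₂ x ⊗[ℂ] L₂ x)
    (Φ : ∀ x, L₂ x →ₗ[ℂ] L₁ x ⊗[ℂ] L₁ x) (Ψ : ∀ x, L₁ x →ₗ[ℂ] L₂ x ⊗[ℂ] L₂ x) : Set X :=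
  (fun p : TotalV L₁ L₂ => p.proj) '' criticalSetZ f g Φ Ψ

/-- The singular points of the divisor `Δ = {δ = 0}`: the points of `Δ` at which `δ` is not a
submersion. -/
def singDelta (f : ∀ x, L₁ x ⊗[ℂ] L₁ x) (g : ∀ x, L₂ x ⊗[ℂ] L₂ x)
    (Φ : ∀ x, L₂ x →ₗ[ℂ] L₁ x ⊗[ℂ] L₁ x) (Ψ : ∀ x, L₁ x →ₗ[ℂ] L₂ x ⊗[ℂ] L₂ x) : Set X :=
  {x | x ∈ branchDelta f g Φ Ψ ∧ ¬ IsSubmersionAt (deltaRep f g Φ Ψ x) x}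

/-- The projection `Z → X` is a finite (branched) covering of degree four with branch locus `Δ`: it
is proper with finite nonempty fibres, the complement of `Δ` is dense, the restriction
over this complement is a covering map, and its fibres are exactly those with four points. -/
structure IsBranchedCoverOfDegreeFour (f : ∀ x, L₁ x ⊗[ℂ] L₁ x) (g : ∀ x, L₂ x ⊗[ℂ] L₂ x)
    (Φ : ∀ x, L₂ x →ₗ[ℂ] L₁ x ⊗[ℂ] L₁ x) (Ψ : ∀ x, L₁ x →ₗ[ℂ] L₂ x ⊗[ℂ] L₂ x) : Prop where
  isProperMap : IsProperMap (fun p : coverZ f g Φ Ψ => p.1.proj)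
  fibre_nonempty : ∀ x, {p ∈ coverZ f g Φ Ψ | p.proj = x}.Nonempty
  fibre_card_le : ∀ x, {p ∈ coverZ f g Φ Ψ | p.proj = x}.encard ≤ 4
  fibre_card_eq : ∀ x, {p ∈ coverZ f g Φ Ψ | p.proj = x}.encard = 4 ↔ x ∉ branchDelta f g Φ Ψ
  dense_compl : Dense (branchDelta f g Φ Ψ)ᶜ
  isCoveringMapOn : IsCoveringMapOn (fun p : coverZ f g Φ Ψ => p.1.proj) (branchDelta f g Φ Ψ)ᶜ

end Cover

end BidoubleCover

end

open BidoubleCover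

open scoped NNReal

set_option linter.unusedSectionVars false

noncomputable section

namespace BidoubleCover

/-! On a fibre, `Z` is the intersection of two conics. If `φ ≠ 0`, eliminating `w` leaves the
quartic `z⁴ - 2f z² - φ²ψ z + f² - φ²g`. Its discriminant is `16 φ⁴` times `fibreDisc`, the local
form of `δ`, and its derivative at a root is `φ (4zw - φψ)`. Hence a fibre has at most four points,
and it has fewer exactly when `δ = 0`, which happens exactly when it meets `R` (`fibre_structure`).

For `Φ = Ψ = 0` the smoothness of the divisors and their transversality make the equations of `Z`
regular. Regularity is an open condition on 1-jets, the fibres are uniformly bounded and `X` is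
compact, so it survives `C¹`-small perturbations (`Perturbation.eventually_regularZ`). The tangent
space of `Z` is then the kernel of the derivative of its equations, and the critical set is the
locus `R` where the vertical 2×2 block is singular. Compactness of `Z` and the inverse function
theorem give the covering off `Δ`; the equidimensional case of Sard's theorem gives density of the
complement.

At a point of `R` the vertical block has rank one. With `(s, p)` its left null vector, `dδ = l (s df
+ p dg + s w dφ + p z dψ)` for an explicit `l` (`disc_gradient`). Regularity of `Z` makes the
bracket surjective, so `δ` is singular only if `l = 0`, that is, at a trivial singularity or at a
triple root of the quartic (`trivial_or_cusp`). At a trivial singularity `δ` is, up to units, a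
difference of two squares, which gives the nodes. At a triple root `64 f³ = 27 φ⁴ψ²` and
symmetrically for `g`, so `f` and `g` are small there and the point lies near `M`.

Near a point of `M` the pair `(f, g)` is a coordinate system. The lower bound on `|Φ|` and `|Ψ|`
controls their logarithmic derivatives independently of their size (`IsTame`). A triple root means
`(f, g) = (3z², 3w²)` with `8z³ = -φ²ψ` and `w = -2z²/φ`: one equation for each cube root, each a
small Lipschitz perturbation of `(f, g) = 0` with a unique solution (`exists_encard_cusps`). In
terms of the quartic invariants, `432 φ⁴ δ = 256 I³ - J²`, and `(J, I)` are local coordinates at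
these points (`IsCuspPoint.bijective`), so they are cusps. `R` is smooth near `M` because `4zw = ΦΨ`
keeps the larger of `|z|`, `|w|` well above the size of `d(ΦΨ)` (`derRam_surjective`). It is
orientable because its equations change by complex linear factors under holomorphic changes of
coordinates (`IsSmoothData.det_positiveChart`). -/

/-! ### The fibre of the covering: the system `z² = f + w φ`, `w² = g + z ψ` -/

/-- The discriminant of the system `z² = f + w φ`, `w² = g + z ψ`. -/
def fibreDisc (f g φ ψ : ℂ) : ℂ :=
  -16 * (-f ^ 2 * g ^ 2 - 9 / 8 * (f * g) * (φ * ψ) ^ 2 + ψ ^ 2 * f ^ 3 + φ ^ 2 * g ^ 3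
    + 27 / 16 ^ 2 * (φ * ψ) ^ 4)

/-- The solutions of the system `z² = f + w φ`, `w² = g + z ψ`. -/
def fibreSet (f g φ ψ : ℂ) : Set (ℂ × ℂ) :=
  {v | v.1 ^ 2 = f + v.2 * φ ∧ v.2 ^ 2 = g + v.1 * ψ}

lemma exists_quartic_factorization (b c d : ℂ) :
    ∃ z₁ z₂ z₃ z₄ : ℂ, ∀ z : ℂ,
      z ^ 4 + b * z ^ 2 + c * z + d = (z - z₁) * (z - z₂) * (z - z₃) * (z - z₄) := by
  open Polynomial in
  let q : ℂ[X] := X ^ 4 + C b * X ^ 2 + C c * X + C d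
  have hq : q.natDegree = 4 := by simp only [q]; compute_degree!
  have hmonic : q.Monic := by
    rw [Monic, leadingCoeff, hq]; simp [q]
  have hs : q.Splits := IsAlgClosed.splits q
  have hcard : Multiset.card q.roots = 4 := by rw [← hs.natDegree_eq_card_roots, hq]
  obtain ⟨z₁, hz₁⟩ := Multiset.card_pos_iff_exists_mem.1 (by rw [hcard]; norm_num)
  obtain ⟨s, h1⟩ := Multiset.exists_cons_of_mem hz₁
  have hs3 : Multiset.card s = 3 := by simpa [h1] using hcard
  obtain ⟨z₂, z₃, z₄, h3⟩ := Multiset.card_eq_three.1 hs3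
  refine ⟨z₁, z₂, z₃, z₄, fun z => ?_⟩
  have := congrArg (Polynomial.eval z) (hs.eq_prod_roots_of_monic hmonic)
  rw [h1, h3] at this
  simp [q] at this
  rw [this]; ring

/-- The two sides differ by a polynomial of degree at most three, so the values at `0, 1, -1, 2`
determine all the relations. -/
lemma quartic_vieta {b c d z₁ z₂ z₃ z₄ : ℂ}
    (H : ∀ z : ℂ, z ^ 4 + b * z ^ 2 + c * z + d = (z - z₁) * (z - z₂) * (z - z₃) * (z - z₄)) :
    z₁ + z₂ + z₃ + z₄ = 0 ∧
      b = z₁ * z₂ + z₁ * z₃ + z₁ * z₄ + z₂ * z₃ + z₂ * z₄ + z₃ * z₄ ∧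
      c = -(z₁ * z₂ * z₃ + z₁ * z₂ * z₄ + z₁ * z₃ * z₄ + z₂ * z₃ * z₄) ∧
      d = z₁ * z₂ * z₃ * z₄ := by
  have h0 := H 0
  have h1 := H 1
  have h2 := H (-1)
  have h3 := H 2
  refine ⟨?_, ?_, ?_, ?_⟩
  · linear_combination (1 / 6) * h3 - (1 / 2) * h1 + (1 / 2) * h0 - (1 / 6) * h2
  · linear_combination (1 / 2) * h1 + (1 / 2) * h2 - h0
  · linear_combination -(1 / 6) * h3 + h1 - (1 / 2) * h0 - (1 / 3) * h2
  · linear_combination h0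

/-- The first equation gives `w = (z² - f)/φ`; substitution in the second gives a quartic in `z`
without cubic term. The four points are its roots, with repetition. -/
lemma fibre_of_ne_zero {f g φ ψ : ℂ} (hφ : φ ≠ 0) :
    ∃ p₁ p₂ p₃ p₄ : ℂ × ℂ, fibreSet f g φ ψ = {p₁, p₂, p₃, p₄} ∧
      (fibreDisc f g φ ψ ≠ 0 ↔
        p₁ ≠ p₂ ∧ p₁ ≠ p₃ ∧ p₁ ≠ p₄ ∧ p₂ ≠ p₃ ∧ p₂ ≠ p₄ ∧ p₃ ≠ p₄) ∧
      (fibreDisc f g φ ψ = 0 ↔ ∃ v ∈ fibreSet f g φ ψ, 4 * v.1 * v.2 = φ * ψ) := by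
  obtain ⟨a, b, c, d, H⟩ :=
    exists_quartic_factorization (-2 * f) (-(φ ^ 2 * ψ)) (f ^ 2 - φ ^ 2 * g)
  obtain ⟨v1, v2, v3, v4⟩ := quartic_vieta H
  have hmem : ∀ z w : ℂ, (z, w) ∈ fibreSet f g φ ψ ↔
      w = (z ^ 2 - f) / φ ∧ (z - a) * (z - b) * (z - c) * (z - d) = 0 := by
    intro z w
    rw [← H z]
    constructor
    · rintro ⟨h1, h2⟩
      simp only at h1 h2
      refine ⟨by rw [eq_div_iff hφ]; linear_combination -h1, ?_⟩
      linear_combination φ ^ 2 * h2 + (z ^ 2 - f + w * φ) * h1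
    · rintro ⟨h1, h2⟩
      have h1' : w * φ = z ^ 2 - f := by rw [h1]; field_simp
      refine ⟨by simp only; linear_combination -h1', ?_⟩
      simp only
      have : φ ^ 2 * (w ^ 2 - (g + z * ψ)) = 0 := by
        linear_combination h2 + (z ^ 2 - f + w * φ) * h1'
      have := (mul_eq_zero.1 this).resolve_left (pow_ne_zero 2 hφ)
      linear_combination this
  -- The classical discriminant of the quartic. Only `φ²g`, `φ²ψ` and `f` enter after multiplication
  -- by `φ⁴`, and all three are symmetric functions of the roots; `d` is eliminated by the vanishing
  -- of the root sum.
  have hdisc : 16 * φ ^ 4 * fibreDisc f g φ ψ =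
      ((a - b) * (a - c) * (a - d) * (b - c) * (b - d) * (c - d)) ^ 2 := by
    have hd : d = -(a + b + c) := by linear_combination v1
    have hr : φ ^ 2 * g = f ^ 2 - a * b * c * d := by linear_combination -v4
    have e1 : 16 * φ ^ 4 * fibreDisc f g φ ψ =
        256 * (φ ^ 2 * g) ^ 2 * (f ^ 2 - φ ^ 2 * g) + 32 * f ^ 3 * (φ ^ 2 * ψ) ^ 2
          - 288 * f * (φ ^ 2 * ψ) ^ 2 * (f ^ 2 - φ ^ 2 * g) - 27 * (φ ^ 2 * ψ) ^ 4 := by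
      unfold fibreDisc; ring
    have hq : φ ^ 2 * ψ = a * b * c + a * b * d + a * c * d + b * c * d := by
      linear_combination -v3
    have hf : f = -(a * b + a * c + a * d + b * c + b * d + c * d) / 2 := by
      linear_combination -(1 / 2) * v2
    rw [e1, hr, hq, hf, hd]
    ring
  have hset : fibreSet f g φ ψ = {(a, (a ^ 2 - f) / φ), (b, (b ^ 2 - f) / φ),
      (c, (c ^ 2 - f) / φ), (d, (d ^ 2 - f) / φ)} := by
    ext ⟨z, w⟩
    rw [hmem]
    simp only [mul_eq_zero, sub_eq_zero, mem_insert_iff, mem_singleton_iff, Prod.mk.injEq]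
    constructor
    · rintro ⟨rfl, ((rfl | rfl) | rfl) | rfl⟩ <;> simp
    · rintro (⟨rfl, rfl⟩ | ⟨rfl, rfl⟩ | ⟨rfl, rfl⟩ | ⟨rfl, rfl⟩) <;> simp
  have hz : fibreDisc f g φ ψ = 0 ↔
      (a - b) * (a - c) * (a - d) * (b - c) * (b - d) * (c - d) = 0 := by
    constructor
    · intro h
      rw [h, mul_zero] at hdisc
      exact pow_eq_zero_iff two_ne_zero |>.1 hdisc.symm
    · intro h
      rw [h] at hdisc
      have : 16 * φ ^ 4 ≠ 0 := mul_ne_zero (by norm_num) (pow_ne_zero 4 hφ)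
      exact (mul_eq_zero.1 (hdisc.trans (by ring))).resolve_left this
  have hinj : ∀ x y : ℂ, ((x, (x ^ 2 - f) / φ) ≠ (y, (y ^ 2 - f) / φ)) ↔ x - y ≠ 0 := by
    intro x y
    rw [sub_ne_zero, not_iff_not, Prod.mk.injEq]
    exact ⟨fun h => h.1, fun h => by simp [h]⟩
  -- The right-hand side is the derivative of the quartic, so the ramification equation singles out
  -- the multiple roots.
  have hder : ∀ z, φ * (4 * z * ((z ^ 2 - f) / φ) - φ * ψ) =
      (z - b) * (z - c) * (z - d) + (z - a) * (z - c) * (z - d) + (z - a) * (z - b) * (z - d)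
        + (z - a) * (z - b) * (z - c) := by
    intro z
    have : φ * (4 * z * ((z ^ 2 - f) / φ) - φ * ψ) = 4 * z * (z ^ 2 - f) - φ ^ 2 * ψ := by
      field_simp
    rw [this]
    linear_combination 2 * z * v2 + v3 + 3 * z ^ 2 * v1
  have hder' : ∀ z, 4 * z * ((z ^ 2 - f) / φ) = φ * ψ ↔
      (z - b) * (z - c) * (z - d) + (z - a) * (z - c) * (z - d) + (z - a) * (z - b) * (z - d)
        + (z - a) * (z - b) * (z - c) = 0 := by
    intro z
    rw [← hder z, mul_eq_zero, sub_eq_zero]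
    simp [hφ]
  refine ⟨_, _, _, _, hset, ?_, ?_⟩
  · rw [Ne, hz]
    simp only [hinj, mul_eq_zero, not_or, ← ne_eq]
    tauto
  · rw [hz, hset]
    simp only [mem_insert_iff, mem_singleton_iff, exists_eq_or_imp, exists_eq_left, hder']
    constructor
    · intro h
      simp only [mul_eq_zero] at h
      rcases h with ((((h | h) | h) | h) | h) | h
      · left; linear_combination ((a - c) * (a - d)) * h
      · left; linear_combination ((a - b) * (a - d)) * h
      · left; linear_combination ((a - b) * (a - c)) * h
      · right; left; linear_combination ((b - a) * (b - d)) * h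
      · right; left; linear_combination ((b - a) * (b - c)) * h
      · right; right; left; linear_combination ((c - a) * (c - b)) * h
    · rintro (h | h | h | h)
      · linear_combination ((b - c) * (b - d) * (c - d)) * h
      · linear_combination (-(a - c) * (a - d) * (c - d)) * h
      · linear_combination ((a - b) * (a - d) * (b - d)) * h
      · linear_combination (-(a - b) * (a - c) * (b - c)) * h

/-- For `φ = 0` the system is triangular: `z = ±a` with `a² = f`, followed by `w² = g ± aψ`. The
discriminant factors as `16 a⁴c²d²`. -/
lemma fibre_of_eq_zero (f g ψ : ℂ) :
    ∃ p₁ p₂ p₃ p₄ : ℂ × ℂ, fibreSet f g 0 ψ = {p₁, p₂, p₃, p₄} ∧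
      (fibreDisc f g 0 ψ ≠ 0 ↔
        p₁ ≠ p₂ ∧ p₁ ≠ p₃ ∧ p₁ ≠ p₄ ∧ p₂ ≠ p₃ ∧ p₂ ≠ p₄ ∧ p₃ ≠ p₄) ∧
      (fibreDisc f g 0 ψ = 0 ↔ ∃ v ∈ fibreSet f g 0 ψ, 4 * v.1 * v.2 = 0 * ψ) := by
  obtain ⟨a, ha⟩ := IsAlgClosed.exists_pow_nat_eq f (n := 2) (by norm_num)
  obtain ⟨c, hc⟩ := IsAlgClosed.exists_pow_nat_eq (g + a * ψ) (n := 2) (by norm_num)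
  obtain ⟨d, hd⟩ := IsAlgClosed.exists_pow_nat_eq (g - a * ψ) (n := 2) (by norm_num)
  have hset : fibreSet f g 0 ψ = {(a, c), (a, -c), (-a, d), (-a, -d)} := by
    ext ⟨z, w⟩
    simp only [fibreSet, mem_ofPred_eq, mul_zero, add_zero, mem_insert_iff, mem_singleton_iff,
      Prod.mk.injEq]
    rw [← ha, sq_eq_sq_iff_eq_or_eq_neg]
    constructor
    · rintro ⟨rfl | rfl, h2⟩
      · rw [← hc, sq_eq_sq_iff_eq_or_eq_neg] at h2; tauto
      · rw [show g + -a * ψ = d ^ 2 by rw [hd]; ring, sq_eq_sq_iff_eq_or_eq_neg] at h2; tauto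
    · rintro (⟨rfl, rfl⟩ | ⟨rfl, rfl⟩ | ⟨rfl, rfl⟩ | ⟨rfl, rfl⟩)
      · exact ⟨Or.inl rfl, hc⟩
      · exact ⟨Or.inl rfl, by rw [← hc]; ring⟩
      · exact ⟨Or.inr rfl, by rw [hd]; ring⟩
      · exact ⟨Or.inr rfl, by linear_combination hd⟩
  have hdisc : fibreDisc f g 0 ψ = 16 * a ^ 4 * c ^ 2 * d ^ 2 := by
    rw [hc, hd, fibreDisc, ← ha]; ring
  have hz : fibreDisc f g 0 ψ = 0 ↔ a = 0 ∨ c = 0 ∨ d = 0 := by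
    rw [hdisc]; simp; tauto
  have hneg : ∀ x : ℂ, x = -x ↔ x = 0 := fun x => self_eq_neg
  refine ⟨_, _, _, _, hset, ?_, ?_⟩
  · rw [Ne, hz]
    simp only [Ne, Prod.mk.injEq, hneg, true_and]
    constructor
    · intro h; push Not at h; tauto
    · rintro ⟨h1, h2, h3, -, -, h4⟩ (h | h | h)
      · subst h
        -- If `a = 0` both values of `w²` equal `g`, so the two pairs of points coincide.
        have : c ^ 2 = d ^ 2 := by rw [hc, hd]; ring
        rcases sq_eq_sq_iff_eq_or_eq_neg.1 this with h | h
        · exact h2 ⟨rfl, h⟩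
        · exact h3 ⟨rfl, h⟩
      · exact h1 h
      · exact h4 h
  · rw [hz, hset]
    simp only [mem_insert_iff, mem_singleton_iff, exists_eq_or_imp, exists_eq_left, zero_mul,
      mul_eq_zero, neg_eq_zero]
    simp
    tauto

lemma fibre_structure (f g φ ψ : ℂ) :
    ∃ p₁ p₂ p₃ p₄ : ℂ × ℂ, fibreSet f g φ ψ = {p₁, p₂, p₃, p₄} ∧
      (fibreDisc f g φ ψ ≠ 0 ↔
        p₁ ≠ p₂ ∧ p₁ ≠ p₃ ∧ p₁ ≠ p₄ ∧ p₂ ≠ p₃ ∧ p₂ ≠ p₄ ∧ p₃ ≠ p₄) ∧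
      (fibreDisc f g φ ψ = 0 ↔ ∃ v ∈ fibreSet f g φ ψ, 4 * v.1 * v.2 = φ * ψ) := by
  by_cases hφ : φ = 0
  · subst hφ; exact fibre_of_eq_zero f g ψ
  · exact fibre_of_ne_zero hφ

lemma fibreSet_nonempty (f g φ ψ : ℂ) : (fibreSet f g φ ψ).Nonempty := by
  obtain ⟨p₁, p₂, p₃, p₄, h, -⟩ := fibre_structure f g φ ψ
  exact ⟨p₁, by simp [h]⟩

lemma encard_fibreSet_le (f g φ ψ : ℂ) : (fibreSet f g φ ψ).encard ≤ 4 := by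
  obtain ⟨p₁, p₂, p₃, p₄, h, -⟩ := fibre_structure f g φ ψ
  rw [h]
  classical
  rw [show ({p₁, p₂, p₃, p₄} : Set (ℂ × ℂ)) = (({p₁, p₂, p₃, p₄} : Finset (ℂ × ℂ)) : Set _) by simp,
    encard_coe_eq_coe_finsetCard]
  exact_mod_cast Finset.card_le_four

lemma encard_fibreSet_eq_iff (f g φ ψ : ℂ) :
    (fibreSet f g φ ψ).encard = 4 ↔ fibreDisc f g φ ψ ≠ 0 := by
  obtain ⟨p₁, p₂, p₃, p₄, h, hd, -⟩ := fibre_structure f g φ ψ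
  rw [h, hd]
  classical
  have key : ∀ a b c : ℂ × ℂ, ({a, b, c} : Set (ℂ × ℂ)).encard ≠ 4 := by
    intro a b c h
    rw [show ({a, b, c} : Set (ℂ × ℂ)) = (({a, b, c} : Finset (ℂ × ℂ)) : Set _) by simp,
      encard_coe_eq_coe_finsetCard] at h
    have h3 : ({a, b, c} : Finset (ℂ × ℂ)).card ≤ 3 := Finset.card_le_three
    have h4 : ({a, b, c} : Finset (ℂ × ℂ)).card = 4 := by exact_mod_cast h
    omega
  constructor
  · intro h4
    refine ⟨?_, ?_, ?_, ?_, ?_, ?_⟩ <;> rintro rfl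
    · exact key p₁ p₃ p₄ (by simpa using h4)
    · exact key p₁ p₂ p₄ (by rw [← h4]; congr 1; ext; simp; tauto)
    · exact key p₁ p₂ p₃ (by rw [← h4]; congr 1; ext; simp; tauto)
    · exact key p₁ p₂ p₄ (by rw [← h4]; congr 1; ext; simp)
    · exact key p₁ p₂ p₃ (by rw [← h4]; congr 1; ext; simp; tauto)
    · exact key p₁ p₂ p₃ (by rw [← h4]; congr 1; ext; simp)
  · rintro ⟨h1, h2, h3, h4, h5, h6⟩
    rw [show ({p₁, p₂, p₃, p₄} : Set (ℂ × ℂ)) =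
      (({p₁, p₂, p₃, p₄} : Finset (ℂ × ℂ)) : Set _) by simp, encard_coe_eq_coe_finsetCard]
    rw [Finset.card_insert_of_notMem (by simp [*]), Finset.card_insert_of_notMem (by simp [*]),
      Finset.card_pair h6]
    norm_num

lemma fibreDisc_eq_zero_iff (f g φ ψ : ℂ) :
    fibreDisc f g φ ψ = 0 ↔ ∃ v ∈ fibreSet f g φ ψ, 4 * v.1 * v.2 = φ * ψ := by
  obtain ⟨p₁, p₂, p₃, p₄, -, -, h⟩ := fibre_structure f g φ ψ
  exact h

/-! ### The gradient of the discriminant along the ramification. -/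

/-- A singular matrix `[[2z, -φ], [-ψ, 2w]]` is of rank at most one, with a nonzero left null vector
`(s, p)`. -/
lemma exists_rank_one {z w φ ψ : ℂ} (h : 4 * z * w = φ * ψ) :
    ∃ p q r s : ℂ, 2 * z = p * q ∧ φ = p * r ∧ ψ = s * q ∧ 2 * w = s * r ∧ (s ≠ 0 ∨ p ≠ 0) := by
  by_cases h1 : φ = 0 ∧ z = 0
  · obtain ⟨rfl, rfl⟩ := h1
    exact ⟨0, ψ, 2 * w, 1, by simp, by simp, by simp, by simp, by simp⟩
  by_cases hφ : φ = 0
  · subst hφ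
    have hz : z ≠ 0 := fun h => h1 ⟨rfl, h⟩
    have hw : w = 0 := by simpa [hz] using h
    subst hw
    refine ⟨1, 2 * z, 0, ψ / (2 * z), by ring, by ring, ?_, by simp, by simp⟩
    field_simp
  · refine ⟨1, 2 * z, φ, 2 * w / φ, by ring, by ring, ?_, ?_, by simp⟩
    · field_simp; linear_combination -h
    · field_simp

/-- The partial derivatives of the discriminant. -/
def discF (f g φ ψ : ℂ) : ℂ := 32 * f * g ^ 2 + 18 * g * (φ * ψ) ^ 2 - 48 * ψ ^ 2 * f ^ 2
def discP (f g φ ψ : ℂ) : ℂ :=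
  36 * f * g * φ * ψ ^ 2 - 32 * φ * g ^ 3 - 27 / 4 * φ ^ 3 * ψ ^ 4

/-- Since `(s, p)` annihilates the vertical derivatives, `s d(z² - f - wφ) + p d(w² - g - zψ)`
involves only `df, dg, dφ, dψ`. Up to sign it is the covector `(s, p, s w, p z)`, to which the
gradient of the discriminant must be proportional. The factor `l` is found by expressing everything
in `p, q, r, s`. -/
lemma disc_gradient {f g φ ψ z w p q r s : ℂ} (h1 : z ^ 2 = f + w * φ) (h2 : w ^ 2 = g + z * ψ)
    (hz : 2 * z = p * q) (hφ : φ = p * r) (hψ : ψ = s * q) (hw : 2 * w = s * r) :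
    ∃ l : ℂ, l = -(p * s * (s * r ^ 2 + p * q ^ 2) ^ 3) ∧
      discF f g φ ψ = l * s ∧ discF g f ψ φ = l * p ∧ discP f g φ ψ = l * (s * w) ∧
      discP g f ψ φ = l * (p * z) := by
  obtain rfl : z = p * q / 2 := by linear_combination hz / 2
  obtain rfl : w = s * r / 2 := by linear_combination hw / 2
  subst hφ hψ
  obtain rfl : f = (p * q / 2) ^ 2 - s * r / 2 * (p * r) := by linear_combination -h1
  obtain rfl : g = (s * r / 2) ^ 2 - p * q / 2 * (s * q) := by linear_combination -h2
  refine ⟨_, rfl, ?_, ?_, ?_, ?_⟩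
  · unfold discF; ring
  · unfold discF; ring
  · unfold discP; ring
  · unfold discP; ring

/-- `(z, w)` is a point of the fibre over which the branch curve has a cusp. -/
structure IsCuspPoint (f g φ ψ z w : ℂ) : Prop where
  f_eq : f = 3 * z ^ 2
  g_eq : g = 3 * w ^ 2
  phi_mul : w * φ = -2 * z ^ 2
  psi_mul : z * ψ = -2 * w ^ 2
  ram : 4 * z * w = φ * ψ
  phi_ne : φ ≠ 0
  psi_ne : ψ ≠ 0

namespace IsCuspPoint

variable {f g φ ψ z w : ℂ}

lemma z_ne (h : IsCuspPoint f g φ ψ z w) : z ≠ 0 := by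
  intro hz
  have := h.ram
  simp [hz, h.phi_ne, h.psi_ne] at this

lemma w_ne (h : IsCuspPoint f g φ ψ z w) : w ≠ 0 := by
  intro hz
  have := h.ram
  simp [hz, h.phi_ne, h.psi_ne] at this

lemma cube_z (h : IsCuspPoint f g φ ψ z w) : 8 * z ^ 3 = -(φ ^ 2 * ψ) := by
  linear_combination 4 * z * h.phi_mul - φ * h.ram

lemma cube_w (h : IsCuspPoint f g φ ψ z w) : 8 * w ^ 3 = -(ψ ^ 2 * φ) := by
  linear_combination 4 * w * h.psi_mul - ψ * h.ram

lemma mem_fibreSet (h : IsCuspPoint f g φ ψ z w) : (z, w) ∈ fibreSet f g φ ψ := by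
  refine ⟨?_, ?_⟩
  · simp only; linear_combination -h.phi_mul - h.f_eq
  · simp only; linear_combination -h.psi_mul - h.g_eq

lemma disc_eq_zero (h : IsCuspPoint f g φ ψ z w) : fibreDisc f g φ ψ = 0 :=
  (fibreDisc_eq_zero_iff ..).2 ⟨_, h.mem_fibreSet, h.ram⟩

lemma gradient_eq_zero (h : IsCuspPoint f g φ ψ z w) :
    discF f g φ ψ = 0 ∧ discF g f ψ φ = 0 ∧ discP f g φ ψ = 0 ∧ discP g f ψ φ = 0 := by
  obtain ⟨p, q, r, s, hz, hφ, hψ, hw, -⟩ := exists_rank_one h.ram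
  obtain ⟨l, hl, h1, h2, h3, h4⟩ := disc_gradient h.mem_fibreSet.1 h.mem_fibreSet.2 hz hφ hψ hw
  have hp : p ≠ 0 := by rintro rfl; exact h.phi_ne (by simp [hφ])
  have : p * (s * r ^ 2 + p * q ^ 2) = 0 := by
    linear_combination 2 * h.phi_mul - 2 * w * hφ - p * r * hw  - (2 * z + p * q) * hz
  have hl0 : l = 0 := by
    rw [hl, (mul_eq_zero.1 this).resolve_left hp]; ring
  simp [h1, h2, h3, h4, hl0]

end IsCuspPoint

/-- If the gradient of the discriminant is degenerate at a ramification point, this point is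
trivial or cuspidal. -/
lemma trivial_or_cusp {f g φ ψ z w p q r s : ℂ} (h1 : z ^ 2 = f + w * φ) (h2 : w ^ 2 = g + z * ψ)
    (hz : 2 * z = p * q) (hφ : φ = p * r) (hψ : ψ = s * q) (hw : 2 * w = s * r)
    (hl : p * s * (s * r ^ 2 + p * q ^ 2) ^ 3 = 0) :
    (f = 0 ∧ φ = 0) ∨ (g = 0 ∧ ψ = 0) ∨ IsCuspPoint f g φ ψ z w := by
  obtain rfl : z = p * q / 2 := by linear_combination hz / 2
  obtain rfl : w = s * r / 2 := by linear_combination hw / 2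
  obtain rfl : f = (p * q / 2) ^ 2 - s * r / 2 * φ := by linear_combination -h1
  obtain rfl : g = (s * r / 2) ^ 2 - p * q / 2 * ψ := by linear_combination -h2
  -- `p = 0` kills `z` and `φ`, hence `f`; `s = 0` kills `w` and `ψ`, hence `g`.
  by_cases hp : p = 0
  · left; simp [hp, hφ]
  by_cases hs : s = 0
  · right; left; simp [hs, hψ]
  -- The last factor expresses `wφ = -2z²` and `zψ = -2w²`, the triple root condition. As `p` and
  -- `s` are nonzero, `q` and `r` can only vanish together, and then `f = φ = 0`.
  have hc : s * r ^ 2 + p * q ^ 2 = 0 := by simpa [hp, hs] using hl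
  by_cases hr : r = 0
  · have hq : q = 0 := by simpa [hr, hp] using hc
    left; simp [hφ, hr, hq]
  by_cases hq : q = 0
  · exact absurd hc (by simp [hq, hs, hr])
  right; right
  subst hφ hψ
  constructor
  · linear_combination -(p / 2) * hc
  · linear_combination -(s / 2) * hc
  · linear_combination (p / 2) * hc
  · linear_combination (s / 2) * hc
  · ring
  · exact mul_ne_zero hp hr
  · exact mul_ne_zero hs hq

/-! ### Surjective linear maps -/

section LinearMaps

variable {E F G Y : Type*} [NormedAddCommGroup E] [NormedSpace ℝ E]
  [NormedAddCommGroup F] [NormedSpace ℝ F]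
  [NormedAddCommGroup G] [NormedSpace ℝ G] [NormedAddCommGroup Y] [NormedSpace ℝ Y]

/-- A fixed right inverse of `T`, composed with a nearby map, stays close to the identity and hence
invertible. -/
lemma isOpen_setOf_surjective [FiniteDimensional ℝ E] [FiniteDimensional ℝ F] :
    IsOpen {T : E →L[ℝ] F | Function.Surjective T} := by
  rw [isOpen_iff_mem_nhds]
  intro T hT
  obtain ⟨R, hR⟩ := LinearMap.exists_rightInverse_of_surjective T.toLinearMap
    (LinearMap.range_eq_top.2 hT)
  let R' : F →L[ℝ] E := LinearMap.toContinuousLinearMap R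
  have hTR : T.comp R' = ContinuousLinearMap.id ℝ F := by
    ext x; exact LinearMap.congr_fun hR x
  have hc : Continuous fun S : E →L[ℝ] F => S.comp R' := by fun_prop
  have hu : {S : F →L[ℝ] F | IsUnit S} ∈ 𝓝 (T.comp R') := by
    have := FiniteDimensional.complete ℝ F
    exact Units.isOpen.mem_nhds (by rw [hTR]; exact isUnit_one)
  filter_upwards [hc.continuousAt.preimage_mem_nhds hu] with S hS y
  obtain ⟨u, hu⟩ := hS
  refine ⟨R' ((↑u⁻¹ : F →L[ℝ] F) y), ?_⟩
  have h1 : (u : F →L[ℝ] F) * (↑u⁻¹ : F →L[ℝ] F) = 1 := u.mul_inv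
  calc S (R' ((↑u⁻¹ : F →L[ℝ] F) y)) = (S.comp R') ((↑u⁻¹ : F →L[ℝ] F) y) := rfl
    _ = ((u : F →L[ℝ] F) * (↑u⁻¹ : F →L[ℝ] F)) y := by rw [hu]; rfl
    _ = y := by rw [h1]; rfl

lemma isOpen_setOf_bijective [FiniteDimensional ℝ E] [FiniteDimensional ℝ F] :
    IsOpen {T : E →L[ℝ] F | Function.Bijective T} := by
  have := FiniteDimensional.complete ℝ E
  convert ContinuousLinearEquiv.isOpen (𝕜 := ℝ) (E := E) (F := F) using 1
  ext T
  constructor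
  · intro h
    exact ⟨(LinearEquiv.ofBijective T.toLinearMap h).toContinuousLinearEquiv, by ext; rfl⟩
  · rintro ⟨e, rfl⟩
    exact e.bijective

lemma bijective_of_injective_of_finrank_eq [FiniteDimensional ℝ E] [FiniteDimensional ℝ F]
    (h : Module.finrank ℝ E = Module.finrank ℝ F)
    {T : E →L[ℝ] F} (hT : Function.Injective T) : Function.Bijective T :=
  ⟨hT, (LinearMap.injective_iff_surjective_of_finrank_eq_finrank (f := T.toLinearMap) h).1 hT⟩

/-- A surjective linear map extends to an isomorphism onto a product. -/
lemma exists_bijective_prod [FiniteDimensional ℝ E] [FiniteDimensional ℝ G]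
    [FiniteDimensional ℝ Y] (h : Module.finrank ℝ E = Module.finrank ℝ G + Module.finrank ℝ Y)
    {T : E →L[ℝ] G} (hT : Function.Surjective T) :
    ∃ B : E →L[ℝ] Y, Function.Bijective (T.prod B) := by
  have hk : Module.finrank ℝ (LinearMap.ker T.toLinearMap) = Module.finrank ℝ Y := by
    have h1 := LinearMap.finrank_range_add_finrank_ker T.toLinearMap
    rw [LinearMap.range_eq_top.2 hT, finrank_top] at h1
    omega
  let κ := LinearEquiv.ofFinrankEq _ _ hk
  obtain ⟨ρ, hρ⟩ := LinearMap.exists_leftInverse_of_injective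
    (LinearMap.ker T.toLinearMap).subtype (Submodule.ker_subtype _)
  refine ⟨LinearMap.toContinuousLinearMap (κ.toLinearMap ∘ₗ ρ), ?_⟩
  apply bijective_of_injective_of_finrank_eq (by rw [Module.finrank_prod, h])
  rw [injective_iff_map_eq_zero]
  intro v hv
  have h1 : T v = 0 := congrArg Prod.fst hv
  have h2 : κ (ρ v) = 0 := congrArg Prod.snd hv
  have h3 : ρ v = 0 := by simpa using h2
  have h4 := LinearMap.congr_fun hρ ⟨v, h1⟩
  simp only [LinearMap.comp_apply, Submodule.subtype_apply, h3, LinearMap.id_apply] at h4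
  exact (congrArg Subtype.val h4).symm

end LinearMaps

/-! ### Regular level sets -/

section LevelSets

variable {E G Y : Type*} [NormedAddCommGroup E] [NormedSpace ℝ E] [FiniteDimensional ℝ E]
  [NormedAddCommGroup G] [NormedSpace ℝ G] [FiniteDimensional ℝ G]
  [NormedAddCommGroup Y] [NormedSpace ℝ Y] [FiniteDimensional ℝ Y]

/-- The inverse function theorem for the map `(H, B)` with `B` linear. -/
lemma exists_straightening {H : E → G} {O : Set E} (hO : IsOpen O) (hH : ContDiffOn ℝ ∞ H O)
    (B : E →L[ℝ] Y) {a : E} (ha : a ∈ O) (hB : Function.Bijective ((fderiv ℝ H a).prod B)) :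
    ∃ Θ : OpenPartialHomeomorph E (G × Y), a ∈ Θ.source ∧ Θ.source ⊆ O ∧
      (∀ x ∈ Θ.source, Θ x = (H x, B x)) ∧ ContDiffOn ℝ ∞ Θ.symm Θ.target ∧
      ∀ x ∈ Θ.source, Function.Bijective ((fderiv ℝ H x).prod B) := by
  have := FiniteDimensional.complete ℝ E
  have hcd : ∀ x ∈ O, ContDiffAt ℝ ∞ (fun x => (H x, B x)) x := fun x hx =>
    ((hH x hx).contDiffAt (hO.mem_nhds hx)).prodMk B.contDiff.contDiffAt
  have hder : ∀ x ∈ O, HasFDerivAt (fun x => (H x, B x)) ((fderiv ℝ H x).prod B) x := fun x hx =>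
    ((((hH x hx).contDiffAt (hO.mem_nhds hx)).differentiableAt (by simp)).hasFDerivAt).prodMk
      B.hasFDerivAt
  have equiv : ∀ x, Function.Bijective ((fderiv ℝ H x).prod B) →
      ∃ e : E ≃L[ℝ] G × Y, (e : E →L[ℝ] G × Y) = (fderiv ℝ H x).prod B := fun x h =>
    ⟨(LinearEquiv.ofBijective ((fderiv ℝ H x).prod B).toLinearMap h).toContinuousLinearEquiv,
      by ext <;> rfl⟩
  obtain ⟨L, hL⟩ := equiv a hB
  have hLder : HasFDerivAt (fun x => (H x, B x)) (L : E →L[ℝ] G × Y) a := hL ▸ hder a ha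
  let Θ₀ := (hcd a ha).toOpenPartialHomeomorph _ hLder (by simp)
  have hΘ₀ : ∀ x, Θ₀ x = (H x, B x) := fun x => rfl
  have hcont : ContinuousOn (fun x => (fderiv ℝ H x).prod B) O := by
    have h1 : ContinuousOn (fderiv ℝ H) O := hH.continuousOn_fderiv_of_isOpen hO (by simp)
    have h2 : Continuous fun T : E →L[ℝ] G => T.prod B := by
      have h3 : (fun T : E →L[ℝ] G => T.prod B) = fun T =>
          (ContinuousLinearMap.inl ℝ G Y).comp T + (ContinuousLinearMap.inr ℝ G Y).comp B := by
        funext T; ext <;> simp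
      rw [h3]
      fun_prop
    exact h2.comp_continuousOn h1
  -- The source is cut down to the points with invertible derivative, so that the inverse is smooth
  -- on the whole target and not only at the image of `a`.
  let O' := O ∩ (fun x => (fderiv ℝ H x).prod B) ⁻¹' {T | Function.Bijective T}
  have hO' : IsOpen O' := hcont.isOpen_inter_preimage hO isOpen_setOf_bijective
  refine ⟨Θ₀.restrOpen O' hO', ?_, ?_, ?_, ?_, ?_⟩
  · exact ⟨(hcd a ha).mem_toOpenPartialHomeomorph_source hLder (by simp), ha, hB⟩
  · exact fun x hx => hx.2.1
  · exact fun x hx => hΘ₀ x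
  · intro y hy
    apply ContDiffAt.contDiffWithinAt
    have hx := (Θ₀.restrOpen O' hO').map_target hy
    obtain ⟨L', hL'⟩ := equiv _ hx.2.2
    refine (Θ₀.restrOpen O' hO').contDiffAt_symm hy (f₀' := L') ?_ (hcd _ hx.2.1)
    rw [hL']
    exact hder _ hx.2.1
  · exact fun x hx => hx.2.2

variable {HM : Type*} [TopologicalSpace HM] {I : ModelWithCorners ℝ E HM}
  {M : Type*} [TopologicalSpace M] [ChartedSpace HM M]

variable (I) in
/-- In the chart around `p₀`, the subset `S` is the zero set of the smooth function `H` on the open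
set `O`. -/
structure IsLocalEquation (S : Set M) (p₀ : M) (H : E → G) (O : Set E) : Prop where
  isOpen : IsOpen O
  subset : O ⊆ (extChartAt I p₀).target
  contDiffOn : ContDiffOn ℝ ∞ H O
  mem_iff : ∀ v ∈ O, (extChartAt I p₀).symm v ∈ S ↔ H v = 0

/-- A regular level set has a chart given by a linear map. -/
lemma IsLocalEquation.exists_chart {S : Set M} {p₀ : M} {H : E → G} {O : Set E}
    (h : IsLocalEquation I S p₀ H O) (B : E →L[ℝ] Y) (p : S)
    (hp : (p : M) ∈ (extChartAt I p₀).source) (hpO : extChartAt I p₀ p ∈ O)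
    (hB : Function.Bijective ((fderiv ℝ H (extChartAt I p₀ p)).prod B)) :
    ∃ (φ : OpenPartialHomeomorph S Y) (σ : Y → E), p ∈ φ.source ∧
      (∀ q ∈ φ.source, (q : M) ∈ (extChartAt I p₀).source ∧ extChartAt I p₀ q ∈ O ∧
        φ q = B (extChartAt I p₀ q) ∧
        Function.Bijective ((fderiv ℝ H (extChartAt I p₀ q)).prod B)) ∧
      ContDiffOn ℝ ∞ σ φ.target ∧
      ∀ a ∈ φ.target, σ a ∈ O ∧ H (σ a) = 0 ∧ B (σ a) = a ∧
        (φ.symm a : M) = (extChartAt I p₀).symm (σ a) := by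
  obtain ⟨Θ, haΘ, hΘO, hΘ, hΘsymm, hbij⟩ := exists_straightening h.isOpen h.contDiffOn B hpO hB
  set e := extChartAt I p₀ with he
  have hcs : Continuous fun a : Y => ((0 : G), a) := by fun_prop
  have key : ∀ a : Y, (0, a) ∈ Θ.target → Θ.symm (0, a) ∈ Θ.source ∧ Θ.symm (0, a) ∈ O ∧
      H (Θ.symm (0, a)) = 0 ∧ B (Θ.symm (0, a)) = a ∧ e.symm (Θ.symm (0, a)) ∈ S := by
    intro a ha
    have h1 := Θ.map_target ha
    have h2 := hΘ _ h1
    rw [Θ.right_inv ha] at h2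
    have h3 : H (Θ.symm (0, a)) = 0 := (congrArg Prod.fst h2).symm
    exact ⟨h1, hΘO h1, h3, (congrArg Prod.snd h2).symm, (h.mem_iff _ (hΘO h1)).2 h3⟩
  have hzero : ∀ q : S, (q : M) ∈ e.source → e q ∈ O → H (e q) = 0 := by
    intro q hq hqO
    rw [← h.mem_iff _ hqO, ← he, e.left_inv hq]
    exact q.2
  have hes : IsOpen e.source := isOpen_extChartAt_source p₀
  have hec : ContinuousOn e e.source := continuousOn_extChartAt p₀
  have hesc : ContinuousOn e.symm e.target := continuousOn_extChartAt_symm p₀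
  classical
  let φ : OpenPartialHomeomorph S Y :=
  { toFun := fun q => B (e q)
    -- The chart of `S` is the slice `H = 0` of the straightening. The point `p` is only a default
    -- value outside the target.
    invFun := fun a => if ha : (0, a) ∈ Θ.target then ⟨e.symm (Θ.symm (0, a)), (key a ha).2.2.2.2⟩
      else p
    source := {q | (q : M) ∈ e.source ∩ e ⁻¹' Θ.source}
    target := {a | (0, a) ∈ Θ.target}
    map_source' := by
      rintro q ⟨hq1, hq2⟩
      have := Θ.map_source hq2
      rw [hΘ _ hq2, hzero q hq1 (hΘO hq2)] at this
      exact this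
    map_target' := by
      intro a ha
      have ha' : ((0 : G), a) ∈ Θ.target := ha
      simp only [ha', dite_true]
      have k := key a ha'
      have k2 := h.subset k.2.1
      exact ⟨e.map_target k2, by simpa [mem_preimage, e.right_inv k2] using k.1⟩
    left_inv' := by
      rintro q ⟨hq1, hq2⟩
      have h2 := Θ.map_source hq2
      have h3 := Θ.left_inv hq2
      rw [hΘ _ hq2, hzero q hq1 (hΘO hq2)] at h2 h3
      have h2' : ((0 : G), B (e q)) ∈ Θ.target := h2
      simp only [h2', dite_true]
      ext
      simp only
      rw [h3, e.left_inv hq1]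
    right_inv' := by
      intro a ha
      have ha' : ((0 : G), a) ∈ Θ.target := ha
      have k := key a ha'
      simp only [ha', dite_true]
      rw [e.right_inv (h.subset k.2.1)]
      exact k.2.2.2.1
    open_source := (hec.isOpen_inter_preimage hes Θ.open_source).preimage continuous_subtype_val
    open_target := Θ.open_target.preimage hcs
    continuousOn_toFun := by
      refine B.continuous.comp_continuousOn (hec.comp continuous_subtype_val.continuousOn ?_)
      exact fun q hq => hq.1
    continuousOn_invFun := by
      rw [continuousOn_iff_continuous_domRestrict, continuous_induced_rng]
      have h1 : ContinuousOn (fun a : Y => e.symm (Θ.symm (0, a))) {a | (0, a) ∈ Θ.target} :=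
        hesc.comp (Θ.continuousOn_symm.comp hcs.continuousOn fun a ha => ha)
          fun a ha => h.subset (key a ha).2.1
      rw [continuousOn_iff_continuous_domRestrict] at h1
      convert h1 using 1
      ext a
      have ha' : ((0 : G), (a : Y)) ∈ Θ.target := a.2
      simp [ha'] }
  refine ⟨φ, fun a => Θ.symm (0, a), ⟨hp, haΘ⟩, ?_, ?_, ?_⟩
  · rintro q ⟨hq1, hq2⟩
    exact ⟨hq1, hΘO hq2, rfl, hbij _ hq2⟩
  · exact hΘsymm.comp (by fun_prop) fun a ha => ha
  · intro a ha
    have ha' : ((0 : G), a) ∈ Θ.target := ha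
    have k := key a ha'
    refine ⟨k.2.1, k.2.2.1, k.2.2.2.1, ?_⟩
    change ((if ha : (0, a) ∈ Θ.target then
      (⟨e.symm (Θ.symm (0, a)), (key a ha).2.2.2.2⟩ : S) else p : S) : M) = _
    simp [ha']

end LevelSets

section LevelSets

variable {E G Y : Type*} [NormedAddCommGroup E] [NormedSpace ℝ E] [FiniteDimensional ℝ E]
  [NormedAddCommGroup G] [NormedSpace ℝ G] [FiniteDimensional ℝ G]
  [NormedAddCommGroup Y] [NormedSpace ℝ Y] [FiniteDimensional ℝ Y]
  {HM : Type*} [TopologicalSpace HM] {I : ModelWithCorners ℝ E HM}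
  {M : Type*} [TopologicalSpace M] [ChartedSpace HM M]

/-- The parametrisation is an immersion because `B`, read in the ambient chart, is a left inverse of
it. -/
lemma IsLocalEquation.exists_submanifoldChart [I.Boundaryless] [IsManifold I ∞ M] {S : Set M}
    {p₀ : M} {H : E → G} {O : Set E}
    (h : IsLocalEquation I S p₀ H O) {k : ℕ} (B : E →L[ℝ] EuclideanSpace ℝ (Fin k)) (p : S)
    (hp : (p : M) ∈ (extChartAt I p₀).source) (hpO : extChartAt I p₀ p ∈ O)
    (hB : Function.Bijective ((fderiv ℝ H (extChartAt I p₀ p)).prod B)) :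
    ∃ φ : OpenPartialHomeomorph S (EuclideanSpace ℝ (Fin k)), p ∈ φ.source ∧
      IsSubmanifoldChart I φ ∧
      ∀ q ∈ φ.source, (q : M) ∈ (extChartAt I p₀).source ∧ extChartAt I p₀ q ∈ O ∧
        φ q = B (extChartAt I p₀ q) ∧
        Function.Bijective ((fderiv ℝ H (extChartAt I p₀ q)).prod B) := by
  obtain ⟨φ, σ, hpφ, hφ, hσ, hφσ⟩ := h.exists_chart B p hp hpO hB
  have hsm : ContMDiffOn 𝓘(ℝ, EuclideanSpace ℝ (Fin k)) I ∞ (fun a => (φ.symm a : M)) φ.target := by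
    have h1 : ContMDiffOn 𝓘(ℝ, EuclideanSpace ℝ (Fin k)) I ∞
        ((extChartAt I p₀).symm ∘ σ) φ.target :=
      (contMDiffOn_extChartAt_symm p₀).comp hσ.contMDiffOn fun a ha => h.subset (hφσ a ha).1
    exact h1.congr fun a ha => (hφσ a ha).2.2.2
  refine ⟨φ, hpφ, ⟨hsm, ?_⟩, hφ⟩
  intro a ha
  have hd : MDifferentiableAt 𝓘(ℝ, EuclideanSpace ℝ (Fin k)) I (fun a => (φ.symm a : M)) a :=
    ((hsm a ha).contMDiffAt (φ.open_target.mem_nhds ha)).mdifferentiableAt (by simp)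
  have hsrc : (φ.symm a : M) ∈ (chartAt HM p₀).source := by
    have := (hφ _ (φ.map_target ha)).1
    rwa [extChartAt_source] at this
  have he : MDifferentiableAt I 𝓘(ℝ, E) (extChartAt I p₀) (φ.symm a : M) :=
    mdifferentiableAt_extChartAt hsrc
  have hB' : MDifferentiableAt 𝓘(ℝ, E) 𝓘(ℝ, EuclideanSpace ℝ (Fin k)) B
      (extChartAt I p₀ (φ.symm a : M)) := B.mdifferentiableAt
  have hcomp := mfderiv_comp (I := 𝓘(ℝ, EuclideanSpace ℝ (Fin k)))
    (I' := I) (I'' := 𝓘(ℝ, EuclideanSpace ℝ (Fin k))) a (hB'.comp (φ.symm a : M) he) hd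
  have hid : ((B ∘ extChartAt I p₀) ∘ fun a => (φ.symm a : M)) =ᶠ[𝓝 a] id := by
    filter_upwards [φ.open_target.mem_nhds ha] with b hb
    have := (hφ _ (φ.map_target hb)).2.2.1
    rw [φ.right_inv hb] at this
    exact this.symm
  rw [hid.mfderiv_eq, mfderiv_id] at hcomp
  intro v w hvw
  have h1 : ∀ v, v = (mfderiv I 𝓘(ℝ, EuclideanSpace ℝ (Fin k)) (B ∘ extChartAt I p₀)
      (φ.symm a : M)) (mfderiv 𝓘(ℝ, EuclideanSpace ℝ (Fin k)) I (fun a => (φ.symm a : M)) a v) :=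
    fun v => DFunLike.congr_fun hcomp v
  rw [h1 v, h1 w, hvw]

/-- The derivative of a curve in terms of the chart at its base point. -/
lemma mfderiv_curve_eq [I.Boundaryless] {γ : ℝ → M} (hγ : MDifferentiableAt 𝓘(ℝ, ℝ) I γ 0) :
    (mfderiv 𝓘(ℝ, ℝ) I γ 0 (1 : ℝ) : E) = fderiv ℝ (extChartAt I (γ 0) ∘ γ) 0 1 := by
  rw [hγ.mfderiv]
  simp [writtenInExtChartAt, fderivWithin_univ]
  rfl

/-- The tangent vectors of a regular level set are the kernel of the derivative. -/
lemma IsLocalEquation.mem_tangentVectors_iff [I.Boundaryless] [IsManifold I ∞ M] {S : Set M}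
    {p : M} {H : E → G} {O : Set E} (h : IsLocalEquation I S p H O) (hpS : p ∈ S)
    (hpO : extChartAt I p p ∈ O) (hsurj : Function.Surjective (fderiv ℝ H (extChartAt I p p)))
    (v : E) : v ∈ (tangentVectors I S p : Set E) ↔ fderiv ℝ H (extChartAt I p p) v = 0 := by
  have hHd : DifferentiableAt ℝ H (extChartAt I p p) :=
    ((h.contDiffOn _ hpO).contDiffAt (h.isOpen.mem_nhds hpO)).differentiableAt (by simp)
  constructor
  · rintro ⟨γ, r, hr, hγ, hγS, rfl, hv⟩
    have h0 : (0 : ℝ) ∈ Ioo (-r) r := ⟨by linarith, hr⟩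
    have hγ0 : MDifferentiableAt 𝓘(ℝ, ℝ) I γ 0 :=
      ((hγ 0 h0).contMDiffAt (Ioo_mem_nhds h0.1 h0.2)).mdifferentiableAt (by simp)
    have hv' : fderiv ℝ (extChartAt I (γ 0) ∘ γ) 0 1 = v := by
      rw [← mfderiv_curve_eq hγ0]; exact hv
    have hed : DifferentiableAt ℝ (extChartAt I (γ 0) ∘ γ) 0 := by
      rw [← mdifferentiableAt_iff_differentiableAt]
      exact (mdifferentiableAt_extChartAt (mem_chart_source _ _)).comp 0 hγ0
    have hz : (H ∘ (extChartAt I (γ 0) ∘ γ)) =ᶠ[𝓝 0] fun _ => (0 : G) := by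
      have c1 : ∀ᶠ t in 𝓝 (0 : ℝ), γ t ∈ (extChartAt I (γ 0)).source :=
        hγ0.continuousAt.eventually_mem (extChartAt_source_mem_nhds (I := I) (γ 0))
      have c2 : ∀ᶠ t in 𝓝 (0 : ℝ), (extChartAt I (γ 0) ∘ γ) t ∈ O :=
        hed.continuousAt.eventually_mem (h.isOpen.mem_nhds hpO)
      filter_upwards [c1, c2, Ioo_mem_nhds h0.1 h0.2] with t ht1 ht2 ht3
      have := (h.mem_iff _ ht2).1
      rw [Function.comp_apply, (extChartAt I (γ 0)).left_inv ht1] at this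
      exact this (hγS t ht3)
    have := fderiv_comp (𝕜 := ℝ) (0 : ℝ) (g := H) (f := extChartAt I (γ 0) ∘ γ) hHd hed
    rw [hz.fderiv_eq] at this
    have := DFunLike.congr_fun this 1
    simp only [ContinuousLinearMap.comp_apply, hv'] at this
    rw [← Function.comp_apply (f := extChartAt I (γ 0)) (g := γ), ← this]
    simp
  · intro hv
    -- Conversely, a kernel vector `v` is realised by a curve: in a chart of `S` given by a linear
    -- complement `B`, the line through the base point with velocity `B v` is lifted to `S`.
    have hfr : Module.finrank ℝ E = Module.finrank ℝ G +
        Module.finrank ℝ (EuclideanSpace ℝ (Fin (Module.finrank ℝ E - Module.finrank ℝ G))) := by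
      have := LinearMap.finrank_le_finrank_of_surjective
        (f := (fderiv ℝ H (extChartAt I p p)).toLinearMap) hsurj
      rw [finrank_euclideanSpace_fin]; omega
    obtain ⟨B, hB⟩ := exists_bijective_prod hfr hsurj
    obtain ⟨φ, σ, hpφ, hφ, hσ, hφσ⟩ := h.exists_chart B ⟨p, hpS⟩ (mem_extChartAt_source p) hpO hB
    set a₀ := B (extChartAt I p p) with ha₀
    have ha₀φ : φ ⟨p, hpS⟩ = a₀ := (hφ _ hpφ).2.2.1
    have ha₀t : a₀ ∈ φ.target := ha₀φ ▸ φ.map_source hpφ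
    have hσ0 : (extChartAt I p).symm (σ a₀) = p := by
      rw [← (hφσ a₀ ha₀t).2.2.2, ← ha₀φ, φ.left_inv hpφ]
    have hσ0' : σ a₀ = extChartAt I p p := by
      have := (extChartAt I p).right_inv (h.subset (hφσ a₀ ha₀t).1)
      rw [← this, hσ0]
    let ℓ : ℝ → EuclideanSpace ℝ (Fin (Module.finrank ℝ E - Module.finrank ℝ G)) :=
      fun t => a₀ + t • B v
    have hℓ : ContDiff ℝ ∞ ℓ := by fun_prop
    have hℓ0 : ℓ 0 = a₀ := by simp [ℓ]
    have hev : ∀ᶠ t in 𝓝 (0 : ℝ), ℓ t ∈ φ.target :=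
      hℓ.continuous.continuousAt.eventually_mem (φ.open_target.mem_nhds (by rw [hℓ0]; exact ha₀t))
    obtain ⟨r, hr, hrt⟩ := Metric.eventually_nhds_iff_ball.1 hev
    have hrt' : ∀ t ∈ Ioo (-r) r, ℓ t ∈ φ.target := fun t ht =>
      hrt t (by rw [Real.ball_eq_Ioo]; simpa using ht)
    have hsmooth : ContDiffOn ℝ ∞ (σ ∘ ℓ) (Ioo (-r) r) :=
      hσ.comp hℓ.contDiffOn hrt'
    have hγ : ContMDiffOn 𝓘(ℝ, ℝ) I ∞ ((extChartAt I p).symm ∘ (σ ∘ ℓ)) (Ioo (-r) r) :=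
      (contMDiffOn_extChartAt_symm p).comp hsmooth.contMDiffOn
        fun t ht => h.subset (hφσ _ (hrt' t ht)).1
    have h0 : (0 : ℝ) ∈ Ioo (-r) r := ⟨by linarith, hr⟩
    have hγ0 : ((extChartAt I p).symm ∘ (σ ∘ ℓ)) 0 = p := by
      simp only [Function.comp_apply, hℓ0, hσ0]
    refine ⟨(extChartAt I p).symm ∘ (σ ∘ ℓ), r, hr, hγ, ?_, hγ0, ?_⟩
    · intro t ht
      have := hφσ _ (hrt' t ht)
      simp only [Function.comp_apply]
      rw [← this.2.2.2]
      exact (φ.symm (ℓ t)).2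
    · have hmd : MDifferentiableAt 𝓘(ℝ, ℝ) I ((extChartAt I p).symm ∘ (σ ∘ ℓ)) 0 :=
        ((hγ 0 h0).contMDiffAt (Ioo_mem_nhds h0.1 h0.2)).mdifferentiableAt (by simp)
      rw [mfderiv_curve_eq hmd, hγ0]
      have heq : (extChartAt I p ∘ ((extChartAt I p).symm ∘ (σ ∘ ℓ))) =ᶠ[𝓝 0] σ ∘ ℓ := by
        filter_upwards [Ioo_mem_nhds h0.1 h0.2] with t ht
        exact (extChartAt I p).right_inv (h.subset (hφσ _ (hrt' t ht)).1)
      rw [heq.fderiv_eq]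
      have hsd : DifferentiableAt ℝ (σ ∘ ℓ) 0 :=
        ((hsmooth 0 h0).contDiffAt (Ioo_mem_nhds h0.1 h0.2)).differentiableAt (by simp)
      have hs0 : (σ ∘ ℓ) 0 = extChartAt I p p := by simp only [Function.comp_apply, hℓ0, hσ0']
      -- The velocity of the lift and `v` are both killed by `dH` and have the same image under `B`;
      -- injectivity of `(dH, B)` identifies them.
      apply hB.1
      have e1 : fderiv ℝ H (extChartAt I p p) (fderiv ℝ (σ ∘ ℓ) 0 1) = 0 := by
        have hz : (H ∘ (σ ∘ ℓ)) =ᶠ[𝓝 0] fun _ => (0 : G) := by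
          filter_upwards [Ioo_mem_nhds h0.1 h0.2] with t ht
          exact (hφσ _ (hrt' t ht)).2.1
        have := fderiv_comp (𝕜 := ℝ) (0 : ℝ) (g := H) (f := σ ∘ ℓ) (by rw [hs0]; exact hHd) hsd
        rw [hz.fderiv_eq, hs0] at this
        have := DFunLike.congr_fun this 1
        simpa using this.symm
      have e2 : B (fderiv ℝ (σ ∘ ℓ) 0 1) = B v := by
        have hz : (B ∘ (σ ∘ ℓ)) =ᶠ[𝓝 0] ℓ := by
          filter_upwards [Ioo_mem_nhds h0.1 h0.2] with t ht
          exact (hφσ _ (hrt' t ht)).2.2.1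
        have := fderiv_comp (𝕜 := ℝ) (0 : ℝ) (g := B) (f := σ ∘ ℓ) B.differentiableAt hsd
        rw [hz.fderiv_eq, B.fderiv] at this
        have := DFunLike.congr_fun this 1
        simp only [ContinuousLinearMap.comp_apply] at this
        rw [← this]
        have hd : HasFDerivAt ℓ ((ContinuousLinearMap.id ℝ ℝ).smulRight (B v)) 0 := by
          have h1 := (hasFDerivAt_id (𝕜 := ℝ) (0 : ℝ)).smul_const (B v)
          exact h1.const_add a₀
        rw [hd.fderiv]; simp
      simp only [ContinuousLinearMap.prod_apply, e1, e2]
      exact Prod.ext hv.symm rfl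

end LevelSets

/-! ### Coordinates on the line bundles -/

section LineBundle

variable {X : Type*} [TopologicalSpace X]
  (L : X → Type*) [∀ x, AddCommGroup (L x)] [∀ x, Module ℂ (L x)] [∀ x, TopologicalSpace (L x)]
  [TopologicalSpace (TotalSpace ℂ L)] [FiberBundle ℂ L] [VectorBundle ℂ ℂ L]
  (L₀ : X → Type*) [∀ x, AddCommGroup (L₀ x)] [∀ x, Module ℂ (L₀ x)]
  [∀ x, TopologicalSpace (L₀ x)]
  [TopologicalSpace (TotalSpace ℂ L₀)] [FiberBundle ℂ L₀] [VectorBundle ℂ ℂ L₀]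

/-- The linear coordinate on the fibre of `L` at `y` in the trivialization around `x₀`. -/
def fibreCoord (x₀ y : X) : L y →ₗ[ℂ] ℂ := (trivializationAt ℂ L x₀).linearMapAt ℂ y

/-- The basis vector of the fibre of `L` at `y` in the trivialization around `x₀`. -/
def fibreFrame (x₀ y : X) : L y := (trivializationAt ℂ L x₀).symm y 1

/-- The transition function between the trivializations around `x₀` and `x₁`. -/
def transition (x₀ x₁ y : X) : ℂ := fibreCoord L x₀ y (fibreFrame L x₁ y)

variable {L}

lemma fibreCoord_frame {x₀ y : X} (hy : y ∈ baseSetAt L x₀) :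
    fibreCoord L x₀ y (fibreFrame L x₀ y) = 1 := by
  have := (trivializationAt ℂ L x₀).linearMapAt_symmₗ (R := ℂ) hy 1
  rwa [Trivialization.coe_symmₗ _ hy] at this

lemma fibreCoord_smul_frame {x₀ y : X} (hy : y ∈ baseSetAt L x₀) (v : L y) :
    fibreCoord L x₀ y v • fibreFrame L x₀ y = v := by
  have h1 := (trivializationAt ℂ L x₀).symmₗ_linearMapAt (R := ℂ) hy v
  have h2 : (trivializationAt ℂ L x₀).linearMapAt ℂ y v =
    (trivializationAt ℂ L x₀).linearMapAt ℂ y v • (1 : ℂ) := by simp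
  rw [h2, map_smul, Trivialization.coe_symmₗ _ hy] at h1
  exact h1

lemma fibreCoord_eq_transition_mul {x₁ y : X} (hy : y ∈ baseSetAt L x₁) (x₀ : X) (v : L y) :
    fibreCoord L x₀ y v = transition L x₀ x₁ y * fibreCoord L x₁ y v := by
  conv_lhs => rw [← fibreCoord_smul_frame hy v]
  rw [map_smul, smul_eq_mul, mul_comm]; rfl

lemma transition_mul_transition {x₀ x₁ y : X} (h₀ : y ∈ baseSetAt L x₀) (h₁ : y ∈ baseSetAt L x₁) :
    transition L x₀ x₁ y * transition L x₁ x₀ y = 1 := by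
  rw [transition, transition, ← fibreCoord_frame h₀,
    fibreCoord_eq_transition_mul h₁ x₀ (fibreFrame L x₀ y)]
  rfl

lemma transition_ne_zero {x₀ x₁ y : X} (h₀ : y ∈ baseSetAt L x₀) (h₁ : y ∈ baseSetAt L x₁) :
    transition L x₀ x₁ y ≠ 0 := fun h => by
  have := transition_mul_transition h₀ h₁
  simp [h] at this

lemma transition_symm {x₀ x₁ y : X} (h₀ : y ∈ baseSetAt L x₀) (h₁ : y ∈ baseSetAt L x₁) :
    transition L x₁ x₀ y = (transition L x₀ x₁ y)⁻¹ :=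
  eq_inv_of_mul_eq_one_right (transition_mul_transition h₀ h₁)

lemma fibreFrame_eq {x₀ x₁ y : X} (h₁ : y ∈ baseSetAt L x₁) :
    fibreFrame L x₀ y = transition L x₁ x₀ y • fibreFrame L x₁ y :=
  (fibreCoord_smul_frame h₁ _).symm

lemma contMDiffOn_transition [ChartedSpace Model X]
    [ContMDiffVectorBundle ω ℂ L 𝓘(ℂ, Model)] (x₀ x₁ : X) :
    ContMDiffOn 𝓘(ℂ, Model) 𝓘(ℂ, ℂ) ω (transition L x₀ x₁) (baseSetAt L x₀ ∩ baseSetAt L x₁) := by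
  have h := contMDiffOn_coordChangeL (n := ω) (IB := 𝓘(ℂ, Model)) (trivializationAt ℂ L x₁)
    (trivializationAt ℂ L x₀)
  have h2 := (h.clm_apply (contMDiffOn_const (c := (1 : ℂ)))).mono
    (inter_comm (baseSetAt L x₀) (baseSetAt L x₁)).subset
  refine h2.congr fun y hy => ?_
  rw [ContinuousLinearEquiv.coe_coe]
  rw [Trivialization.coordChangeL_apply _ _ ⟨hy.2, hy.1⟩]
  simp only [transition, fibreCoord, fibreFrame]
  rw [Trivialization.linearMapAt_apply, if_pos hy.1]

lemma sqCoord_tmul (x₀ y : X) (a b : L y) :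
    sqCoord L x₀ y (a ⊗ₜ b) = fibreCoord L x₀ y a * fibreCoord L x₀ y b := by
  simp [sqCoord, fibreCoord]

lemma sqCoord_eq_transition_mul {x₁ y : X} (hy : y ∈ baseSetAt L x₁) (x₀ : X) (t : L y ⊗[ℂ] L y) :
    sqCoord L x₀ y t = transition L x₀ x₁ y ^ 2 * sqCoord L x₁ y t := by
  induction t with
  | zero => simp
  | tmul a b =>
    rw [sqCoord_tmul, sqCoord_tmul, fibreCoord_eq_transition_mul hy x₀ a,
      fibreCoord_eq_transition_mul hy x₀ b]
    ring
  | add a b ha hb => rw [map_add, map_add, ha, hb]; ring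

lemma sqCoord_smul_frame {x₀ y : X} (hy : y ∈ baseSetAt L x₀) (t : L y ⊗[ℂ] L y) :
    sqCoord L x₀ y t • (fibreFrame L x₀ y ⊗ₜ[ℂ] fibreFrame L x₀ y) = t := by
  induction t with
  | zero => simp
  | tmul a b =>
    conv_rhs => rw [← fibreCoord_smul_frame hy a, ← fibreCoord_smul_frame hy b]
    rw [sqCoord_tmul, TensorProduct.smul_tmul_smul]
  | add a b ha hb => rw [map_add, add_smul, ha, hb]

lemma sqCoord_injective {x₀ y : X} (hy : y ∈ baseSetAt L x₀) :
    Function.Injective (sqCoord L x₀ y) := fun s t h => by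
  rw [← sqCoord_smul_frame hy s, h, sqCoord_smul_frame hy]

lemma sqRep_eq_transition_mul (s : ∀ x, L x ⊗[ℂ] L x) {x₁ y : X} (hy : y ∈ baseSetAt L x₁)
    (x₀ : X) : sqRep s x₀ y = transition L x₀ x₁ y ^ 2 * sqRep s x₁ y :=
  sqCoord_eq_transition_mul hy x₀ _

lemma sqRep_eq_zero_iff (s : ∀ x, L x ⊗[ℂ] L x) {x₀ y : X} (hy : y ∈ baseSetAt L x₀) :
    sqRep s x₀ y = 0 ↔ s y = 0 := map_eq_zero_iff _ (sqCoord_injective hy)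

variable {L₀}

lemma sqCoord_hom_apply (Φ : ∀ x, L₀ x →ₗ[ℂ] L x ⊗[ℂ] L x) {x₀ y : X} (hy : y ∈ baseSetAt L₀ x₀)
    (v : L₀ y) : sqCoord L x₀ y (Φ y v) = fibreCoord L₀ x₀ y v * homRep Φ x₀ y := by
  conv_lhs => rw [← fibreCoord_smul_frame hy v]
  rw [map_smul, map_smul, smul_eq_mul]; rfl

/-- The frame of `L₀` enters as the argument of `Φ`, so its transition function occurs inverted,
with the indices exchanged: the cocycle of `L² ⊗ L₀⁻¹`. -/
lemma homRep_eq_transition_mul (Φ : ∀ x, L₀ x →ₗ[ℂ] L x ⊗[ℂ] L x) {x₀ x₁ y : X}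
    (hy : y ∈ baseSetAt L x₁) (h₁ : y ∈ baseSetAt L₀ x₁) :
    homRep Φ x₀ y =
      transition L x₀ x₁ y ^ 2 * transition L₀ x₁ x₀ y * homRep Φ x₁ y := by
  change sqCoord L x₀ y (Φ y (fibreFrame L₀ x₀ y)) = _
  rw [fibreFrame_eq h₁, map_smul, map_smul, sqCoord_eq_transition_mul hy x₀, smul_eq_mul]
  change _ = _ * sqCoord L x₁ y (Φ y (fibreFrame L₀ x₁ y))
  ring

lemma homRep_eq_zero_iff (Φ : ∀ x, L₀ x →ₗ[ℂ] L x ⊗[ℂ] L x) {x₀ y : X}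
    (hy : y ∈ baseSetAt L x₀) (hy' : y ∈ baseSetAt L₀ x₀) : homRep Φ x₀ y = 0 ↔ Φ y = 0 := by
  constructor
  · intro h
    ext v
    apply sqCoord_injective hy
    rw [sqCoord_hom_apply Φ hy', h]; simp
  · intro h; simp [homRep, h]

end LineBundle

/-! ### The equations of `Z`, `R` and `δ` in local coordinates. -/

section Cover

variable {X : Type*} [TopologicalSpace X]
  {L₁ : X → Type*} [∀ x, AddCommGroup (L₁ x)] [∀ x, Module ℂ (L₁ x)]
  {L₂ : X → Type*} [∀ x, AddCommGroup (L₂ x)] [∀ x, Module ℂ (L₂ x)]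
  [∀ x, TopologicalSpace (L₁ x)] [TopologicalSpace (TotalSpace ℂ L₁)] [FiberBundle ℂ L₁]
  [VectorBundle ℂ ℂ L₁]
  [∀ x, TopologicalSpace (L₂ x)] [TopologicalSpace (TotalSpace ℂ L₂)] [FiberBundle ℂ L₂]
  [VectorBundle ℂ ℂ L₂]
  (f : ∀ x, L₁ x ⊗[ℂ] L₁ x) (g : ∀ x, L₂ x ⊗[ℂ] L₂ x)
  (Φ : ∀ x, L₂ x →ₗ[ℂ] L₁ x ⊗[ℂ] L₁ x) (Ψ : ∀ x, L₁ x →ₗ[ℂ] L₂ x ⊗[ℂ] L₂ x)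

lemma mem_coverZ_iff {x₀ : X} {p : TotalV L₁ L₂} (h₁ : p.proj ∈ baseSetAt L₁ x₀)
    (h₂ : p.proj ∈ baseSetAt L₂ x₀) :
    p ∈ coverZ f g Φ Ψ ↔
      (fibreCoord L₁ x₀ p.proj p.2.1, fibreCoord L₂ x₀ p.proj p.2.2) ∈
        fibreSet (sqRep f x₀ p.proj) (sqRep g x₀ p.proj) (homRep Φ x₀ p.proj)
          (homRep Ψ x₀ p.proj) := by
  refine and_congr ?_ ?_
  · rw [← (sqCoord_injective h₁).eq_iff, sqCoord_tmul, map_add, sqCoord_hom_apply Φ h₂, ← pow_two]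
    rfl
  · rw [← (sqCoord_injective h₂).eq_iff, sqCoord_tmul, map_add, sqCoord_hom_apply Ψ h₁, ← pow_two]
    rfl

/-- The tensors lie in a one-dimensional space, where a single coordinate decides equality. Both
sides are bilinear in `z'` and `w'`, so testing on the frames is enough. -/
lemma mem_ramificationR_iff {x₀ : X} {p : TotalV L₁ L₂} (h₁ : p.proj ∈ baseSetAt L₁ x₀)
    (h₂ : p.proj ∈ baseSetAt L₂ x₀) :
    p ∈ ramificationR f g Φ Ψ ↔ p ∈ coverZ f g Φ Ψ ∧
      4 * fibreCoord L₁ x₀ p.proj p.2.1 * fibreCoord L₂ x₀ p.proj p.2.2 =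
        homRep Φ x₀ p.proj * homRep Ψ x₀ p.proj := by
  refine and_congr Iff.rfl ?_
  have hinj : ∀ (a b : L₁ p.proj ⊗[ℂ] L₁ p.proj) (c d : L₂ p.proj ⊗[ℂ] L₂ p.proj) (k : ℂ),
      k • (a ⊗ₜ[ℂ] c) = b ⊗ₜ[ℂ] d ↔
        k * (sqCoord L₁ x₀ _ a * sqCoord L₂ x₀ _ c) = sqCoord L₁ x₀ _ b * sqCoord L₂ x₀ _ d := by
    intro a b c d k
    constructor
    · intro h
      have := congrArg (LinearMap.mul' ℂ ℂ ∘ₗ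
        TensorProduct.map (sqCoord L₁ x₀ p.proj) (sqCoord L₂ x₀ p.proj)) h
      simpa using this
    · intro h
      rw [← sqCoord_smul_frame h₁ a, ← sqCoord_smul_frame h₁ b, ← sqCoord_smul_frame h₂ c,
        ← sqCoord_smul_frame h₂ d, TensorProduct.smul_tmul_smul, TensorProduct.smul_tmul_smul,
        smul_smul, h]
  simp only [hinj, sqCoord_tmul, sqCoord_hom_apply Φ h₂, sqCoord_hom_apply Ψ h₁]
  constructor
  · intro h
    have := h (fibreFrame L₁ x₀ p.proj) (fibreFrame L₂ x₀ p.proj)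
    rw [fibreCoord_frame h₁, fibreCoord_frame h₂] at this
    linear_combination this
  · intro h z' w'
    linear_combination (fibreCoord L₁ x₀ p.proj z') * (fibreCoord L₂ x₀ p.proj w') * h

lemma deltaRep_eq (x₀ y : X) : deltaRep f g Φ Ψ x₀ y =
    fibreDisc (sqRep f x₀ y) (sqRep g x₀ y) (homRep Φ x₀ y) (homRep Ψ x₀ y) := rfl

/-- All five monomials of the discriminant have weight four in each of the two line bundles. -/
lemma deltaRep_eq_transition_mul {x₀ x₁ y : X} (h₁ : y ∈ baseSetAt L₁ x₁) (h₂ : y ∈ baseSetAt L₂ x₁)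
    (h₁' : y ∈ baseSetAt L₁ x₀) (h₂' : y ∈ baseSetAt L₂ x₀) :
    deltaRep f g Φ Ψ x₀ y =
      (transition L₁ x₀ x₁ y * transition L₂ x₀ x₁ y) ^ 4 * deltaRep f g Φ Ψ x₁ y := by
  rw [deltaRep_eq, deltaRep_eq, sqRep_eq_transition_mul f h₁ x₀, sqRep_eq_transition_mul g h₂ x₀,
    homRep_eq_transition_mul Φ h₁ h₂, homRep_eq_transition_mul Ψ h₂ h₁,
    transition_symm h₁' h₁, transition_symm h₂' h₂]
  have n₁ := transition_ne_zero h₁' h₁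
  have n₂ := transition_ne_zero h₂' h₂
  unfold fibreDisc
  field_simp

variable [ChartedSpace Model X]

/-- The chart of the total space of `L₁ ⊕ L₂` around `x₀`. -/
abbrev totalChart (L₁ L₂ : X → Type*) [∀ x, AddCommGroup (L₁ x)] [∀ x, Module ℂ (L₁ x)]
    [∀ x, AddCommGroup (L₂ x)] [∀ x, Module ℂ (L₂ x)]
    [∀ x, TopologicalSpace (L₁ x)] [TopologicalSpace (TotalSpace ℂ L₁)] [FiberBundle ℂ L₁]
    [VectorBundle ℂ ℂ L₁]
    [∀ x, TopologicalSpace (L₂ x)] [TopologicalSpace (TotalSpace ℂ L₂)] [FiberBundle ℂ L₂]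
    [VectorBundle ℂ ℂ L₂] (x₀ : X) : PartialEquiv (TotalV L₁ L₂) (Model × (ℂ × ℂ)) :=
  extChartAt modelV (⟨x₀, 0⟩ : TotalV L₁ L₂)

/-- The domain in `X` of the coordinates around `x₀`. -/
def coordDomain (L₁ L₂ : X → Type*) [∀ x, AddCommGroup (L₁ x)] [∀ x, Module ℂ (L₁ x)]
    [∀ x, AddCommGroup (L₂ x)] [∀ x, Module ℂ (L₂ x)]
    [∀ x, TopologicalSpace (L₁ x)] [TopologicalSpace (TotalSpace ℂ L₁)] [FiberBundle ℂ L₁]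
    [∀ x, TopologicalSpace (L₂ x)] [TopologicalSpace (TotalSpace ℂ L₂)] [FiberBundle ℂ L₂]
     (x₀ : X) : Set X :=
  (chartAt Model x₀).source ∩ (baseSetAt L₁ x₀ ∩ baseSetAt L₂ x₀)

lemma isOpen_coordDomain (x₀ : X) : IsOpen (coordDomain L₁ L₂ x₀) :=
  (chartAt Model x₀).open_source.inter
    ((trivializationAt ℂ L₁ x₀).open_baseSet.inter (trivializationAt ℂ L₂ x₀).open_baseSet)

lemma mem_coordDomain (x₀ : X) : x₀ ∈ coordDomain L₁ L₂ x₀ :=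
  ⟨mem_chart_source _ _, mem_baseSet_trivializationAt ℂ L₁ x₀, mem_baseSet_trivializationAt ℂ L₂ x₀⟩

/-- The domain in the model space of the coordinates around `x₀`. -/
def coordTarget (L₁ L₂ : X → Type*) [∀ x, AddCommGroup (L₁ x)] [∀ x, Module ℂ (L₁ x)]
    [∀ x, AddCommGroup (L₂ x)] [∀ x, Module ℂ (L₂ x)]
    [∀ x, TopologicalSpace (L₁ x)] [TopologicalSpace (TotalSpace ℂ L₁)] [FiberBundle ℂ L₁]
    [∀ x, TopologicalSpace (L₂ x)] [TopologicalSpace (TotalSpace ℂ L₂)] [FiberBundle ℂ L₂]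
     (x₀ : X) : Set Model :=
  (chartAt Model x₀).target ∩ (chartAt Model x₀).symm ⁻¹' (baseSetAt L₁ x₀ ∩ baseSetAt L₂ x₀)

lemma isOpen_coordTarget (x₀ : X) : IsOpen (coordTarget L₁ L₂ x₀) :=
  (chartAt Model x₀).isOpen_inter_preimage_symm
    ((trivializationAt ℂ L₁ x₀).open_baseSet.inter (trivializationAt ℂ L₂ x₀).open_baseSet)

lemma symm_mem_coordDomain {x₀ : X} {a : Model} (ha : a ∈ coordTarget L₁ L₂ x₀) :
    (chartAt Model x₀).symm a ∈ coordDomain L₁ L₂ x₀ :=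
  ⟨(chartAt Model x₀).map_target ha.1, ha.2⟩

lemma chart_mem_coordTarget {x₀ y : X} (hy : y ∈ coordDomain L₁ L₂ x₀) :
    chartAt Model x₀ y ∈ coordTarget L₁ L₂ x₀ :=
  ⟨(chartAt Model x₀).map_source hy.1, by
    rw [mem_preimage, (chartAt Model x₀).left_inv hy.1]; exact hy.2⟩

/-- The charts of the total space depend on the base point alone, so a family of coordinates indexed
by `X` suffices. -/
lemma extChartAt_eq_totalChart (p : TotalV L₁ L₂) :
    extChartAt modelV p = totalChart L₁ L₂ p.proj := by
  rw [totalChart, FiberBundle.extChartAt, FiberBundle.extChartAt]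

lemma totalChart_source (x₀ : X) :
    (totalChart L₁ L₂ x₀).source = {p | p.proj ∈ coordDomain L₁ L₂ x₀} := by
  rw [totalChart, FiberBundle.extChartAt]
  ext p
  simp only [coordDomain, mfld_simps, Trivialization.source_eq]
  exact ⟨fun h => ⟨h.2, h.1.1, h.1.2⟩, fun h => ⟨⟨h.2.1, h.2.2⟩, h.1⟩⟩

lemma mem_totalChart_source {x₀ : X} {p : TotalV L₁ L₂} :
    p ∈ (totalChart L₁ L₂ x₀).source ↔ p.proj ∈ coordDomain L₁ L₂ x₀ := by
  rw [totalChart_source]; rfl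

lemma totalChart_target (x₀ : X) :
    (totalChart L₁ L₂ x₀).target = coordTarget L₁ L₂ x₀ ×ˢ univ := by
  rw [totalChart, FiberBundle.extChartAt_target]
  simp [coordTarget]

lemma mem_totalChart_target {x₀ : X} {v : Model × (ℂ × ℂ)} :
    v ∈ (totalChart L₁ L₂ x₀).target ↔ v.1 ∈ coordTarget L₁ L₂ x₀ := by
  rw [totalChart_target]; simp

lemma totalChart_apply {x₀ : X} {p : TotalV L₁ L₂} (hp : p.proj ∈ coordDomain L₁ L₂ x₀) :
    totalChart L₁ L₂ x₀ p =
      (chartAt Model x₀ p.proj, fibreCoord L₁ x₀ p.proj p.2.1, fibreCoord L₂ x₀ p.proj p.2.2) := by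
  rw [totalChart, FiberBundle.extChartAt]
  simp only [fibreCoord, Trivialization.linearMapAt_apply, if_pos hp.2.1, if_pos hp.2.2]
  rfl

lemma totalChart_symm {x₀ : X} {v : Model × (ℂ × ℂ)} (hv : v.1 ∈ coordTarget L₁ L₂ x₀) :
    ((totalChart L₁ L₂ x₀).symm v).proj = (chartAt Model x₀).symm v.1 ∧
    fibreCoord L₁ x₀ ((totalChart L₁ L₂ x₀).symm v).proj ((totalChart L₁ L₂ x₀).symm v).2.1 = v.2.1 ∧
    fibreCoord L₂ x₀ ((totalChart L₁ L₂ x₀).symm v).proj ((totalChart L₁ L₂ x₀).symm v).2.2 =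
      v.2.2 := by
  have hv' := mem_totalChart_target.2 hv
  have h1 := (totalChart L₁ L₂ x₀).map_target hv'
  have h2 := (totalChart L₁ L₂ x₀).right_inv hv'
  rw [mem_totalChart_source] at h1
  rw [totalChart_apply h1] at h2
  refine ⟨?_, congrArg (fun t => t.2.1) h2, congrArg (fun t => t.2.2) h2⟩
  rw [← congrArg Prod.fst h2, (chartAt Model x₀).left_inv h1.1]

end Cover

/-! ### The underlying real manifolds -/

lemma isManifold_real_of_complex {E : Type*} [NormedAddCommGroup E] [NormedSpace ℂ E]
    {H : Type*} [TopologicalSpace H] (I : ModelWithCorners ℂ E H) (J : ModelWithCorners ℝ E H)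
    (hI : (I : H → E) = J) (hI' : (I.symm : E → H) = J.symm)
    (M : Type*) [TopologicalSpace M] [ChartedSpace H M] [IsManifold I ω M] : IsManifold J ∞ M := by
  apply isManifold_of_contDiffOn
  intro e e' he he'
  have h := (contDiffGroupoid ω I).compatible he he'
  have h2 : ContDiffOn ℂ ω (I ∘ (e.symm ≫ₕ e') ∘ I.symm)
      (I.symm ⁻¹' (e.symm ≫ₕ e').source ∩ range I) := h.1
  rw [← hI, ← hI']
  exact (h2.restrict_scalars ℝ).of_le le_top

instance realManifold {X : Type*} [TopologicalSpace X] [ChartedSpace Model X]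
    [IsManifold 𝓘(ℂ, Model) ω X] : IsManifold 𝓘(ℝ, Model) ∞ X :=
  isManifold_real_of_complex 𝓘(ℂ, Model) 𝓘(ℝ, Model) rfl rfl X

section Local

variable {X : Type*} [TopologicalSpace X] [ChartedSpace Model X] [IsManifold 𝓘(ℂ, Model) ω X]

/-- The local expression of a function in the chart around `x₀`. -/
def inChart (x₀ : X) (r : X → ℂ) (a : Model) : ℂ := r ((chartAt Model x₀).symm a)

lemma inChart_apply {x₀ y : X} (hy : y ∈ (chartAt Model x₀).source) (r : X → ℂ) :
    inChart x₀ r (chartAt Model x₀ y) = r y := by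
  rw [inChart, (chartAt Model x₀).left_inv hy]

lemma contDiffAt_inChart_complex {x₀ y : X} (hy : y ∈ (chartAt Model x₀).source) {r : X → ℂ}
    {s : Set X} (hs : IsOpen s) (hys : y ∈ s) (hr : ContMDiffOn 𝓘(ℂ, Model) 𝓘(ℂ, ℂ) ω r s) :
    ContDiffAt ℂ ω (inChart x₀ r) (chartAt Model x₀ y) := by
  have h1 : ContMDiffAt 𝓘(ℂ, Model) 𝓘(ℂ, Model) ω (chartAt Model x₀).symm (chartAt Model x₀ y) :=
    (contMDiffOn_chart_symm (I := 𝓘(ℂ, Model)) (n := ω) (x := x₀)).contMDiffAt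
      ((chartAt Model x₀).open_target.mem_nhds ((chartAt Model x₀).map_source hy))
  have h2 : ContMDiffAt 𝓘(ℂ, Model) 𝓘(ℂ, ℂ) ω r ((chartAt Model x₀).symm (chartAt Model x₀ y)) := by
    rw [(chartAt Model x₀).left_inv hy]
    exact (hr y hys).contMDiffAt (hs.mem_nhds hys)
  exact (h2.comp _ h1).contDiffAt

lemma contDiffAt_inChart_of_complex {x₀ y : X} (hy : y ∈ (chartAt Model x₀).source) {r : X → ℂ}
    {s : Set X} (hs : IsOpen s) (hys : y ∈ s) (hr : ContMDiffOn 𝓘(ℂ, Model) 𝓘(ℂ, ℂ) ω r s) :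
    ContDiffAt ℝ ∞ (inChart x₀ r) (chartAt Model x₀ y) :=
  ((contDiffAt_inChart_complex hy hs hys hr).restrict_scalars ℝ).of_le le_top

lemma contDiffAt_inChart {x₀ y : X} (hy : y ∈ (chartAt Model x₀).source) {r : X → ℂ}
    {s : Set X} (hs : IsOpen s) (hys : y ∈ s) (hr : ContMDiffOn 𝓘(ℝ, Model) 𝓘(ℝ, ℂ) ∞ r s) :
    ContDiffAt ℝ ∞ (inChart x₀ r) (chartAt Model x₀ y) := by
  have h1 : ContMDiffAt 𝓘(ℝ, Model) 𝓘(ℝ, Model) ∞ (chartAt Model x₀).symm (chartAt Model x₀ y) :=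
    (contMDiffOn_chart_symm (I := 𝓘(ℝ, Model)) (n := ∞) (x := x₀)).contMDiffAt
      ((chartAt Model x₀).open_target.mem_nhds ((chartAt Model x₀).map_source hy))
  have h2 : ContMDiffAt 𝓘(ℝ, Model) 𝓘(ℝ, ℂ) ∞ r ((chartAt Model x₀).symm (chartAt Model x₀ y)) := by
    rw [(chartAt Model x₀).left_inv hy]
    exact (hr y hys).contMDiffAt (hs.mem_nhds hys)
  exact (h2.comp _ h1).contDiffAt

/-- The change of charts from `x₀` to `x₁`. -/
def chartChange (x₀ x₁ : X) (a : Model) : Model := chartAt Model x₁ ((chartAt Model x₀).symm a)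

lemma contDiffAt_chartChange {x₀ x₁ y : X} (h₀ : y ∈ (chartAt Model x₀).source)
    (h₁ : y ∈ (chartAt Model x₁).source) :
    ContDiffAt ℂ ω (chartChange x₀ x₁) (chartAt Model x₀ y) := by
  have h1 : ContMDiffAt 𝓘(ℂ, Model) 𝓘(ℂ, Model) ω (chartAt Model x₀).symm (chartAt Model x₀ y) :=
    (contMDiffOn_chart_symm (I := 𝓘(ℂ, Model)) (n := ω) (x := x₀)).contMDiffAt
      ((chartAt Model x₀).open_target.mem_nhds ((chartAt Model x₀).map_source h₀))
  have h2 : ContMDiffAt 𝓘(ℂ, Model) 𝓘(ℂ, Model) ω (chartAt Model x₁)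
      ((chartAt Model x₀).symm (chartAt Model x₀ y)) := by
    rw [(chartAt Model x₀).left_inv h₀]
    exact (contMDiffOn_chart (I := 𝓘(ℂ, Model)) (n := ω) (x := x₁)).contMDiffAt
      ((chartAt Model x₁).open_source.mem_nhds h₁)
  exact (h2.comp _ h1).contDiffAt

lemma contDiffAt_chartChange_real {x₀ x₁ y : X} (h₀ : y ∈ (chartAt Model x₀).source)
    (h₁ : y ∈ (chartAt Model x₁).source) :
    ContDiffAt ℝ ∞ (chartChange x₀ x₁) (chartAt Model x₀ y) :=
  ((contDiffAt_chartChange h₀ h₁).restrict_scalars ℝ).of_le le_top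

/-- Near a point, a property which holds in the domain of the chart around `x₀` can be read in the
chart. -/
lemma eventually_chart {x₀ y : X} (hy : y ∈ (chartAt Model x₀).source) {p : X → Prop}
    (h : ∀ᶠ z in 𝓝 y, p z) : ∀ᶠ a in 𝓝 (chartAt Model x₀ y),
      p ((chartAt Model x₀).symm a) ∧ a ∈ (chartAt Model x₀).target := by
  have ht := (chartAt Model x₀).map_source hy
  have hc := (chartAt Model x₀).symm.continuousAt ht
  rw [ContinuousAt, OpenPartialHomeomorph.left_inv _ hy] at hc
  exact (hc.eventually h).and ((chartAt Model x₀).open_target.mem_nhds ht)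

/-- The local expressions of a section in two charts. -/
lemma inChart_eventuallyEq {x₀ x₁ y : X} (h₀ : y ∈ (chartAt Model x₀).source)
    (h₁ : y ∈ (chartAt Model x₁).source) {r₀ r₁ τ : X → ℂ} (h : ∀ᶠ z in 𝓝 y, r₀ z = τ z * r₁ z) :
    inChart x₀ r₀ =ᶠ[𝓝 (chartAt Model x₀ y)]
      fun a => inChart x₀ τ a * inChart x₁ r₁ (chartChange x₀ x₁ a) := by
  filter_upwards [eventually_chart h₀ (h.and ((chartAt Model x₁).open_source.mem_nhds h₁))]
    with a ⟨⟨ha1, ha2⟩, ha3⟩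
  simp only [inChart, chartChange]
  rw [ha1, (chartAt Model x₁).left_inv ha2]

end Local

/-! ### Comparison of the `C¹` norm with local coordinates. -/

section Norm

variable {X : Type*} [TopologicalSpace X] [T2Space X] [ChartedSpace Model X]
  [IsManifold 𝓘(ℂ, Model) ω X]
  {L₁ : X → Type*} [∀ x, AddCommGroup (L₁ x)] [∀ x, Module ℂ (L₁ x)]
  {L₂ : X → Type*} [∀ x, AddCommGroup (L₂ x)] [∀ x, Module ℂ (L₂ x)]
  [∀ x, TopologicalSpace (L₁ x)] [TopologicalSpace (TotalSpace ℂ L₁)] [FiberBundle ℂ L₁]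
  [VectorBundle ℂ ℂ L₁]
  [∀ x, TopologicalSpace (L₂ x)] [TopologicalSpace (TotalSpace ℂ L₂)] [FiberBundle ℂ L₂]
  [VectorBundle ℂ ℂ L₂]

/-- The transition functions of a line bundle, trivialized over the domains of `L₁` and `L₂`. -/
structure IsCocycle (L₁ L₂ : X → Type*) [∀ x, AddCommGroup (L₁ x)] [∀ x, Module ℂ (L₁ x)]
    [∀ x, AddCommGroup (L₂ x)] [∀ x, Module ℂ (L₂ x)]
    [∀ x, TopologicalSpace (L₁ x)] [TopologicalSpace (TotalSpace ℂ L₁)] [FiberBundle ℂ L₁]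
    [∀ x, TopologicalSpace (L₂ x)] [TopologicalSpace (TotalSpace ℂ L₂)] [FiberBundle ℂ L₂]
    (τ : X → X → X → ℂ) : Prop where
  smooth : ∀ x₀ x₁, ContMDiffOn 𝓘(ℂ, Model) 𝓘(ℂ, ℂ) ω (τ x₀ x₁)
    ((baseSetAt L₁ x₀ ∩ baseSetAt L₂ x₀) ∩ (baseSetAt L₁ x₁ ∩ baseSetAt L₂ x₁))
  ne_zero : ∀ x₀ x₁, ∀ y ∈ (baseSetAt L₁ x₀ ∩ baseSetAt L₂ x₀) ∩
    (baseSetAt L₁ x₁ ∩ baseSetAt L₂ x₁), τ x₀ x₁ y ≠ 0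

/-- The local representatives of a smooth section of a line bundle. -/
structure IsSectionRep (L₁ L₂ : X → Type*) [∀ x, AddCommGroup (L₁ x)] [∀ x, Module ℂ (L₁ x)]
    [∀ x, AddCommGroup (L₂ x)] [∀ x, Module ℂ (L₂ x)]
    [∀ x, TopologicalSpace (L₁ x)] [TopologicalSpace (TotalSpace ℂ L₁)] [FiberBundle ℂ L₁]
    [∀ x, TopologicalSpace (L₂ x)] [TopologicalSpace (TotalSpace ℂ L₂)] [FiberBundle ℂ L₂]
    (τ : X → X → X → ℂ) (rep : X → X → ℂ) : Prop where
  smooth : ∀ x₀, ContMDiffOn 𝓘(ℝ, Model) 𝓘(ℝ, ℂ) ∞ (rep x₀) (baseSetAt L₁ x₀ ∩ baseSetAt L₂ x₀)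
  change : ∀ x₀ x₁, ∀ y ∈ (baseSetAt L₁ x₀ ∩ baseSetAt L₂ x₀) ∩
    (baseSetAt L₁ x₁ ∩ baseSetAt L₂ x₁), rep x₀ y = τ x₀ x₁ y * rep x₁ y

lemma isOpen_baseSets (x₀ : X) : IsOpen (baseSetAt L₁ x₀ ∩ baseSetAt L₂ x₀) :=
  (trivializationAt ℂ L₁ x₀).open_baseSet.inter (trivializationAt ℂ L₂ x₀).open_baseSet

lemma IsSectionRep.contDiffAt {τ : X → X → X → ℂ} {rep : X → X → ℂ}
    (h : IsSectionRep L₁ L₂ τ rep) {x₀ y : X} (hy : y ∈ coordDomain L₁ L₂ x₀) :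
    ContDiffAt ℝ ∞ (inChart x₀ (rep x₀)) (chartAt Model x₀ y) :=
  contDiffAt_inChart hy.1 (isOpen_baseSets x₀) hy.2 (h.smooth x₀)

/-- The norm is measured in the charts of the cover, the estimates are made in the chart around
`x₀`. The change of chart and trivialization costs a constant which is uniform over all sections and
over a neighbourhood of `x₀`. -/
lemma exists_norm_bound (𝒦 : C1Cover L₁ L₂) {τ : X → X → X → ℂ} (hτ : IsCocycle L₁ L₂ τ) (x₀ : X) :
    ∃ C : ℝ, 0 < C ∧ ∀ᶠ a in 𝓝 (chartAt Model x₀ x₀), ∀ (rep : X → X → ℂ) (N : ℝ),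
      IsSectionRep L₁ L₂ τ rep → 𝒦.NormLE rep N →
        0 ≤ N ∧ ‖inChart x₀ (rep x₀) a‖ ≤ C * N ∧ ‖fderiv ℝ (inChart x₀ (rep x₀)) a‖ ≤ C * N := by
  have hx₀ : x₀ ∈ coordDomain L₁ L₂ x₀ := mem_coordDomain x₀
  have hj : ∀ j : Fin 𝒦.n, ∃ C : ℝ, 0 < C ∧ ∀ᶠ a in 𝓝 (chartAt Model x₀ x₀),
      (chartAt Model x₀).symm a ∈ 𝒦.K j → ∀ (rep : X → X → ℂ) (N : ℝ),
      IsSectionRep L₁ L₂ τ rep → 𝒦.NormLE rep N →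
        0 ≤ N ∧ ‖inChart x₀ (rep x₀) a‖ ≤ C * N ∧ ‖fderiv ℝ (inChart x₀ (rep x₀)) a‖ ≤ C * N := by
    intro j
    by_cases hxj : x₀ ∈ 𝒦.K j
    · have hx₁ : x₀ ∈ coordDomain L₁ L₂ (𝒦.pt j) := 𝒦.K_subset j hxj
      set x₁ := 𝒦.pt j with hx₁def
      have hu : ContDiffAt ℝ ∞ (inChart x₀ (τ x₀ x₁)) (chartAt Model x₀ x₀) :=
        contDiffAt_inChart_of_complex hx₀.1 ((isOpen_baseSets x₀).inter (isOpen_baseSets x₁))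
          ⟨hx₀.2, hx₁.2⟩ (hτ.smooth x₀ x₁)
      have hκ := contDiffAt_chartChange_real hx₀.1 hx₁.1
      have b1 := (hu.continuousAt.norm).eventually_lt_const (lt_add_one _)
      have b2 := ((hu.fderiv_right (m := 0) (by simp)).continuousAt.norm).eventually_lt_const
        (lt_add_one _)
      have b3 := ((hκ.fderiv_right (m := 0) (by simp)).continuousAt.norm).eventually_lt_const
        (lt_add_one _)
      set c1 := ‖inChart x₀ (τ x₀ x₁) (chartAt Model x₀ x₀)‖ + 1
      set c2 := ‖fderiv ℝ (inChart x₀ (τ x₀ x₁)) (chartAt Model x₀ x₀)‖ + 1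
      set c3 := ‖fderiv ℝ (chartChange x₀ x₁) (chartAt Model x₀ x₀)‖ + 1
      have p1 : 0 < c1 := by positivity
      have p2 : 0 < c2 := by positivity
      have p3 : 0 < c3 := by positivity
      -- `c1`, `c2`, `c3` bound the transition function, its derivative and the derivative of the
      -- change of charts. The product and chain rules give `c1` for the value and `c2 + c1 c3` for
      -- the derivative.
      refine ⟨c1 + c2 + c1 * c3, by positivity, ?_⟩
      have hdom : ∀ᶠ y in 𝓝 x₀, y ∈ coordDomain L₁ L₂ x₀ ∩ coordDomain L₁ L₂ x₁ :=
        ((isOpen_coordDomain x₀).inter (isOpen_coordDomain x₁)).mem_nhds ⟨hx₀, hx₁⟩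
      filter_upwards [b1, b2, b3, eventually_chart hx₀.1 hdom]
        with a ha1 ha2 ha3 ⟨⟨hd0, hd1⟩, hat⟩ haK rep N hrep hN
      set y := (chartAt Model x₀).symm a with hy
      have hay : a = chartAt Model x₀ y := ((chartAt Model x₀).right_inv hat).symm
      obtain ⟨hn1, hn2⟩ := hN j y haK
      have hN0 : 0 ≤ N := (norm_nonneg _).trans hn1
      have hκa : chartChange x₀ x₁ a = chartAt Model x₁ y := rfl
      have heq := inChart_eventuallyEq hd0.1 hd1.1 (r₀ := rep x₀) (r₁ := rep x₁) (τ := τ x₀ x₁) (by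
        filter_upwards [((isOpen_coordDomain (L₁ := L₁) (L₂ := L₂) x₀).inter
          (isOpen_coordDomain x₁)).mem_nhds ⟨hd0, hd1⟩] with z hz
        exact hrep.change x₀ x₁ z ⟨hz.1.2, hz.2.2⟩)
      rw [← hay] at heq
      have hn1' : ‖inChart x₁ (rep x₁) (chartChange x₀ x₁ a)‖ ≤ N := by
        rw [hκa, inChart_apply hd1.1]; exact hn1
      have hn2' : ‖fderiv ℝ (inChart x₁ (rep x₁)) (chartChange x₀ x₁ a)‖ ≤ N := hn2
      have d1 : DifferentiableAt ℝ (inChart x₁ (rep x₁)) (chartChange x₀ x₁ a) := by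
        rw [hκa]; exact (hrep.contDiffAt hd1).differentiableAt (by simp)
      have d2 : DifferentiableAt ℝ (chartChange x₀ x₁) a := by
        rw [hay]; exact (contDiffAt_chartChange_real hd0.1 hd1.1).differentiableAt (by simp)
      have d3 : DifferentiableAt ℝ (inChart x₀ (τ x₀ x₁)) a := by
        rw [hay]
        exact (contDiffAt_inChart_of_complex hd0.1 ((isOpen_baseSets x₀).inter (isOpen_baseSets x₁))
          ⟨hd0.2, hd1.2⟩ (hτ.smooth x₀ x₁)).differentiableAt (by simp)
      refine ⟨hN0, ?_, ?_⟩
      · rw [heq.eq_of_nhds, norm_mul]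
        calc _ ≤ c1 * N := by gcongr
          _ ≤ _ := by gcongr; nlinarith [mul_pos p1 p3]
      · have hder := (d3.hasFDerivAt.mul (d1.hasFDerivAt.comp a d2.hasFDerivAt)).fderiv
        rw [heq.fderiv_eq]
        have hfun : (fun a => inChart x₀ (τ x₀ x₁) a * inChart x₁ (rep x₁) (chartChange x₀ x₁ a)) =
          (inChart x₀ (τ x₀ x₁) * (inChart x₁ (rep x₁) ∘ chartChange x₀ x₁)) := rfl
        rw [hfun, hder]
        refine (norm_add_le _ _).trans ?_
        rw [norm_smul, norm_smul]
        calc _ ≤ c1 * (N * c3) + N * c2 := by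
              gcongr
              · exact (ContinuousLinearMap.opNorm_comp_le _ _).trans (by gcongr)
              · exact hn1'
          _ ≤ _ := by nlinarith [mul_nonneg p1.le hN0]
    · refine ⟨1, one_pos, ?_⟩
      -- A compact set of the cover not containing `x₀` is closed, hence avoided by all points near
      -- `x₀`.
      have : ∀ᶠ y in 𝓝 x₀, y ∉ 𝒦.K j := (𝒦.isCompact_K j).isClosed.isOpen_compl.mem_nhds hxj
      filter_upwards [eventually_chart hx₀.1 this] with a ha h
      exact absurd h ha.1
  choose C hC0 hC using hj
  have hsum := Finset.sum_nonneg fun j (_ : j ∈ Finset.univ) => (hC0 j).le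
  refine ⟨1 + ∑ j, C j, by linarith, ?_⟩
  filter_upwards [Filter.eventually_all.2 hC] with a ha rep N hrep hN
  have hmem : (chartAt Model x₀).symm a ∈ ⋃ j, 𝒦.K j := by rw [𝒦.iUnion_K]; trivial
  obtain ⟨j, hj⟩ := mem_iUnion.1 hmem
  obtain ⟨h0, h1, h2⟩ := ha j hj rep N hrep hN
  have hle : C j ≤ 1 + ∑ j, C j := by
    have := Finset.single_le_sum (fun j _ => (hC0 j).le) (Finset.mem_univ j)
    linarith
  exact ⟨h0, h1.trans (by gcongr), h2.trans (by gcongr)⟩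

end Norm

/-! ### The local equations of `Z` and `R` -/

/-- The coordinate functions on the model of the total space. -/
def dBase : Model × (ℂ × ℂ) →L[ℝ] Model := ContinuousLinearMap.fst ℝ Model (ℂ × ℂ)
def dFst : Model × (ℂ × ℂ) →L[ℝ] ℂ :=
  (ContinuousLinearMap.fst ℝ ℂ ℂ).comp (ContinuousLinearMap.snd ℝ Model (ℂ × ℂ))
def dSnd : Model × (ℂ × ℂ) →L[ℝ] ℂ :=
  (ContinuousLinearMap.snd ℝ ℂ ℂ).comp (ContinuousLinearMap.snd ℝ Model (ℂ × ℂ))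

@[simp] lemma dBase_apply (v : Model × (ℂ × ℂ)) : dBase v = v.1 := rfl
@[simp] lemma dFst_apply (v : Model × (ℂ × ℂ)) : dFst v = v.2.1 := rfl
@[simp] lemma dSnd_apply (v : Model × (ℂ × ℂ)) : dSnd v = v.2.2 := rfl

/-- The three equations `z² = F + w P`, `w² = G + z Q` and `4 z w = P Q`. -/
def eqZ (F P : Model → ℂ) (v : Model × (ℂ × ℂ)) : ℂ := v.2.1 ^ 2 - F v.1 - v.2.2 * P v.1
def eqW (G Q : Model → ℂ) (v : Model × (ℂ × ℂ)) : ℂ := v.2.2 ^ 2 - G v.1 - v.2.1 * Q v.1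
def eqR (P Q : Model → ℂ) (v : Model × (ℂ × ℂ)) : ℂ := 4 * v.2.1 * v.2.2 - P v.1 * Q v.1

/-- The system of equations of `Z`. -/
def covEq (F G P Q : Model → ℂ) (v : Model × (ℂ × ℂ)) : ℂ × ℂ := (eqZ F P v, eqW G Q v)

/-- The system of equations of `R`. -/
def ramEq (F G P Q : Model → ℂ) (v : Model × (ℂ × ℂ)) : (ℂ × ℂ) × ℂ := (covEq F G P Q v, eqR P Q v)

/-- The derivatives of the equations, as functions of the jets. -/
def derZ (z w P : ℂ) (F' P' : Model →L[ℝ] ℂ) : Model × (ℂ × ℂ) →L[ℝ] ℂ :=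
  (2 * z) • dFst - F'.comp dBase - (P • dSnd + w • P'.comp dBase)
def derW (z w Q : ℂ) (G' Q' : Model →L[ℝ] ℂ) : Model × (ℂ × ℂ) →L[ℝ] ℂ :=
  (2 * w) • dSnd - G'.comp dBase - (Q • dFst + z • Q'.comp dBase)
def derR (z w P Q : ℂ) (P' Q' : Model →L[ℝ] ℂ) : Model × (ℂ × ℂ) →L[ℝ] ℂ :=
  (4 * z) • dSnd + (4 * w) • dFst - (P • Q'.comp dBase + Q • P'.comp dBase)
def derCov (z w P Q : ℂ) (F' G' P' Q' : Model →L[ℝ] ℂ) : Model × (ℂ × ℂ) →L[ℝ] ℂ × ℂ :=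
  (derZ z w P F' P').prod (derW z w Q G' Q')
def derRam (z w P Q : ℂ) (F' G' P' Q' : Model →L[ℝ] ℂ) : Model × (ℂ × ℂ) →L[ℝ] (ℂ × ℂ) × ℂ :=
  (derCov z w P Q F' G' P' Q').prod (derR z w P Q P' Q')

section Derivatives

variable {F G P Q : Model → ℂ} {v : Model × (ℂ × ℂ)}

lemma hasFDerivAt_eqZ (hF : DifferentiableAt ℝ F v.1) (hP : DifferentiableAt ℝ P v.1) :
    HasFDerivAt (eqZ F P) (derZ v.2.1 v.2.2 (P v.1) (fderiv ℝ F v.1) (fderiv ℝ P v.1)) v := by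
  have h1 := hF.hasFDerivAt.comp v dBase.hasFDerivAt
  have h2 := hP.hasFDerivAt.comp v dBase.hasFDerivAt
  have h3 := (dFst.hasFDerivAt (x := v)).pow 2
  have h4 := (dSnd.hasFDerivAt (x := v)).mul h2
  refine ((h3.sub h1).sub h4).congr_fderiv ?_
  ext <;> simp [derZ]

lemma hasFDerivAt_eqW (hF : DifferentiableAt ℝ G v.1) (hP : DifferentiableAt ℝ Q v.1) :
    HasFDerivAt (eqW G Q) (derW v.2.1 v.2.2 (Q v.1) (fderiv ℝ G v.1) (fderiv ℝ Q v.1)) v := by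
  have h1 := hF.hasFDerivAt.comp v dBase.hasFDerivAt
  have h2 := hP.hasFDerivAt.comp v dBase.hasFDerivAt
  have h3 := (dSnd.hasFDerivAt (x := v)).pow 2
  have h4 := (dFst.hasFDerivAt (x := v)).mul h2
  refine ((h3.sub h1).sub h4).congr_fderiv ?_
  ext <;> simp [derW]

lemma hasFDerivAt_eqR (hP : DifferentiableAt ℝ P v.1) (hQ : DifferentiableAt ℝ Q v.1) :
    HasFDerivAt (eqR P Q)
      (derR v.2.1 v.2.2 (P v.1) (Q v.1) (fderiv ℝ P v.1) (fderiv ℝ Q v.1)) v := by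
  have h1 := hP.hasFDerivAt.comp v dBase.hasFDerivAt
  have h2 := hQ.hasFDerivAt.comp v dBase.hasFDerivAt
  have h3 := ((dFst.hasFDerivAt (x := v)).const_mul 4).mul (dSnd.hasFDerivAt (x := v))
  refine (h3.sub (h1.mul h2)).congr_fderiv ?_
  ext <;> simp [derR]; ring

lemma hasFDerivAt_covEq (hF : DifferentiableAt ℝ F v.1) (hG : DifferentiableAt ℝ G v.1)
    (hP : DifferentiableAt ℝ P v.1) (hQ : DifferentiableAt ℝ Q v.1) :
    HasFDerivAt (covEq F G P Q) (derCov v.2.1 v.2.2 (P v.1) (Q v.1) (fderiv ℝ F v.1)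
      (fderiv ℝ G v.1) (fderiv ℝ P v.1) (fderiv ℝ Q v.1)) v :=
  (hasFDerivAt_eqZ hF hP).prodMk (hasFDerivAt_eqW hG hQ)

lemma hasFDerivAt_ramEq (hF : DifferentiableAt ℝ F v.1) (hG : DifferentiableAt ℝ G v.1)
    (hP : DifferentiableAt ℝ P v.1) (hQ : DifferentiableAt ℝ Q v.1) :
    HasFDerivAt (ramEq F G P Q) (derRam v.2.1 v.2.2 (P v.1) (Q v.1) (fderiv ℝ F v.1)
      (fderiv ℝ G v.1) (fderiv ℝ P v.1) (fderiv ℝ Q v.1)) v :=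
  (hasFDerivAt_covEq hF hG hP hQ).prodMk (hasFDerivAt_eqR hP hQ)

lemma covEq_eq_zero_iff : covEq F G P Q v = 0 ↔ v.2 ∈ fibreSet (F v.1) (G v.1) (P v.1) (Q v.1) := by
  simp only [covEq, eqZ, eqW, fibreSet, mem_ofPred_eq, Prod.mk_eq_zero]
  refine and_congr ?_ ?_
  · rw [sub_sub, sub_eq_zero]
  · rw [sub_sub, sub_eq_zero]

lemma ramEq_eq_zero_iff : ramEq F G P Q v = 0 ↔ v.2 ∈ fibreSet (F v.1) (G v.1) (P v.1) (Q v.1) ∧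
    4 * v.2.1 * v.2.2 = P v.1 * Q v.1 := by
  simp only [ramEq, Prod.mk_eq_zero, covEq_eq_zero_iff, eqR, sub_eq_zero]

lemma contDiffOn_covEq {O : Set Model} (hF : ContDiffOn ℝ ∞ F O) (hG : ContDiffOn ℝ ∞ G O)
    (hP : ContDiffOn ℝ ∞ P O) (hQ : ContDiffOn ℝ ∞ Q O) :
    ContDiffOn ℝ ∞ (covEq F G P Q) (O ×ˢ univ) := by
  have hm : MapsTo (Prod.fst : Model × (ℂ × ℂ) → Model) (O ×ˢ univ) O := fun v hv => hv.1
  have h1 := hF.comp contDiffOn_fst hm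
  have h2 := hG.comp contDiffOn_fst hm
  have h3 := hP.comp contDiffOn_fst hm
  have h4 := hQ.comp contDiffOn_fst hm
  have hz : ContDiffOn ℝ ∞ (fun v : Model × (ℂ × ℂ) => v.2.1) (O ×ˢ univ) := by fun_prop
  have hw : ContDiffOn ℝ ∞ (fun v : Model × (ℂ × ℂ) => v.2.2) (O ×ˢ univ) := by fun_prop
  exact (((hz.pow 2).sub h1).sub (hw.mul h3)).prodMk (((hw.pow 2).sub h2).sub (hz.mul h4))

lemma contDiffOn_ramEq {O : Set Model} (hF : ContDiffOn ℝ ∞ F O) (hG : ContDiffOn ℝ ∞ G O)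
    (hP : ContDiffOn ℝ ∞ P O) (hQ : ContDiffOn ℝ ∞ Q O) :
    ContDiffOn ℝ ∞ (ramEq F G P Q) (O ×ˢ univ) := by
  have hm : MapsTo (Prod.fst : Model × (ℂ × ℂ) → Model) (O ×ˢ univ) O := fun v hv => hv.1
  have h3 := hP.comp contDiffOn_fst hm
  have h4 := hQ.comp contDiffOn_fst hm
  have hz : ContDiffOn ℝ ∞ (fun v : Model × (ℂ × ℂ) => v.2.1) (O ×ˢ univ) := by fun_prop
  have hw : ContDiffOn ℝ ∞ (fun v : Model × (ℂ × ℂ) => v.2.2) (O ×ˢ univ) := by fun_prop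
  exact (contDiffOn_covEq hF hG hP hQ).prodMk
    (((contDiffOn_const.mul hz).mul hw).sub (h3.mul h4))

end Derivatives

section Cover

variable {X : Type*} [TopologicalSpace X] [T2Space X] [ChartedSpace Model X] [IsManifold 𝓘(ℂ, Model) ω X]
  {L₁ : X → Type*} [∀ x, AddCommGroup (L₁ x)] [∀ x, Module ℂ (L₁ x)]
  {L₂ : X → Type*} [∀ x, AddCommGroup (L₂ x)] [∀ x, Module ℂ (L₂ x)]
  [∀ x, TopologicalSpace (L₁ x)] [TopologicalSpace (TotalSpace ℂ L₁)] [FiberBundle ℂ L₁]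
  [VectorBundle ℂ ℂ L₁]
  [∀ x, TopologicalSpace (L₂ x)] [TopologicalSpace (TotalSpace ℂ L₂)] [FiberBundle ℂ L₂]
  [VectorBundle ℂ ℂ L₂]

variable (L₁ L₂) in
instance realManifoldTotal [ContMDiffVectorBundle ω ℂ L₁ 𝓘(ℂ, Model)]
    [ContMDiffVectorBundle ω ℂ L₂ 𝓘(ℂ, Model)] : IsManifold modelV ∞ (TotalV L₁ L₂) :=
  isManifold_real_of_complex (𝓘(ℂ, Model).prod 𝓘(ℂ, ℂ × ℂ)) modelV rfl rfl _

/-- The data of a perturbed bidouble cover. -/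
structure IsSmoothData (f : ∀ x, L₁ x ⊗[ℂ] L₁ x) (g : ∀ x, L₂ x ⊗[ℂ] L₂ x)
    (Φ : ∀ x, L₂ x →ₗ[ℂ] L₁ x ⊗[ℂ] L₁ x) (Ψ : ∀ x, L₁ x →ₗ[ℂ] L₂ x ⊗[ℂ] L₂ x) : Prop where
  hf : IsHolomorphicSection f
  hg : IsHolomorphicSection g
  hΦ : IsSmoothSection Φ
  hΨ : IsSmoothSection Ψ

variable {f : ∀ x, L₁ x ⊗[ℂ] L₁ x} {g : ∀ x, L₂ x ⊗[ℂ] L₂ x}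
  {Φ : ∀ x, L₂ x →ₗ[ℂ] L₁ x ⊗[ℂ] L₁ x} {Ψ : ∀ x, L₁ x →ₗ[ℂ] L₂ x ⊗[ℂ] L₂ x}

/-- The local expression of a section of `L ⊗ L`. -/
abbrev locSq {L : X → Type*} [∀ x, AddCommGroup (L x)] [∀ x, Module ℂ (L x)]
    [∀ x, TopologicalSpace (L x)] [TopologicalSpace (TotalSpace ℂ L)] [FiberBundle ℂ L]
    [VectorBundle ℂ ℂ L] (s : ∀ x, L x ⊗[ℂ] L x) (x₀ : X) : Model → ℂ := inChart x₀ (sqRep s x₀)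

/-- The local expression of a section of `L ⊗ L ⊗ L'⁻¹`. -/
abbrev locHom {L L' : X → Type*} [∀ x, AddCommGroup (L x)] [∀ x, Module ℂ (L x)]
    [∀ x, TopologicalSpace (L x)] [TopologicalSpace (TotalSpace ℂ L)] [FiberBundle ℂ L]
    [VectorBundle ℂ ℂ L] [∀ x, AddCommGroup (L' x)] [∀ x, Module ℂ (L' x)]
    [∀ x, TopologicalSpace (L' x)] [TopologicalSpace (TotalSpace ℂ L')] [FiberBundle ℂ L']
    [VectorBundle ℂ ℂ L'] (s : ∀ x, L' x →ₗ[ℂ] L x ⊗[ℂ] L x) (x₀ : X) : Model → ℂ :=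
  inChart x₀ (homRep s x₀)

lemma chart_symm_eq {x₀ : X} {a : Model} (ha : a ∈ coordTarget L₁ L₂ x₀) :
    a = chartAt Model x₀ ((chartAt Model x₀).symm a) := ((chartAt Model x₀).right_inv ha.1).symm

lemma contDiffAt_locSq_left (hf : IsHolomorphicSection f) {x₀ y : X}
    (hy : y ∈ coordDomain L₁ L₂ x₀) : ContDiffAt ℝ ∞ (locSq f x₀) (chartAt Model x₀ y) :=
  contDiffAt_inChart_of_complex hy.1 (trivializationAt ℂ L₁ x₀).open_baseSet hy.2.1 (hf x₀)

lemma contDiffAt_locSq_right (hg : IsHolomorphicSection g) {x₀ y : X}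
    (hy : y ∈ coordDomain L₁ L₂ x₀) : ContDiffAt ℝ ∞ (locSq g x₀) (chartAt Model x₀ y) :=
  contDiffAt_inChart_of_complex hy.1 (trivializationAt ℂ L₂ x₀).open_baseSet hy.2.2 (hg x₀)

lemma contDiffAt_locHom_left (hΦ : IsSmoothSection Φ) {x₀ y : X}
    (hy : y ∈ coordDomain L₁ L₂ x₀) : ContDiffAt ℝ ∞ (locHom Φ x₀) (chartAt Model x₀ y) :=
  contDiffAt_inChart hy.1 (isOpen_baseSets x₀) hy.2 (hΦ x₀)

lemma contDiffAt_locHom_right (hΨ : IsSmoothSection Ψ) {x₀ y : X}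
    (hy : y ∈ coordDomain L₁ L₂ x₀) : ContDiffAt ℝ ∞ (locHom Ψ x₀) (chartAt Model x₀ y) :=
  contDiffAt_inChart hy.1 (isOpen_baseSets x₀) ⟨hy.2.2, hy.2.1⟩ (hΨ x₀)

lemma contDiffOn_of_at {x₀ : X} {F : Model → ℂ}
    (h : ∀ y ∈ coordDomain L₁ L₂ x₀, ContDiffAt ℝ ∞ F (chartAt Model x₀ y)) :
    ContDiffOn ℝ ∞ F (coordTarget L₁ L₂ x₀) := fun a ha => by
  have := h _ (symm_mem_coordDomain ha)
  rw [← chart_symm_eq ha] at this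
  exact this.contDiffWithinAt

/-- The local equations of `Z` and of `R` in the coordinates around `x₀`. -/
abbrev locCov (f : ∀ x, L₁ x ⊗[ℂ] L₁ x) (g : ∀ x, L₂ x ⊗[ℂ] L₂ x)
    (Φ : ∀ x, L₂ x →ₗ[ℂ] L₁ x ⊗[ℂ] L₁ x) (Ψ : ∀ x, L₁ x →ₗ[ℂ] L₂ x ⊗[ℂ] L₂ x) (x₀ : X) :
    Model × (ℂ × ℂ) → ℂ × ℂ := covEq (locSq f x₀) (locSq g x₀) (locHom Φ x₀) (locHom Ψ x₀)
abbrev locRam (f : ∀ x, L₁ x ⊗[ℂ] L₁ x) (g : ∀ x, L₂ x ⊗[ℂ] L₂ x)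
    (Φ : ∀ x, L₂ x →ₗ[ℂ] L₁ x ⊗[ℂ] L₁ x) (Ψ : ∀ x, L₁ x →ₗ[ℂ] L₂ x ⊗[ℂ] L₂ x) (x₀ : X) :
    Model × (ℂ × ℂ) → (ℂ × ℂ) × ℂ :=
  ramEq (locSq f x₀) (locSq g x₀) (locHom Φ x₀) (locHom Ψ x₀)

lemma isOpen_totalChart_target (x₀ : X) : IsOpen (totalChart L₁ L₂ x₀).target := by
  rw [totalChart_target]; exact (isOpen_coordTarget x₀).prod isOpen_univ

lemma symm_mem_coverZ_iff {x₀ : X} {v : Model × (ℂ × ℂ)} (hv : v.1 ∈ coordTarget L₁ L₂ x₀) :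
    (totalChart L₁ L₂ x₀).symm v ∈ coverZ f g Φ Ψ ↔ locCov f g Φ Ψ x₀ v = 0 := by
  obtain ⟨h1, h2, h3⟩ := totalChart_symm hv
  have hd := symm_mem_coordDomain hv
  rw [← h1] at hd
  rw [mem_coverZ_iff f g Φ Ψ hd.2.1 hd.2.2, h2, h3, covEq_eq_zero_iff, h1]
  rfl

lemma symm_mem_ramificationR_iff {x₀ : X} {v : Model × (ℂ × ℂ)}
    (hv : v.1 ∈ coordTarget L₁ L₂ x₀) :
    (totalChart L₁ L₂ x₀).symm v ∈ ramificationR f g Φ Ψ ↔ locRam f g Φ Ψ x₀ v = 0 := by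
  obtain ⟨h1, h2, h3⟩ := totalChart_symm hv
  have hd := symm_mem_coordDomain hv
  rw [← h1] at hd
  rw [mem_ramificationR_iff f g Φ Ψ hd.2.1 hd.2.2, symm_mem_coverZ_iff hv, covEq_eq_zero_iff, h2,
    h3, ramEq_eq_zero_iff, h1]
  rfl

namespace IsSmoothData

lemma isLocalEquation_coverZ (h : IsSmoothData f g Φ Ψ) (x₀ : X) :
    IsLocalEquation modelV (coverZ f g Φ Ψ) (⟨x₀, 0⟩ : TotalV L₁ L₂) (locCov f g Φ Ψ x₀)
      (totalChart L₁ L₂ x₀).target where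
  isOpen := isOpen_totalChart_target x₀
  subset := subset_rfl
  contDiffOn := by
    rw [totalChart_target]
    exact contDiffOn_covEq (contDiffOn_of_at fun y hy => contDiffAt_locSq_left h.hf hy)
      (contDiffOn_of_at fun y hy => contDiffAt_locSq_right h.hg hy)
      (contDiffOn_of_at fun y hy => contDiffAt_locHom_left h.hΦ hy)
      (contDiffOn_of_at fun y hy => contDiffAt_locHom_right h.hΨ hy)
  mem_iff := fun v hv => symm_mem_coverZ_iff (mem_totalChart_target.1 hv)

lemma isLocalEquation_ramificationR (h : IsSmoothData f g Φ Ψ) (x₀ : X) :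
    IsLocalEquation modelV (ramificationR f g Φ Ψ) (⟨x₀, 0⟩ : TotalV L₁ L₂) (locRam f g Φ Ψ x₀)
      (totalChart L₁ L₂ x₀).target where
  isOpen := isOpen_totalChart_target x₀
  subset := subset_rfl
  contDiffOn := by
    rw [totalChart_target]
    exact contDiffOn_ramEq (contDiffOn_of_at fun y hy => contDiffAt_locSq_left h.hf hy)
      (contDiffOn_of_at fun y hy => contDiffAt_locSq_right h.hg hy)
      (contDiffOn_of_at fun y hy => contDiffAt_locHom_left h.hΦ hy)
      (contDiffOn_of_at fun y hy => contDiffAt_locHom_right h.hΨ hy)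
  mem_iff := fun v hv => symm_mem_ramificationR_iff (mem_totalChart_target.1 hv)

end IsSmoothData

end Cover

/-! ### Change of coordinates -/

section Change

variable {X : Type*} [TopologicalSpace X] [T2Space X] [ChartedSpace Model X]
  [IsManifold 𝓘(ℂ, Model) ω X]
  {L₁ : X → Type*} [∀ x, AddCommGroup (L₁ x)] [∀ x, Module ℂ (L₁ x)]
  {L₂ : X → Type*} [∀ x, AddCommGroup (L₂ x)] [∀ x, Module ℂ (L₂ x)]
  [∀ x, TopologicalSpace (L₁ x)] [TopologicalSpace (TotalSpace ℂ L₁)] [FiberBundle ℂ L₁]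
  [VectorBundle ℂ ℂ L₁]
  [∀ x, TopologicalSpace (L₂ x)] [TopologicalSpace (TotalSpace ℂ L₂)] [FiberBundle ℂ L₂]
  [VectorBundle ℂ ℂ L₂]

variable (L₁ L₂) in
/-- The change of coordinates on the total space from those around `x₀` to those around `x₁`. -/
def totalChange (x₀ x₁ : X) (v : Model × (ℂ × ℂ)) : Model × (ℂ × ℂ) :=
  (chartChange x₀ x₁ v.1, inChart x₀ (transition L₁ x₁ x₀) v.1 * v.2.1,
    inChart x₀ (transition L₂ x₁ x₀) v.1 * v.2.2)

lemma contDiffAt_totalChange [ContMDiffVectorBundle ω ℂ L₁ 𝓘(ℂ, Model)]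
    [ContMDiffVectorBundle ω ℂ L₂ 𝓘(ℂ, Model)] {x₀ x₁ y : X}
    (h₀ : y ∈ coordDomain L₁ L₂ x₀) (h₁ : y ∈ coordDomain L₁ L₂ x₁) (u : ℂ × ℂ) :
    ContDiffAt ℂ ω (totalChange L₁ L₂ x₀ x₁) (chartAt Model x₀ y, u) := by
  have c1 : ContDiffAt ℂ ω (inChart x₀ (transition L₁ x₁ x₀)) (chartAt Model x₀ y) :=
    contDiffAt_inChart_complex h₀.1 ((trivializationAt ℂ L₁ x₁).open_baseSet.inter
      (trivializationAt ℂ L₁ x₀).open_baseSet) ⟨h₁.2.1, h₀.2.1⟩ (contMDiffOn_transition x₁ x₀)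
  have c2 : ContDiffAt ℂ ω (inChart x₀ (transition L₂ x₁ x₀)) (chartAt Model x₀ y) :=
    contDiffAt_inChart_complex h₀.1 ((trivializationAt ℂ L₂ x₁).open_baseSet.inter
      (trivializationAt ℂ L₂ x₀).open_baseSet) ⟨h₁.2.2, h₀.2.2⟩ (contMDiffOn_transition x₁ x₀)
  have c3 := contDiffAt_chartChange h₀.1 h₁.1
  have hfst : ContDiffAt ℂ ω (Prod.fst : Model × (ℂ × ℂ) → Model) (chartAt Model x₀ y, u) :=
    contDiffAt_fst
  have hz : ContDiffAt ℂ ω (fun v : Model × (ℂ × ℂ) => v.2.1) (chartAt Model x₀ y, u) := by fun_prop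
  have hw : ContDiffAt ℂ ω (fun v : Model × (ℂ × ℂ) => v.2.2) (chartAt Model x₀ y, u) := by fun_prop
  exact (c3.comp (chartAt Model x₀ y, u) hfst).prodMk
    (((c1.comp (chartAt Model x₀ y, u) hfst).mul hz).prodMk
      ((c2.comp (chartAt Model x₀ y, u) hfst).mul hw))

lemma totalChange_apply {x₀ x₁ y : X} (h₀ : y ∈ coordDomain L₁ L₂ x₀) (u : ℂ × ℂ) :
    totalChange L₁ L₂ x₀ x₁ (chartAt Model x₀ y, u) =
      (chartAt Model x₁ y, transition L₁ x₁ x₀ y * u.1, transition L₂ x₁ x₀ y * u.2) := by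
  simp only [totalChange, chartChange, inChart, (chartAt Model x₀).left_inv h₀.1]

lemma totalChange_totalChange {x₀ x₁ y : X} (h₀ : y ∈ coordDomain L₁ L₂ x₀)
    (h₁ : y ∈ coordDomain L₁ L₂ x₁) (u : ℂ × ℂ) :
    totalChange L₁ L₂ x₁ x₀ (totalChange L₁ L₂ x₀ x₁ (chartAt Model x₀ y, u)) =
      (chartAt Model x₀ y, u) := by
  rw [totalChange_apply h₀, totalChange_apply h₁]
  simp only
  rw [← mul_assoc, ← mul_assoc, transition_mul_transition h₀.2.1 h₁.2.1,
    transition_mul_transition h₀.2.2 h₁.2.2, one_mul, one_mul]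

lemma totalChange_totalChart {x₀ x₁ : X} {p : TotalV L₁ L₂} (h₀ : p.proj ∈ coordDomain L₁ L₂ x₀)
    (h₁ : p.proj ∈ coordDomain L₁ L₂ x₁) :
    totalChange L₁ L₂ x₀ x₁ (totalChart L₁ L₂ x₀ p) = totalChart L₁ L₂ x₁ p := by
  rw [totalChart_apply h₀, totalChart_apply h₁, totalChange_apply h₀,
    fibreCoord_eq_transition_mul h₀.2.1 x₁, fibreCoord_eq_transition_mul h₀.2.2 x₁]

lemma eventually_eq_chart {x₀ y : X} (hy : y ∈ coordDomain L₁ L₂ x₀) {s : Set X}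
    (hs : s ∈ 𝓝 y) (u : ℂ × ℂ) : ∀ᶠ v : Model × (ℂ × ℂ) in 𝓝 (chartAt Model x₀ y, u),
      ∃ z ∈ s, z ∈ coordDomain L₁ L₂ x₀ ∧ v = (chartAt Model x₀ z, v.2) := by
  have h1 := eventually_chart (p := fun z => z ∈ s ∩ coordDomain L₁ L₂ x₀) hy.1
    (Filter.inter_mem hs ((isOpen_coordDomain x₀).mem_nhds hy))
  have h2 : Filter.Tendsto (Prod.fst : Model × (ℂ × ℂ) → Model) (𝓝 (chartAt Model x₀ y, u))
    (𝓝 (chartAt Model x₀ y)) := continuousAt_fst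
  filter_upwards [h2.eventually h1] with v ⟨hv1, hv2⟩
  exact ⟨_, hv1.1, hv1.2, by rw [(chartAt Model x₀).right_inv hv2]⟩

/-- The two changes of coordinates are mutually inverse near the point. The derivative is kept
complex linear because its real determinant must later be positive. -/
lemma fderiv_totalChange_bijective [ContMDiffVectorBundle ω ℂ L₁ 𝓘(ℂ, Model)]
    [ContMDiffVectorBundle ω ℂ L₂ 𝓘(ℂ, Model)] {x₀ x₁ y : X}
    (h₀ : y ∈ coordDomain L₁ L₂ x₀) (h₁ : y ∈ coordDomain L₁ L₂ x₁) (u : ℂ × ℂ) :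
    Function.Bijective (fderiv ℂ (totalChange L₁ L₂ x₀ x₁) (chartAt Model x₀ y, u)) := by
  have key : ∀ {x₀ x₁ : X}, y ∈ coordDomain L₁ L₂ x₀ → y ∈ coordDomain L₁ L₂ x₁ → ∀ u : ℂ × ℂ,
      (fderiv ℂ (totalChange L₁ L₂ x₁ x₀) (totalChange L₁ L₂ x₀ x₁ (chartAt Model x₀ y, u))).comp
        (fderiv ℂ (totalChange L₁ L₂ x₀ x₁) (chartAt Model x₀ y, u)) =
          ContinuousLinearMap.id ℂ _ := by
    intro x₀ x₁ h₀ h₁ u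
    have d1 := (contDiffAt_totalChange h₀ h₁ u).differentiableAt (by simp)
    have d2 : DifferentiableAt ℂ (totalChange L₁ L₂ x₁ x₀)
        (totalChange L₁ L₂ x₀ x₁ (chartAt Model x₀ y, u)) := by
      rw [totalChange_apply h₀]
      exact (contDiffAt_totalChange h₁ h₀ _).differentiableAt (by simp)
    rw [← fderiv_comp _ d2 d1]
    have : totalChange L₁ L₂ x₁ x₀ ∘ totalChange L₁ L₂ x₀ x₁ =ᶠ[𝓝 (chartAt Model x₀ y, u)] id := by
      filter_upwards [eventually_eq_chart h₀ ((isOpen_coordDomain x₁).mem_nhds h₁) u]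
        with v ⟨z, hz1, hz0, hv⟩
      rw [hv]
      exact totalChange_totalChange hz0 hz1 _
    rw [this.fderiv_eq, fderiv_id]
  have k1 := key h₀ h₁ u
  have k2 := key h₁ h₀ (transition L₁ x₁ x₀ y * u.1, transition L₂ x₁ x₀ y * u.2)
  rw [← totalChange_apply h₀, totalChange_totalChange h₀ h₁] at k2
  refine Function.bijective_iff_has_inverse.2 ⟨_, fun v => DFunLike.congr_fun k1 v,
    fun v => DFunLike.congr_fun k2 v⟩

/-- The derivative at a zero of the multiple of a function. -/
lemma fderiv_mul_comp_of_eq_zero {h₀ h₁ m : Model × (ℂ × ℂ) → ℂ}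
    {κ : Model × (ℂ × ℂ) → Model × (ℂ × ℂ)} {v : Model × (ℂ × ℂ)}
    (he : h₀ =ᶠ[𝓝 v] fun u => m u * h₁ (κ u)) (hm : DifferentiableAt ℝ m v)
    (hκ : DifferentiableAt ℂ κ v) (hh : DifferentiableAt ℝ h₁ (κ v)) (h0 : h₁ (κ v) = 0)
    (ξ : Model × (ℂ × ℂ)) :
    fderiv ℝ h₀ v ξ = m v * fderiv ℝ h₁ (κ v) (fderiv ℂ κ v ξ) := by
  have hκ' := hκ.hasFDerivAt.restrictScalars ℝ
  have := hm.hasFDerivAt.mul (hh.hasFDerivAt.comp v hκ')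
  rw [he.fderiv_eq]
  have hf : (fun u => m u * h₁ (κ u)) = m * (h₁ ∘ κ) := rfl
  rw [hf, this.fderiv]
  simp [h0]

variable {f : ∀ x, L₁ x ⊗[ℂ] L₁ x} {g : ∀ x, L₂ x ⊗[ℂ] L₂ x}
  {Φ : ∀ x, L₂ x →ₗ[ℂ] L₁ x ⊗[ℂ] L₁ x} {Ψ : ∀ x, L₁ x →ₗ[ℂ] L₂ x ⊗[ℂ] L₂ x}

namespace IsSmoothData

lemma hasFDerivAt_locCov (h : IsSmoothData f g Φ Ψ) {x₀ y : X} (hy : y ∈ coordDomain L₁ L₂ x₀)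
    (u : ℂ × ℂ) : HasFDerivAt (locCov f g Φ Ψ x₀)
      (derCov u.1 u.2 (homRep Φ x₀ y) (homRep Ψ x₀ y) (fderiv ℝ (locSq f x₀) (chartAt Model x₀ y))
        (fderiv ℝ (locSq g x₀) (chartAt Model x₀ y)) (fderiv ℝ (locHom Φ x₀) (chartAt Model x₀ y))
        (fderiv ℝ (locHom Ψ x₀) (chartAt Model x₀ y))) (chartAt Model x₀ y, u) := by
  have := hasFDerivAt_covEq (v := (chartAt Model x₀ y, u))
    ((contDiffAt_locSq_left h.hf hy).differentiableAt (by simp))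
    ((contDiffAt_locSq_right h.hg hy).differentiableAt (by simp))
    ((contDiffAt_locHom_left h.hΦ hy).differentiableAt (by simp))
    ((contDiffAt_locHom_right h.hΨ hy).differentiableAt (by simp))
  simpa only [inChart_apply hy.1] using this

lemma hasFDerivAt_locRam (h : IsSmoothData f g Φ Ψ) {x₀ y : X} (hy : y ∈ coordDomain L₁ L₂ x₀)
    (u : ℂ × ℂ) : HasFDerivAt (locRam f g Φ Ψ x₀)
      (derRam u.1 u.2 (homRep Φ x₀ y) (homRep Ψ x₀ y) (fderiv ℝ (locSq f x₀) (chartAt Model x₀ y))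
        (fderiv ℝ (locSq g x₀) (chartAt Model x₀ y)) (fderiv ℝ (locHom Φ x₀) (chartAt Model x₀ y))
        (fderiv ℝ (locHom Ψ x₀) (chartAt Model x₀ y))) (chartAt Model x₀ y, u) := by
  have := hasFDerivAt_ramEq (v := (chartAt Model x₀ y, u))
    ((contDiffAt_locSq_left h.hf hy).differentiableAt (by simp))
    ((contDiffAt_locSq_right h.hg hy).differentiableAt (by simp))
    ((contDiffAt_locHom_left h.hΦ hy).differentiableAt (by simp))
    ((contDiffAt_locHom_right h.hΨ hy).differentiableAt (by simp))
  simpa only [inChart_apply hy.1] using this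

end IsSmoothData

/-- The equations in two coordinate systems. -/
lemma locRam_change {x₀ x₁ y : X} (h₀ : y ∈ coordDomain L₁ L₂ x₀) (h₁ : y ∈ coordDomain L₁ L₂ x₁)
    (u : ℂ × ℂ) :
    let r₀ := locRam f g Φ Ψ x₀ (chartAt Model x₀ y, u)
    let r₁ := locRam f g Φ Ψ x₁ (totalChange L₁ L₂ x₀ x₁ (chartAt Model x₀ y, u))
    r₀.1.1 = transition L₁ x₀ x₁ y ^ 2 * r₁.1.1 ∧ r₀.1.2 = transition L₂ x₀ x₁ y ^ 2 * r₁.1.2 ∧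
      r₀.2 = transition L₁ x₀ x₁ y * transition L₂ x₀ x₁ y * r₁.2 := by
  have n₁ := transition_ne_zero h₀.2.1 h₁.2.1
  have n₂ := transition_ne_zero h₀.2.2 h₁.2.2
  rw [totalChange_apply h₀]
  simp only [locRam, ramEq, covEq, eqZ, eqW, eqR, inChart_apply h₀.1, inChart_apply h₁.1]
  rw [sqRep_eq_transition_mul f h₁.2.1 x₀, sqRep_eq_transition_mul g h₁.2.2 x₀,
    homRep_eq_transition_mul Φ (x₀ := x₀) h₁.2.1 h₁.2.2,
    homRep_eq_transition_mul Ψ (x₀ := x₀) h₁.2.2 h₁.2.1,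
    transition_symm h₀.2.1 h₁.2.1, transition_symm h₀.2.2 h₁.2.2]
  refine ⟨?_, ?_, ?_⟩ <;> field_simp

lemma differentiableAt_inChart_transition {L : X → Type*} [∀ x, AddCommGroup (L x)]
    [∀ x, Module ℂ (L x)] [∀ x, TopologicalSpace (L x)] [TopologicalSpace (TotalSpace ℂ L)]
    [FiberBundle ℂ L] [VectorBundle ℂ ℂ L] [ContMDiffVectorBundle ω ℂ L 𝓘(ℂ, Model)]
    {x₀ x₁ y : X} (hy : y ∈ (chartAt Model x₀).source) (h₀ : y ∈ baseSetAt L x₀)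
    (h₁ : y ∈ baseSetAt L x₁) (u : ℂ × ℂ) :
    DifferentiableAt ℝ (fun v : Model × (ℂ × ℂ) => inChart x₀ (transition L x₀ x₁) v.1)
      (chartAt Model x₀ y, u) := by
  have c := (contDiffAt_inChart_of_complex hy ((trivializationAt ℂ L x₀).open_baseSet.inter
      (trivializationAt ℂ L x₁).open_baseSet) ⟨h₀, h₁⟩
      (contMDiffOn_transition x₀ x₁)).differentiableAt (by simp)
  exact DifferentiableAt.comp (g := inChart x₀ (transition L x₀ x₁)) (f := Prod.fst)
    (chartAt Model x₀ y, u) c differentiableAt_fst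

variable [ContMDiffVectorBundle ω ℂ L₁ 𝓘(ℂ, Model)] [ContMDiffVectorBundle ω ℂ L₂ 𝓘(ℂ, Model)]

/-- The derivatives at a zero of two functions related by a change of coordinates. -/
lemma fderiv_change {x₀ x₁ y : X} (h₀ : y ∈ coordDomain L₁ L₂ x₀)
    (h₁ : y ∈ coordDomain L₁ L₂ x₁) (u : ℂ × ℂ) {r₀ r₁ : Model × (ℂ × ℂ) → ℂ} {m : X → ℂ}
    (hm : DifferentiableAt ℝ (fun v : Model × (ℂ × ℂ) => inChart x₀ m v.1) (chartAt Model x₀ y, u))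
    (hr : DifferentiableAt ℝ r₁ (totalChange L₁ L₂ x₀ x₁ (chartAt Model x₀ y, u)))
    (he : ∀ z ∈ coordDomain L₁ L₂ x₀ ∩ coordDomain L₁ L₂ x₁, ∀ u : ℂ × ℂ,
      r₀ (chartAt Model x₀ z, u) =
        m z * r₁ (totalChange L₁ L₂ x₀ x₁ (chartAt Model x₀ z, u)))
    (hz : r₁ (totalChange L₁ L₂ x₀ x₁ (chartAt Model x₀ y, u)) = 0) (ξ : Model × (ℂ × ℂ)) :
    fderiv ℝ r₀ (chartAt Model x₀ y, u) ξ =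
      m y * fderiv ℝ r₁ (totalChange L₁ L₂ x₀ x₁ (chartAt Model x₀ y, u))
        (fderiv ℂ (totalChange L₁ L₂ x₀ x₁) (chartAt Model x₀ y, u) ξ) := by
  have e := fderiv_mul_comp_of_eq_zero (h₀ := r₀) (h₁ := r₁) (m := fun v => inChart x₀ m v.1)
    (κ := totalChange L₁ L₂ x₀ x₁) (v := (chartAt Model x₀ y, u)) (by
      filter_upwards [eventually_eq_chart h₀ ((isOpen_coordDomain x₁).mem_nhds h₁) u]
        with v ⟨z, hz1, hz0, hv⟩
      rw [hv]
      simp only [inChart_apply hz0.1]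
      exact he z ⟨hz0, hz1⟩ v.2) hm
    ((contDiffAt_totalChange h₀ h₁ u).differentiableAt (by simp)) hr hz ξ
  simpa only [inChart_apply h₀.1] using e

lemma IsSmoothData.fderiv_locCov_change (h : IsSmoothData f g Φ Ψ) {x₀ x₁ y : X}
    (h₀ : y ∈ coordDomain L₁ L₂ x₀) (h₁ : y ∈ coordDomain L₁ L₂ x₁) (u : ℂ × ℂ)
    (hz : locCov f g Φ Ψ x₁ (totalChange L₁ L₂ x₀ x₁ (chartAt Model x₀ y, u)) = 0)
    (ξ : Model × (ℂ × ℂ)) :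
    let r₁ := fderiv ℝ (locCov f g Φ Ψ x₁) (totalChange L₁ L₂ x₀ x₁ (chartAt Model x₀ y, u))
      (fderiv ℂ (totalChange L₁ L₂ x₀ x₁) (chartAt Model x₀ y, u) ξ)
    fderiv ℝ (locCov f g Φ Ψ x₀) (chartAt Model x₀ y, u) ξ =
      (transition L₁ x₀ x₁ y ^ 2 * r₁.1, transition L₂ x₀ x₁ y ^ 2 * r₁.2) := by
  intro r₁
  have D0 := h.hasFDerivAt_locCov h₀ u
  have D1 := h.hasFDerivAt_locCov h₁ (transition L₁ x₁ x₀ y * u.1, transition L₂ x₁ x₀ y * u.2)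
  rw [← totalChange_apply h₀] at D1
  have m1 : DifferentiableAt ℝ (fun v : Model × (ℂ × ℂ) =>
      inChart x₀ (fun z => transition L₁ x₀ x₁ z ^ 2) v.1) (chartAt Model x₀ y, u) :=
    (differentiableAt_inChart_transition h₀.1 h₀.2.1 h₁.2.1 u).pow 2
  have m2 : DifferentiableAt ℝ (fun v : Model × (ℂ × ℂ) =>
      inChart x₀ (fun z => transition L₂ x₀ x₁ z ^ 2) v.1) (chartAt Model x₀ y, u) :=
    (differentiableAt_inChart_transition h₀.1 h₀.2.2 h₁.2.2 u).pow 2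
  have e1 := fderiv_change h₀ h₁ u (r₀ := fun v => (locCov f g Φ Ψ x₀ v).1)
    (r₁ := fun v => (locCov f g Φ Ψ x₁ v).1) (m := fun z => transition L₁ x₀ x₁ z ^ 2) m1
    D1.differentiableAt.fst (fun z hz u => (locRam_change hz.1 hz.2 u).1) (by rw [hz]; rfl) ξ
  have e2 := fderiv_change h₀ h₁ u (r₀ := fun v => (locCov f g Φ Ψ x₀ v).2)
    (r₁ := fun v => (locCov f g Φ Ψ x₁ v).2) (m := fun z => transition L₂ x₀ x₁ z ^ 2) m2
    D1.differentiableAt.snd (fun z hz u => (locRam_change hz.1 hz.2 u).2.1) (by rw [hz]; rfl) ξ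
  rw [fderiv.fst D0.differentiableAt, fderiv.fst D1.differentiableAt] at e1
  rw [fderiv.snd D0.differentiableAt, fderiv.snd D1.differentiableAt] at e2
  exact Prod.ext e1 e2

lemma IsSmoothData.fderiv_locRam_change (h : IsSmoothData f g Φ Ψ) {x₀ x₁ y : X}
    (h₀ : y ∈ coordDomain L₁ L₂ x₀) (h₁ : y ∈ coordDomain L₁ L₂ x₁) (u : ℂ × ℂ)
    (hz : locRam f g Φ Ψ x₁ (totalChange L₁ L₂ x₀ x₁ (chartAt Model x₀ y, u)) = 0)
    (ξ : Model × (ℂ × ℂ)) :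
    let r₁ := fderiv ℝ (locRam f g Φ Ψ x₁) (totalChange L₁ L₂ x₀ x₁ (chartAt Model x₀ y, u))
      (fderiv ℂ (totalChange L₁ L₂ x₀ x₁) (chartAt Model x₀ y, u) ξ)
    fderiv ℝ (locRam f g Φ Ψ x₀) (chartAt Model x₀ y, u) ξ =
      ((transition L₁ x₀ x₁ y ^ 2 * r₁.1.1, transition L₂ x₀ x₁ y ^ 2 * r₁.1.2),
        transition L₁ x₀ x₁ y * transition L₂ x₀ x₁ y * r₁.2) := by
  intro r₁
  have D0 := h.hasFDerivAt_locRam h₀ u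
  have D1 := h.hasFDerivAt_locRam h₁ (transition L₁ x₁ x₀ y * u.1, transition L₂ x₁ x₀ y * u.2)
  rw [← totalChange_apply h₀] at D1
  have m1 := (differentiableAt_inChart_transition h₀.1 h₀.2.1 h₁.2.1 u).mul
    (differentiableAt_inChart_transition h₀.1 h₀.2.2 h₁.2.2 u)
  have hz' : locCov f g Φ Ψ x₁ (totalChange L₁ L₂ x₀ x₁ (chartAt Model x₀ y, u)) = 0 :=
    congrArg Prod.fst hz
  have e1 := h.fderiv_locCov_change h₀ h₁ u hz' ξ
  have e2 := fderiv_change h₀ h₁ u (r₀ := fun v => (locRam f g Φ Ψ x₀ v).2)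
    (r₁ := fun v => (locRam f g Φ Ψ x₁ v).2)
    (m := fun z => transition L₁ x₀ x₁ z * transition L₂ x₀ x₁ z) m1
    D1.differentiableAt.snd (fun z hz u => (locRam_change hz.1 hz.2 u).2.2) (by rw [hz]; rfl) ξ
  rw [fderiv.snd D0.differentiableAt, fderiv.snd D1.differentiableAt] at e2
  have f0 : fderiv ℝ (locCov f g Φ Ψ x₀) (chartAt Model x₀ y, u) ξ =
      (fderiv ℝ (locRam f g Φ Ψ x₀) (chartAt Model x₀ y, u) ξ).1 := by
    change fderiv ℝ (fun v => (locRam f g Φ Ψ x₀ v).1) _ ξ = _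
    rw [fderiv.fst D0.differentiableAt]; rfl
  have f1 : ∀ η, fderiv ℝ (locCov f g Φ Ψ x₁) (totalChange L₁ L₂ x₀ x₁ (chartAt Model x₀ y, u)) η =
      (fderiv ℝ (locRam f g Φ Ψ x₁) (totalChange L₁ L₂ x₀ x₁ (chartAt Model x₀ y, u)) η).1 := by
    intro η
    change fderiv ℝ (fun v => (locRam f g Φ Ψ x₁ v).1) _ η = _
    rw [fderiv.fst D1.differentiableAt]; rfl
  rw [f0] at e1
  simp only [f1] at e1
  exact Prod.ext e1 e2

/-- All points of `Z` over `y` are regular in the coordinates around `x₀`. -/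
def RegularZ (f : ∀ x, L₁ x ⊗[ℂ] L₁ x) (g : ∀ x, L₂ x ⊗[ℂ] L₂ x)
    (Φ : ∀ x, L₂ x →ₗ[ℂ] L₁ x ⊗[ℂ] L₁ x) (Ψ : ∀ x, L₁ x →ₗ[ℂ] L₂ x ⊗[ℂ] L₂ x) (x₀ y : X) : Prop :=
  ∀ u : ℂ × ℂ, locCov f g Φ Ψ x₀ (chartAt Model x₀ y, u) = 0 →
    Function.Surjective (fderiv ℝ (locCov f g Φ Ψ x₀) (chartAt Model x₀ y, u))

/-- All points of `R` over `y` are regular in the coordinates around `x₀`. -/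
def RegularR (f : ∀ x, L₁ x ⊗[ℂ] L₁ x) (g : ∀ x, L₂ x ⊗[ℂ] L₂ x)
    (Φ : ∀ x, L₂ x →ₗ[ℂ] L₁ x ⊗[ℂ] L₁ x) (Ψ : ∀ x, L₁ x →ₗ[ℂ] L₂ x ⊗[ℂ] L₂ x) (x₀ y : X) : Prop :=
  ∀ u : ℂ × ℂ, locRam f g Φ Ψ x₀ (chartAt Model x₀ y, u) = 0 →
    Function.Surjective (fderiv ℝ (locRam f g Φ Ψ x₀) (chartAt Model x₀ y, u))

lemma locRam_change_eq_zero {x₀ x₁ y : X} (h₀ : y ∈ coordDomain L₁ L₂ x₀)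
    (h₁ : y ∈ coordDomain L₁ L₂ x₁) {u : ℂ × ℂ}
    (hz : locRam f g Φ Ψ x₀ (chartAt Model x₀ y, u) = 0) :
    locRam f g Φ Ψ x₁ (totalChange L₁ L₂ x₀ x₁ (chartAt Model x₀ y, u)) = 0 := by
  have n₁ := transition_ne_zero h₀.2.1 h₁.2.1
  have n₂ := transition_ne_zero h₀.2.2 h₁.2.2
  obtain ⟨e1, e2, e3⟩ := locRam_change (f := f) (g := g) (Φ := Φ) (Ψ := Ψ) h₀ h₁ u
  rw [hz] at e1 e2 e3
  refine Prod.ext (Prod.ext ?_ ?_) ?_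
  · simpa [n₁] using e1
  · simpa [n₂] using e2
  · simpa [n₁, n₂] using e3

lemma locCov_change_eq_zero {x₀ x₁ y : X} (h₀ : y ∈ coordDomain L₁ L₂ x₀)
    (h₁ : y ∈ coordDomain L₁ L₂ x₁) {u : ℂ × ℂ}
    (hz : locCov f g Φ Ψ x₀ (chartAt Model x₀ y, u) = 0) :
    locCov f g Φ Ψ x₁ (totalChange L₁ L₂ x₀ x₁ (chartAt Model x₀ y, u)) = 0 := by
  have n₁ := transition_ne_zero h₀.2.1 h₁.2.1
  have n₂ := transition_ne_zero h₀.2.2 h₁.2.2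
  obtain ⟨e1, e2, -⟩ := locRam_change (f := f) (g := g) (Φ := Φ) (Ψ := Ψ) h₀ h₁ u
  have hz1 := congrArg Prod.fst hz
  have hz2 := congrArg Prod.snd hz
  refine Prod.ext ?_ ?_
  · exact (mul_eq_zero.1 (e1.symm.trans hz1)).resolve_left (pow_ne_zero 2 n₁)
  · exact (mul_eq_zero.1 (e2.symm.trans hz2)).resolve_left (pow_ne_zero 2 n₂)

/-- At a zero, the derivatives of the equations in two coordinate systems differ by invertible maps
on both sides. Thus estimates made around one centre `x₀` yield regularity in the coordinates
centred at every nearby `y`. -/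
lemma RegularZ.change (h : IsSmoothData f g Φ Ψ) {x₀ x₁ y : X}
    (h₀ : y ∈ coordDomain L₁ L₂ x₀) (h₁ : y ∈ coordDomain L₁ L₂ x₁)
    (hr : RegularZ f g Φ Ψ x₁ y) : RegularZ f g Φ Ψ x₀ y := by
  intro u hu
  have n₁ := transition_ne_zero h₀.2.1 h₁.2.1
  have n₂ := transition_ne_zero h₀.2.2 h₁.2.2
  have hz := locCov_change_eq_zero h₀ h₁ hu
  have hs : Function.Surjective (fderiv ℝ (locCov f g Φ Ψ x₁)
      (totalChange L₁ L₂ x₀ x₁ (chartAt Model x₀ y, u))) := by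
    rw [totalChange_apply h₀] at hz ⊢
    exact hr _ hz
  intro c
  obtain ⟨η, hη⟩ := hs (c.1 / transition L₁ x₀ x₁ y ^ 2, c.2 / transition L₂ x₀ x₁ y ^ 2)
  obtain ⟨ξ, rfl⟩ := (fderiv_totalChange_bijective h₀ h₁ u).2 η
  refine ⟨ξ, ?_⟩
  rw [h.fderiv_locCov_change h₀ h₁ u hz ξ, hη]
  refine Prod.ext ?_ ?_ <;> simp only <;> field_simp

lemma RegularR.change (h : IsSmoothData f g Φ Ψ) {x₀ x₁ y : X}
    (h₀ : y ∈ coordDomain L₁ L₂ x₀) (h₁ : y ∈ coordDomain L₁ L₂ x₁)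
    (hr : RegularR f g Φ Ψ x₁ y) : RegularR f g Φ Ψ x₀ y := by
  intro u hu
  have n₁ := transition_ne_zero h₀.2.1 h₁.2.1
  have n₂ := transition_ne_zero h₀.2.2 h₁.2.2
  have hz := locRam_change_eq_zero h₀ h₁ hu
  have hs : Function.Surjective (fderiv ℝ (locRam f g Φ Ψ x₁)
      (totalChange L₁ L₂ x₀ x₁ (chartAt Model x₀ y, u))) := by
    rw [totalChange_apply h₀] at hz ⊢
    exact hr _ hz
  intro c
  obtain ⟨η, hη⟩ := hs ((c.1.1 / transition L₁ x₀ x₁ y ^ 2, c.1.2 / transition L₂ x₀ x₁ y ^ 2),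
    c.2 / (transition L₁ x₀ x₁ y * transition L₂ x₀ x₁ y))
  obtain ⟨ξ, rfl⟩ := (fderiv_totalChange_bijective h₀ h₁ u).2 η
  refine ⟨ξ, ?_⟩
  rw [h.fderiv_locRam_change h₀ h₁ u hz ξ, hη]
  refine Prod.ext (Prod.ext ?_ ?_) ?_ <;> simp only <;> field_simp

end Change

/-! ### Smoothness of `Z`, its critical set and its branch locus. -/

lemma finrank_model : Module.finrank ℝ Model = 4 := by
  rw [finrank_real_of_complex, finrank_euclideanSpace_fin]

lemma finrank_total : Module.finrank ℝ (Model × (ℂ × ℂ)) = 8 := by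
  simp [Module.finrank_prod, finrank_model, Complex.finrank_real_complex]

lemma exists_right_null {z w φ ψ : ℂ} (h : 4 * z * w = φ * ψ) :
    ∃ a b : ℂ, (a, b) ≠ 0 ∧ 2 * z * a = φ * b ∧ 2 * w * b = ψ * a := by
  obtain ⟨p, q, r, s, hz, hφ, hψ, hw, -⟩ := exists_rank_one h
  by_cases hqr : q = 0 ∧ r = 0
  · obtain ⟨rfl, rfl⟩ := hqr
    exact ⟨1, 0, by simp, by rw [hz]; simp, by rw [hψ]; simp⟩
  · refine ⟨r, q, ?_, by rw [hz, hφ]; ring, by rw [hw, hψ]; ring⟩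
    simpa [Prod.ext_iff, and_comm] using hqr

/-- Away from the ramification, the fibre coordinates of a vector in the kernel of the derivative
are determined by its base coordinates. -/
lemma derCov_bijective_prod {z w P Q : ℂ} (F' G' P' Q' : Model →L[ℝ] ℂ)
    (h : 4 * z * w ≠ P * Q) :
    Function.Bijective ((derCov z w P Q F' G' P' Q').prod dBase) := by
  have hd : 4 * z * w - P * Q ≠ 0 := sub_ne_zero.2 h
  apply bijective_of_injective_of_finrank_eq
  · simp [Module.finrank_prod, finrank_model, Complex.finrank_real_complex]
  rw [injective_iff_map_eq_zero]
  rintro ⟨x, a, b⟩ hv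
  have hx : x = 0 := congrArg Prod.snd hv
  have h1 : derCov z w P Q F' G' P' Q' (x, a, b) = 0 := congrArg Prod.fst hv
  subst hx
  have h2 : 2 * z * a - P * b = 0 := by simpa [derCov, derZ] using congrArg Prod.fst h1
  have h3 : 2 * w * b - Q * a = 0 := by simpa [derCov, derW] using congrArg Prod.snd h1
  have ha : a = 0 := by
    refine (mul_eq_zero.1 (?_ : (4 * z * w - P * Q) * a = 0)).resolve_left hd
    linear_combination 2 * w * h2 + P * h3
  have hb : b = 0 := by
    refine (mul_eq_zero.1 (?_ : (4 * z * w - P * Q) * b = 0)).resolve_left hd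
    linear_combination Q * h2 + 2 * z * h3
  simp [ha, hb]

section Cover

variable {X : Type*} [TopologicalSpace X] [T2Space X] [ChartedSpace Model X]
  [IsManifold 𝓘(ℂ, Model) ω X]
  {L₁ : X → Type*} [∀ x, AddCommGroup (L₁ x)] [∀ x, Module ℂ (L₁ x)]
  {L₂ : X → Type*} [∀ x, AddCommGroup (L₂ x)] [∀ x, Module ℂ (L₂ x)]
  [∀ x, TopologicalSpace (L₁ x)] [TopologicalSpace (TotalSpace ℂ L₁)] [FiberBundle ℂ L₁]
  [VectorBundle ℂ ℂ L₁]
  [∀ x, TopologicalSpace (L₂ x)] [TopologicalSpace (TotalSpace ℂ L₂)] [FiberBundle ℂ L₂]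
  [VectorBundle ℂ ℂ L₂]
  [ContMDiffVectorBundle ω ℂ L₁ 𝓘(ℂ, Model)] [ContMDiffVectorBundle ω ℂ L₂ 𝓘(ℂ, Model)]
  {f : ∀ x, L₁ x ⊗[ℂ] L₁ x} {g : ∀ x, L₂ x ⊗[ℂ] L₂ x}
  {Φ : ∀ x, L₂ x →ₗ[ℂ] L₁ x ⊗[ℂ] L₁ x} {Ψ : ∀ x, L₁ x →ₗ[ℂ] L₂ x ⊗[ℂ] L₂ x}

lemma mem_coverZ_iff_locCov {x₀ : X} {p : TotalV L₁ L₂} (hp : p.proj ∈ coordDomain L₁ L₂ x₀) :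
    p ∈ coverZ f g Φ Ψ ↔ locCov f g Φ Ψ x₀ (totalChart L₁ L₂ x₀ p) = 0 := by
  have hs := mem_totalChart_source.2 hp
  have := symm_mem_coverZ_iff (f := f) (g := g) (Φ := Φ) (Ψ := Ψ)
    (mem_totalChart_target.1 ((totalChart L₁ L₂ x₀).map_source hs))
  rwa [(totalChart L₁ L₂ x₀).left_inv hs] at this

lemma mem_ramificationR_iff_locRam {x₀ : X} {p : TotalV L₁ L₂}
    (hp : p.proj ∈ coordDomain L₁ L₂ x₀) :
    p ∈ ramificationR f g Φ Ψ ↔ locRam f g Φ Ψ x₀ (totalChart L₁ L₂ x₀ p) = 0 := by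
  have hs := mem_totalChart_source.2 hp
  have := symm_mem_ramificationR_iff (f := f) (g := g) (Φ := Φ) (Ψ := Ψ)
    (mem_totalChart_target.1 ((totalChart L₁ L₂ x₀).map_source hs))
  rwa [(totalChart L₁ L₂ x₀).left_inv hs] at this

lemma RegularZ.surjective {x₀ : X} {p : TotalV L₁ L₂} (hp : p.proj ∈ coordDomain L₁ L₂ x₀)
    (hr : RegularZ f g Φ Ψ x₀ p.proj) (hpZ : p ∈ coverZ f g Φ Ψ) :
    Function.Surjective (fderiv ℝ (locCov f g Φ Ψ x₀) (totalChart L₁ L₂ x₀ p)) := by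
  rw [mem_coverZ_iff_locCov hp, totalChart_apply hp] at hpZ
  rw [totalChart_apply hp]
  exact hr _ hpZ

lemma RegularR.surjective {x₀ : X} {p : TotalV L₁ L₂} (hp : p.proj ∈ coordDomain L₁ L₂ x₀)
    (hr : RegularR f g Φ Ψ x₀ p.proj) (hpZ : p ∈ ramificationR f g Φ Ψ) :
    Function.Surjective (fderiv ℝ (locRam f g Φ Ψ x₀) (totalChart L₁ L₂ x₀ p)) := by
  rw [mem_ramificationR_iff_locRam hp, totalChart_apply hp] at hpZ
  rw [totalChart_apply hp]
  exact hr _ hpZ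

theorem isSmoothSubmanifold_coverZ (h : IsSmoothData f g Φ Ψ)
    (hr : ∀ y, RegularZ f g Φ Ψ y y) : IsSmoothSubmanifold modelV 4 (coverZ f g Φ Ψ) := by
  intro p
  have hp : p.1.proj ∈ coordDomain L₁ L₂ p.1.proj := mem_coordDomain _
  have hsurj := (hr p.1.proj).surjective hp p.2
  obtain ⟨B, hB⟩ := exists_bijective_prod (Y := EuclideanSpace ℝ (Fin 4)) (by
    rw [finrank_total, finrank_euclideanSpace_fin]
    simp [Module.finrank_prod, Complex.finrank_real_complex]) hsurj
  obtain ⟨φ, hpφ, hφ, -⟩ := (h.isLocalEquation_coverZ p.1.proj).exists_submanifoldChart B p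
    (mem_totalChart_source.2 hp) ((totalChart L₁ L₂ _).map_source (mem_totalChart_source.2 hp)) hB
  exact ⟨φ, hφ, hpφ⟩

lemma IsSmoothData.isLocalEquation_coverZ_at (h : IsSmoothData f g Φ Ψ) (p : TotalV L₁ L₂) :
    IsLocalEquation modelV (coverZ f g Φ Ψ) p (locCov f g Φ Ψ p.proj)
      (totalChart L₁ L₂ p.proj).target := by
  have := h.isLocalEquation_coverZ p.proj
  refine ⟨this.isOpen, ?_, this.contDiffOn, ?_⟩
  · rw [extChartAt_eq_totalChart]
  · rw [extChartAt_eq_totalChart]; exact this.mem_iff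

lemma mfderiv_proj (p : TotalV L₁ L₂) (v : Model × (ℂ × ℂ)) :
    (mfderiv modelV 𝓘(ℝ, Model) (fun p : TotalV L₁ L₂ => p.proj) p v : Model) = v.1 := by
  have hd : MDifferentiableAt modelV 𝓘(ℝ, Model) (fun p : TotalV L₁ L₂ => p.proj) p :=
    (Bundle.contMDiff_proj (n := ∞) (IB := 𝓘(ℝ, Model)) (L₁ ×ᵇ L₂)).mdifferentiable (by simp) p
  have hp : p.proj ∈ coordDomain L₁ L₂ p.proj := mem_coordDomain _
  rw [hd.mfderiv]
  have heq : writtenInExtChartAt modelV 𝓘(ℝ, Model) p (fun p : TotalV L₁ L₂ => p.proj)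
      =ᶠ[𝓝 (totalChart L₁ L₂ p.proj p)] fun v => dBase v := by
    filter_upwards [(isOpen_totalChart_target p.proj).mem_nhds
      ((totalChart L₁ L₂ _).map_source (mem_totalChart_source.2 hp))] with v hv
    have hv' := mem_totalChart_target.1 hv
    simp only [writtenInExtChartAt, Function.comp_apply, extChartAt_eq_totalChart]
    rw [(totalChart_symm hv').1]
    simp [(chartAt Model p.proj).right_inv hv'.1]
  have hrange : range (modelV : ModelProd Model (ℂ × ℂ) → Model × (ℂ × ℂ)) = univ :=
    ModelWithCorners.range_eq_univ _
  rw [hrange, fderivWithin_univ, extChartAt_eq_totalChart, heq.fderiv_eq, dBase.fderiv]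
  rfl

/-- The tangent space is the kernel of the derivative of the equations. Its projection to the base
fails to be an isomorphism exactly when it contains a nonzero vertical vector, that is, when the
block `[[2z, -φ], [-ψ, 2w]]` is singular. -/
theorem criticalSetZ_eq_ramificationR (h : IsSmoothData f g Φ Ψ)
    (hr : ∀ y, RegularZ f g Φ Ψ y y) : criticalSetZ f g Φ Ψ = ramificationR f g Φ Ψ := by
  ext p
  have hp : p.proj ∈ coordDomain L₁ L₂ p.proj := mem_coordDomain _
  by_cases hpZ : p ∈ coverZ f g Φ Ψ
  swap
  · exact ⟨fun h => absurd h.1 hpZ, fun h => absurd h.1 hpZ⟩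
  rw [mem_ramificationR_iff f g Φ Ψ hp.2.1 hp.2.2]
  set z := fibreCoord L₁ p.proj p.proj p.2.1 with hz
  set w := fibreCoord L₂ p.proj p.proj p.2.2 with hw
  have hsurj := (hr p.proj).surjective hp hpZ
  have htan : ∀ v : Model × (ℂ × ℂ), v ∈ (tangentVectors modelV (coverZ f g Φ Ψ) p : Set _) ↔
      fderiv ℝ (locCov f g Φ Ψ p.proj) (totalChart L₁ L₂ p.proj p) v = 0 := by
    intro v
    have := (h.isLocalEquation_coverZ_at p).mem_tangentVectors_iff hpZ
      (by rw [extChartAt_eq_totalChart]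
          exact (totalChart L₁ L₂ _).map_source (mem_totalChart_source.2 hp))
      (by rw [extChartAt_eq_totalChart]; exact hsurj) v
    rwa [extChartAt_eq_totalChart] at this
  rw [totalChart_apply hp, (h.hasFDerivAt_locCov hp (z, w)).fderiv] at htan
  simp only at htan
  set D := derCov z w (homRep Φ p.proj p.proj) (homRep Ψ p.proj p.proj)
    (fderiv ℝ (locSq f p.proj) (chartAt Model p.proj p.proj))
    (fderiv ℝ (locSq g p.proj) (chartAt Model p.proj p.proj))
    (fderiv ℝ (locHom Φ p.proj) (chartAt Model p.proj p.proj))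
    (fderiv ℝ (locHom Ψ p.proj) (chartAt Model p.proj p.proj)) with hD
  have hbij : BijOn (mfderiv modelV 𝓘(ℝ, Model) (fun p : TotalV L₁ L₂ => p.proj) p)
      (tangentVectors modelV (coverZ f g Φ Ψ) p) univ ↔
      4 * z * w ≠ homRep Φ p.proj p.proj * homRep Ψ p.proj p.proj := by
    constructor
    · intro hb hram
      obtain ⟨a, b, hab, h1, h2⟩ := exists_right_null hram
      have hm : ((0, a, b) : Model × (ℂ × ℂ)) ∈
          (tangentVectors modelV (coverZ f g Φ Ψ) p : Set _) := by
        rw [htan]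
        refine Prod.ext ?_ ?_
        · simp [hD, derCov, derZ]; linear_combination h1
        · simp [hD, derCov, derW]; linear_combination h2
      have hm0 : (0 : Model × (ℂ × ℂ)) ∈ (tangentVectors modelV (coverZ f g Φ Ψ) p : Set _) := by
        rw [htan, map_zero]
      have := hb.injOn hm hm0 (by
        rw [show mfderiv modelV 𝓘(ℝ, Model) (fun p : TotalV L₁ L₂ => p.proj) p
          ((0, a, b) : Model × (ℂ × ℂ)) = (0 : Model) from mfderiv_proj p _,
          show mfderiv modelV 𝓘(ℝ, Model) (fun p : TotalV L₁ L₂ => p.proj) p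
          (0 : Model × (ℂ × ℂ)) = (0 : Model) from mfderiv_proj p _])
      exact hab (congrArg Prod.snd this)
    · intro hne
      have hb := derCov_bijective_prod (fderiv ℝ (locSq f p.proj) (chartAt Model p.proj p.proj))
        (fderiv ℝ (locSq g p.proj) (chartAt Model p.proj p.proj))
        (fderiv ℝ (locHom Φ p.proj) (chartAt Model p.proj p.proj))
        (fderiv ℝ (locHom Ψ p.proj) (chartAt Model p.proj p.proj)) hne
      rw [← hD] at hb
      refine ⟨fun _ _ => mem_univ _, ?_, ?_⟩
      · intro v hv v' hv' hvv
        have e1 : (v : Model × (ℂ × ℂ)).1 = (v' : Model × (ℂ × ℂ)).1 := by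
          rw [← mfderiv_proj p v, ← mfderiv_proj p v', hvv]
        exact hb.1 (Prod.ext (((htan v).1 hv).trans ((htan v').1 hv').symm) e1)
      · intro x _
        obtain ⟨v, hv⟩ := hb.2 (0, x)
        exact ⟨v, (htan v).2 (congrArg Prod.fst hv),
          (mfderiv_proj p v).trans (congrArg Prod.snd hv)⟩
  constructor
  · rintro ⟨-, hn⟩
    exact ⟨hpZ, not_not.1 (fun hc => hn (hbij.2 hc))⟩
  · rintro ⟨-, hn⟩
    exact ⟨hpZ, fun hc => hbij.1 hc hn⟩

/-- The point of the total space over `y` with given fibre coordinates. -/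
def fibrePoint (L₁ L₂ : X → Type*) [∀ x, AddCommGroup (L₁ x)] [∀ x, Module ℂ (L₁ x)]
    [∀ x, AddCommGroup (L₂ x)] [∀ x, Module ℂ (L₂ x)]
    [∀ x, TopologicalSpace (L₁ x)] [TopologicalSpace (TotalSpace ℂ L₁)] [FiberBundle ℂ L₁]
    [VectorBundle ℂ ℂ L₁]
    [∀ x, TopologicalSpace (L₂ x)] [TopologicalSpace (TotalSpace ℂ L₂)] [FiberBundle ℂ L₂]
    [VectorBundle ℂ ℂ L₂] (x₀ y : X) (u : ℂ × ℂ) : TotalV L₁ L₂ :=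
  ⟨y, (u.1 • fibreFrame L₁ x₀ y, u.2 • fibreFrame L₂ x₀ y)⟩

lemma fibreCoord_fibrePoint {x₀ y : X} (h₁ : y ∈ baseSetAt L₁ x₀) (h₂ : y ∈ baseSetAt L₂ x₀)
    (u : ℂ × ℂ) : fibreCoord L₁ x₀ y (fibrePoint L₁ L₂ x₀ y u).2.1 = u.1 ∧
      fibreCoord L₂ x₀ y (fibrePoint L₁ L₂ x₀ y u).2.2 = u.2 := by
  simp [fibrePoint, fibreCoord_frame h₁, fibreCoord_frame h₂]

lemma fibrePoint_mem_coverZ_iff {x₀ y : X} (h₁ : y ∈ baseSetAt L₁ x₀) (h₂ : y ∈ baseSetAt L₂ x₀)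
    (u : ℂ × ℂ) : fibrePoint L₁ L₂ x₀ y u ∈ coverZ f g Φ Ψ ↔
      u ∈ fibreSet (sqRep f x₀ y) (sqRep g x₀ y) (homRep Φ x₀ y) (homRep Ψ x₀ y) := by
  obtain ⟨e1, e2⟩ := fibreCoord_fibrePoint h₁ h₂ u
  have := mem_coverZ_iff f g Φ Ψ (x₀ := x₀) (p := fibrePoint L₁ L₂ x₀ y u) h₁ h₂
  refine this.trans (Eq.to_iff (congrArg (fun v => v ∈ fibreSet (sqRep f x₀ y) (sqRep g x₀ y)
    (homRep Φ x₀ y) (homRep Ψ x₀ y)) (Prod.ext e1 e2)))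

lemma fibrePoint_coord {x₀ : X} (p : TotalV L₁ L₂) (h₁ : p.proj ∈ baseSetAt L₁ x₀)
    (h₂ : p.proj ∈ baseSetAt L₂ x₀) : fibrePoint L₁ L₂ x₀ p.proj
      (fibreCoord L₁ x₀ p.proj p.2.1, fibreCoord L₂ x₀ p.proj p.2.2) = p := by
  simp only [fibrePoint, fibreCoord_smul_frame h₁, fibreCoord_smul_frame h₂]

lemma fibre_eq_image {x₀ y : X} (h₁ : y ∈ baseSetAt L₁ x₀) (h₂ : y ∈ baseSetAt L₂ x₀) :
    {p ∈ coverZ f g Φ Ψ | p.proj = y} = fibrePoint L₁ L₂ x₀ y ''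
      fibreSet (sqRep f x₀ y) (sqRep g x₀ y) (homRep Φ x₀ y) (homRep Ψ x₀ y) := by
  ext p
  constructor
  · rintro ⟨hp, rfl⟩
    exact ⟨_, (mem_coverZ_iff f g Φ Ψ h₁ h₂).1 hp, fibrePoint_coord p h₁ h₂⟩
  · rintro ⟨u, hu, rfl⟩
    exact ⟨(fibrePoint_mem_coverZ_iff h₁ h₂ u).2 hu, rfl⟩

lemma encard_fibre {x₀ y : X} (h₁ : y ∈ baseSetAt L₁ x₀) (h₂ : y ∈ baseSetAt L₂ x₀) :
    {p ∈ coverZ f g Φ Ψ | p.proj = y}.encard =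
      (fibreSet (sqRep f x₀ y) (sqRep g x₀ y) (homRep Φ x₀ y) (homRep Ψ x₀ y)).encard := by
  rw [fibre_eq_image h₁ h₂]
  refine Function.Injective.encard_image (fun u v huv => ?_) _
  obtain ⟨e1, e2⟩ := fibreCoord_fibrePoint (L₁ := L₁) (L₂ := L₂) h₁ h₂ u
  obtain ⟨e3, e4⟩ := fibreCoord_fibrePoint (L₁ := L₁) (L₂ := L₂) h₁ h₂ v
  have := congrArg (fun p : TotalV L₁ L₂ =>
    (fibreCoord L₁ x₀ p.proj p.2.1, fibreCoord L₂ x₀ p.proj p.2.2)) huv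
  exact ((Prod.ext e1 e2 : (_, _) = u).symm.trans this).trans (Prod.ext e3 e4)

lemma mem_image_ramificationR_iff {x₀ y : X} (h₁ : y ∈ baseSetAt L₁ x₀)
    (h₂ : y ∈ baseSetAt L₂ x₀) :
    y ∈ (fun p : TotalV L₁ L₂ => p.proj) '' ramificationR f g Φ Ψ ↔
      deltaRep f g Φ Ψ x₀ y = 0 := by
  rw [deltaRep_eq, fibreDisc_eq_zero_iff]
  constructor
  · rintro ⟨p, hp, rfl⟩
    rw [mem_ramificationR_iff f g Φ Ψ h₁ h₂] at hp
    exact ⟨_, (mem_coverZ_iff f g Φ Ψ h₁ h₂).1 hp.1, hp.2⟩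
  · rintro ⟨u, hu, hu'⟩
    refine ⟨fibrePoint L₁ L₂ x₀ y u, ?_, rfl⟩
    have := mem_ramificationR_iff f g Φ Ψ (x₀ := x₀) (p := fibrePoint L₁ L₂ x₀ y u) h₁ h₂
    rw [this, fibrePoint_mem_coverZ_iff h₁ h₂]
    refine ⟨hu, ?_⟩
    obtain ⟨e1, e2⟩ := fibreCoord_fibrePoint (L₁ := L₁) (L₂ := L₂) h₁ h₂ u
    exact (congrArg₂ (fun a b : ℂ => 4 * a * b) e1 e2).trans hu'

theorem mem_branchDelta_iff (h : IsSmoothData f g Φ Ψ) (hr : ∀ y, RegularZ f g Φ Ψ y y)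
    {x₀ y : X} (h₁ : y ∈ baseSetAt L₁ x₀) (h₂ : y ∈ baseSetAt L₂ x₀) :
    y ∈ branchDelta f g Φ Ψ ↔ deltaRep f g Φ Ψ x₀ y = 0 := by
  rw [branchDelta, criticalSetZ_eq_ramificationR h hr, mem_image_ramificationR_iff h₁ h₂]

end Cover

/-! ### The projection of `Z` as a branched covering of degree four. -/

lemma norm_le_of_mem_fibreSet {f g φ ψ : ℂ} {b : ℝ} (hf : ‖f‖ ≤ b) (hg : ‖g‖ ≤ b)
    (hφ : ‖φ‖ ≤ b) (hψ : ‖ψ‖ ≤ b) {u : ℂ × ℂ} (hu : u ∈ fibreSet f g φ ψ) : ‖u‖ ≤ b + 1 := by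
  have hb : 0 ≤ b := (norm_nonneg f).trans hf
  have h1 : ‖u.1‖ ^ 2 ≤ b + ‖u‖ * b := by
    rw [← norm_pow, hu.1]
    exact (norm_add_le _ _).trans (add_le_add hf ((norm_mul _ _).trans_le
      (mul_le_mul (norm_snd_le u) hφ (norm_nonneg _) (norm_nonneg _))))
  have h2 : ‖u.2‖ ^ 2 ≤ b + ‖u‖ * b := by
    rw [← norm_pow, hu.2]
    exact (norm_add_le _ _).trans (add_le_add hg ((norm_mul _ _).trans_le
      (mul_le_mul (norm_fst_le u) hψ (norm_nonneg _) (norm_nonneg _))))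
  have h3 : ‖u‖ ^ 2 ≤ b + ‖u‖ * b := by
    rcases max_choice ‖u.1‖ ‖u.2‖ with h | h <;> rw [Prod.norm_def, h] <;>
      rw [Prod.norm_def, h] at h1 h2 <;> assumption
  -- For `‖u‖ > b + 1` one has `‖u‖² > (b + 1)‖u‖ > b + b‖u‖`.
  by_contra! h
  nlinarith

section Cover

variable {X : Type*} [TopologicalSpace X] [T2Space X] [ChartedSpace Model X]
  [IsManifold 𝓘(ℂ, Model) ω X]
  {L₁ : X → Type*} [∀ x, AddCommGroup (L₁ x)] [∀ x, Module ℂ (L₁ x)]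
  {L₂ : X → Type*} [∀ x, AddCommGroup (L₂ x)] [∀ x, Module ℂ (L₂ x)]
  [∀ x, TopologicalSpace (L₁ x)] [TopologicalSpace (TotalSpace ℂ L₁)] [FiberBundle ℂ L₁]
  [VectorBundle ℂ ℂ L₁]
  [∀ x, TopologicalSpace (L₂ x)] [TopologicalSpace (TotalSpace ℂ L₂)] [FiberBundle ℂ L₂]
  [VectorBundle ℂ ℂ L₂]
  [ContMDiffVectorBundle ω ℂ L₁ 𝓘(ℂ, Model)] [ContMDiffVectorBundle ω ℂ L₂ 𝓘(ℂ, Model)]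
  {f : ∀ x, L₁ x ⊗[ℂ] L₁ x} {g : ∀ x, L₂ x ⊗[ℂ] L₂ x}
  {Φ : ∀ x, L₂ x →ₗ[ℂ] L₁ x ⊗[ℂ] L₁ x} {Ψ : ∀ x, L₁ x →ₗ[ℂ] L₂ x ⊗[ℂ] L₂ x}

lemma continuous_totalProj : Continuous (fun p : TotalV L₁ L₂ => p.proj) :=
  FiberBundle.continuous_proj (ℂ × ℂ) (L₁ ×ᵇ L₂)

instance t2Space_totalV : T2Space (TotalV L₁ L₂) := by
  refine ⟨fun p q hpq => ?_⟩
  by_cases h : p.proj = q.proj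
  · let e := (trivializationAt (ℂ × ℂ) (L₁ ×ᵇ L₂) p.proj).toOpenPartialHomeomorph
    have hp : p ∈ e.source := FiberBundle.mem_trivializationAt_proj_source
    have hq : q ∈ e.source := by
      have : q ∈ (trivializationAt (ℂ × ℂ) (L₁ ×ᵇ L₂) q.proj).source :=
        FiberBundle.mem_trivializationAt_proj_source
      rw [← h] at this
      exact this
    obtain ⟨u, v, hu, hv, hpu, hqv, huv⟩ := t2_separation (e.injOn.ne hp hq hpq)
    exact ⟨e.source ∩ e ⁻¹' u, e.source ∩ e ⁻¹' v, e.isOpen_inter_preimage hu,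
      e.isOpen_inter_preimage hv, ⟨hp, hpu⟩, ⟨hq, hqv⟩,
      ((huv.preimage e).mono inter_subset_right inter_subset_right)⟩
  · obtain ⟨u, v, hu, hv, hpu, hqv, huv⟩ := t2_separation h
    exact ⟨_, _, hu.preimage continuous_totalProj, hv.preimage continuous_totalProj, hpu, hqv,
      huv.preimage _⟩

/-- `Z` is compact over a compact set in the domain of a chart. -/
lemma isCompact_coverZ_over (h : IsSmoothData f g Φ Ψ) {x₀ : X} {K : Set X} (hK : IsCompact K)
    (hKs : K ⊆ coordDomain L₁ L₂ x₀) :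
    ∃ C ⊆ coverZ f g Φ Ψ, IsCompact C ∧ ∀ p ∈ coverZ f g Φ Ψ, p.proj ∈ K → p ∈ C := by
  set A := chartAt Model x₀ '' K with hA
  have hAc : IsCompact A :=
    hK.image_of_continuousOn ((chartAt Model x₀).continuousOn.mono fun y hy => (hKs hy).1)
  have hAt : A ⊆ coordTarget L₁ L₂ x₀ := by
    rintro _ ⟨y, hy, rfl⟩; exact chart_mem_coordTarget (hKs hy)
  have hcont : ∀ F : Model → ℂ, (∀ y ∈ coordDomain L₁ L₂ x₀,
      ContDiffAt ℝ ∞ F (chartAt Model x₀ y)) → ContinuousOn F A := fun F hF =>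
    ((contDiffOn_of_at hF).continuousOn).mono hAt
  obtain ⟨b1, hb1⟩ := hAc.exists_bound_of_continuousOn
    (hcont _ fun y hy => contDiffAt_locSq_left h.hf hy)
  obtain ⟨b2, hb2⟩ := hAc.exists_bound_of_continuousOn
    (hcont _ fun y hy => contDiffAt_locSq_right h.hg hy)
  obtain ⟨b3, hb3⟩ := hAc.exists_bound_of_continuousOn
    (hcont _ fun y hy => contDiffAt_locHom_left h.hΦ hy)
  obtain ⟨b4, hb4⟩ := hAc.exists_bound_of_continuousOn
    (hcont _ fun y hy => contDiffAt_locHom_right h.hΨ hy)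
  set b := max (max b1 b2) (max b3 b4)
  set T := A ×ˢ Metric.closedBall (0 : ℂ × ℂ) (b + 1) with hT
  have hTc : IsCompact T := hAc.prod (isCompact_closedBall _ _)
  have hTt : T ⊆ (totalChart L₁ L₂ x₀).target := fun v hv => mem_totalChart_target.2 (hAt hv.1)
  have hloc := (h.isLocalEquation_coverZ x₀).contDiffOn.continuousOn.mono hTt
  have hS : IsCompact (T ∩ locCov f g Φ Ψ x₀ ⁻¹' {0}) :=
    hTc.of_isClosed_subset (hloc.preimage_isClosed_of_isClosed hTc.isClosed isClosed_singleton)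
      inter_subset_left
  refine ⟨(totalChart L₁ L₂ x₀).symm '' (T ∩ locCov f g Φ Ψ x₀ ⁻¹' {0}), ?_, ?_, ?_⟩
  · rintro _ ⟨v, ⟨hv, hv0⟩, rfl⟩
    exact (symm_mem_coverZ_iff (hAt hv.1)).2 hv0
  · exact hS.image_of_continuousOn ((continuousOn_extChartAt_symm _).mono
      (inter_subset_left.trans hTt))
  · intro p hp hpK
    have hpd := hKs hpK
    refine ⟨totalChart L₁ L₂ x₀ p, ⟨?_, (mem_coverZ_iff_locCov hpd).1 hp⟩,
      (totalChart L₁ L₂ x₀).left_inv (mem_totalChart_source.2 hpd)⟩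
    have hmem := (mem_coverZ_iff_locCov hpd).1 hp
    rw [totalChart_apply hpd] at hmem ⊢
    have hpA : chartAt Model x₀ p.proj ∈ A := mem_image_of_mem _ hpK
    rw [covEq_eq_zero_iff] at hmem
    refine ⟨hpA, ?_⟩
    rw [mem_closedBall_zero_iff]
    exact norm_le_of_mem_fibreSet ((hb1 _ hpA).trans (by simp [b])) ((hb2 _ hpA).trans (by simp [b]))
      ((hb3 _ hpA).trans (by simp [b])) ((hb4 _ hpA).trans (by simp [b])) hmem

lemma isCompact_coverZ (𝒦 : C1Cover L₁ L₂) (h : IsSmoothData f g Φ Ψ) :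
    IsCompact (coverZ f g Φ Ψ) := by
  choose C hC1 hC2 hC3 using fun j => isCompact_coverZ_over h (𝒦.isCompact_K j) (𝒦.K_subset j)
  have : coverZ f g Φ Ψ = ⋃ j, C j := by
    refine Subset.antisymm (fun p hp => ?_) (iUnion_subset hC1)
    have : p.proj ∈ ⋃ j, 𝒦.K j := by rw [𝒦.iUnion_K]; trivial
    obtain ⟨j, hj⟩ := mem_iUnion.1 this
    exact mem_iUnion.2 ⟨j, hC3 j p hp hj⟩
  rw [this]
  exact isCompact_iUnion hC2

/-- Off `R` the base coordinates complete the equations of `Z` to a local coordinate system, so the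
projection itself is a chart of `Z` followed by the inverse of a chart of `X`. -/
lemma isLocalHomeomorphOn_proj (h : IsSmoothData f g Φ Ψ) (hr : ∀ y, RegularZ f g Φ Ψ y y) :
    IsLocalHomeomorphOn (fun p : coverZ f g Φ Ψ => p.1.proj)
      ((fun p : coverZ f g Φ Ψ => p.1.proj) ⁻¹' (branchDelta f g Φ Ψ)ᶜ) := by
  apply IsLocalHomeomorphOn.mk
  intro p hp
  have hd : p.1.proj ∈ coordDomain L₁ L₂ p.1.proj := mem_coordDomain _
  have hne : 4 * fibreCoord L₁ p.1.proj p.1.proj p.1.2.1 * fibreCoord L₂ p.1.proj p.1.proj p.1.2.2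
      ≠ homRep Φ p.1.proj p.1.proj * homRep Ψ p.1.proj p.1.proj := by
    intro he
    apply hp
    rw [branchDelta, criticalSetZ_eq_ramificationR h hr]
    exact ⟨p.1, (mem_ramificationR_iff f g Φ Ψ hd.2.1 hd.2.2).2 ⟨p.2, he⟩, rfl⟩
  obtain ⟨φ, σ, hpφ, hφ, -, -⟩ := (h.isLocalEquation_coverZ p.1.proj).exists_chart dBase p
    (mem_totalChart_source.2 hd) ((totalChart L₁ L₂ _).map_source (mem_totalChart_source.2 hd)) (by
      change Function.Bijective ((fderiv ℝ _ (totalChart L₁ L₂ _ p.1)).prod _)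
      rw [totalChart_apply hd, (h.hasFDerivAt_locCov hd _).fderiv]
      exact derCov_bijective_prod _ _ _ _ hne)
  have hval : ∀ q ∈ φ.source, φ q = chartAt Model p.1.proj q.1.proj ∧
      q.1.proj ∈ coordDomain L₁ L₂ p.1.proj := by
    intro q hq
    obtain ⟨h1, -, h2, -⟩ := hφ q hq
    have h1' := mem_totalChart_source.1 h1
    refine ⟨h2.trans ?_, h1'⟩
    rw [totalChart_apply h1']; rfl
  refine ⟨φ.trans (chartAt Model p.1.proj).symm, ?_, ?_⟩
  · rw [OpenPartialHomeomorph.trans_source]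
    refine ⟨hpφ, ?_⟩
    rw [mem_preimage, (hval p hpφ).1]
    exact (chartAt Model p.1.proj).map_source hd.1
  · intro q hq
    rw [OpenPartialHomeomorph.trans_source] at hq
    obtain ⟨h1, h2⟩ := hval q hq.1
    change q.1.proj = (chartAt Model p.1.proj).symm (φ q)
    rw [h1, (chartAt Model p.1.proj).left_inv h2.1]

lemma det_eq_zero_of_apply_eq_zero {T : Model →L[ℝ] Model} {ξ : Model} (hξ : ξ ≠ 0)
    (h : T ξ = 0) : T.det = 0 := by
  by_contra hd
  have := (LinearMap.equivOfDetNeZero T.toLinearMap hd).injective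
  exact hξ (this ((show T.toLinearMap ξ = 0 from h).trans (map_zero T.toLinearMap).symm))

/-- The critical values of the projection have measure zero: the local version. -/
lemma exists_chart_critical_null (h : IsSmoothData f g Φ Ψ) (hr : ∀ y, RegularZ f g Φ Ψ y y)
    [MeasurableSpace Model] [BorelSpace Model] (μ : MeasureTheory.Measure Model)
    [μ.IsAddHaarMeasure] (p : coverZ f g Φ Ψ) :
    ∃ s : Set (coverZ f g Φ Ψ), IsOpen s ∧ p ∈ s ∧
      (∀ q ∈ s, q.1.proj ∈ coordDomain L₁ L₂ p.1.proj) ∧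
      μ ((fun q : coverZ f g Φ Ψ => chartAt Model p.1.proj q.1.proj) ''
        {q ∈ s | q.1 ∈ ramificationR f g Φ Ψ}) = 0 := by
  set x₀ := p.1.proj with hx₀
  have hd : p.1.proj ∈ coordDomain L₁ L₂ x₀ := mem_coordDomain _
  have hsurj := (hr p.1.proj).surjective hd p.2
  obtain ⟨B, hB⟩ := exists_bijective_prod (Y := Model) (by
    rw [finrank_total, finrank_model]
    simp [Module.finrank_prod, Complex.finrank_real_complex]) hsurj
  obtain ⟨φ, σ, hpφ, hφ, hσ, hσ'⟩ := (h.isLocalEquation_coverZ x₀).exists_chart B p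
    (mem_totalChart_source.2 hd) ((totalChart L₁ L₂ _).map_source (mem_totalChart_source.2 hd)) hB
  refine ⟨φ.source, φ.open_source, hpφ, fun q hq => mem_totalChart_source.1 (hφ q hq).1, ?_⟩
  have hσd : ∀ a ∈ φ.target, HasFDerivAt σ (fderiv ℝ σ a) a := fun a ha =>
    ((hσ.contDiffAt (φ.open_target.mem_nhds ha)).differentiableAt (by simp)).hasFDerivAt
  -- Source and target of the projection both have real dimension four, so only the elementary case
  -- of Sard's theorem is needed: the image of the zero set of the Jacobian is null.
  have hnull := MeasureTheory.addHaar_image_eq_zero_of_det_fderivWithin_eq_zero μ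
    (f := fun a => (σ a).1) (s := {a ∈ φ.target | (dBase.comp (fderiv ℝ σ a)).det = 0})
    (f' := fun a => dBase.comp (fderiv ℝ σ a))
    (fun a ha => (dBase.hasFDerivAt.comp a (hσd a ha.1)).hasFDerivWithinAt) (fun a ha => ha.2)
  refine MeasureTheory.measure_mono_null ?_ hnull
  rintro _ ⟨q, ⟨hq, hqR⟩, rfl⟩
  obtain ⟨hq1, hqO, hq2, hq3⟩ := hφ q hq
  have hqd := mem_totalChart_source.1 hq1
  have hat := φ.map_source hq
  obtain ⟨ha1, ha2, ha3, ha4⟩ := hσ' _ hat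
  rw [φ.left_inv hq] at ha4
  have hσq : σ (φ q) = totalChart L₁ L₂ x₀ q.1 := by
    rw [ha4]; exact ((totalChart L₁ L₂ x₀).right_inv ha1).symm
  refine ⟨φ q, ⟨hat, ?_⟩, ?_⟩
  swap
  · simp only [hσq, totalChart_apply hqd]
  have hram := ((mem_ramificationR_iff f g Φ Ψ hqd.2.1 hqd.2.2).1 hqR).2
  obtain ⟨α, β, hne, e1, e2⟩ := exists_right_null hram
  set D := fderiv ℝ (locCov f g Φ Ψ x₀) (totalChart L₁ L₂ x₀ q.1) with hD
  have hDv : D (0, α, β) = 0 := by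
    rw [hD, totalChart_apply hqd, (h.hasFDerivAt_locCov hqd _).fderiv]
    refine Prod.ext ?_ ?_
    · simp [derCov, derZ]; linear_combination e1
    · simp [derCov, derW]; linear_combination e2
  -- The derivative of the parametrisation takes values in the kernel of `D` and is a section of
  -- `B`.
  have hDσ : ∀ ξ, D (fderiv ℝ σ (φ q) ξ) = 0 ∧ B (fderiv ℝ σ (φ q) ξ) = ξ := by
    intro ξ
    have hDd : HasFDerivAt (locCov f g Φ Ψ x₀) D (σ (φ q)) := by
      rw [hσq]
      exact (((h.isLocalEquation_coverZ x₀).contDiffOn.contDiffAt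
        ((h.isLocalEquation_coverZ x₀).isOpen.mem_nhds hqO)).differentiableAt
          (by simp)).hasFDerivAt
    have c1 := hDd.comp _ (hσd _ hat)
    have c2 := (B.hasFDerivAt (x := σ (φ q))).comp _ (hσd _ hat)
    have k1 : (locCov f g Φ Ψ x₀ ∘ σ) =ᶠ[𝓝 (φ q)] fun _ => 0 := by
      filter_upwards [φ.open_target.mem_nhds hat] with a ha using (hσ' a ha).2.1
    have k2 : (B ∘ σ) =ᶠ[𝓝 (φ q)] id := by
      filter_upwards [φ.open_target.mem_nhds hat] with a ha using (hσ' a ha).2.2.1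
    have u1 := (c1.congr_of_eventuallyEq k1.symm).unique (hasFDerivAt_const _ _)
    have u2 := (c2.congr_of_eventuallyEq k2.symm).unique (hasFDerivAt_id _)
    exact ⟨congrArg (fun T => T ξ) u1, congrArg (fun T => T ξ) u2⟩
  set ξ := B (0, α, β) with hξ
  have hinj : Function.Injective (D.prod B) := hq3.1
  -- The vertical null vector is therefore tangent to `Z`, and its parameter `ξ` is a nonzero vector
  -- killed by the derivative of the projection.
  have hσξ : fderiv ℝ σ (φ q) ξ = (0, α, β) :=
    hinj (Prod.ext ((hDσ ξ).1.trans hDv.symm) ((hDσ ξ).2.trans hξ))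
  refine det_eq_zero_of_apply_eq_zero (ξ := ξ) ?_ ?_
  · intro h0
    apply hne
    have := hinj (a₁ := (0, α, β)) (a₂ := 0) (Prod.ext (hDv.trans (map_zero D).symm)
      ((hξ.symm.trans h0).trans (map_zero B).symm))
    exact congrArg Prod.snd this
  · simp [hσξ]

/-- The fibre over `y` is finite and the projection is closed, so near `y` the branch locus is
covered by finitely many null sets. An open set contained in it is null in the chart, hence empty.
-/
lemma dense_compl_branchDelta (h : IsSmoothData f g Φ Ψ)
    (hr : ∀ y, RegularZ f g Φ Ψ y y)
    (hcl : IsClosedMap (fun p : coverZ f g Φ Ψ => p.1.proj)) :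
    Dense (branchDelta f g Φ Ψ)ᶜ := by
  let _ : MeasurableSpace Model := borel Model
  have : BorelSpace Model := ⟨rfl⟩
  have : ProperSpace Model := FiniteDimensional.proper ℝ Model
  let μ : MeasureTheory.Measure Model := MeasureTheory.Measure.addHaar
  rw [← interior_eq_empty_iff_dense_compl, eq_empty_iff_forall_notMem]
  intro y hy
  have hyd : y ∈ coordDomain L₁ L₂ y := mem_coordDomain y
  choose s hso hps hsd hsμ using exists_chart_critical_null h hr μ
  have hfin : {p : coverZ f g Φ Ψ | p.1.proj = y}.Finite := by
    have h4 : {p ∈ coverZ f g Φ Ψ | p.proj = y}.Finite := by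
      rw [← Set.encard_lt_top_iff, encard_fibre hyd.2.1 hyd.2.2]
      exact (encard_fibreSet_le _ _ _ _).trans_lt (by decide)
    refine Set.Finite.of_finite_image (f := Subtype.val) (h4.subset ?_)
      Subtype.val_injective.injOn
    rintro _ ⟨p, hp, rfl⟩
    exact ⟨p.2, hp⟩
  -- `C` is closed and misses `y`: over its complement all of `Z` lies in the chosen neighbourhoods
  -- of the points of the fibre.
  set C := (fun p : coverZ f g Φ Ψ => p.1.proj) ''
    (⋃ p ∈ {p : coverZ f g Φ Ψ | p.1.proj = y}, s p)ᶜ with hC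
  have hCc : IsClosed C := hcl _ (isOpen_biUnion fun p _ => hso p).isClosed_compl
  have hyC : y ∉ C := by
    rintro ⟨p, hp, hpy⟩
    exact hp (mem_biUnion (show p ∈ {p : coverZ f g Φ Ψ | p.1.proj = y} from hpy) (hps p))
  set W := interior (branchDelta f g Φ Ψ) ∩ Cᶜ ∩ coordDomain L₁ L₂ y with hW
  have hWo : IsOpen W := (isOpen_interior.inter hCc.isOpen_compl).inter (isOpen_coordDomain y)
  have hsub : chartAt Model y '' W ⊆ ⋃ p ∈ {p : coverZ f g Φ Ψ | p.1.proj = y},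
      (fun q : coverZ f g Φ Ψ => chartAt Model p.1.proj q.1.proj) ''
        {q ∈ s p | q.1 ∈ ramificationR f g Φ Ψ} := by
    rintro _ ⟨z, ⟨⟨hz1, hz2⟩, hz3⟩, rfl⟩
    have := interior_subset hz1
    rw [branchDelta, criticalSetZ_eq_ramificationR h hr] at this
    obtain ⟨q, hqR, rfl⟩ := this
    have hq' : (⟨q, hqR.1⟩ : coverZ f g Φ Ψ) ∈
        ⋃ p ∈ {p : coverZ f g Φ Ψ | p.1.proj = y}, s p := by
      by_contra hcon
      exact hz2 ⟨⟨q, hqR.1⟩, hcon, rfl⟩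
    obtain ⟨p, hp, hqs⟩ := mem_iUnion₂.1 hq'
    refine mem_biUnion hp ⟨⟨q, hqR.1⟩, ⟨hqs, hqR⟩, ?_⟩
    simp only [show p.1.proj = y from hp]
  have hopen : IsOpen (chartAt Model y '' W) :=
    (chartAt Model y).isOpen_image_of_subset_source hWo fun z hz => hz.2.1
  have hzero : μ (chartAt Model y '' W) = 0 :=
    MeasureTheory.measure_mono_null hsub
      ((MeasureTheory.measure_biUnion_null_iff hfin.countable).2 fun p _ => hsμ p)
  have := (hopen.measure_eq_zero_iff μ).1 hzero
  exact (this ▸ (mem_image_of_mem _ ⟨⟨hy, hyC⟩, hyd⟩ : chartAt Model y y ∈ chartAt Model y '' W) :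
    chartAt Model y y ∈ (∅ : Set Model))

/-- `Z` is compact, which gives properness and turns the local homeomorphism off `Δ` into a covering
map. The statements about fibres are those on the quartic. -/
theorem isBranchedCover (𝒦 : C1Cover L₁ L₂) (h : IsSmoothData f g Φ Ψ)
    (hr : ∀ y, RegularZ f g Φ Ψ y y) : IsBranchedCoverOfDegreeFour f g Φ Ψ := by
  have : CompactSpace (coverZ f g Φ Ψ) := isCompact_iff_compactSpace.1 (isCompact_coverZ 𝒦 h)
  have hc : Continuous (fun p : coverZ f g Φ Ψ => p.1.proj) :=
    continuous_totalProj.comp continuous_subtype_val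
  refine ⟨hc.isProperMap, fun x => ?_, fun x => ?_, fun x => ?_,
    dense_compl_branchDelta h hr hc.isClosedMap,
    IsCoveringMapOn.of_isLocalHomeomorphOn hc (isLocalHomeomorphOn_proj h hr)⟩
  all_goals have hx : x ∈ coordDomain L₁ L₂ x := mem_coordDomain x
  · rw [fibre_eq_image hx.2.1 hx.2.2]
    exact (fibreSet_nonempty _ _ _ _).image _
  · rw [encard_fibre hx.2.1 hx.2.2]
    exact encard_fibreSet_le _ _ _ _
  · rw [encard_fibre hx.2.1 hx.2.2, encard_fibreSet_eq_iff, mem_branchDelta_iff h hr hx.2.1 hx.2.2]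
    rfl

end Cover

/-! ### Differentials of functions on a surface, read in a chart -/

section Differential

variable {X : Type*} [TopologicalSpace X] [ChartedSpace Model X] [IsManifold 𝓘(ℂ, Model) ω X]
  {E : Type*} [NormedAddCommGroup E] [NormedSpace ℝ E]

lemma fderiv_chartChange_comp {x₀ x₁ y : X} (h₀ : y ∈ (chartAt Model x₀).source)
    (h₁ : y ∈ (chartAt Model x₁).source) :
    (fderiv ℝ (chartChange x₁ x₀) (chartAt Model x₁ y)).comp
      (fderiv ℝ (chartChange x₀ x₁) (chartAt Model x₀ y)) = ContinuousLinearMap.id ℝ Model := by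
  have hκ : chartChange x₀ x₁ (chartAt Model x₀ y) = chartAt Model x₁ y := by
    simp only [chartChange, (chartAt Model x₀).left_inv h₀]
  have d1 := ((contDiffAt_chartChange_real h₀ h₁).differentiableAt (by simp)).hasFDerivAt
  have d2 : HasFDerivAt (chartChange x₁ x₀) (fderiv ℝ (chartChange x₁ x₀) (chartAt Model x₁ y))
      (chartChange x₀ x₁ (chartAt Model x₀ y)) := by
    rw [hκ]
    exact ((contDiffAt_chartChange_real h₁ h₀).differentiableAt (by simp)).hasFDerivAt
  have he : chartChange x₁ x₀ ∘ chartChange x₀ x₁ =ᶠ[𝓝 (chartAt Model x₀ y)] id := by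
    filter_upwards [eventually_chart h₀ ((chartAt Model x₁).open_source.mem_nhds h₁)]
      with a ⟨ha1, ha2⟩
    simp only [chartChange, Function.comp_apply, id]
    rw [(chartAt Model x₁).left_inv ha1, (chartAt Model x₀).right_inv ha2]
  exact ((d2.comp _ d1).congr_of_eventuallyEq he.symm).unique (hasFDerivAt_id _)

lemma fderiv_chartChange_bijective {x₀ x₁ y : X} (h₀ : y ∈ (chartAt Model x₀).source)
    (h₁ : y ∈ (chartAt Model x₁).source) :
    Function.Bijective (fderiv ℝ (chartChange x₀ x₁) (chartAt Model x₀ y)) := by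
  refine ⟨Function.LeftInverse.injective
      (g := fderiv ℝ (chartChange x₁ x₀) (chartAt Model x₁ y)) fun v => ?_,
    Function.RightInverse.surjective
      (g := fderiv ℝ (chartChange x₁ x₀) (chartAt Model x₁ y)) fun v => ?_⟩
  · exact congrArg (fun T => T v) (fderiv_chartChange_comp h₀ h₁)
  · exact congrArg (fun T => T v) (fderiv_chartChange_comp h₁ h₀)

/-- The differential of a function in terms of its expression in the chart around `x₀`. -/
lemma mfderiv_eq_fderiv_comp {x₀ y : X} (hy : y ∈ (chartAt Model x₀).source) {r : X → E}
    (hr : DifferentiableAt ℝ (fun a => r ((chartAt Model x₀).symm a)) (chartAt Model x₀ y)) :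
    (mfderiv 𝓘(ℝ, Model) 𝓘(ℝ, E) r y : Model →L[ℝ] E) =
      (fderiv ℝ (fun a => r ((chartAt Model x₀).symm a)) (chartAt Model x₀ y)).comp
        (fderiv ℝ (chartChange y x₀) (chartAt Model y y)) := by
  have hyy := mem_chart_source Model y
  have hκ : chartChange y x₀ (chartAt Model y y) = chartAt Model x₀ y := by
    simp only [chartChange, (chartAt Model y).left_inv hyy]
  have d1 := ((contDiffAt_chartChange_real hyy hy).differentiableAt (by simp)).hasFDerivAt
  have d2 := hr.hasFDerivAt
  rw [← hκ] at d2
  have he : (fun a => r ((chartAt Model y).symm a)) =ᶠ[𝓝 (chartAt Model y y)]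
      (fun a => r ((chartAt Model x₀).symm a)) ∘ chartChange y x₀ := by
    filter_upwards [eventually_chart hyy ((chartAt Model x₀).open_source.mem_nhds hy)]
      with a ⟨ha1, ha2⟩
    simp only [chartChange, Function.comp_apply]
    rw [(chartAt Model x₀).left_inv ha1]
  have d3 := (d2.comp _ d1).congr_of_eventuallyEq he
  have hcont : ContinuousAt r y := by
    have h1 := hr.continuousAt.comp ((chartAt Model x₀).continuousAt hy)
    refine h1.congr ?_
    filter_upwards [(chartAt Model x₀).open_source.mem_nhds hy] with z hz
    simp only [Function.comp_apply, (chartAt Model x₀).left_inv hz]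
  have hm : HasMFDerivAt 𝓘(ℝ, Model) 𝓘(ℝ, E) r y
      ((fderiv ℝ (fun a => r ((chartAt Model x₀).symm a)) (chartChange y x₀ (chartAt Model y y))).comp
        (fderiv ℝ (chartChange y x₀) (chartAt Model y y))) := by
    refine ⟨hcont, ?_⟩
    simp only [writtenInExtChartAt, mfld_simps]
    exact d3.hasFDerivWithinAt
  rw [hm.mfderiv, hκ]
  rfl

/-- The definition uses the preferred chart at `y`; explicit computations take place in the chart
around a nearby `x₀`. -/
lemma isSubmersionAt_iff {x₀ y : X} (hy : y ∈ (chartAt Model x₀).source) {r : X → ℂ}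
    (hr : DifferentiableAt ℝ (inChart x₀ r) (chartAt Model x₀ y)) :
    IsSubmersionAt r y ↔ Function.Surjective (fderiv ℝ (inChart x₀ r) (chartAt Model x₀ y)) := by
  have hb := fderiv_chartChange_bijective (mem_chart_source Model y) hy
  rw [IsSubmersionAt, show mfderiv 𝓘(ℝ, Model) 𝓘(ℝ, ℂ) r y = _ from mfderiv_eq_fderiv_comp hy hr]
  refine ⟨fun h => ?_, fun h => ?_⟩
  · exact Function.Surjective.of_comp (f := fderiv ℝ (inChart x₀ r) (chartAt Model x₀ y)) h
  · exact Function.Surjective.comp (g := fderiv ℝ (inChart x₀ r) (chartAt Model x₀ y)) h hb.2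

lemma isTransverseAt_iff {x₀ y : X} (hy : y ∈ (chartAt Model x₀).source) {r s : X → ℂ}
    (hr : DifferentiableAt ℝ (inChart x₀ r) (chartAt Model x₀ y))
    (hs : DifferentiableAt ℝ (inChart x₀ s) (chartAt Model x₀ y)) :
    IsTransverseAt r s y ↔ Function.Bijective
      ((fderiv ℝ (inChart x₀ r) (chartAt Model x₀ y)).prod
        (fderiv ℝ (inChart x₀ s) (chartAt Model x₀ y))) := by
  have hb := fderiv_chartChange_bijective (mem_chart_source Model y) hy
  have hd := hr.hasFDerivAt.prodMk hs.hasFDerivAt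
  have hd' : HasFDerivAt (fun a => (fun y => (r y, s y)) ((chartAt Model x₀).symm a)) _ _ := hd
  rw [IsTransverseAt, show mfderiv 𝓘(ℝ, Model) 𝓘(ℝ, ℂ × ℂ) (fun y => (r y, s y)) y = _ from
    mfderiv_eq_fderiv_comp hy hd'.differentiableAt, hd'.fderiv]
  exact hb.of_comp_iff ((fderiv ℝ (inChart x₀ r) (chartAt Model x₀ y)).prod
    (fderiv ℝ (inChart x₀ s) (chartAt Model x₀ y)))

end Differential

/-! ### Jets -/

/-- The values and the derivatives of four complex valued functions on the model space. -/
abbrev Jet := (ℂ × ℂ × ℂ × ℂ) × ((Model →L[ℝ] ℂ) × (Model →L[ℝ] ℂ) × (Model →L[ℝ] ℂ) ×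
  (Model →L[ℝ] ℂ))

namespace Jet

/-- The fibre of `Z` at a jet. -/
def fibre (j : Jet) : Set (ℂ × ℂ) := fibreSet j.1.1 j.1.2.1 j.1.2.2.1 j.1.2.2.2

/-- The derivatives of the equations of `Z` and `R` at a jet. -/
def cov (j : Jet) (u : ℂ × ℂ) : Model × (ℂ × ℂ) →L[ℝ] ℂ × ℂ :=
  derCov u.1 u.2 j.1.2.2.1 j.1.2.2.2 j.2.1 j.2.2.1 j.2.2.2.1 j.2.2.2.2
def ram (j : Jet) (u : ℂ × ℂ) : Model × (ℂ × ℂ) →L[ℝ] (ℂ × ℂ) × ℂ :=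
  derRam u.1 u.2 j.1.2.2.1 j.1.2.2.2 j.2.1 j.2.2.1 j.2.2.2.1 j.2.2.2.2

lemma isClosed_fibre : IsClosed {p : Jet × (ℂ × ℂ) | p.2 ∈ p.1.fibre} := by
  have : {p : Jet × (ℂ × ℂ) | p.2 ∈ p.1.fibre} =
      {p | p.2.1 ^ 2 = p.1.1.1 + p.2.2 * p.1.1.2.2.1} ∩
        {p | p.2.2 ^ 2 = p.1.1.2.1 + p.2.1 * p.1.1.2.2.2} := rfl
  rw [this]
  exact (isClosed_eq (by fun_prop) (by fun_prop)).inter (isClosed_eq (by fun_prop) (by fun_prop))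

lemma isClosed_ram : IsClosed {p : Jet × (ℂ × ℂ) | 4 * p.2.1 * p.2.2 = p.1.1.2.2.1 * p.1.1.2.2.2} :=
  isClosed_eq (by fun_prop) (by fun_prop)

lemma continuous_comp {Y : Type*} [TopologicalSpace Y] {s : Y → Model →L[ℝ] ℂ}
    (hs : Continuous s) : Continuous fun y => (s y).comp dBase :=
  hs.clm_comp continuous_const

lemma continuous_cov : Continuous fun p : Jet × (ℂ × ℂ) => p.1.cov p.2 := by
  unfold cov derCov derZ derW
  have h1 := continuous_comp (Y := Jet × (ℂ × ℂ)) (s := fun p => p.1.2.1) (by fun_prop)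
  have h2 := continuous_comp (Y := Jet × (ℂ × ℂ)) (s := fun p => p.1.2.2.1) (by fun_prop)
  have h3 := continuous_comp (Y := Jet × (ℂ × ℂ)) (s := fun p => p.1.2.2.2.1) (by fun_prop)
  have h4 := continuous_comp (Y := Jet × (ℂ × ℂ)) (s := fun p => p.1.2.2.2.2) (by fun_prop)
  refine (ContinuousLinearMap.prodₗᵢ ℝ).continuous.comp (Continuous.prodMk ?_ ?_)
  · fun_prop
  · fun_prop

lemma continuous_ram : Continuous fun p : Jet × (ℂ × ℂ) => p.1.ram p.2 := by
  have h1 : Continuous fun p : Jet × (ℂ × ℂ) =>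
      derR p.2.1 p.2.2 p.1.1.2.2.1 p.1.1.2.2.2 p.1.2.2.2.1 p.1.2.2.2.2 := by
    unfold derR
    have h3 := continuous_comp (Y := Jet × (ℂ × ℂ)) (s := fun p => p.1.2.2.2.1) (by fun_prop)
    have h4 := continuous_comp (Y := Jet × (ℂ × ℂ)) (s := fun p => p.1.2.2.2.2) (by fun_prop)
    fun_prop
  exact (ContinuousLinearMap.prodₗᵢ ℝ).continuous.comp (continuous_cov.prodMk h1)

/-- A property of the points of the fibre which is open holds over a neighbourhood. -/
lemma eventually_fibre {j₀ : Jet} {p : Jet → ℂ × ℂ → Prop}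
    (h : ∀ u ∈ j₀.fibre, ∀ᶠ q : Jet × (ℂ × ℂ) in 𝓝 (j₀, u), p q.1 q.2) :
    ∀ᶠ j in 𝓝 j₀, ∀ u ∈ j.fibre, p j u := by
  -- Jets near `j₀` have coefficients bounded by `‖j₀.1‖ + 1`, so their fibres lie in one ball of
  -- radius `‖j₀.1‖ + 2`. On this compact ball the tube lemma applies, the incidence relation with
  -- the fibre being closed.
  have hK := (isCompact_closedBall (0 : ℂ × ℂ) (‖j₀.1‖ + 1 + 1)).eventually_forall_of_forall_eventually
    (x₀ := j₀) (P := fun j u => u ∈ j.fibre → p j u) fun u _ => by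
      by_cases hu : u ∈ j₀.fibre
      · filter_upwards [h u hu] with q hq _ using hq
      · filter_upwards [isClosed_fibre.isOpen_compl.mem_nhds (x := (j₀, u)) hu] with q hq hqk
        exact absurd hqk hq
  have hb : ∀ᶠ j in 𝓝 j₀, ‖j.1‖ < ‖j₀.1‖ + 1 :=
    (continuous_fst.norm.continuousAt).eventually_lt_const (lt_add_one _)
  filter_upwards [hK, hb] with j hj hjb u hu
  refine hj u ?_ hu
  rw [mem_closedBall_zero_iff]
  exact norm_le_of_mem_fibreSet ((norm_fst_le j.1).trans hjb.le)
    (((norm_fst_le j.1.2).trans (norm_snd_le j.1)).trans hjb.le)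
    ((((norm_fst_le j.1.2.2).trans (norm_snd_le j.1.2)).trans (norm_snd_le j.1)).trans hjb.le)
    ((((norm_snd_le j.1.2.2).trans (norm_snd_le j.1.2)).trans (norm_snd_le j.1)).trans hjb.le) hu

lemma eventually_cov {j₀ : Jet} (h : ∀ u ∈ j₀.fibre, Function.Surjective (j₀.cov u)) :
    ∀ᶠ j in 𝓝 j₀, ∀ u ∈ j.fibre, Function.Surjective (j.cov u) :=
  eventually_fibre fun u hu => (continuous_cov.continuousAt (x := (j₀, u))).eventually
    (isOpen_setOf_surjective.mem_nhds (h u hu))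

lemma eventually_ram {j₀ : Jet} (h : ∀ u ∈ j₀.fibre, 4 * u.1 * u.2 = j₀.1.2.2.1 * j₀.1.2.2.2 →
      Function.Surjective (j₀.ram u)) :
    ∀ᶠ j in 𝓝 j₀, ∀ u ∈ j.fibre, 4 * u.1 * u.2 = j.1.2.2.1 * j.1.2.2.2 →
      Function.Surjective (j.ram u) := by
  refine eventually_fibre fun u hu => ?_
  by_cases hr : 4 * u.1 * u.2 = j₀.1.2.2.1 * j₀.1.2.2.2
  · filter_upwards [(continuous_ram.continuousAt (x := (j₀, u))).eventually
      (isOpen_setOf_surjective.mem_nhds (h u hu hr))] with q hq _ using hq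
  · filter_upwards [isClosed_ram.isOpen_compl.mem_nhds (x := (j₀, u)) hr] with q hq hqk
    exact absurd hqk hq

/-- Regularity of the unperturbed cover. -/
lemma cov_surjective {f g : ℂ} {F G : Model →L[ℝ] ℂ} (hF : f = 0 → Function.Surjective F)
    (hG : g = 0 → Function.Surjective G)
    (hFG : f = 0 → g = 0 → Function.Surjective (F.prod G)) {u : ℂ × ℂ}
    (hu : u ∈ fibre ((f, g, 0, 0), (F, G, 0, 0))) :
    Function.Surjective (cov ((f, g, 0, 0), (F, G, 0, 0)) u) := by
  obtain ⟨z, w⟩ := u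
  have h1 : z ^ 2 = f := by simpa [fibre, fibreSet] using hu.1
  have h2 : w ^ 2 = g := by simpa [fibre, fibreSet] using hu.2
  have key : ∀ x a b, cov ((f, g, 0, 0), (F, G, 0, 0)) (z, w) (x, a, b) =
      (2 * z * a - F x, 2 * w * b - G x) := by
    intro x a b; simp [cov, derCov, derZ, derW]
  rintro ⟨α, β⟩
  by_cases hz : z = 0
  · by_cases hw : w = 0
    · obtain ⟨x, hx⟩ := hFG (by simp [← h1, hz]) (by simp [← h2, hw]) (-α, -β)
      refine ⟨(x, 0, 0), ?_⟩
      have hx1 : F x = -α := congrArg Prod.fst hx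
      have hx2 : G x = -β := congrArg Prod.snd hx
      rw [key]; simp [hx1, hx2]
    · obtain ⟨x, hx⟩ := hF (by simp [← h1, hz]) (-α)
      refine ⟨(x, 0, (β + G x) / (2 * w)), ?_⟩
      rw [key, hx]; ext <;> simp; field_simp; ring
  · by_cases hw : w = 0
    · obtain ⟨x, hx⟩ := hG (by simp [← h2, hw]) (-β)
      refine ⟨(x, (α + F x) / (2 * z), 0), ?_⟩
      rw [key, hx]; ext <;> simp; field_simp; ring
    · refine ⟨(0, α / (2 * z), β / (2 * w)), ?_⟩
      rw [key]; ext <;> simp <;> field_simp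

/-- On the unperturbed `R` one of `z`, `w` vanishes. If `z = 0`, then `w ≠ 0` off `M`: the first
equation is solved by `dF`, the second by `b` and the third by `a`. At a point of `M` the
differential of `4zw` is zero, which is why those points need a separate analysis. -/
lemma ram_surjective {f g : ℂ} {F G : Model →L[ℝ] ℂ} (hF : f = 0 → Function.Surjective F)
    (hG : g = 0 → Function.Surjective G)
    (hFG : ¬ (f = 0 ∧ g = 0)) {u : ℂ × ℂ}
    (hu : u ∈ fibre ((f, g, 0, 0), (F, G, 0, 0))) (hr : 4 * u.1 * u.2 = 0) :
    Function.Surjective (ram ((f, g, 0, 0), (F, G, 0, 0)) u) := by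
  obtain ⟨z, w⟩ := u
  have h1 : z ^ 2 = f := by simpa [fibre, fibreSet] using hu.1
  have h2 : w ^ 2 = g := by simpa [fibre, fibreSet] using hu.2
  have key : ∀ x a b, ram ((f, g, 0, 0), (F, G, 0, 0)) (z, w) (x, a, b) =
      ((2 * z * a - F x, 2 * w * b - G x), 4 * z * b + 4 * w * a) := by
    intro x a b; simp [ram, derRam, derCov, derZ, derW, derR]
  have hzw : z = 0 ∨ w = 0 := by simpa using hr
  rintro ⟨⟨α, β⟩, γ⟩
  rcases hzw with hz | hw
  · have hf : f = 0 := by simp [← h1, hz]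
    have hw : w ≠ 0 := fun hw => hFG ⟨hf, by simp [← h2, hw]⟩
    obtain ⟨x, hx⟩ := hF hf (-α)
    refine ⟨(x, γ / (4 * w), (β + G x) / (2 * w)), ?_⟩
    rw [key, hx]; ext <;> simp [hz] <;> field_simp; ring
  · have hg : g = 0 := by simp [← h2, hw]
    have hz : z ≠ 0 := fun hz => hFG ⟨by simp [← h1, hz], hg⟩
    obtain ⟨x, hx⟩ := hG hg (-β)
    refine ⟨(x, (α + F x) / (2 * z), γ / (4 * z)), ?_⟩
    rw [key, hx]; ext <;> simp [hw] <;> field_simp; ring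

end Jet

section Cover

variable {X : Type*} [TopologicalSpace X] [T2Space X] [ChartedSpace Model X]
  [IsManifold 𝓘(ℂ, Model) ω X]
  {L₁ : X → Type*} [∀ x, AddCommGroup (L₁ x)] [∀ x, Module ℂ (L₁ x)]
  {L₂ : X → Type*} [∀ x, AddCommGroup (L₂ x)] [∀ x, Module ℂ (L₂ x)]
  [∀ x, TopologicalSpace (L₁ x)] [TopologicalSpace (TotalSpace ℂ L₁)] [FiberBundle ℂ L₁]
  [VectorBundle ℂ ℂ L₁]
  [∀ x, TopologicalSpace (L₂ x)] [TopologicalSpace (TotalSpace ℂ L₂)] [FiberBundle ℂ L₂]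
  [VectorBundle ℂ ℂ L₂]

/-! ### Small perturbations -/

/-- A pair of smooth sections together with bounds of their `C¹` norms. -/
structure Perturbation (𝒦 : C1Cover L₁ L₂) where
  Φ : ∀ x, L₂ x →ₗ[ℂ] L₁ x ⊗[ℂ] L₁ x
  Ψ : ∀ x, L₁ x →ₗ[ℂ] L₂ x ⊗[ℂ] L₂ x
  N : ℝ
  N' : ℝ
  smooth_left : IsSmoothSection Φ
  smooth_right : IsSmoothSection Ψ
  norm_left : 𝒦.NormLE (homRep Φ) N
  norm_right : 𝒦.NormLE (homRep Ψ) N'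

namespace Perturbation

variable {𝒦 : C1Cover L₁ L₂}

/-- The size of a perturbation. -/
def size (t : Perturbation 𝒦) : ℝ := max (max t.N t.N') 0

variable (𝒦) in
/-- The filter of small perturbations. -/
def small : Filter (Perturbation 𝒦) := Filter.comap size (𝓝 0)

lemma exists_of_eventually {p : Perturbation 𝒦 → Prop} (h : ∀ᶠ t in small 𝒦, p t) :
    ∃ ε : ℝ, 0 < ε ∧ ∀ t : Perturbation 𝒦, t.N < ε → t.N' < ε → p t := by
  rw [small, Filter.eventually_comap] at h
  obtain ⟨ε, hε, hp⟩ := Metric.eventually_nhds_iff.1 h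
  refine ⟨ε, hε, fun t h1 h2 => hp ?_ t rfl⟩
  -- The `0` in the maximum makes the size nonnegative, so that its distance to `0` is the size
  -- itself.
  have h0 : 0 ≤ t.size := le_max_right _ _
  rw [Real.dist_eq, sub_zero, abs_of_nonneg h0, size]
  exact max_lt (max_lt h1 h2) hε

lemma tendsto_size : Filter.Tendsto size (small 𝒦) (𝓝 0) := Filter.tendsto_comap

/-- Compactness of `X` makes the smallness of the perturbation uniform in the point. -/
lemma eventually_forall [CompactSpace X] {p : X → Perturbation 𝒦 → Prop}
    (h : ∀ x₀, ∀ᶠ q in small 𝒦 ×ˢ 𝓝 x₀, p q.2 q.1) : ∀ᶠ t in small 𝒦, ∀ y, p y t := by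
  have := (isCompact_univ (X := X)).mem_prod_nhdsSet_of_forall (l := small 𝒦)
    (s := {q | p q.2 q.1}) fun y _ => h y
  rw [nhdsSet_univ, Filter.mem_prod_top] at this
  exact this

end Perturbation

section Cocycle

variable [ContMDiffVectorBundle ω ℂ L₁ 𝓘(ℂ, Model)] [ContMDiffVectorBundle ω ℂ L₂ 𝓘(ℂ, Model)]

variable (L₁ L₂) in
lemma isCocycle_left : IsCocycle L₁ L₂
    (fun x₀ x₁ y => transition L₁ x₀ x₁ y ^ 2 * transition L₂ x₁ x₀ y) where
  smooth x₀ x₁ := by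
    have h1 := (contMDiffOn_transition (L := L₁) x₀ x₁).mono (show
      ((baseSetAt L₁ x₀ ∩ baseSetAt L₂ x₀) ∩ (baseSetAt L₁ x₁ ∩ baseSetAt L₂ x₁)) ⊆ _ from
      fun y hy => ⟨hy.1.1, hy.2.1⟩)
    have h2 := (contMDiffOn_transition (L := L₂) x₁ x₀).mono (show
      ((baseSetAt L₁ x₀ ∩ baseSetAt L₂ x₀) ∩ (baseSetAt L₁ x₁ ∩ baseSetAt L₂ x₁)) ⊆ _ from
      fun y hy => ⟨hy.2.2, hy.1.2⟩)
    simp only [pow_two]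
    exact (h1.mul h1).mul h2
  ne_zero x₀ x₁ y hy := mul_ne_zero (pow_ne_zero _ (transition_ne_zero hy.1.1 hy.2.1))
    (transition_ne_zero hy.2.2 hy.1.2)

variable (L₁ L₂) in
lemma isCocycle_right : IsCocycle L₁ L₂
    (fun x₀ x₁ y => transition L₂ x₀ x₁ y ^ 2 * transition L₁ x₁ x₀ y) where
  smooth x₀ x₁ := by
    have h1 := (contMDiffOn_transition (L := L₂) x₀ x₁).mono (show
      ((baseSetAt L₁ x₀ ∩ baseSetAt L₂ x₀) ∩ (baseSetAt L₁ x₁ ∩ baseSetAt L₂ x₁)) ⊆ _ from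
      fun y hy => ⟨hy.1.2, hy.2.2⟩)
    have h2 := (contMDiffOn_transition (L := L₁) x₁ x₀).mono (show
      ((baseSetAt L₁ x₀ ∩ baseSetAt L₂ x₀) ∩ (baseSetAt L₁ x₁ ∩ baseSetAt L₂ x₁)) ⊆ _ from
      fun y hy => ⟨hy.2.1, hy.1.1⟩)
    simp only [pow_two]
    exact (h1.mul h1).mul h2
  ne_zero x₀ x₁ y hy := mul_ne_zero (pow_ne_zero _ (transition_ne_zero hy.1.2 hy.2.2))
    (transition_ne_zero hy.2.1 hy.1.1)

lemma isSectionRep_left {Φ : ∀ x, L₂ x →ₗ[ℂ] L₁ x ⊗[ℂ] L₁ x} (hΦ : IsSmoothSection Φ) :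
    IsSectionRep L₁ L₂ (fun x₀ x₁ y => transition L₁ x₀ x₁ y ^ 2 * transition L₂ x₁ x₀ y)
      (homRep Φ) where
  smooth := hΦ
  change _ _ _ hy := homRep_eq_transition_mul Φ hy.2.1 hy.2.2

lemma isSectionRep_right {Ψ : ∀ x, L₁ x →ₗ[ℂ] L₂ x ⊗[ℂ] L₂ x} (hΨ : IsSmoothSection Ψ) :
    IsSectionRep L₁ L₂ (fun x₀ x₁ y => transition L₂ x₀ x₁ y ^ 2 * transition L₁ x₁ x₀ y)
      (homRep Ψ) where
  smooth x₀ := (hΨ x₀).mono (inter_comm _ _).subset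
  change _ _ _ hy := homRep_eq_transition_mul Ψ hy.2.2 hy.2.1

namespace Perturbation

variable {𝒦 : C1Cover L₁ L₂}

variable (𝒦) in
lemma exists_bounds (x₀ : X) : ∃ C : ℝ, 0 < C ∧ ∀ᶠ a in 𝓝 (chartAt Model x₀ x₀),
    ∀ t : Perturbation 𝒦, 0 ≤ t.N ∧ 0 ≤ t.N' ∧
      ‖locHom t.Φ x₀ a‖ ≤ C * t.N ∧ ‖fderiv ℝ (locHom t.Φ x₀) a‖ ≤ C * t.N ∧
      ‖locHom t.Ψ x₀ a‖ ≤ C * t.N' ∧ ‖fderiv ℝ (locHom t.Ψ x₀) a‖ ≤ C * t.N' := by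
  obtain ⟨C, hC, h1⟩ := exists_norm_bound 𝒦 (isCocycle_left L₁ L₂) x₀
  obtain ⟨C', hC', h2⟩ := exists_norm_bound 𝒦 (isCocycle_right L₁ L₂) x₀
  refine ⟨max C C', lt_max_of_lt_left hC, ?_⟩
  filter_upwards [h1, h2] with a ha1 ha2 t
  obtain ⟨k1, k2, k3⟩ := ha1 _ t.N (isSectionRep_left t.smooth_left) t.norm_left
  obtain ⟨k4, k5, k6⟩ := ha2 _ t.N' (isSectionRep_right t.smooth_right) t.norm_right
  have e1 : C ≤ max C C' := le_max_left _ _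
  have e2 : C' ≤ max C C' := le_max_right _ _
  exact ⟨k1, k4, k2.trans (by gcongr), k3.trans (by gcongr), k5.trans (by gcongr),
    k6.trans (by gcongr)⟩

/-- A lower bound of the absolute value at a point, in the coordinates around this point. -/
lemma exists_lower_bound_left (S : Set X) {c : ℝ} (hc : 0 < c) {x₀ : X} (hx₀ : x₀ ∈ S) :
    ∃ c' : ℝ, 0 < c' ∧ ∀ t : Perturbation 𝒦, 𝒦.AbsGE (homRep t.Φ) S (c * t.N) →
      c' * t.N ≤ ‖homRep t.Φ x₀ x₀‖ := by
  have hmem : x₀ ∈ ⋃ j, 𝒦.K j := by rw [𝒦.iUnion_K]; trivial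
  obtain ⟨j, hj⟩ := mem_iUnion.1 hmem
  have h0 : x₀ ∈ coordDomain L₁ L₂ x₀ := mem_coordDomain x₀
  have h1 : x₀ ∈ coordDomain L₁ L₂ (𝒦.pt j) := 𝒦.K_subset j hj
  have hne := (isCocycle_left L₁ L₂).ne_zero x₀ (𝒦.pt j) x₀ ⟨h0.2, h1.2⟩
  refine ⟨‖transition L₁ x₀ (𝒦.pt j) x₀ ^ 2 * transition L₂ (𝒦.pt j) x₀ x₀‖ * c,
    mul_pos (norm_pos_iff.2 hne) hc, fun t ht => ?_⟩
  rw [homRep_eq_transition_mul t.Φ (x₁ := 𝒦.pt j) h1.2.1 h1.2.2,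
    norm_mul _ (homRep t.Φ _ _)]
  refine (mul_assoc _ _ _).trans_le (mul_le_mul_of_nonneg_left (ht j x₀ ⟨hj, hx₀⟩) (norm_nonneg _))

lemma exists_lower_bound_right (S : Set X) {c : ℝ} (hc : 0 < c) {x₀ : X} (hx₀ : x₀ ∈ S) :
    ∃ c' : ℝ, 0 < c' ∧ ∀ t : Perturbation 𝒦, 𝒦.AbsGE (homRep t.Ψ) S (c * t.N') →
      c' * t.N' ≤ ‖homRep t.Ψ x₀ x₀‖ := by
  have hmem : x₀ ∈ ⋃ j, 𝒦.K j := by rw [𝒦.iUnion_K]; trivial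
  obtain ⟨j, hj⟩ := mem_iUnion.1 hmem
  have h0 : x₀ ∈ coordDomain L₁ L₂ x₀ := mem_coordDomain x₀
  have h1 : x₀ ∈ coordDomain L₁ L₂ (𝒦.pt j) := 𝒦.K_subset j hj
  have hne := (isCocycle_right L₁ L₂).ne_zero x₀ (𝒦.pt j) x₀ ⟨h0.2, h1.2⟩
  refine ⟨‖transition L₂ x₀ (𝒦.pt j) x₀ ^ 2 * transition L₁ (𝒦.pt j) x₀ x₀‖ * c,
    mul_pos (norm_pos_iff.2 hne) hc, fun t ht => ?_⟩
  rw [homRep_eq_transition_mul t.Ψ (x₁ := 𝒦.pt j) h1.2.2 h1.2.1,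
    norm_mul _ (homRep t.Ψ _ _)]
  refine (mul_assoc _ _ _).trans_le (mul_le_mul_of_nonneg_left (ht j x₀ ⟨hj, hx₀⟩) (norm_nonneg _))

/-- The jet of the data of a perturbed cover, in the coordinates around `x₀`. -/
def jet (f : ∀ x, L₁ x ⊗[ℂ] L₁ x) (g : ∀ x, L₂ x ⊗[ℂ] L₂ x) (t : Perturbation 𝒦) (x₀ : X)
    (a : Model) : Jet :=
  ((locSq f x₀ a, locSq g x₀ a, locHom t.Φ x₀ a, locHom t.Ψ x₀ a),
    (fderiv ℝ (locSq f x₀) a, fderiv ℝ (locSq g x₀) a, fderiv ℝ (locHom t.Φ x₀) a,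
      fderiv ℝ (locHom t.Ψ x₀) a))

variable {f : ∀ x, L₁ x ⊗[ℂ] L₁ x} {g : ∀ x, L₂ x ⊗[ℂ] L₂ x}

lemma tendsto_of_norm_le {E : Type*} [NormedAddCommGroup E] {x₀ : X} {C : ℝ}
    {r : Perturbation 𝒦 → Model → E} (h : ∀ᶠ a in 𝓝 (chartAt Model x₀ x₀), ∀ t : Perturbation 𝒦,
      ‖r t a‖ ≤ C * t.size) :
    Filter.Tendsto (fun q : Perturbation 𝒦 × Model => r q.1 q.2)
      (small 𝒦 ×ˢ 𝓝 (chartAt Model x₀ x₀)) (𝓝 0) := by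
  refine squeeze_zero_norm' (a := fun q : Perturbation 𝒦 × Model => C * q.1.size) ?_ ?_
  · filter_upwards [Filter.Eventually.prod_inr h (small 𝒦)] with q hq using hq q.1
  · have := (tendsto_size (𝒦 := 𝒦)).const_mul C
    rw [mul_zero] at this
    exact this.comp Filter.tendsto_fst

/-- The jets of the data tend to the unperturbed jet at `x₀` as the perturbation shrinks and the
point approaches `x₀`. Every open condition on 1-jets satisfied in the limit is thus inherited
nearby. -/
lemma tendsto_jet (hf : IsHolomorphicSection f) (hg : IsHolomorphicSection g) (x₀ : X) :
    Filter.Tendsto (fun q : Perturbation 𝒦 × Model => jet f g q.1 x₀ q.2)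
      (small 𝒦 ×ˢ 𝓝 (chartAt Model x₀ x₀))
      (𝓝 ((sqRep f x₀ x₀, sqRep g x₀ x₀, 0, 0), (fderiv ℝ (locSq f x₀) (chartAt Model x₀ x₀),
        fderiv ℝ (locSq g x₀) (chartAt Model x₀ x₀), 0, 0))) := by
  have hx : x₀ ∈ coordDomain L₁ L₂ x₀ := mem_coordDomain x₀
  have cf := contDiffAt_locSq_left (L₂ := L₂) hf hx
  have cg := contDiffAt_locSq_right (L₁ := L₁) hg hx
  obtain ⟨C, hC, hb⟩ := exists_bounds 𝒦 x₀
  have hN : ∀ t : Perturbation 𝒦, t.N ≤ t.size := fun t => (le_max_left _ _).trans (le_max_left _ _)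
  have hN' : ∀ t : Perturbation 𝒦, t.N' ≤ t.size :=
    fun t => (le_max_right _ _).trans (le_max_left _ _)
  have a1 : Filter.Tendsto (locSq f x₀) (𝓝 (chartAt Model x₀ x₀)) (𝓝 (sqRep f x₀ x₀)) := by
    rw [← inChart_apply hx.1 (sqRep f x₀)]; exact cf.continuousAt
  have a2 : Filter.Tendsto (locSq g x₀) (𝓝 (chartAt Model x₀ x₀)) (𝓝 (sqRep g x₀ x₀)) := by
    rw [← inChart_apply hx.1 (sqRep g x₀)]; exact cg.continuousAt
  have a3 : Filter.Tendsto (fderiv ℝ (locSq f x₀)) (𝓝 (chartAt Model x₀ x₀)) (𝓝 _) :=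
    (cf.fderiv_right (m := 0) (by simp)).continuousAt
  have a4 : Filter.Tendsto (fderiv ℝ (locSq g x₀)) (𝓝 (chartAt Model x₀ x₀)) (𝓝 _) :=
    (cg.fderiv_right (m := 0) (by simp)).continuousAt
  have b1 := tendsto_of_norm_le (𝒦 := 𝒦) (x₀ := x₀) (C := C) (r := fun t a => locHom t.Φ x₀ a) (by
    filter_upwards [hb] with a ha t
    exact (ha t).2.2.1.trans (mul_le_mul_of_nonneg_left (hN t) hC.le))
  have b2 := tendsto_of_norm_le (𝒦 := 𝒦) (x₀ := x₀) (C := C) (r := fun t a => locHom t.Ψ x₀ a) (by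
    filter_upwards [hb] with a ha t
    exact (ha t).2.2.2.2.1.trans (mul_le_mul_of_nonneg_left (hN' t) hC.le))
  have b3 := tendsto_of_norm_le (𝒦 := 𝒦) (x₀ := x₀) (C := C)
    (r := fun t a => fderiv ℝ (locHom t.Φ x₀) a) (by
    filter_upwards [hb] with a ha t
    exact (ha t).2.2.2.1.trans (mul_le_mul_of_nonneg_left (hN t) hC.le))
  have b4 := tendsto_of_norm_le (𝒦 := 𝒦) (x₀ := x₀) (C := C)
    (r := fun t a => fderiv ℝ (locHom t.Ψ x₀) a) (by
    filter_upwards [hb] with a ha t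
    exact (ha t).2.2.2.2.2.trans (mul_le_mul_of_nonneg_left (hN' t) hC.le))
  exact ((a1.comp Filter.tendsto_snd).prodMk_nhds ((a2.comp Filter.tendsto_snd).prodMk_nhds
    (b1.prodMk_nhds b2))).prodMk_nhds ((a3.comp Filter.tendsto_snd).prodMk_nhds
    ((a4.comp Filter.tendsto_snd).prodMk_nhds (b3.prodMk_nhds b4)))

/-- A statement about points near `x₀` can be proved in the chart around `x₀`. -/
lemma eventually_of_chart {x₀ : X} {p : X → Perturbation 𝒦 → Prop}
    (h : ∀ᶠ q : Perturbation 𝒦 × Model in small 𝒦 ×ˢ 𝓝 (chartAt Model x₀ x₀),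
      ∀ y ∈ coordDomain L₁ L₂ x₀, chartAt Model x₀ y = q.2 → p y q.1) :
    ∀ᶠ q in small 𝒦 ×ˢ 𝓝 x₀, p q.2 q.1 := by
  have hx : x₀ ∈ coordDomain L₁ L₂ x₀ := mem_coordDomain x₀
  have hc := (chartAt Model x₀).continuousAt hx.1
  have ht : Filter.Tendsto (fun q : Perturbation 𝒦 × X => (q.1, chartAt Model x₀ q.2))
      (small 𝒦 ×ˢ 𝓝 x₀) (small 𝒦 ×ˢ 𝓝 (chartAt Model x₀ x₀)) :=
    Filter.tendsto_fst.prodMk (hc.tendsto.comp Filter.tendsto_snd)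
  filter_upwards [ht.eventually h, Filter.Eventually.prod_inr
    ((isOpen_coordDomain (L₁ := L₁) (L₂ := L₂) x₀).mem_nhds hx) (small 𝒦)] with q h1 h2
  exact h1 q.2 h2 rfl

lemma isSmoothData (t : Perturbation 𝒦) (hf : IsHolomorphicSection f)
    (hg : IsHolomorphicSection g) : IsSmoothData f g t.Φ t.Ψ :=
  ⟨hf, hg, t.smooth_left, t.smooth_right⟩

lemma regularZ_of_jet (t : Perturbation 𝒦) (hf : IsHolomorphicSection f)
    (hg : IsHolomorphicSection g) {x₀ y : X} (hy : y ∈ coordDomain L₁ L₂ x₀)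
    (h : ∀ u ∈ (t.jet f g x₀ (chartAt Model x₀ y)).fibre,
      Function.Surjective ((t.jet f g x₀ (chartAt Model x₀ y)).cov u)) :
    RegularZ f g t.Φ t.Ψ x₀ y := by
  intro u hu
  rw [((t.isSmoothData hf hg).hasFDerivAt_locCov hy u).fderiv]
  rw [covEq_eq_zero_iff] at hu
  have := h u hu
  simpa only [Jet.cov, jet, locHom, inChart_apply hy.1] using this

lemma regularR_of_jet (t : Perturbation 𝒦) (hf : IsHolomorphicSection f)
    (hg : IsHolomorphicSection g) {x₀ y : X} (hy : y ∈ coordDomain L₁ L₂ x₀)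
    (h : ∀ u ∈ (t.jet f g x₀ (chartAt Model x₀ y)).fibre,
      4 * u.1 * u.2 = locHom t.Φ x₀ (chartAt Model x₀ y) * locHom t.Ψ x₀ (chartAt Model x₀ y) →
      Function.Surjective ((t.jet f g x₀ (chartAt Model x₀ y)).ram u)) :
    RegularR f g t.Φ t.Ψ x₀ y := by
  intro u hu
  rw [((t.isSmoothData hf hg).hasFDerivAt_locRam hy u).fderiv]
  rw [ramEq_eq_zero_iff] at hu
  have := h u hu.1 hu.2
  simpa only [Jet.ram, jet, locHom, inChart_apply hy.1] using this

lemma surjective_fderiv (hf : IsHolomorphicSection f) (hfs : IsSmoothDivisor f) (x₀ : X)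
    (h : sqRep f x₀ x₀ = 0) :
    Function.Surjective (fderiv ℝ (locSq f x₀) (chartAt Model x₀ x₀)) := by
  have h0 : f x₀ = 0 := (sqRep_eq_zero_iff f (mem_baseSet_trivializationAt ℂ L₁ x₀)).1 h
  have hd := contDiffAt_inChart_of_complex (mem_chart_source Model x₀)
    (trivializationAt ℂ L₁ x₀).open_baseSet (mem_baseSet_trivializationAt ℂ L₁ x₀) (hf x₀)
  exact (isSubmersionAt_iff (mem_chart_source Model x₀) (hd.differentiableAt (by simp))).1
    (hfs x₀ h0)

lemma bijective_fderiv (hf : IsHolomorphicSection f) (hg : IsHolomorphicSection g)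
    (hfg : ∀ x, f x = 0 → g x = 0 → IsTransverseAt (sqRep f x) (sqRep g x) x) (x₀ : X)
    (h : sqRep f x₀ x₀ = 0) (h' : sqRep g x₀ x₀ = 0) :
    Function.Bijective ((fderiv ℝ (locSq f x₀) (chartAt Model x₀ x₀)).prod
      (fderiv ℝ (locSq g x₀) (chartAt Model x₀ x₀))) := by
  have hx : x₀ ∈ coordDomain L₁ L₂ x₀ := mem_coordDomain x₀
  exact (isTransverseAt_iff hx.1 ((contDiffAt_locSq_left hf hx).differentiableAt (by simp))
    ((contDiffAt_locSq_right hg hx).differentiableAt (by simp))).1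
    (hfg x₀ ((sqRep_eq_zero_iff f hx.2.1).1 h) ((sqRep_eq_zero_iff g hx.2.2).1 h'))

-- At a point of the unperturbed cover, each equation is either solved vertically (`z ≠ 0` or `w ≠
-- 0`) or by the differential of `f` or `g`. Openness on jets and compactness do the rest.
variable (𝒦) in
theorem eventually_regularZ [CompactSpace X] (hf : IsHolomorphicSection f)
    (hg : IsHolomorphicSection g)
    (hfs : IsSmoothDivisor f) (hgs : IsSmoothDivisor g)
    (hfg : ∀ x, f x = 0 → g x = 0 → IsTransverseAt (sqRep f x) (sqRep g x) x) :
    ∀ᶠ t in small 𝒦, ∀ y, RegularZ f g t.Φ t.Ψ y y := by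
  refine eventually_forall fun x₀ =>
    eventually_of_chart (p := fun y t => RegularZ f g t.Φ t.Ψ y y) ?_
  have h := Jet.eventually_cov (j₀ := ((sqRep f x₀ x₀, sqRep g x₀ x₀, 0, 0),
      (fderiv ℝ (locSq f x₀) (chartAt Model x₀ x₀),
        fderiv ℝ (locSq g x₀) (chartAt Model x₀ x₀), 0, 0))) fun u hu =>
    Jet.cov_surjective (surjective_fderiv hf hfs x₀)
      (surjective_fderiv hg hgs x₀)
      (fun h h' => (bijective_fderiv hf hg hfg x₀ h h').2) hu
  filter_upwards [(tendsto_jet (𝒦 := 𝒦) hf hg x₀).eventually h] with q hq y hy hyq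
  have := q.1.regularZ_of_jet hf hg hy (by rw [hyq]; exact hq)
  exact this.change (q.1.isSmoothData hf hg) (mem_coordDomain y) hy

lemma eventually_regularR_of_ne (hf : IsHolomorphicSection f)
    (hg : IsHolomorphicSection g)
    (hfs : IsSmoothDivisor f) (hgs : IsSmoothDivisor g) {x₀ : X} (hx₀ : ¬ (f x₀ = 0 ∧ g x₀ = 0)) :
    ∀ᶠ q in small 𝒦 ×ˢ 𝓝 x₀, RegularR f g q.1.Φ q.1.Ψ q.2 q.2 := by
  refine eventually_of_chart (p := fun y t => RegularR f g t.Φ t.Ψ y y) ?_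
  have hx : x₀ ∈ coordDomain L₁ L₂ x₀ := mem_coordDomain x₀
  have h := Jet.eventually_ram (j₀ := ((sqRep f x₀ x₀, sqRep g x₀ x₀, 0, 0),
      (fderiv ℝ (locSq f x₀) (chartAt Model x₀ x₀),
        fderiv ℝ (locSq g x₀) (chartAt Model x₀ x₀), 0, 0))) fun u hu hur =>
    Jet.ram_surjective (surjective_fderiv hf hfs x₀)
      (surjective_fderiv hg hgs x₀)
      (by rwa [sqRep_eq_zero_iff f hx.2.1, sqRep_eq_zero_iff g hx.2.2]) hu (by simpa using hur)
  filter_upwards [(tendsto_jet (𝒦 := 𝒦) hf hg x₀).eventually h] with q hq y hy hyq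
  have := q.1.regularR_of_jet hf hg hy (by rw [hyq]; exact hq)
  exact this.change (q.1.isSmoothData hf hg) (mem_coordDomain y) hy

end Perturbation

end Cocycle

end Cover

/-! ### The discriminant -/

lemma fibreDisc_swap (f g φ ψ : ℂ) : fibreDisc f g φ ψ = fibreDisc g f ψ φ := by
  unfold fibreDisc; ring

lemma hasFDerivAt_fibreDisc {F G P Q : Model → ℂ} {a : Model} {F' G' P' Q' : Model →L[ℝ] ℂ}
    (hF : HasFDerivAt F F' a) (hG : HasFDerivAt G G' a) (hP : HasFDerivAt P P' a)
    (hQ : HasFDerivAt Q Q' a) :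
    HasFDerivAt (fun a => fibreDisc (F a) (G a) (P a) (Q a))
      (discF (F a) (G a) (P a) (Q a) • F' + discF (G a) (F a) (Q a) (P a) • G' +
        discP (F a) (G a) (P a) (Q a) • P' + discP (G a) (F a) (Q a) (P a) • Q') a := by
  have hPQ := hP.mul hQ
  have h := (((((hF.pow 2).neg.mul (hG.pow 2)).sub
    (((hF.mul hG).const_mul (9 / 8)).mul (hPQ.pow 2))).add
    ((hQ.pow 2).mul (hF.pow 3))).add ((hP.pow 2).mul (hG.pow 3))).add
    ((hPQ.pow 4).const_mul (27 / 16 ^ 2))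
  refine (h.const_mul (-16)).congr_fderiv ?_
  ext v
  simp [discF, discP]
  ring

/-- The differential of the discriminant along the ramification. -/
lemma surjective_discriminant {j : Jet} {z w : ℂ} (hu : (z, w) ∈ j.fibre)
    (hram : 4 * z * w = j.1.2.2.1 * j.1.2.2.2) (hs : Function.Surjective (j.cov (z, w)))
    (h1 : ¬ (j.1.1 = 0 ∧ j.1.2.2.1 = 0)) (h2 : ¬ (j.1.2.1 = 0 ∧ j.1.2.2.2 = 0))
    (h3 : ¬ IsCuspPoint j.1.1 j.1.2.1 j.1.2.2.1 j.1.2.2.2 z w) :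
    Function.Surjective (discF j.1.1 j.1.2.1 j.1.2.2.1 j.1.2.2.2 • j.2.1 +
      discF j.1.2.1 j.1.1 j.1.2.2.2 j.1.2.2.1 • j.2.2.1 +
      discP j.1.1 j.1.2.1 j.1.2.2.1 j.1.2.2.2 • j.2.2.2.1 +
      discP j.1.2.1 j.1.1 j.1.2.2.2 j.1.2.2.1 • j.2.2.2.2) := by
  obtain ⟨⟨f, g, φ, ψ⟩, F', G', P', Q'⟩ := j
  simp only at hram h1 h2 h3 ⊢
  obtain ⟨p, q, r, s, hz, hφ, hψ, hw, hsp⟩ := exists_rank_one hram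
  obtain ⟨l, hl, e1, e2, e3, e4⟩ := disc_gradient hu.1 hu.2 hz hφ hψ hw
  -- Vanishing of `l` would make the point trivial or cuspidal, which is excluded.
  have hl0 : l ≠ 0 := by
    intro h0
    rw [h0] at hl
    rcases trivial_or_cusp hu.1 hu.2 hz hφ hψ hw (by linear_combination hl) with h | h | h
    · exact h1 h
    · exact h2 h
    · exact h3 h
  intro γ
  have hex : ∃ α β : ℂ, s * α + p * β = -(γ / l) := by
    rcases hsp with hs0 | hp0
    · exact ⟨-(γ / l) / s, 0, by field_simp; ring⟩
    · exact ⟨0, -(γ / l) / p, by field_simp; ring⟩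
  obtain ⟨α, β, hαβ⟩ := hex
  obtain ⟨⟨x, a, b⟩, hx⟩ := hs (α, β)
  have k1 : 2 * z * a - F' x - (φ * b + w * P' x) = α := by
    simpa [Jet.cov, derCov, derZ] using congrArg Prod.fst hx
  have k2 : 2 * w * b - G' x - (ψ * a + z * Q' x) = β := by
    simpa [Jet.cov, derCov, derW] using congrArg Prod.snd hx
  refine ⟨x, ?_⟩
  rw [e1, e2, e3, e4]
  simp only [add_apply, smul_apply, smul_eq_mul]
  -- The differential of the discriminant is `-l` times the combination `(s, p)` of the differential
  -- of the equations; the vertical components `a`, `b` cancel because `(s, p)` is a null vector.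
  have hγ : γ = -l * (s * α + p * β) := by rw [hαβ]; field_simp
  rw [hγ, ← k1, ← k2, hφ, hψ, hz, hw]
  ring

/-! ### Smooth square roots and the normal form of a node. -/

section Forms

variable {X : Type*} [TopologicalSpace X] [ChartedSpace Model X] [IsManifold 𝓘(ℂ, Model) ω X]

lemma zero_smul_clm (T : Model →L[ℝ] ℂ) : (0 : ℂ) • T = 0 := by ext; simp

lemma contMDiffOn_mul {r s : X → ℂ} {O : Set X} (hr : ContMDiffOn 𝓘(ℝ, Model) 𝓘(ℝ, ℂ) ∞ r O)
    (hs : ContMDiffOn 𝓘(ℝ, Model) 𝓘(ℝ, ℂ) ∞ s O) :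
    ContMDiffOn 𝓘(ℝ, Model) 𝓘(ℝ, ℂ) ∞ (fun y => r y * s y) O :=
  (show ContDiff ℝ ∞ (fun v : ℂ × ℂ => v.1 * v.2) from
    contDiff_fst.mul contDiff_snd).contMDiff.comp_contMDiffOn (hr.prodMk_space hs)

/-- At a zero of `r₁` the product rule reduces to `d(τ r₁) = τ dr₁`. The singular points of a
section are therefore independent of the trivialization. -/
lemma isSubmersionAt_mul_iff {y : X} {r₀ r₁ τ : X → ℂ} (h : ∀ᶠ z in 𝓝 y, r₀ z = τ z * r₁ z)
    (hτ : ContMDiffAt 𝓘(ℝ, Model) 𝓘(ℝ, ℂ) ∞ τ y) (hr : ContMDiffAt 𝓘(ℝ, Model) 𝓘(ℝ, ℂ) ∞ r₁ y)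
    (hτ0 : τ y ≠ 0) (hr0 : r₁ y = 0) : IsSubmersionAt r₀ y ↔ IsSubmersionAt r₁ y := by
  have hy := mem_chart_source Model y
  have hd : ∀ {r : X → ℂ}, ContMDiffAt 𝓘(ℝ, Model) 𝓘(ℝ, ℂ) ∞ r y →
      DifferentiableAt ℝ (inChart y r) (chartAt Model y y) := by
    intro r hr
    have h1 : ContMDiffAt 𝓘(ℝ, Model) 𝓘(ℝ, Model) ∞ (chartAt Model y).symm (chartAt Model y y) :=
      (contMDiffOn_chart_symm (I := 𝓘(ℝ, Model)) (n := ∞) (x := y)).contMDiffAt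
        ((chartAt Model y).open_target.mem_nhds ((chartAt Model y).map_source hy))
    have h2 : ContMDiffAt 𝓘(ℝ, Model) 𝓘(ℝ, ℂ) ∞ r ((chartAt Model y).symm (chartAt Model y y)) := by
      rwa [(chartAt Model y).left_inv hy]
    exact (h2.comp _ h1).contDiffAt.differentiableAt (by simp)
  have he : inChart y r₀ =ᶠ[𝓝 (chartAt Model y y)] inChart y τ * inChart y r₁ := by
    filter_upwards [eventually_chart hy h] with a ha using ha.1
  have hder := ((hd hτ).hasFDerivAt.mul (hd hr).hasFDerivAt).congr_of_eventuallyEq he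
  rw [isSubmersionAt_iff hy hder.differentiableAt, isSubmersionAt_iff hy (hd hr), hder.fderiv,
    inChart_apply hy, inChart_apply hy, hr0, zero_smul_clm, add_zero]
  constructor
  · intro hs v
    obtain ⟨x, hx⟩ := hs (τ y * v)
    refine ⟨x, mul_left_cancel₀ hτ0 ?_⟩
    simpa using hx
  · intro hs v
    obtain ⟨x, hx⟩ := hs (v / τ y)
    refine ⟨x, ?_⟩
    simp [hx]; field_simp

lemma HasNormalFormAt.mul {T : ℂ → ℂ → ℂ} {y : X} {r₀ r₁ τ : X → ℂ} {O : Set X} (hO : IsOpen O)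
    (hyO : y ∈ O) (h : ∀ z ∈ O, r₀ z = τ z * r₁ z) (hτ0 : ∀ z ∈ O, τ z ≠ 0)
    (hτ : ContMDiffOn 𝓘(ℝ, Model) 𝓘(ℝ, ℂ) ∞ τ O)
    (hr : HasNormalFormAt T r₁ y) : HasNormalFormAt T r₀ y := by
  obtain ⟨O', u, v, k, hO', hyO', hu, hv, hk, hu0, hv0, htr, hk0, heq⟩ := hr
  refine ⟨O ∩ O', u, v, fun z => τ z * k z, hO.inter hO', ⟨hyO, hyO'⟩, hu.mono inter_subset_right,
    hv.mono inter_subset_right,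
    contMDiffOn_mul (hτ.mono inter_subset_left) (hk.mono inter_subset_right), hu0, hv0, htr,
    fun z hz => mul_ne_zero (hτ0 z hz.1) (hk0 z hz.2), fun z hz => ?_⟩
  simp only [h z hz.1, heq z hz.2]; ring

/-- A smooth function which does not vanish at a point has a smooth square root near this point. -/
lemma exists_smooth_sqrt {y : X} {r : X → ℂ} {O : Set X} (hO : IsOpen O) (hyO : y ∈ O)
    (hr : ContMDiffOn 𝓘(ℝ, Model) 𝓘(ℝ, ℂ) ∞ r O) (h0 : r y ≠ 0) :
    ∃ (O' : Set X) (s : X → ℂ), IsOpen O' ∧ y ∈ O' ∧ O' ⊆ O ∧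
      ContMDiffOn 𝓘(ℝ, Model) 𝓘(ℝ, ℂ) ∞ s O' ∧ ∀ z ∈ O', s z ^ 2 = r z ∧ s z ≠ 0 := by
  obtain ⟨b, hb⟩ := IsAlgClosed.exists_pow_nat_eq (r y) (n := 2) (by norm_num)
  have hb0 : b ≠ 0 := by rintro rfl; simp at hb; exact h0 hb.symm
  have hq : ContMDiffOn 𝓘(ℝ, Model) 𝓘(ℝ, ℂ) ∞ (fun z => (r y)⁻¹ * r z) O :=
    contMDiffOn_mul contMDiffOn_const hr
  have hopen : IsOpen (O ∩ (fun z => (r y)⁻¹ * r z) ⁻¹' Complex.slitPlane) :=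
    hq.continuousOn.isOpen_inter_preimage hO Complex.isOpen_slitPlane
  -- Dividing by the value at `y` moves the function to `1`, inside the slit plane, where the
  -- logarithm is smooth; the constant `b` restores the factor.
  refine ⟨_, fun z => b * Complex.exp (Complex.log ((r y)⁻¹ * r z) / 2), hopen,
    ⟨hyO, by simp [h0]⟩, inter_subset_left, ?_, fun z hz => ?_⟩
  · intro z hz
    have hsm : ContDiffAt ℝ ∞ (fun ζ : ℂ => b * Complex.exp (Complex.log ζ / 2))
        ((r y)⁻¹ * r z) := by
      have h1 : ContDiffAt ℝ ∞ Complex.log ((r y)⁻¹ * r z) :=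
        (Complex.contDiffAt_log hz.2).restrict_scalars ℝ
      have h2 : ContDiff ℝ ∞ Complex.exp := Complex.contDiff_exp
      exact contDiffAt_const.mul (h2.contDiffAt.comp _ (h1.div_const 2))
    exact ContMDiffAt.comp_contMDiffWithinAt z
      (g := fun ζ : ℂ => b * Complex.exp (Complex.log ζ / 2)) (f := fun z => (r y)⁻¹ * r z)
      hsm.contMDiffAt ((hq z hz.1).mono inter_subset_left)
  · have hz0 : (r y)⁻¹ * r z ≠ 0 := Complex.slitPlane_ne_zero hz.2
    refine ⟨?_, mul_ne_zero hb0 (Complex.exp_ne_zero _)⟩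
    simp only
    rw [mul_pow, ← Complex.exp_nat_mul, hb]
    have : ((2 : ℕ) : ℂ) * (Complex.log ((r y)⁻¹ * r z) / 2) = Complex.log ((r y)⁻¹ * r z) := by
      push_cast; ring
    rw [this, Complex.exp_log hz0]
    field_simp

lemma differentiableAt_inChart_of_contMDiffOn {x₀ y : X} (hy : y ∈ (chartAt Model x₀).source)
    {r : X → ℂ} {O : Set X} (hO : IsOpen O) (hyO : y ∈ O)
    (hr : ContMDiffOn 𝓘(ℝ, Model) 𝓘(ℝ, ℂ) ∞ r O) :
    DifferentiableAt ℝ (inChart x₀ r) (chartAt Model x₀ y) :=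
  (contDiffAt_inChart hy hO hyO hr).differentiableAt (by simp)

/-- The node of the discriminant at a point where `F` and `P` vanish transversally. -/
lemma hasNodeAt_fibreDisc {F G P Q : X → ℂ} {x : X} {O : Set X} (hO : IsOpen O) (hx : x ∈ O)
    (hF : ContMDiffOn 𝓘(ℝ, Model) 𝓘(ℝ, ℂ) ∞ F O) (hG : ContMDiffOn 𝓘(ℝ, Model) 𝓘(ℝ, ℂ) ∞ G O)
    (hP : ContMDiffOn 𝓘(ℝ, Model) 𝓘(ℝ, ℂ) ∞ P O) (hQ : ContMDiffOn 𝓘(ℝ, Model) 𝓘(ℝ, ℂ) ∞ Q O)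
    (hF0 : F x = 0) (hP0 : P x = 0) (hG0 : G x ≠ 0) (ht : IsTransverseAt F P x) :
    HasNodeAt (fun y => fibreDisc (F y) (G y) (P y) (Q y)) x := by
  -- The discriminant equals `16 (A F² - C P²)`, where `A = G²` and `C = G³` at `x`. With square
  -- roots `α`, `γ` of these units it factors as `16 (αF - γP)(αF + γP)`.
  set A : X → ℂ := fun y => G y * G y - Q y * Q y * F y with hA
  set C : X → ℂ := fun y => G y * G y * G y + 27 / 256 * (P y * P y * (Q y * Q y * (Q y * Q y)))
    - 9 / 8 * (F y * G y * (Q y * Q y)) with hC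
  have hAs : ContMDiffOn 𝓘(ℝ, Model) 𝓘(ℝ, ℂ) ∞ A O :=
    (contMDiffOn_mul hG hG).sub (contMDiffOn_mul (contMDiffOn_mul hQ hQ) hF)
  have hCs : ContMDiffOn 𝓘(ℝ, Model) 𝓘(ℝ, ℂ) ∞ C O :=
    ((contMDiffOn_mul (contMDiffOn_mul hG hG) hG).add (contMDiffOn_mul contMDiffOn_const
      (contMDiffOn_mul (contMDiffOn_mul hP hP) (contMDiffOn_mul (contMDiffOn_mul hQ hQ)
        (contMDiffOn_mul hQ hQ))))).sub (contMDiffOn_mul contMDiffOn_const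
          (contMDiffOn_mul (contMDiffOn_mul hF hG) (contMDiffOn_mul hQ hQ)))
  obtain ⟨O₁, α, hO₁, hx₁, hs₁, hα, hα2⟩ := exists_smooth_sqrt hO hx hAs
    (by simp [hA, hF0, hG0])
  obtain ⟨O₂, γ, hO₂, hx₂, hs₂, hγ, hγ2⟩ := exists_smooth_sqrt hO hx hCs
    (by simp [hC, hF0, hP0, hG0])
  have hα' := hα.mono (inter_subset_left : O₁ ∩ O₂ ⊆ O₁)
  have hγ' := hγ.mono (inter_subset_right : O₁ ∩ O₂ ⊆ O₂)
  have hF' := hF.mono ((inter_subset_left : O₁ ∩ O₂ ⊆ O₁).trans hs₁)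
  have hP' := hP.mono ((inter_subset_left : O₁ ∩ O₂ ⊆ O₁).trans hs₁)
  have hu : ContMDiffOn 𝓘(ℝ, Model) 𝓘(ℝ, ℂ) ∞ (fun y => α y * F y - γ y * P y) (O₁ ∩ O₂) :=
    (contMDiffOn_mul hα' hF').sub (contMDiffOn_mul hγ' hP')
  have hv : ContMDiffOn 𝓘(ℝ, Model) 𝓘(ℝ, ℂ) ∞ (fun y => α y * F y + γ y * P y) (O₁ ∩ O₂) :=
    (contMDiffOn_mul hα' hF').add (contMDiffOn_mul hγ' hP')
  have hOo := hO₁.inter hO₂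
  have hxO : x ∈ O₁ ∩ O₂ := ⟨hx₁, hx₂⟩
  refine ⟨O₁ ∩ O₂, fun y => α y * F y - γ y * P y, fun y => α y * F y + γ y * P y, fun _ => 16,
    hOo, hxO, hu, hv, contMDiffOn_const, by simp [hF0, hP0], by simp [hF0, hP0], ?_,
    fun _ _ => by norm_num, fun y hy => ?_⟩
  · have hxc := mem_chart_source Model x
    have dα := differentiableAt_inChart_of_contMDiffOn hxc hOo hxO hα'
    have dγ := differentiableAt_inChart_of_contMDiffOn hxc hOo hxO hγ'
    have dF := differentiableAt_inChart_of_contMDiffOn hxc hOo hxO hF'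
    have dP := differentiableAt_inChart_of_contMDiffOn hxc hOo hxO hP'
    have du := differentiableAt_inChart_of_contMDiffOn hxc hOo hxO hu
    have dv := differentiableAt_inChart_of_contMDiffOn hxc hOo hxO hv
    rw [isTransverseAt_iff hxc dF dP] at ht
    rw [isTransverseAt_iff hxc du dv]
    have hα0 := (hα2 x hx₁).2
    have hγ0 := (hγ2 x hx₂).2
    have eu : fderiv ℝ (inChart x fun y => α y * F y - γ y * P y) (chartAt Model x x) =
        α x • fderiv ℝ (inChart x F) (chartAt Model x x) -
          γ x • fderiv ℝ (inChart x P) (chartAt Model x x) := by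
      have := ((dα.hasFDerivAt.mul dF.hasFDerivAt).sub (dγ.hasFDerivAt.mul dP.hasFDerivAt)).fderiv
      rw [inChart_apply hxc, inChart_apply hxc, inChart_apply hxc, inChart_apply hxc, hF0, hP0,
        zero_smul_clm, zero_smul_clm, add_zero, add_zero] at this
      exact this
    have ev : fderiv ℝ (inChart x fun y => α y * F y + γ y * P y) (chartAt Model x x) =
        α x • fderiv ℝ (inChart x F) (chartAt Model x x) +
          γ x • fderiv ℝ (inChart x P) (chartAt Model x x) := by
      have := ((dα.hasFDerivAt.mul dF.hasFDerivAt).add (dγ.hasFDerivAt.mul dP.hasFDerivAt)).fderiv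
      rw [inChart_apply hxc, inChart_apply hxc, inChart_apply hxc, inChart_apply hxc, hF0, hP0,
        zero_smul_clm, zero_smul_clm, add_zero, add_zero] at this
      exact this
    rw [eu, ev]
    apply bijective_of_injective_of_finrank_eq
    · simp [Module.finrank_prod, finrank_model, Complex.finrank_real_complex]
    rw [injective_iff_map_eq_zero]
    intro ξ hξ
    have k1 := congrArg Prod.fst hξ
    have k2 := congrArg Prod.snd hξ
    simp only [ContinuousLinearMap.prod_apply, sub_apply,
      add_apply, smul_apply, smul_eq_mul, Prod.fst_zero,
      Prod.snd_zero] at k1 k2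
    apply ht.1
    rw [map_zero]
    refine Prod.ext ?_ ?_
    · refine (mul_eq_zero.1 (?_ : α x * _ = 0)).resolve_left hα0
      simp only [ContinuousLinearMap.prod_apply]
      linear_combination (k1 + k2) / 2
    · refine (mul_eq_zero.1 (?_ : γ x * _ = 0)).resolve_left hγ0
      simp only [ContinuousLinearMap.prod_apply]
      linear_combination (k2 - k1) / 2
  · have e1 := (hα2 y hy.1).1
    have e2 := (hγ2 y hy.2).1
    simp only [hA, hC] at e1 e2
    simp only [fibreDisc]
    linear_combination (-16 * F y ^ 2) * e1 + (16 * P y ^ 2) * e2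

end Forms

/-! ### The singular points of the branch curve. -/

section Cover

variable {X : Type*} [TopologicalSpace X] [T2Space X] [ChartedSpace Model X]
  [IsManifold 𝓘(ℂ, Model) ω X]
  {L₁ : X → Type*} [∀ x, AddCommGroup (L₁ x)] [∀ x, Module ℂ (L₁ x)]
  {L₂ : X → Type*} [∀ x, AddCommGroup (L₂ x)] [∀ x, Module ℂ (L₂ x)]
  [∀ x, TopologicalSpace (L₁ x)] [TopologicalSpace (TotalSpace ℂ L₁)] [FiberBundle ℂ L₁]
  [VectorBundle ℂ ℂ L₁]
  [∀ x, TopologicalSpace (L₂ x)] [TopologicalSpace (TotalSpace ℂ L₂)] [FiberBundle ℂ L₂]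
  [VectorBundle ℂ ℂ L₂]
  [ContMDiffVectorBundle ω ℂ L₁ 𝓘(ℂ, Model)] [ContMDiffVectorBundle ω ℂ L₂ 𝓘(ℂ, Model)]
  {f : ∀ x, L₁ x ⊗[ℂ] L₁ x} {g : ∀ x, L₂ x ⊗[ℂ] L₂ x}
  {Φ : ∀ x, L₂ x →ₗ[ℂ] L₁ x ⊗[ℂ] L₁ x} {Ψ : ∀ x, L₁ x →ₗ[ℂ] L₂ x ⊗[ℂ] L₂ x}

lemma contMDiffOn_real_of_complex {E : Type*} [NormedAddCommGroup E] [NormedSpace ℂ E]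
    {r : X → E} {O : Set X} (hO : IsOpen O)
    (hr : ContMDiffOn 𝓘(ℂ, Model) 𝓘(ℂ, E) ω r O) : ContMDiffOn 𝓘(ℝ, Model) 𝓘(ℝ, E) ∞ r O := by
  intro y hy
  have h := (hr y hy).contMDiffAt (hO.mem_nhds hy)
  rw [contMDiffAt_iff] at h
  refine ContMDiffAt.contMDiffWithinAt (contMDiffAt_iff.2 ⟨h.1, ?_⟩)
  exact (h.2.restrict_scalars ℝ).of_le le_top

lemma contMDiffOn_sqRep_left (hf : IsHolomorphicSection f) (x₀ : X) :
    ContMDiffOn 𝓘(ℝ, Model) 𝓘(ℝ, ℂ) ∞ (sqRep f x₀) (baseSetAt L₁ x₀ ∩ baseSetAt L₂ x₀) :=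
  (contMDiffOn_real_of_complex (trivializationAt ℂ L₁ x₀).open_baseSet (hf x₀)).mono
    inter_subset_left

lemma contMDiffOn_sqRep_right (hg : IsHolomorphicSection g) (x₀ : X) :
    ContMDiffOn 𝓘(ℝ, Model) 𝓘(ℝ, ℂ) ∞ (sqRep g x₀) (baseSetAt L₁ x₀ ∩ baseSetAt L₂ x₀) :=
  (contMDiffOn_real_of_complex (trivializationAt ℂ L₂ x₀).open_baseSet (hg x₀)).mono
    inter_subset_right

namespace IsSmoothData

lemma contMDiffOn_deltaRep (h : IsSmoothData f g Φ Ψ) (x₀ : X) :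
    ContMDiffOn 𝓘(ℝ, Model) 𝓘(ℝ, ℂ) ∞ (deltaRep f g Φ Ψ x₀)
      (baseSetAt L₁ x₀ ∩ baseSetAt L₂ x₀) := by
  have hs : ContDiff ℝ ∞ (fun v : ℂ × ℂ × ℂ × ℂ => fibreDisc v.1 v.2.1 v.2.2.1 v.2.2.2) := by
    unfold fibreDisc; fun_prop
  have h1 := contMDiffOn_sqRep_left (L₂ := L₂) h.hf x₀
  have h2 := contMDiffOn_sqRep_right (L₁ := L₁) h.hg x₀
  have h3 := h.hΦ x₀
  have h4 := (h.hΨ x₀).mono (inter_comm (baseSetAt L₁ x₀) _).subset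
  have h5 := hs.contMDiff.comp_contMDiffOn
    (h1.prodMk_space (h2.prodMk_space (h3.prodMk_space h4)))
  exact h5.congr fun y _ => deltaRep_eq f g Φ Ψ x₀ y

variable (L₁ L₂) in
/-- The factor of automorphy of the discriminant. -/
lemma contMDiffOn_deltaFactor (x₀ x₁ : X) : ContMDiffOn 𝓘(ℝ, Model) 𝓘(ℝ, ℂ) ∞
    (fun y => (transition L₁ x₀ x₁ y * transition L₂ x₀ x₁ y) ^ 4)
    ((baseSetAt L₁ x₀ ∩ baseSetAt L₂ x₀) ∩ (baseSetAt L₁ x₁ ∩ baseSetAt L₂ x₁)) := by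
  have h1 := (contMDiffOn_real_of_complex ((trivializationAt ℂ L₁ x₀).open_baseSet.inter
    (trivializationAt ℂ L₁ x₁).open_baseSet) (contMDiffOn_transition (L := L₁) x₀ x₁)).mono
    (show (baseSetAt L₁ x₀ ∩ baseSetAt L₂ x₀) ∩ (baseSetAt L₁ x₁ ∩ baseSetAt L₂ x₁) ⊆ _ from
      fun y hy => ⟨hy.1.1, hy.2.1⟩)
  have h2 := (contMDiffOn_real_of_complex ((trivializationAt ℂ L₂ x₀).open_baseSet.inter
    (trivializationAt ℂ L₂ x₁).open_baseSet) (contMDiffOn_transition (L := L₂) x₀ x₁)).mono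
    (show (baseSetAt L₁ x₀ ∩ baseSetAt L₂ x₀) ∩ (baseSetAt L₁ x₁ ∩ baseSetAt L₂ x₁) ⊆ _ from
      fun y hy => ⟨hy.1.2, hy.2.2⟩)
  have hs : ContDiff ℝ ∞ (fun v : ℂ × ℂ => (v.1 * v.2) ^ 4) :=
    (contDiff_fst.mul contDiff_snd).pow 4
  have h3 := hs.contMDiff.comp_contMDiffOn (h1.prodMk_space h2)
  exact h3.congr fun y _ => rfl

lemma isSubmersionAt_deltaRep_iff (h : IsSmoothData f g Φ Ψ) {x₀ x₁ y : X}
    (h₀ : y ∈ coordDomain L₁ L₂ x₀) (h₁ : y ∈ coordDomain L₁ L₂ x₁)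
    (h0 : deltaRep f g Φ Ψ x₁ y = 0) :
    IsSubmersionAt (deltaRep f g Φ Ψ x₀) y ↔ IsSubmersionAt (deltaRep f g Φ Ψ x₁) y := by
  have hO := (isOpen_baseSets (L₁ := L₁) (L₂ := L₂) x₀).inter (isOpen_baseSets (L₁ := L₁) (L₂ := L₂) x₁)
  refine isSubmersionAt_mul_iff
    (τ := fun y => (transition L₁ x₀ x₁ y * transition L₂ x₀ x₁ y) ^ 4) ?_
    ((contMDiffOn_deltaFactor L₁ L₂ x₀ x₁).contMDiffAt (hO.mem_nhds ⟨h₀.2, h₁.2⟩))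
    ((h.contMDiffOn_deltaRep x₁).contMDiffAt
      ((isOpen_baseSets (L₁ := L₁) (L₂ := L₂) x₁).mem_nhds h₁.2))
    (pow_ne_zero _ (mul_ne_zero (transition_ne_zero h₀.2.1 h₁.2.1)
      (transition_ne_zero h₀.2.2 h₁.2.2))) h0
  filter_upwards [hO.mem_nhds ⟨h₀.2, h₁.2⟩] with z hz
  exact deltaRep_eq_transition_mul f g Φ Ψ hz.2.1 hz.2.2 hz.1.1 hz.1.2

lemma hasNormalFormAt_deltaRep {T : ℂ → ℂ → ℂ} {x₀ x₁ y : X}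
    (h₀ : y ∈ coordDomain L₁ L₂ x₀) (h₁ : y ∈ coordDomain L₁ L₂ x₁)
    (hn : HasNormalFormAt T (deltaRep f g Φ Ψ x₁) y) :
    HasNormalFormAt T (deltaRep f g Φ Ψ x₀) y :=
  hn.mul ((isOpen_baseSets (L₁ := L₁) (L₂ := L₂) x₀).inter
    (isOpen_baseSets (L₁ := L₁) (L₂ := L₂) x₁)) ⟨h₀.2, h₁.2⟩
    (fun _ hz => deltaRep_eq_transition_mul f g Φ Ψ hz.2.1 hz.2.2 hz.1.1 hz.1.2)
    (fun _ hz => pow_ne_zero _ (mul_ne_zero (transition_ne_zero hz.1.1 hz.2.1)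
      (transition_ne_zero hz.1.2 hz.2.2))) (contMDiffOn_deltaFactor L₁ L₂ x₀ x₁)

lemma hasFDerivAt_deltaRep (h : IsSmoothData f g Φ Ψ) {x₀ y : X}
    (hy : y ∈ coordDomain L₁ L₂ x₀) :
    HasFDerivAt (inChart x₀ (deltaRep f g Φ Ψ x₀))
      (discF (sqRep f x₀ y) (sqRep g x₀ y) (homRep Φ x₀ y) (homRep Ψ x₀ y) •
          fderiv ℝ (locSq f x₀) (chartAt Model x₀ y) +
        discF (sqRep g x₀ y) (sqRep f x₀ y) (homRep Ψ x₀ y) (homRep Φ x₀ y) •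
          fderiv ℝ (locSq g x₀) (chartAt Model x₀ y) +
        discP (sqRep f x₀ y) (sqRep g x₀ y) (homRep Φ x₀ y) (homRep Ψ x₀ y) •
          fderiv ℝ (locHom Φ x₀) (chartAt Model x₀ y) +
        discP (sqRep g x₀ y) (sqRep f x₀ y) (homRep Ψ x₀ y) (homRep Φ x₀ y) •
          fderiv ℝ (locHom Ψ x₀) (chartAt Model x₀ y)) (chartAt Model x₀ y) := by
  have := hasFDerivAt_fibreDisc
    ((contDiffAt_locSq_left h.hf hy).differentiableAt (by simp)).hasFDerivAt
    ((contDiffAt_locSq_right h.hg hy).differentiableAt (by simp)).hasFDerivAt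
    ((contDiffAt_locHom_left h.hΦ hy).differentiableAt (by simp)).hasFDerivAt
    ((contDiffAt_locHom_right h.hΨ hy).differentiableAt (by simp)).hasFDerivAt
  simp only [locSq, locHom, inChart_apply hy.1] at this
  exact this

lemma not_isSubmersionAt (h : IsSmoothData f g Φ Ψ) {x₀ y : X}
    (hy : y ∈ coordDomain L₁ L₂ x₀)
    (h1 : discF (sqRep f x₀ y) (sqRep g x₀ y) (homRep Φ x₀ y) (homRep Ψ x₀ y) = 0)
    (h2 : discF (sqRep g x₀ y) (sqRep f x₀ y) (homRep Ψ x₀ y) (homRep Φ x₀ y) = 0)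
    (h3 : discP (sqRep f x₀ y) (sqRep g x₀ y) (homRep Φ x₀ y) (homRep Ψ x₀ y) = 0)
    (h4 : discP (sqRep g x₀ y) (sqRep f x₀ y) (homRep Ψ x₀ y) (homRep Φ x₀ y) = 0) :
    ¬ IsSubmersionAt (deltaRep f g Φ Ψ x₀) y := by
  have hd := h.hasFDerivAt_deltaRep hy
  rw [isSubmersionAt_iff hy.1 hd.differentiableAt, hd.fderiv, h1, h2, h3, h4]
  intro hs
  obtain ⟨v, hv⟩ := hs 1
  simp at hv

/-- The discriminant lies in the square of the ideal `(f, φ)` and in the square of `(g, ψ)`, so it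
vanishes together with its gradient. -/
theorem trivialSing_subset_singDelta (h : IsSmoothData f g Φ Ψ)
    (hr : ∀ y, RegularZ f g Φ Ψ y y) : trivialSing f g Φ Ψ ⊆ singDelta f g Φ Ψ := by
  intro x hx
  have hxd : x ∈ coordDomain L₁ L₂ x := mem_coordDomain x
  refine ⟨?_, ?_⟩
  · rw [mem_branchDelta_iff h hr hxd.2.1 hxd.2.2, deltaRep_eq]
    rcases hx with ⟨h1, h2⟩ | ⟨h1, h2⟩
    · rw [(sqRep_eq_zero_iff f hxd.2.1).2 h1, (homRep_eq_zero_iff Φ hxd.2.1 hxd.2.2).2 h2]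
      simp [fibreDisc]
    · rw [(sqRep_eq_zero_iff g hxd.2.2).2 h1, (homRep_eq_zero_iff Ψ hxd.2.2 hxd.2.1).2 h2]
      simp [fibreDisc]
  · rcases hx with ⟨h1, h2⟩ | ⟨h1, h2⟩
    · have e1 := (sqRep_eq_zero_iff f hxd.2.1).2 h1
      have e2 := (homRep_eq_zero_iff Φ hxd.2.1 hxd.2.2).2 h2
      apply h.not_isSubmersionAt hxd <;> rw [e1, e2] <;> simp [discF, discP]
    · have e1 := (sqRep_eq_zero_iff g hxd.2.2).2 h1
      have e2 := (homRep_eq_zero_iff Ψ hxd.2.2 hxd.2.1).2 h2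
      apply h.not_isSubmersionAt hxd <;> rw [e1, e2] <;> simp [discF, discP]

/-- The singular points of the branch curve which are not trivial. -/
theorem mem_singDelta_diff_iff (h : IsSmoothData f g Φ Ψ)
    (hr : ∀ y, RegularZ f g Φ Ψ y y) {x₀ y : X} (hy : y ∈ coordDomain L₁ L₂ x₀) :
    y ∈ singDelta f g Φ Ψ \ trivialSing f g Φ Ψ ↔
      ∃ z w, IsCuspPoint (sqRep f x₀ y) (sqRep g x₀ y) (homRep Φ x₀ y) (homRep Ψ x₀ y) z w := by
  have hyy : y ∈ coordDomain L₁ L₂ y := mem_coordDomain y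
  have hreg : RegularZ f g Φ Ψ x₀ y := (hr y).change h hy hyy
  constructor
  · rintro ⟨⟨hΔ, hns⟩, htriv⟩
    rw [mem_branchDelta_iff h hr hy.2.1 hy.2.2] at hΔ
    -- Singularity is defined in the trivialization around `y` itself; at a zero of `δ` it may be
    -- tested in the one around `x₀`.
    rw [h.isSubmersionAt_deltaRep_iff hyy hy hΔ] at hns
    rw [deltaRep_eq, fibreDisc_eq_zero_iff] at hΔ
    obtain ⟨⟨z, w⟩, hu, hram⟩ := hΔ
    refine ⟨z, w, ?_⟩
    by_contra hcusp
    apply hns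
    have hd := h.hasFDerivAt_deltaRep hy
    rw [isSubmersionAt_iff hy.1 hd.differentiableAt, hd.fderiv]
    have hsurj := hreg (z, w) (by
      rw [covEq_eq_zero_iff]; simpa only [locSq, locHom, inChart_apply hy.1] using hu)
    rw [(h.hasFDerivAt_locCov hy (z, w)).fderiv] at hsurj
    refine surjective_discriminant (j := ((sqRep f x₀ y, sqRep g x₀ y, homRep Φ x₀ y,
      homRep Ψ x₀ y), (fderiv ℝ (locSq f x₀) (chartAt Model x₀ y),
      fderiv ℝ (locSq g x₀) (chartAt Model x₀ y), fderiv ℝ (locHom Φ x₀) (chartAt Model x₀ y),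
      fderiv ℝ (locHom Ψ x₀) (chartAt Model x₀ y)))) hu hram hsurj ?_ ?_ hcusp
    · rintro ⟨e1, e2⟩
      exact htriv (Or.inl ⟨(sqRep_eq_zero_iff f hy.2.1).1 e1,
        (homRep_eq_zero_iff Φ hy.2.1 hy.2.2).1 e2⟩)
    · rintro ⟨e1, e2⟩
      exact htriv (Or.inr ⟨(sqRep_eq_zero_iff g hy.2.2).1 e1,
        (homRep_eq_zero_iff Ψ hy.2.2 hy.2.1).1 e2⟩)
  · rintro ⟨z, w, hc⟩
    have h0 : deltaRep f g Φ Ψ x₀ y = 0 := hc.disc_eq_zero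
    obtain ⟨g1, g2, g3, g4⟩ := hc.gradient_eq_zero
    refine ⟨⟨(mem_branchDelta_iff h hr hy.2.1 hy.2.2).2 h0, ?_⟩, ?_⟩
    · rw [h.isSubmersionAt_deltaRep_iff hyy hy h0]
      exact h.not_isSubmersionAt hy g1 g2 g3 g4
    · rintro (⟨-, e⟩ | ⟨-, e⟩)
      · exact hc.phi_ne ((homRep_eq_zero_iff Φ hy.2.1 hy.2.2).2 e)
      · exact hc.psi_ne ((homRep_eq_zero_iff Ψ hy.2.2 hy.2.1).2 e)

theorem hasNodeAt_left (h : IsSmoothData f g Φ Ψ) {x : X} (hf : f x = 0) (hΦ : Φ x = 0)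
    (hg : g x ≠ 0) (ht : IsTransverseAt (sqRep f x) (homRep Φ x) x) :
    HasNodeAt (deltaRep f g Φ Ψ x) x := by
  have hx : x ∈ coordDomain L₁ L₂ x := mem_coordDomain x
  exact hasNodeAt_fibreDisc (isOpen_baseSets x) hx.2 (contMDiffOn_sqRep_left h.hf x)
    (contMDiffOn_sqRep_right h.hg x) (h.hΦ x)
    ((h.hΨ x).mono (inter_comm (baseSetAt L₁ x) _).subset) ((sqRep_eq_zero_iff f hx.2.1).2 hf)
    ((homRep_eq_zero_iff Φ hx.2.1 hx.2.2).2 hΦ)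
    (fun h0 => hg ((sqRep_eq_zero_iff g hx.2.2).1 h0)) ht

theorem hasNodeAt_right (h : IsSmoothData f g Φ Ψ) {x : X} (hg : g x = 0) (hΨ : Ψ x = 0)
    (hf : f x ≠ 0) (ht : IsTransverseAt (sqRep g x) (homRep Ψ x) x) :
    HasNodeAt (deltaRep f g Φ Ψ x) x := by
  have hx : x ∈ coordDomain L₁ L₂ x := mem_coordDomain x
  have := hasNodeAt_fibreDisc (isOpen_baseSets x) hx.2 (contMDiffOn_sqRep_right h.hg x)
    (contMDiffOn_sqRep_left h.hf x) ((h.hΨ x).mono (inter_comm (baseSetAt L₁ x) _).subset)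
    (h.hΦ x) ((sqRep_eq_zero_iff g hx.2.2).2 hg) ((homRep_eq_zero_iff Ψ hx.2.2 hx.2.1).2 hΨ)
    (fun h0 => hf ((sqRep_eq_zero_iff f hx.2.1).1 h0)) ht
  simp only [fibreDisc_swap (sqRep g x _)] at this
  exact this

end IsSmoothData

end Cover

/-! ### Local analysis near a point of `M` -/

/-- On the ball, `P` has absolute value comparable to `n` and derivative bounded in terms of `n`. -/
structure IsTame (P : Model → ℂ) (a₀ : Model) (R C n : ℝ) : Prop where
  pos : 0 < n
  contDiffOn : ContDiffOn ℝ ∞ P (Metric.ball a₀ R)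
  norm_le : ∀ a ∈ Metric.ball a₀ R, ‖P a‖ ≤ C * n
  norm_fderiv_le : ∀ a ∈ Metric.ball a₀ R, ‖fderiv ℝ P a‖ ≤ C * n
  le_norm : ∀ a ∈ Metric.ball a₀ R, n ≤ C * ‖P a‖

namespace IsTame

variable {P : Model → ℂ} {a₀ a : Model} {R C n : ℝ}

lemma ne_zero (h : IsTame P a₀ R C n) (ha : a ∈ Metric.ball a₀ R) : P a ≠ 0 := by
  intro h0
  have := h.le_norm a ha
  rw [h0, norm_zero, mul_zero] at this
  exact absurd h.pos (not_lt.2 this)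

lemma hasFDerivAt (h : IsTame P a₀ R C n) (ha : a ∈ Metric.ball a₀ R) :
    HasFDerivAt P (fderiv ℝ P a) a :=
  ((h.contDiffOn.contDiffAt (Metric.isOpen_ball.mem_nhds ha)).differentiableAt
    (by simp)).hasFDerivAt

lemma norm_fderiv_le_mul (h : IsTame P a₀ R C n) (hC : 0 < C) (ha : a ∈ Metric.ball a₀ R) :
    ‖fderiv ℝ P a‖ ≤ C ^ 2 * ‖P a‖ :=
  (h.norm_fderiv_le a ha).trans (by nlinarith [h.le_norm a ha])

/-- The size `n` cancels: the logarithmic derivative is bounded by a constant that does not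
degenerate as the perturbation tends to zero. -/
lemma norm_fderiv_div_le (h : IsTame P a₀ R C n) (hC : 0 < C) (ha : a ∈ Metric.ball a₀ R)
    (v : Model) : ‖fderiv ℝ P a v / P a‖ ≤ C ^ 2 * ‖v‖ := by
  have hp := norm_pos_iff.2 (h.ne_zero ha)
  rw [norm_div, div_le_iff₀ hp]
  refine ((fderiv ℝ P a).le_opNorm v).trans ?_
  have := mul_le_mul_of_nonneg_right (h.norm_fderiv_le_mul hC ha) (norm_nonneg v)
  linarith

end IsTame

/-- The block system is solvable because its Schur complement `k - m T⁻¹ b` is nonzero: the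
correction has norm at most `μβ/κ < ‖k‖`. Equal dimensions reduce this to injectivity. -/
lemma surjective_of_norm_lt {E G : Type*} [NormedAddCommGroup E] [NormedSpace ℝ E]
    [FiniteDimensional ℝ E] [NormedAddCommGroup G] [NormedSpace ℝ G] [FiniteDimensional ℝ G]
    (hfin : Module.finrank ℝ E = Module.finrank ℝ G) (T : E →L[ℝ] G) (b : ℂ →L[ℝ] G)
    (m : E →L[ℝ] ℂ) (k : ℂ) {κ β μ : ℝ} (hκ : 0 < κ) (hT : ∀ v, κ * ‖v‖ ≤ ‖T v‖)
    (hb : ∀ ζ, ‖b ζ‖ ≤ β * ‖ζ‖) (hm : ∀ v, ‖m v‖ ≤ μ * ‖v‖) (hμ : 0 ≤ μ) (h : μ * β < κ * ‖k‖) :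
    ∀ (y : G) (γ : ℂ), ∃ (x : E) (ζ : ℂ), b ζ - T x = y ∧ k * ζ - m x = γ := by
  let S : E × ℂ →L[ℝ] G × ℂ :=
    (b.comp (ContinuousLinearMap.snd ℝ E ℂ) - T.comp (ContinuousLinearMap.fst ℝ E ℂ)).prod
      (k • ContinuousLinearMap.snd ℝ E ℂ - m.comp (ContinuousLinearMap.fst ℝ E ℂ))
  have hS : ∀ v, S v = (b v.2 - T v.1, k * v.2 - m v.1) := fun v => rfl
  have hbij : Function.Bijective S := by
    apply bijective_of_injective_of_finrank_eq
    · simp [Module.finrank_prod, hfin]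
    rw [injective_iff_map_eq_zero]
    rintro ⟨x, ζ⟩ hv
    rw [hS] at hv
    have h1 : b ζ = T x := sub_eq_zero.1 (congrArg Prod.fst hv)
    have h2 : k * ζ = m x := sub_eq_zero.1 (congrArg Prod.snd hv)
    have e1 : κ * ‖x‖ ≤ β * ‖ζ‖ := (hT x).trans (h1 ▸ hb ζ)
    have e2 : ‖k‖ * ‖ζ‖ ≤ μ * ‖x‖ := by rw [← norm_mul, h2]; exact hm x
    have hζ : ‖ζ‖ = 0 := by
      by_contra hne
      have hpos : 0 < ‖ζ‖ := lt_of_le_of_ne (norm_nonneg _) (Ne.symm hne)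
      have e3 : κ * ‖k‖ * ‖ζ‖ ≤ μ * β * ‖ζ‖ := by
        calc κ * ‖k‖ * ‖ζ‖ ≤ κ * (μ * ‖x‖) := by
              rw [mul_assoc]; exact mul_le_mul_of_nonneg_left e2 hκ.le
          _ = μ * (κ * ‖x‖) := by ring
          _ ≤ μ * (β * ‖ζ‖) := mul_le_mul_of_nonneg_left e1 hμ
          _ = _ := by ring
      exact absurd (le_of_mul_le_mul_right e3 hpos) (not_le.2 h)
    have hx : ‖x‖ = 0 := by
      rw [hζ, mul_zero] at e1
      exact le_antisymm (by nlinarith [norm_nonneg x]) (norm_nonneg x)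
    rw [norm_eq_zero] at hζ hx
    simp [hζ, hx]
  intro y γ
  obtain ⟨⟨x, ζ⟩, hx⟩ := hbij.2 (y, γ)
  rw [hS] at hx
  exact ⟨x, ζ, congrArg Prod.fst hx, congrArg Prod.snd hx⟩

/-- Regularity of the ramification curve for given bounds. -/
lemma derRam_surjective {z w P Q : ℂ} {F' G' P' Q' : Model →L[ℝ] ℂ} {κ C n n' ε : ℝ}
    (hκ : 0 < κ) (hC : 0 < C) (hn : 0 < n) (hn' : 0 < n')
    (hT : ∀ v, κ * ‖v‖ ≤ ‖(F'.prod G') v‖)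
    (hz : ‖z‖ ≤ 2) (hw : ‖w‖ ≤ 2) (hP : ‖P‖ ≤ C * n) (hQ : ‖Q‖ ≤ C * n')
    (hP' : ‖P'‖ ≤ C * n) (hQ' : ‖Q'‖ ≤ C * n') (hnP : n ≤ C * ‖P‖) (hnQ : n' ≤ C * ‖Q‖)
    (hε : n < ε) (hε' : n' < ε) (h1 : C * ε ≤ 1) (h2 : 4 * (C * ε) ≤ κ)
    (h3 : 16 * C ^ 3 * ε ≤ κ) (hr : 4 * z * w = P * Q) :
    Function.Surjective (derRam z w P Q F' G' P' Q') := by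
  have hε0 : 0 < ε := hn.trans hε
  have hCn : C * n ≤ C * ε := mul_le_mul_of_nonneg_left hε.le hC.le
  have hCn' : C * n' ≤ C * ε := mul_le_mul_of_nonneg_left hε'.le hC.le
  -- The horizontal part of the derivative of the two equations of `Z`, up to sign. Its terms in
  -- `P'`, `Q'` are small, so it keeps the lower bound of `(F', G')` up to a factor two.
  set T : Model →L[ℝ] ℂ × ℂ := (F' + w • P').prod (G' + z • Q') with hTdef
  have hTv : ∀ v, κ / 2 * ‖v‖ ≤ ‖T v‖ := by
    intro v
    have e : (F'.prod G') v = T v - (w * P' v, z * Q' v) := by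
      ext <;> simp [hTdef]
    have b1 : ‖w * P' v‖ ≤ κ / 2 * ‖v‖ := by
      rw [norm_mul]
      calc ‖w‖ * ‖P' v‖ ≤ 2 * (C * ε * ‖v‖) := by
            refine mul_le_mul hw ((P'.le_opNorm v).trans ?_) (norm_nonneg _) (by norm_num)
            exact mul_le_mul_of_nonneg_right (hP'.trans hCn) (norm_nonneg _)
        _ ≤ _ := by nlinarith [norm_nonneg v]
    have b2 : ‖z * Q' v‖ ≤ κ / 2 * ‖v‖ := by
      rw [norm_mul]
      calc ‖z‖ * ‖Q' v‖ ≤ 2 * (C * ε * ‖v‖) := by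
            refine mul_le_mul hz ((Q'.le_opNorm v).trans ?_) (norm_nonneg _) (by norm_num)
            exact mul_le_mul_of_nonneg_right (hQ'.trans hCn') (norm_nonneg _)
        _ ≤ _ := by nlinarith [norm_nonneg v]
    have b3 : ‖((w * P' v, z * Q' v) : ℂ × ℂ)‖ ≤ κ / 2 * ‖v‖ := by
      rw [Prod.norm_def]; exact max_le b1 b2
    have := hT v
    rw [e] at this
    have := this.trans (norm_sub_le _ _)
    linarith
  set m : Model →L[ℝ] ℂ := P • Q' + Q • P' with hm
  have hmv : ∀ v, ‖m v‖ ≤ 2 * C ^ 2 * (n * n') * ‖v‖ := by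
    intro v
    have e : m v = P * Q' v + Q * P' v := by simp [hm]
    rw [e]
    refine (norm_add_le _ _).trans ?_
    rw [norm_mul, norm_mul]
    have c1 : ‖P‖ * ‖Q' v‖ ≤ (C * n) * (C * n' * ‖v‖) :=
      mul_le_mul hP ((Q'.le_opNorm v).trans (mul_le_mul_of_nonneg_right hQ' (norm_nonneg _)))
        (norm_nonneg _) (by positivity)
    have c2 : ‖Q‖ * ‖P' v‖ ≤ (C * n') * (C * n * ‖v‖) :=
      mul_le_mul hQ ((P'.le_opNorm v).trans (mul_le_mul_of_nonneg_right hP' (norm_nonneg _)))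
        (norm_nonneg _) (by positivity)
    nlinarith
  have key : ∀ x a b, derRam z w P Q F' G' P' Q' (x, a, b) =
      ((2 * z * a - P * b, 2 * w * b - Q * a) - T x, 4 * z * b + 4 * w * a - m x) := by
    intro x a b
    refine Prod.ext (Prod.ext ?_ ?_) ?_ <;> simp [derRam, derCov, derZ, derW, derR, hTdef, hm] <;>
      ring
  -- Since `4zw = PQ` and `|P|`, `|Q|` are comparable to `n`, `n'`, the product `|zw|` is at least
  -- of order `n n'`.
  have hzw : n * n' ≤ 4 * C ^ 2 * (‖z‖ * ‖w‖) := by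
    have e : 4 * (‖z‖ * ‖w‖) = ‖P‖ * ‖Q‖ := by
      rw [← norm_mul P Q, ← hr]; simp [mul_assoc]
    have : n * n' ≤ (C * ‖P‖) * (C * ‖Q‖) :=
      mul_le_mul hnP hnQ hn'.le (by positivity)
    calc n * n' ≤ C ^ 2 * (‖P‖ * ‖Q‖) := by nlinarith
      _ = _ := by rw [← e]; ring
  -- For the larger coordinate `s`, the bounds `n n' ≤ 4C²s²` and `n n' < ε²` give `n n' < 2Csε` by
  -- a geometric mean. The differential of `PQ`, of order `n n'`, is thus negligible against `4s`.
  have hsmall : ∀ s : ℝ, 0 ≤ s → n * n' ≤ 4 * C ^ 2 * s ^ 2 →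
      2 * C ^ 2 * (n * n') * 4 < κ / 2 * (4 * s) := by
    intro s hs hs'
    have hnn : 0 < n * n' := mul_pos hn hn'
    have hnn2 : n * n' < ε ^ 2 := by nlinarith
    have hs0 : 0 < s := by
      rcases hs.lt_or_eq with h | h
      · exact h
      · rw [← h] at hs'; nlinarith
    have hprod : n * n' < 2 * C * s * ε := by
      by_contra! hcon
      have : (2 * C * s * ε) ^ 2 ≤ (n * n') ^ 2 := by
        have : 0 ≤ 2 * C * s * ε := by positivity
        nlinarith
      have h4 : (n * n') * (n * n') < (4 * C ^ 2 * s ^ 2) * ε ^ 2 :=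
        mul_lt_mul' hs' hnn2 hnn.le (by positivity)
      nlinarith
    have hC2 : 0 < C ^ 2 := by positivity
    calc 2 * C ^ 2 * (n * n') * 4 = 8 * C ^ 2 * (n * n') := by ring
      _ < 8 * C ^ 2 * (2 * C * s * ε) := by
          exact mul_lt_mul_of_pos_left hprod (by positivity)
      _ = (16 * C ^ 3 * ε) * s := by ring
      _ ≤ κ * s := mul_le_mul_of_nonneg_right h3 hs
      _ ≤ _ := by nlinarith
  have hfin : Module.finrank ℝ Model = Module.finrank ℝ (ℂ × ℂ) := by
    simp [Module.finrank_prod, finrank_model, Complex.finrank_real_complex]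
  have hμ : 0 ≤ 2 * C ^ 2 * (n * n') := by positivity
  have hQ1 : ‖Q‖ ≤ 1 := hQ.trans (hCn'.trans h1)
  have hP1 : ‖P‖ ≤ 1 := hP.trans (hCn.trans h1)
  have n2 : ‖(2 : ℂ)‖ = 2 := by simp
  have n4 : ‖(4 : ℂ)‖ = 4 := by simp
  rintro ⟨y, γ⟩
  -- Only one fibre direction is used, the one whose coefficient in `d(4zw)` is the larger
  -- coordinate; the other component is set to zero.
  rcases le_total ‖z‖ ‖w‖ with hle | hle
  · obtain ⟨x, ζ, e1, e2⟩ := surjective_of_norm_lt hfin T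
      (((2 * z) • ContinuousLinearMap.id ℝ ℂ).prod (-(Q • ContinuousLinearMap.id ℝ ℂ))) m (4 * w)
      (half_pos hκ) hTv (β := 4) (fun ζ => by
        simp only [ContinuousLinearMap.prod_apply, Prod.norm_def]
        refine max_le ?_ ?_
        · simp only [smul_apply, ContinuousLinearMap.id_apply, smul_eq_mul, norm_mul, n2]
          exact mul_le_mul_of_nonneg_right (by linarith) (norm_nonneg _)
        · simp only [neg_apply, smul_apply, ContinuousLinearMap.id_apply, smul_eq_mul, norm_neg,
            norm_mul]
          exact mul_le_mul_of_nonneg_right (by linarith) (norm_nonneg _)) hmv hμ (by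
        rw [norm_mul, n4]
        refine hsmall _ (norm_nonneg _) (hzw.trans ?_)
        rw [pow_two ‖w‖]
        exact mul_le_mul_of_nonneg_left (mul_le_mul_of_nonneg_right hle (norm_nonneg _))
          (by positivity)) y γ
    refine ⟨(x, ζ, 0), ?_⟩
    rw [key, ← e1, ← e2]
    simp
  · obtain ⟨x, ζ, e1, e2⟩ := surjective_of_norm_lt hfin T
      ((-(P • ContinuousLinearMap.id ℝ ℂ)).prod ((2 * w) • ContinuousLinearMap.id ℝ ℂ)) m (4 * z)
      (half_pos hκ) hTv (β := 4) (fun ζ => by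
        simp only [ContinuousLinearMap.prod_apply, Prod.norm_def]
        refine max_le ?_ ?_
        · simp only [neg_apply, smul_apply, ContinuousLinearMap.id_apply, smul_eq_mul, norm_neg,
            norm_mul]
          exact mul_le_mul_of_nonneg_right (by linarith) (norm_nonneg _)
        · simp only [smul_apply, ContinuousLinearMap.id_apply, smul_eq_mul, norm_mul, n2]
          exact mul_le_mul_of_nonneg_right (by linarith) (norm_nonneg _)) hmv hμ (by
        rw [norm_mul, n4]
        refine hsmall _ (norm_nonneg _) (hzw.trans ?_)
        rw [pow_two ‖z‖]
        exact mul_le_mul_of_nonneg_left (mul_le_mul_of_nonneg_left hle (norm_nonneg _))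
          (by positivity)) y γ
    refine ⟨(x, 0, ζ), ?_⟩
    rw [key, ← e1, ← e2]
    simp

/-- The cube of the size of a cusp point. -/
lemma IsCuspPoint.norm_le {f g φ ψ z w : ℂ} (h : IsCuspPoint f g φ ψ z w) {b : ℝ} (hφ : ‖φ‖ ≤ b)
    (hψ : ‖ψ‖ ≤ b) : ‖z‖ ≤ b / 2 ∧ ‖w‖ ≤ b / 2 := by
  have hb : 0 ≤ b := (norm_nonneg _).trans hφ
  have n8 : ‖(8 : ℂ)‖ = 8 := by simp
  have h1 : 8 * ‖z‖ ^ 3 ≤ b ^ 3 := by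
    have := congrArg norm h.cube_z
    rw [norm_mul, norm_pow, norm_neg, norm_mul, norm_pow, n8] at this
    rw [this, pow_succ b 2]
    gcongr
  have h2 : 8 * ‖w‖ ^ 3 ≤ b ^ 3 := by
    have := congrArg norm h.cube_w
    rw [norm_mul, norm_pow, norm_neg, norm_mul, norm_pow, n8] at this
    rw [this, pow_succ b 2]
    gcongr
  constructor
  · refine le_of_pow_le_pow_left₀ (n := 3) (by norm_num) (by positivity) ?_
    rw [div_pow]; linarith
  · refine le_of_pow_le_pow_left₀ (n := 3) (by norm_num) (by positivity) ?_
    rw [div_pow]; linarith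

/-- The invariants of the quartic defining the fibres. -/
def invI (f g φ : ℂ) : ℂ := 4 * f ^ 2 - 3 * φ ^ 2 * g
def invJ (f g φ ψ : ℂ) : ℂ := -128 * f ^ 3 + 144 * (f * g) * φ ^ 2 - 27 * φ ^ 4 * ψ ^ 2

/-- This is the classical relation `27 disc = 4 I³ - J²` for the quartic, whose invariant `I` is `4
invI` and whose discriminant is `16 φ⁴ fibreDisc`. It exhibits the cusp, with `I` and `J` as
prospective coordinates. -/
lemma fibreDisc_eq_inv (f g φ ψ : ℂ) :
    432 * φ ^ 4 * fibreDisc f g φ ψ = 256 * invI f g φ ^ 3 - invJ f g φ ψ ^ 2 := by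
  unfold fibreDisc invI invJ; ring

lemma IsCuspPoint.inv_eq_zero {f g φ ψ z w : ℂ} (h : IsCuspPoint f g φ ψ z w) :
    invI f g φ = 0 ∧ invJ f g φ ψ = 0 := by
  have e : φ ^ 2 * w ^ 2 = 4 * z ^ 4 := by
    have := h.phi_mul
    linear_combination (w * φ - 2 * z ^ 2) * this
  have e2 : φ ^ 4 * ψ ^ 2 = 64 * z ^ 6 := by
    have := h.cube_z
    linear_combination (-8 * z ^ 3 + φ ^ 2 * ψ) * this
  rw [invI, invJ, h.f_eq, h.g_eq]
  constructor
  · linear_combination -9 * e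
  · linear_combination 1296 * z ^ 2 * e - 27 * e2

lemma hasFDerivAt_inv {F G P Q : Model → ℂ} {a : Model} {F' G' P' Q' : Model →L[ℝ] ℂ}
    (hF : HasFDerivAt F F' a) (hG : HasFDerivAt G G' a) (hP : HasFDerivAt P P' a)
    (hQ : HasFDerivAt Q Q' a) :
    HasFDerivAt (fun a => invI (F a) (G a) (P a)) ((8 * F a) • F' - (3 * P a ^ 2) • G' -
        (6 * P a * G a) • P') a ∧
    HasFDerivAt (fun a => invJ (F a) (G a) (P a) (Q a))
      ((-384 * F a ^ 2 + 144 * G a * P a ^ 2) • F' + (144 * F a * P a ^ 2) • G' +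
        (288 * F a * G a * P a - 108 * P a ^ 3 * Q a ^ 2) • P' -
        (54 * P a ^ 4 * Q a) • Q') a := by
  constructor
  · have h := ((hF.pow 2).const_mul 4).sub (((hP.pow 2).const_mul 3).mul hG)
    refine h.congr_fderiv ?_
    ext v; simp; ring
  · have h := (((hF.pow 3).const_mul (-128)).add (((hF.mul hG).const_mul 144).mul (hP.pow 2))).sub
      (((hP.pow 4).const_mul 27).mul (hQ.pow 2))
    refine h.congr_fderiv ?_
    ext v; simp; ring

/-- The kernel of the derivative of the invariants at a cusp point. -/
lemma IsCuspPoint.kernel {f g φ ψ z w df dg dφ dψ : ℂ} (h : IsCuspPoint f g φ ψ z w)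
    (h1 : 8 * f * df - 3 * φ ^ 2 * dg - 6 * φ * g * dφ = 0)
    (h2 : (-384 * f ^ 2 + 144 * g * φ ^ 2) * df + 144 * f * φ ^ 2 * dg +
      (288 * f * g * φ - 108 * φ ^ 3 * ψ ^ 2) * dφ - 54 * φ ^ 4 * ψ * dψ = 0) :
    df = z ^ 2 * (4 * (dφ / φ) + 2 * (dψ / ψ)) ∧ dg = w ^ 2 * (2 * (dφ / φ) + 4 * (dψ / ψ)) := by
  have hφ := h.phi_ne
  have hψ := h.psi_ne
  have hz := h.z_ne
  have hw := h.w_ne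
  obtain ⟨x, rfl⟩ : ∃ x, dφ = φ * x := ⟨dφ / φ, by field_simp⟩
  obtain ⟨y, rfl⟩ : ∃ y, dψ = ψ * y := ⟨dψ / ψ, by field_simp⟩
  rw [mul_div_cancel_left₀ x hφ, mul_div_cancel_left₀ y hψ]
  have e : φ ^ 2 * w ^ 2 = 4 * z ^ 4 := by
    have := h.phi_mul
    linear_combination (w * φ - 2 * z ^ 2) * this
  have e2 : φ ^ 4 * ψ ^ 2 = 64 * z ^ 6 := by
    have := h.cube_z
    linear_combination (-8 * z ^ 3 + φ ^ 2 * ψ) * this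
  rw [h.f_eq, h.g_eq] at h1 h2
  have k1 : 24 * z ^ 2 * df - 3 * φ ^ 2 * dg - 72 * z ^ 4 * x = 0 := by
    linear_combination h1 + 18 * x * e
  have k2 : -1728 * z ^ 4 * df + 432 * z ^ 2 * φ ^ 2 * dg + 3456 * z ^ 6 * x - 3456 * z ^ 6 * y = 0 := by
    linear_combination h2 - (432 * df + 2592 * z ^ 2 * x) * e + (108 * x + 54 * y) * e2
  have hdf : df = z ^ 2 * (4 * x + 2 * y) := by
    have : 1728 * z ^ 4 * (df - z ^ 2 * (4 * x + 2 * y)) = 0 := by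
      linear_combination k2 + 144 * z ^ 2 * k1
    have h0 : (1728 : ℂ) * z ^ 4 ≠ 0 := mul_ne_zero (by norm_num) (pow_ne_zero _ hz)
    exact sub_eq_zero.1 ((mul_eq_zero.1 this).resolve_left h0)
  refine ⟨hdf, ?_⟩
  have : φ ^ 2 * (dg - w ^ 2 * (2 * x + 4 * y)) = 0 := by
    linear_combination -k1 / 3 + 8 * z ^ 2 * hdf - (2 * x + 4 * y) * e
  exact sub_eq_zero.1 ((mul_eq_zero.1 this).resolve_left (pow_ne_zero _ hφ))

/-- The invariants are local coordinates at a cusp point. -/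
lemma IsCuspPoint.bijective {F G P Q : Model → ℂ} {a : Model} {z w : ℂ} {κ C ε : ℝ}
    (h : IsCuspPoint (F a) (G a) (P a) (Q a) z w)
    (hT : ∀ v, κ * ‖v‖ ≤ ‖((fderiv ℝ F a).prod (fderiv ℝ G a)) v‖) (hC : 0 < C)
    (hF : DifferentiableAt ℝ F a) (hG : DifferentiableAt ℝ G a)
    (hP : DifferentiableAt ℝ P a) (hQ : DifferentiableAt ℝ Q a)
    (hP' : ∀ v, ‖fderiv ℝ P a v / P a‖ ≤ C ^ 2 * ‖v‖)
    (hQ' : ∀ v, ‖fderiv ℝ Q a v / Q a‖ ≤ C ^ 2 * ‖v‖)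
    (hPε : ‖P a‖ ≤ C * ε) (hQε : ‖Q a‖ ≤ C * ε) (hε : 2 * C ^ 4 * ε ^ 2 < κ) :
    Function.Bijective ((fderiv ℝ (fun a => invJ (F a) (G a) (P a) (Q a)) a).prod
      (fderiv ℝ (fun a => invI (F a) (G a) (P a)) a)) := by
  obtain ⟨dI, dJ⟩ := hasFDerivAt_inv hF.hasFDerivAt hG.hasFDerivAt hP.hasFDerivAt hQ.hasFDerivAt
  rw [dI.fderiv, dJ.fderiv]
  apply bijective_of_injective_of_finrank_eq
  · simp [Module.finrank_prod, finrank_model, Complex.finrank_real_complex]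
  rw [injective_iff_map_eq_zero]
  intro v hv
  have e2 := congrArg Prod.fst hv
  have e1 := congrArg Prod.snd hv
  simp only [ContinuousLinearMap.prod_apply, add_apply, sub_apply, smul_apply, smul_eq_mul,
    Prod.fst_zero, Prod.snd_zero] at e1 e2
  obtain ⟨k1, k2⟩ := h.kernel e1 e2
  obtain ⟨bz, bw⟩ := h.norm_le hPε hQε
  have hb : 0 ≤ C * ε := (norm_nonneg _).trans hPε
  -- On the common kernel of `dI` and `dJ` the vector `(dF, dG) v` consists of `z²` and `w²` times
  -- logarithmic derivatives of `P` and `Q`. As `|z|, |w| ≤ Cε/2`, it is at most `6 (Cε/2)² C² ‖v‖`,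
  -- too small for the lower bound `κ` unless `v = 0`.
  have key : ∀ (s : ℂ) (x y α β : ℂ), ‖s‖ ≤ C * ε / 2 → ‖x‖ ≤ C ^ 2 * ‖v‖ → ‖y‖ ≤ C ^ 2 * ‖v‖ →
      ‖α‖ + ‖β‖ ≤ 6 → ‖s ^ 2 * (α * x + β * y)‖ ≤ 2 * C ^ 4 * ε ^ 2 * ‖v‖ := by
    intro s x y α β hs hx hy hαβ
    rw [norm_mul, norm_pow]
    have h1 : ‖α * x + β * y‖ ≤ 6 * (C ^ 2 * ‖v‖) := by
      refine (norm_add_le _ _).trans ?_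
      rw [norm_mul, norm_mul]
      calc _ ≤ ‖α‖ * (C ^ 2 * ‖v‖) + ‖β‖ * (C ^ 2 * ‖v‖) := by gcongr
        _ = (‖α‖ + ‖β‖) * (C ^ 2 * ‖v‖) := by ring
        _ ≤ _ := by gcongr
    calc ‖s‖ ^ 2 * ‖α * x + β * y‖ ≤ (C * ε / 2) ^ 2 * (6 * (C ^ 2 * ‖v‖)) := by gcongr
      _ = 3 / 2 * (C ^ 4 * ε ^ 2 * ‖v‖) := by ring
      _ ≤ _ := by
        have : 0 ≤ C ^ 4 * ε ^ 2 * ‖v‖ := by positivity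
        linarith
  have c1 : ‖((fderiv ℝ F a).prod (fderiv ℝ G a)) v‖ ≤ 2 * C ^ 4 * ε ^ 2 * ‖v‖ := by
    rw [ContinuousLinearMap.prod_apply, Prod.norm_def]
    refine max_le ?_ ?_
    · rw [k1]; exact key z _ _ 4 2 bz (hP' v) (hQ' v) (by norm_num)
    · rw [k2]; exact key w _ _ 2 4 bw (hP' v) (hQ' v) (by norm_num)
  by_contra hv0
  have hpos := norm_pos_iff.2 hv0
  have := (hT v).trans c1
  exact absurd (le_of_mul_le_mul_right this hpos) (not_le.2 hε)

/-- A cube root of `p² q` near `1`. -/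
def cubeRoot (v : ℂ × ℂ) : ℂ := Complex.exp ((2 * Complex.log v.1 + Complex.log v.2) / 3)

/-- The relative position of the cusps. -/
def cuspMap (v : ℂ × ℂ) : ℂ × ℂ := (cubeRoot v ^ 2, cubeRoot v ^ 4 / v.1 ^ 2)

lemma cubeRoot_pow {v : ℂ × ℂ} (h1 : v.1 ≠ 0) (h2 : v.2 ≠ 0) :
    cubeRoot v ^ 3 = v.1 ^ 2 * v.2 := by
  rw [cubeRoot, ← Complex.exp_nat_mul]
  have : ((3 : ℕ) : ℂ) * ((2 * Complex.log v.1 + Complex.log v.2) / 3) =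
      (2 : ℕ) * Complex.log v.1 + Complex.log v.2 := by push_cast; ring
  rw [this, Complex.exp_add, Complex.exp_nat_mul, Complex.exp_log h1, Complex.exp_log h2]

lemma cuspMap_one : cuspMap (1, 1) = (1, 1) := by simp [cuspMap, cubeRoot]

lemma contDiffAt_cuspMap : ContDiffAt ℝ 1 cuspMap (1, 1) := by
  have h1 : ContDiffAt ℝ 1 (fun v : ℂ × ℂ => Complex.log v.1) (1, 1) :=
    ((Complex.contDiffAt_log (n := 1) (by simp)).restrict_scalars ℝ).comp _ contDiffAt_fst
  have h2 : ContDiffAt ℝ 1 (fun v : ℂ × ℂ => Complex.log v.2) (1, 1) :=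
    ((Complex.contDiffAt_log (n := 1) (by simp)).restrict_scalars ℝ).comp _ contDiffAt_snd
  have h3 : ContDiffAt ℝ 1 cubeRoot (1, 1) :=
    ((contDiffAt_const.mul h1).add h2 |>.div_const 3).cexp
  have h4 : ContDiffAt ℝ 1 (fun v : ℂ × ℂ => (v.1 ^ 2)⁻¹) (1, 1) :=
    (contDiffAt_fst.pow 2).inv (by simp)
  exact (h3.pow 2).prodMk (by simpa only [div_eq_mul_inv] using (h3.pow 4).mul h4)

/-- From `8z³ = -φ²ψ` follows `z = ζ z₀ e`, with `z₀` the solution for the reference values `k`,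
`l`, with `e³ = p²q` and `ζ³ = 1`; then `w = -2z²/φ`. The unknowns `z`, `w` disappear and one
equation for the position remains for each `ζ`. -/
lemma isCuspPoint_iff_exists {f g k l p q z₀ w₀ e : ℂ} (hk : k ≠ 0) (hl : l ≠ 0) (hp : p ≠ 0)
    (hq : q ≠ 0) (hz₀ : 8 * z₀ ^ 3 = -(k ^ 2 * l)) (hw₀ : w₀ * k = -2 * z₀ ^ 2)
    (he : e ^ 3 = p ^ 2 * q) :
    (∃ z w, IsCuspPoint f g (k * p) (l * q) z w) ↔
      ∃ ζ : ℂ, ζ ^ 3 = 1 ∧ f = 3 * ζ ^ 2 * z₀ ^ 2 * e ^ 2 ∧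
        g = 3 * ζ ^ 4 * w₀ ^ 2 * (e ^ 4 / p ^ 2) := by
  have hz₀0 : z₀ ≠ 0 := by
    rintro rfl
    have : k ^ 2 * l = 0 := by linear_combination hz₀
    simp [hk, hl] at this
  have he0 : e ≠ 0 := by
    rintro rfl
    have : p ^ 2 * q = 0 := by rw [← he]; ring
    simp [hp, hq] at this
  obtain rfl : w₀ = -2 * z₀ ^ 2 / k := by rw [eq_div_iff hk, hw₀]
  constructor
  · rintro ⟨z, w, h⟩
    have hz3 : z ^ 3 = z₀ ^ 3 * e ^ 3 := by
      linear_combination h.cube_z / 8 - hz₀ * e ^ 3 / 8 + k ^ 2 * l / 8 * he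
    have hw : w = -2 * z ^ 2 / (k * p) := by
      rw [eq_div_iff h.phi_ne]; exact h.phi_mul
    refine ⟨z / (z₀ * e), ?_, ?_, ?_⟩
    · rw [div_pow, hz3, mul_pow, div_self]
      exact mul_ne_zero (pow_ne_zero _ hz₀0) (pow_ne_zero _ he0)
    · rw [h.f_eq]; field_simp
    · rw [h.g_eq, hw]; field_simp
  · rintro ⟨ζ, hζ, rfl, rfl⟩
    have hζ0 : ζ ≠ 0 := by rintro rfl; simp at hζ
    refine ⟨ζ * z₀ * e, ζ ^ 2 * (-2 * z₀ ^ 2 / k) * (e ^ 2 / p), ?_, ?_, ?_, ?_, ?_,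
      mul_ne_zero hk hp, mul_ne_zero hl hq⟩
    · ring
    · field_simp
    · field_simp
    · field_simp
      linear_combination (8 * ζ ^ 3 * z₀ ^ 3) * he + (p ^ 2 * q * ζ ^ 3) * hz₀ -
        k ^ 2 * l * p ^ 2 * q * hζ
    · field_simp
      linear_combination (-8 * ζ ^ 3 * z₀ ^ 3) * he - (p ^ 2 * q * ζ ^ 3) * hz₀ +
        k ^ 2 * l * p ^ 2 * q * hζ

lemma encard_cubeRoots : {ζ : ℂ | ζ ^ 3 = 1}.encard = 3 := by
  have h := (Complex.isPrimitiveRoot_exp 3 (by norm_num)).card_nthRootsFinset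
  have : {ζ : ℂ | ζ ^ 3 = 1} = (Polynomial.nthRootsFinset 3 (1 : ℂ) : Set ℂ) := by
    ext ζ; simp
  rw [this, encard_coe_eq_coe_finsetCard, h]; rfl

/-- Relative to its value at the centre, a tame function has a Lipschitz constant independent of
`n`. -/
lemma IsTame.norm_sub_le {P : Model → ℂ} {a₀ a b : Model} {R C n : ℝ} (h : IsTame P a₀ R C n)
    (hC : 0 < C) (ha : a ∈ Metric.ball a₀ R) (hb : b ∈ Metric.ball a₀ R) :
    ‖(P a₀)⁻¹ * P a - (P a₀)⁻¹ * P b‖ ≤ C ^ 2 * ‖a - b‖ := by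
  have hR : 0 < R := Metric.nonempty_ball.1 ⟨a, ha⟩
  have h₀ : a₀ ∈ Metric.ball a₀ R := Metric.mem_ball_self hR
  have h1 := (convex_ball a₀ R).norm_image_sub_le_of_norm_fderiv_le (𝕜 := ℝ) (f := P) (C := C * n)
    (fun x hx => (h.hasFDerivAt hx).differentiableAt) h.norm_fderiv_le hb ha
  have hp := norm_pos_iff.2 (h.ne_zero h₀)
  rw [← mul_sub, norm_mul, norm_inv, inv_mul_le_iff₀ hp]
  have h2 := mul_le_mul_of_nonneg_right (h.le_norm a₀ h₀) (mul_nonneg hC.le (norm_nonneg (a - b)))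
  nlinarith

lemma exists_equiv_bound {T : Model →L[ℝ] ℂ × ℂ} (hT : Function.Bijective T) :
    ∃ (e : Model ≃L[ℝ] ℂ × ℂ) (κ : ℝ), (e : Model →L[ℝ] ℂ × ℂ) = T ∧ 0 < κ ∧
      κ = ‖(e.symm : ℂ × ℂ →L[ℝ] Model)‖⁻¹ ∧ ∀ v, κ * ‖v‖ ≤ ‖T v‖ := by
  let e : Model ≃L[ℝ] ℂ × ℂ := ContinuousLinearEquiv.ofBijective T
    (LinearMap.ker_eq_bot.2 hT.1) (LinearMap.range_eq_top.2 hT.2)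
  have heT : ∀ v, e v = T v := fun v => rfl
  have hpos : 0 < ‖(e.symm : ℂ × ℂ →L[ℝ] Model)‖ := by
    rw [norm_pos_iff]
    intro h0
    have := congrArg (fun S : ℂ × ℂ →L[ℝ] Model => e (S (1, 1))) h0
    simp at this
  refine ⟨e, _, rfl, inv_pos.2 hpos, rfl, fun v => ?_⟩
  rw [inv_mul_le_iff₀ hpos, ← heT]
  have := (e.symm : ℂ × ℂ →L[ℝ] Model).le_opNorm (e v)
  simpa using this

/-- Existence and uniqueness of the solution of a perturbed system of equations. -/
lemma existsUnique_perturbed {Θ H : Model → ℂ × ℂ} {e : Model ≃L[ℝ] ℂ × ℂ} {a₀ : Model}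
    {κ r η : ℝ} (hκ : 0 < κ) (hκe : κ = ‖(e.symm : ℂ × ℂ →L[ℝ] Model)‖⁻¹)
    (he : ∀ v, κ * ‖v‖ ≤ ‖e v‖) (hr : 0 < r)
    (hΘ : ∀ a ∈ Metric.ball a₀ r, ∀ b ∈ Metric.ball a₀ r,
      ‖Θ a - Θ b - e (a - b)‖ ≤ κ / 4 * ‖a - b‖)
    (hH : ∀ a ∈ Metric.ball a₀ r, ∀ b ∈ Metric.ball a₀ r, ‖H a - H b‖ ≤ η * ‖a - b‖)
    (hη : η ≤ κ / 4) (hΘ0 : Θ a₀ = 0) (hH0 : ‖H a₀‖ ≤ κ * r / 4) :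
    ∃! a, a ∈ Metric.ball a₀ r ∧ Θ a = H a := by
  have happ : ∀ a ∈ Metric.ball a₀ r, ∀ b ∈ Metric.ball a₀ r,
      ‖(Θ a - H a) - (Θ b - H b) - e (a - b)‖ ≤ κ / 2 * ‖a - b‖ := by
    intro a ha b hb
    have : (Θ a - H a) - (Θ b - H b) - e (a - b) = (Θ a - Θ b - e (a - b)) - (H a - H b) := by abel
    rw [this]
    refine (norm_sub_le _ _).trans ?_
    have h1 := hΘ a ha b hb
    have h2 := (hH a ha b hb).trans (mul_le_mul_of_nonneg_right hη (norm_nonneg _))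
    linarith
  have hsub : Metric.closedBall a₀ (r / 2) ⊆ Metric.ball a₀ r :=
    Metric.closedBall_subset_ball (by linarith)
  have hlin : ApproximatesLinearOn (fun a => Θ a - H a) (e : Model →L[ℝ] ℂ × ℂ)
      (Metric.ball a₀ r) (Real.toNNReal (κ / 2)) := by
    intro a ha b hb
    rw [Real.coe_toNNReal _ (half_pos hκ).le]
    exact happ a ha b hb
  -- The difference `Θ - H` deviates from `e` by at most `κ/2`, so the image of the ball of radius
  -- `r/2` contains a ball of radius `(κ - κ/2) r/2 = κr/4` around `-H a₀`, hence `0`. The same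
  -- estimate gives uniqueness.
  have hsurj := hlin.surjOn_closedBall_of_nonlinearRightInverse e.toNonlinearRightInverse
    (half_pos hr).le hsub
  have hrad : (((e.toNonlinearRightInverse.nnnorm : ℝ≥0) : ℝ)⁻¹ - (Real.toNNReal (κ / 2) : ℝ))
      * (r / 2) = κ * r / 4 := by
    rw [Real.coe_toNNReal _ (half_pos hκ).le]
    have : ((e.toNonlinearRightInverse.nnnorm : ℝ≥0) : ℝ)⁻¹ = κ := hκe.symm
    rw [this]; ring
  rw [hrad] at hsurj
  obtain ⟨a, ha, ha0⟩ := hsurj (a := 0) (by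
    rw [mem_closedBall_iff_norm]
    simpa [hΘ0] using hH0)
  refine ⟨a, ⟨hsub ha, sub_eq_zero.1 ha0⟩, ?_⟩
  rintro b ⟨hb, hb0⟩
  have h1 := happ b hb a (hsub ha)
  rw [sub_eq_zero.2 hb0, show Θ a - H a = 0 from ha0, sub_zero, zero_sub, norm_neg] at h1
  have h2 := (he (b - a)).trans h1
  have h3 : ‖b - a‖ = 0 := by nlinarith [norm_nonneg (b - a)]
  exact sub_eq_zero.1 (norm_eq_zero.1 h3)

/-- Near a transversal intersection point of `F = 0` and `G = 0`, a small tame perturbation has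
exactly three cusps. -/
theorem exists_encard_cusps {F G : Model → ℂ} {a₀ : Model} (hF : ContDiffAt ℝ ∞ F a₀)
    (hG : ContDiffAt ℝ ∞ G a₀) (hF0 : F a₀ = 0) (hG0 : G a₀ = 0)
    (hb : Function.Bijective ((fderiv ℝ F a₀).prod (fderiv ℝ G a₀))) {R C : ℝ} (hR : 0 < R)
    (hC : 0 < C) :
    ∃ r₀ : ℝ, 0 < r₀ ∧ r₀ ≤ R ∧ ∀ r : ℝ, 0 < r → r ≤ r₀ → ∃ ε : ℝ, 0 < ε ∧
      ∀ (P Q : Model → ℂ) (n n' : ℝ), IsTame P a₀ R C n → IsTame Q a₀ R C n' → n < ε → n' < ε →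
        {a ∈ Metric.ball a₀ r | ∃ z w, IsCuspPoint (F a) (G a) (P a) (Q a) z w}.encard = 3 := by
  obtain ⟨e, κ, heT, hκ, hκe, hκv⟩ := exists_equiv_bound hb
  have hstrict : HasStrictFDerivAt (fun a => (F a, G a)) (e : Model →L[ℝ] ℂ × ℂ) a₀ := by
    rw [heT]
    exact (hF.hasStrictFDerivAt (by simp)).prodMk (hG.hasStrictFDerivAt (by simp))
  have hκ4 : 0 < Real.toNNReal (κ / 4) := Real.toNNReal_pos.2 (by positivity)
  obtain ⟨s, hs, hlin⟩ := hstrict.approximates_deriv_on_nhds (Or.inr hκ4)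
  obtain ⟨r₁, hr₁, hsr⟩ := Metric.mem_nhds_iff.1 hs
  obtain ⟨K, t, ht, hK⟩ := contDiffAt_cuspMap.exists_lipschitzOnWith
  obtain ⟨σ, hσ, hσt⟩ := Metric.mem_nhds_iff.1 ht
  -- On the ball of radius `r₀` the relative values `pq` move by less than `σ`, so they stay in the
  -- set where `cuspMap` is Lipschitz.
  set r₀ := min (min r₁ R) (min σ 1 / (2 * C ^ 2)) with hr₀
  have hσ1 : 0 < min σ 1 := lt_min hσ one_pos
  have hr₀pos : 0 < r₀ := by positivity
  refine ⟨r₀, hr₀pos, (min_le_left _ _).trans (min_le_right _ _), fun r hr hrr => ?_⟩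
  have hrr₁ : r ≤ r₁ := hrr.trans ((min_le_left _ _).trans (min_le_left _ _))
  have hrR : r ≤ R := hrr.trans ((min_le_left _ _).trans (min_le_right _ _))
  have hrC : C ^ 2 * r ≤ min σ 1 / 2 := by
    have := hrr.trans (min_le_right _ _)
    rw [le_div_iff₀ (by positivity)] at this
    linarith
  -- `B` will bound `3z₀²` and `3w₀²`. The first entry makes the Lipschitz constant `B K C²` of the
  -- right-hand side at most `κ/4`, the second bounds its value at the centre by `κr/4`.
  set B := min (κ / (4 * (K * C ^ 2 + 1))) (κ * r / 4) with hB
  have hB0 : 0 < B := by positivity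
  have hBη : B * (K * C ^ 2) ≤ κ / 4 := by
    have h1 : B ≤ κ / (4 * (K * C ^ 2 + 1)) := min_le_left _ _
    rw [le_div_iff₀ (by positivity)] at h1
    nlinarith
  -- Chosen so that `(Cε)² = B`; since `|z₀|, |w₀| ≤ Cε/2`, one gets `|3z₀²|, |3w₀²| ≤ 3B/4`.
  set ε := Real.sqrt B / C with hε
  have hε0 : 0 < ε := by positivity
  refine ⟨ε, hε0, fun P Q n n' hP hQ hn hn' => ?_⟩
  have ha₀ : a₀ ∈ Metric.ball a₀ R := Metric.mem_ball_self hR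
  have hballR : Metric.ball a₀ r ⊆ Metric.ball a₀ R := Metric.ball_subset_ball hrR
  set k := P a₀ with hk
  set l := Q a₀ with hl
  have hk0 : k ≠ 0 := hP.ne_zero ha₀
  have hl0 : l ≠ 0 := hQ.ne_zero ha₀
  obtain ⟨z₀, hz₀'⟩ := IsAlgClosed.exists_pow_nat_eq (-(k ^ 2 * l) / 8) (n := 3) (by norm_num)
  have hz₀ : 8 * z₀ ^ 3 = -(k ^ 2 * l) := by rw [hz₀']; ring
  set w₀ := -2 * z₀ ^ 2 / k with hw₀'
  have hw₀ : w₀ * k = -2 * z₀ ^ 2 := by rw [hw₀']; field_simp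
  -- the size of the base solution
  have hkn : ‖k‖ ≤ C * ε := (hP.norm_le a₀ ha₀).trans (mul_le_mul_of_nonneg_left hn.le hC.le)
  have hln : ‖l‖ ≤ C * ε := (hQ.norm_le a₀ ha₀).trans (mul_le_mul_of_nonneg_left hn'.le hC.le)
  -- With `f` and `g` replaced by `3z₀²` and `3w₀²`, the reference values form a cusp point, so the
  -- general size estimate applies to them.
  have hcusp₀ : IsCuspPoint (3 * z₀ ^ 2) (3 * w₀ ^ 2) k l z₀ w₀ := by
    refine ⟨rfl, rfl, hw₀, ?_, ?_, hk0, hl0⟩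
    · rw [hw₀']; field_simp; linear_combination z₀ * hz₀
    · rw [hw₀']; field_simp; linear_combination -hz₀
  obtain ⟨hzb, hwb⟩ := hcusp₀.norm_le hkn hln
  have hCε : (C * ε) ^ 2 = B := by
    rw [hε, mul_div_cancel₀ _ hC.ne', Real.sq_sqrt hB0.le]
  have hz2 : ‖3 * z₀ ^ 2‖ ≤ B := by
    have n3 : ‖(3 : ℂ)‖ = 3 := by simp
    rw [norm_mul, norm_pow, n3]
    nlinarith [norm_nonneg z₀]
  have hw2 : ‖3 * w₀ ^ 2‖ ≤ B := by
    have n3 : ‖(3 : ℂ)‖ = 3 := by simp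
    rw [norm_mul, norm_pow, n3]
    nlinarith [norm_nonneg w₀]
  -- relative coordinates
  set pq : Model → ℂ × ℂ := fun a => (k⁻¹ * P a, l⁻¹ * Q a) with hpq
  have hpqL : ∀ a ∈ Metric.ball a₀ R, ∀ b ∈ Metric.ball a₀ R,
      ‖pq a - pq b‖ ≤ C ^ 2 * ‖a - b‖ := by
    intro a ha b hb
    rw [Prod.norm_def]
    exact max_le (hP.norm_sub_le hC ha hb) (hQ.norm_sub_le hC ha hb)
  have hpq0 : pq a₀ = (1, 1) := by simp [hpq, ← hk, ← hl, hk0, hl0]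
  have hpqt : ∀ a ∈ Metric.ball a₀ r, pq a ∈ t := by
    intro a ha
    apply hσt
    rw [mem_ball_iff_norm, ← hpq0]
    refine (hpqL a (hballR ha) a₀ ha₀).trans_lt ?_
    have h1 : ‖a - a₀‖ < r := mem_ball_iff_norm.1 ha
    have h2 : C ^ 2 * ‖a - a₀‖ < C ^ 2 * r := by gcongr
    have h3 : min σ 1 ≤ σ := min_le_left _ _
    linarith
  set H : ℂ → Model → ℂ × ℂ := fun ζ a =>
    (3 * ζ ^ 2 * z₀ ^ 2 * (cuspMap (pq a)).1, 3 * ζ ^ 4 * w₀ ^ 2 * (cuspMap (pq a)).2) with hH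
  have hiff : ∀ a ∈ Metric.ball a₀ r, (∃ z w, IsCuspPoint (F a) (G a) (P a) (Q a) z w) ↔
      ∃ ζ : ℂ, ζ ^ 3 = 1 ∧ (F a, G a) = H ζ a := by
    intro a ha
    have hPa := hP.ne_zero (hballR ha)
    have hQa := hQ.ne_zero (hballR ha)
    have e1 : k * (pq a).1 = P a := by simp [hpq]; field_simp
    have e2 : l * (pq a).2 = Q a := by simp [hpq]; field_simp
    have hp0 : (pq a).1 ≠ 0 := mul_ne_zero (inv_ne_zero hk0) hPa
    have hq0 : (pq a).2 ≠ 0 := mul_ne_zero (inv_ne_zero hl0) hQa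
    have := isCuspPoint_iff_exists (f := F a) (g := G a) hk0 hl0 hp0 hq0 hz₀ hw₀
      (cubeRoot_pow hp0 hq0)
    rw [e1, e2] at this
    rw [this]
    simp only [hH, cuspMap, Prod.mk.injEq]
  have hζn : ∀ ζ : ℂ, ζ ^ 3 = 1 → ‖ζ‖ = 1 := fun ζ hζ =>
    Complex.norm_eq_one_of_pow_eq_one hζ (by norm_num)
  have hex : ∀ ζ : ℂ, ζ ^ 3 = 1 → ∃! a, a ∈ Metric.ball a₀ r ∧ (F a, G a) = H ζ a := by
    intro ζ hζ
    have hn1 := hζn ζ hζ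
    have c1 : ‖3 * ζ ^ 2 * z₀ ^ 2‖ ≤ B := by
      have : 3 * ζ ^ 2 * z₀ ^ 2 = ζ ^ 2 * (3 * z₀ ^ 2) := by ring
      rw [this, norm_mul, norm_pow, hn1]; simpa using hz2
    have c2 : ‖3 * ζ ^ 4 * w₀ ^ 2‖ ≤ B := by
      have : 3 * ζ ^ 4 * w₀ ^ 2 = ζ ^ 4 * (3 * w₀ ^ 2) := by ring
      rw [this, norm_mul, norm_pow, hn1]; simpa using hw2
    refine existsUnique_perturbed (Θ := fun a => (F a, G a)) (η := B * (K * C ^ 2)) hκ hκe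
      (fun v => by rw [← heT] at hκv; exact hκv v) hr ?_ ?_ hBη (by simp [hF0, hG0]) ?_
    · intro a ha b hb
      have := hlin a (hsr (Metric.ball_subset_ball hrr₁ ha)) b (hsr (Metric.ball_subset_ball hrr₁ hb))
      rwa [Real.coe_toNNReal _ (by positivity)] at this
    · intro a ha b hb
      have h1 := hK.norm_sub_le (hpqt a ha) (hpqt b hb)
      have h2 := hpqL a (hballR ha) b (hballR hb)
      have h3 : ‖cuspMap (pq a) - cuspMap (pq b)‖ ≤ K * C ^ 2 * ‖a - b‖ := by
        refine h1.trans ?_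
        rw [mul_assoc]
        exact mul_le_mul_of_nonneg_left h2 K.2
      rw [Prod.norm_def]
      refine max_le ?_ ?_
      · simp only [hH, Prod.fst_sub, ← mul_sub, norm_mul (3 * ζ ^ 2 * z₀ ^ 2)]
        rw [mul_assoc B]
        exact mul_le_mul c1 ((norm_fst_le _).trans h3) (norm_nonneg _) hB0.le
      · simp only [hH, Prod.snd_sub, ← mul_sub, norm_mul (3 * ζ ^ 4 * w₀ ^ 2)]
        rw [mul_assoc B]
        exact mul_le_mul c2 ((norm_snd_le _).trans h3) (norm_nonneg _) hB0.le
    · simp only [hH, hpq0, cuspMap_one, mul_one]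
      rw [Prod.norm_def]
      exact (max_le c1 c2).trans (min_le_right _ _)
  choose! α hα hαu using hex
  have hset : {a ∈ Metric.ball a₀ r | ∃ z w, IsCuspPoint (F a) (G a) (P a) (Q a) z w} =
      α '' {ζ : ℂ | ζ ^ 3 = 1} := by
    ext a
    constructor
    · rintro ⟨ha, hc⟩
      obtain ⟨ζ, hζ, hζa⟩ := (hiff a ha).1 hc
      exact ⟨ζ, hζ, (hαu ζ hζ a ⟨ha, hζa⟩).symm⟩
    · rintro ⟨ζ, hζ, rfl⟩
      exact ⟨(hα ζ hζ).1, (hiff _ (hα ζ hζ).1).2 ⟨ζ, hζ, (hα ζ hζ).2⟩⟩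
  -- Different cube roots of unity give different points: equality would force `ζ² = ξ²`, and
  -- squaring is injective on cube roots of unity.
  rw [hset, InjOn.encard_image, encard_cubeRoots]
  intro ζ hζ ξ hξ heq
  have e1 := congrArg Prod.fst (hα ζ hζ).2
  have e2 := congrArg Prod.fst (hα ξ hξ).2
  rw [← heq, e1] at e2
  simp only [hH] at e2
  have hcne : (cuspMap (pq (α ζ))).1 ≠ 0 := by
    simp [cuspMap, cubeRoot, Complex.exp_ne_zero]
  have hz2ne : z₀ ^ 2 ≠ 0 := pow_ne_zero _ hcusp₀.z_ne
  have h2 : ζ ^ 2 = ξ ^ 2 := by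
    have := mul_right_cancel₀ hz2ne (mul_right_cancel₀ hcne e2)
    linear_combination this / 3
  have hζ1 : ζ ^ 3 = 1 := hζ
  have hζ2 : ξ ^ 3 = 1 := hξ
  calc ζ = (ζ ^ 2) ^ 2 := by linear_combination -ζ * hζ1
    _ = (ξ ^ 2) ^ 2 := by rw [h2]
    _ = ξ := by linear_combination ξ * hζ2

/-! ### The cusps near `M` -/

/-- Expressing `f` and `g` by `φ` and `ψ` alone shows that both are small when the perturbation is,
so cusps occur only near `M`. -/
lemma IsCuspPoint.cube_eq {f g φ ψ z w : ℂ} (h : IsCuspPoint f g φ ψ z w) :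
    64 * f ^ 3 = 27 * φ ^ 4 * ψ ^ 2 ∧ 64 * g ^ 3 = 27 * ψ ^ 4 * φ ^ 2 := by
  rw [h.f_eq, h.g_eq]
  constructor
  · linear_combination 27 * (8 * z ^ 3 - φ ^ 2 * ψ) * h.cube_z
  · linear_combination 27 * (8 * w ^ 3 - ψ ^ 2 * φ) * h.cube_w

/-- The derivative bound allows a variation of at most `C n R ≤ c n / 2` on the ball, so half of the
lower bound at the centre persists everywhere. -/
lemma isTame_of_bounds {P : Model → ℂ} {a₀ : Model} {R C c n : ℝ} (hC : 0 < C) (hc : 0 < c)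
    (hn : 0 < n) (hP : ContDiffOn ℝ ∞ P (Metric.ball a₀ R))
    (h1 : ∀ a ∈ Metric.ball a₀ R, ‖P a‖ ≤ C * n)
    (h2 : ∀ a ∈ Metric.ball a₀ R, ‖fderiv ℝ P a‖ ≤ C * n) (h3 : c * n ≤ ‖P a₀‖)
    (hR : C * R ≤ c / 2) : IsTame P a₀ R (max C (2 / c)) n where
  pos := hn
  contDiffOn := hP
  norm_le a ha := (h1 a ha).trans (mul_le_mul_of_nonneg_right (le_max_left _ _) hn.le)
  norm_fderiv_le a ha := (h2 a ha).trans (mul_le_mul_of_nonneg_right (le_max_left _ _) hn.le)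
  le_norm a ha := by
    have hR0 : 0 < R := Metric.nonempty_ball.1 ⟨a, ha⟩
    have h4 := (convex_ball a₀ R).norm_image_sub_le_of_norm_fderiv_le (𝕜 := ℝ) (f := P)
      (fun x hx => (hP.contDiffAt (Metric.isOpen_ball.mem_nhds hx)).differentiableAt (by simp))
      h2 ha (Metric.mem_ball_self hR0)
    have h5 : ‖a₀ - a‖ ≤ R := by
      rw [norm_sub_rev]; exact (mem_ball_iff_norm.1 ha).le
    have h6 := norm_sub_norm_le (P a₀) (P a)
    have h7 : C * n * ‖a₀ - a‖ ≤ c / 2 * n := by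
      calc C * n * ‖a₀ - a‖ ≤ C * n * R := mul_le_mul_of_nonneg_left h5 (by positivity)
        _ = C * R * n := by ring
        _ ≤ _ := mul_le_mul_of_nonneg_right hR hn.le
    have h8 : c / 2 * n ≤ ‖P a‖ := by linarith
    calc n = 2 / c * (c / 2 * n) := by field_simp
      _ ≤ 2 / c * ‖P a‖ := mul_le_mul_of_nonneg_left h8 (by positivity)
      _ ≤ _ := mul_le_mul_of_nonneg_right (le_max_right _ _) (norm_nonneg _)

section Forms

variable {X : Type*} [TopologicalSpace X] [ChartedSpace Model X] [IsManifold 𝓘(ℂ, Model) ω X]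

/-- The cusp of the discriminant at a point where its invariants vanish transversally. -/
lemma hasCuspAt_fibreDisc {F G P Q : X → ℂ} {x₀ x : X} (hxc : x ∈ (chartAt Model x₀).source)
    {O : Set X} (hO : IsOpen O) (hx : x ∈ O)
    (hF : ContMDiffOn 𝓘(ℝ, Model) 𝓘(ℝ, ℂ) ∞ F O) (hG : ContMDiffOn 𝓘(ℝ, Model) 𝓘(ℝ, ℂ) ∞ G O)
    (hP : ContMDiffOn 𝓘(ℝ, Model) 𝓘(ℝ, ℂ) ∞ P O) (hQ : ContMDiffOn 𝓘(ℝ, Model) 𝓘(ℝ, ℂ) ∞ Q O)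
    {z w : ℂ} (hc : IsCuspPoint (F x) (G x) (P x) (Q x) z w)
    (ht : Function.Bijective
      ((fderiv ℝ (inChart x₀ fun y => invJ (F y) (G y) (P y) (Q y)) (chartAt Model x₀ x)).prod
        (fderiv ℝ (inChart x₀ fun y => invI (F y) (G y) (P y)) (chartAt Model x₀ x)))) :
    HasCuspAt (fun y => fibreDisc (F y) (G y) (P y) (Q y)) x := by
  -- A cube root of `256` turns `J² - 256 I³` into `u² - v³` with `u = J`, `v = k I`; the unit is
  -- `-(432 P⁴)⁻¹`, whence the restriction to `P ≠ 0`.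
  obtain ⟨k, hk⟩ := IsAlgClosed.exists_pow_nat_eq (256 : ℂ) (n := 3) (by norm_num)
  have hk0 : k ≠ 0 := by rintro rfl; norm_num at hk
  have hO' : IsOpen (O ∩ P ⁻¹' {0}ᶜ) := hP.continuousOn.isOpen_inter_preimage hO isOpen_compl_singleton
  have hxO' : x ∈ O ∩ P ⁻¹' {0}ᶜ := ⟨hx, hc.phi_ne⟩
  have hsub : O ∩ P ⁻¹' {0}ᶜ ⊆ O := inter_subset_left
  have hv := (hF.prodMk_space (hG.prodMk_space (hP.prodMk_space hQ))).mono hsub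
  have sJ : ContDiff ℝ ∞ (fun v : ℂ × ℂ × ℂ × ℂ => invJ v.1 v.2.1 v.2.2.1 v.2.2.2) := by
    unfold invJ; fun_prop
  have sI : ContDiff ℝ ∞ (fun v : ℂ × ℂ × ℂ × ℂ => invI v.1 v.2.1 v.2.2.1) := by
    unfold invI; fun_prop
  have hJ : ContMDiffOn 𝓘(ℝ, Model) 𝓘(ℝ, ℂ) ∞ (fun y => invJ (F y) (G y) (P y) (Q y))
      (O ∩ P ⁻¹' {0}ᶜ) := by
    have := sJ.contMDiff.comp_contMDiffOn hv
    exact this.congr fun y _ => rfl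
  have hI : ContMDiffOn 𝓘(ℝ, Model) 𝓘(ℝ, ℂ) ∞ (fun y => invI (F y) (G y) (P y))
      (O ∩ P ⁻¹' {0}ᶜ) := by
    have := sI.contMDiff.comp_contMDiffOn hv
    exact this.congr fun y _ => rfl
  have hkI : ContMDiffOn 𝓘(ℝ, Model) 𝓘(ℝ, ℂ) ∞ (fun y => k * invI (F y) (G y) (P y))
      (O ∩ P ⁻¹' {0}ᶜ) := contMDiffOn_mul contMDiffOn_const hI
  have sH : ContDiffOn ℝ ∞ (fun p : ℂ => -(432 * p ^ 4)⁻¹) {0}ᶜ := by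
    intro p hp
    have hp0 : 432 * p ^ 4 ≠ 0 := mul_ne_zero (by norm_num) (pow_ne_zero _ hp)
    exact ((contDiffAt_const.mul (contDiffAt_id.pow 4)).inv hp0).neg.contDiffWithinAt
  have hH : ContMDiffOn 𝓘(ℝ, Model) 𝓘(ℝ, ℂ) ∞ (fun y => -(432 * P y ^ 4)⁻¹) (O ∩ P ⁻¹' {0}ᶜ) :=
    sH.contMDiffOn.comp (hP.mono hsub) inter_subset_right
  obtain ⟨i0, j0⟩ := hc.inv_eq_zero
  refine ⟨O ∩ P ⁻¹' {0}ᶜ, fun y => invJ (F y) (G y) (P y) (Q y),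
    fun y => k * invI (F y) (G y) (P y), fun y => -(432 * P y ^ 4)⁻¹, hO', hxO', hJ, hkI, hH, j0,
    by simp only [i0, mul_zero], ?_, fun y hy => ?_, fun y hy => ?_⟩
  · have dJ := differentiableAt_inChart_of_contMDiffOn hxc hO' hxO' hJ
    have dI := differentiableAt_inChart_of_contMDiffOn hxc hO' hxO' hI
    have dkI := differentiableAt_inChart_of_contMDiffOn hxc hO' hxO' hkI
    rw [isTransverseAt_iff hxc dJ dkI]
    have e : fderiv ℝ (inChart x₀ fun y => k * invI (F y) (G y) (P y)) (chartAt Model x₀ x) =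
        k • fderiv ℝ (inChart x₀ fun y => invI (F y) (G y) (P y)) (chartAt Model x₀ x) :=
      (dI.hasFDerivAt.const_mul k).fderiv
    rw [e]
    apply bijective_of_injective_of_finrank_eq
    · simp [Module.finrank_prod, finrank_model, Complex.finrank_real_complex]
    rw [injective_iff_map_eq_zero]
    intro ξ hξ
    have k1 := congrArg Prod.fst hξ
    have k2 := congrArg Prod.snd hξ
    simp only [ContinuousLinearMap.prod_apply, smul_apply, smul_eq_mul, Prod.fst_zero,
      Prod.snd_zero] at k1 k2
    apply ht.1
    rw [map_zero]
    exact Prod.ext k1 ((mul_eq_zero.1 k2).resolve_left hk0)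
  · exact neg_ne_zero.2 (inv_ne_zero (mul_ne_zero (by norm_num) (pow_ne_zero _ hy.2)))
  · have hp : P y ≠ 0 := hy.2
    have := fibreDisc_eq_inv (F y) (G y) (P y) (Q y)
    have e : fibreDisc (F y) (G y) (P y) (Q y) =
        (432 * P y ^ 4)⁻¹ * (256 * invI (F y) (G y) (P y) ^ 3 - invJ (F y) (G y) (P y) (Q y) ^ 2) := by
      rw [← this]; field_simp
    simp only [e]
    rw [mul_pow, hk]; ring

end Forms

section Cover

variable {X : Type*} [TopologicalSpace X] [T2Space X] [ChartedSpace Model X]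
  [IsManifold 𝓘(ℂ, Model) ω X]
  {L₁ : X → Type*} [∀ x, AddCommGroup (L₁ x)] [∀ x, Module ℂ (L₁ x)]
  {L₂ : X → Type*} [∀ x, AddCommGroup (L₂ x)] [∀ x, Module ℂ (L₂ x)]
  [∀ x, TopologicalSpace (L₁ x)] [TopologicalSpace (TotalSpace ℂ L₁)] [FiberBundle ℂ L₁]
  [VectorBundle ℂ ℂ L₁]
  [∀ x, TopologicalSpace (L₂ x)] [TopologicalSpace (TotalSpace ℂ L₂)] [FiberBundle ℂ L₂]
  [VectorBundle ℂ ℂ L₂]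
  [ContMDiffVectorBundle ω ℂ L₁ 𝓘(ℂ, Model)] [ContMDiffVectorBundle ω ℂ L₂ 𝓘(ℂ, Model)]
  {f : ∀ x, L₁ x ⊗[ℂ] L₁ x} {g : ∀ x, L₂ x ⊗[ℂ] L₂ x} {𝒦 : C1Cover L₁ L₂}

namespace Perturbation

lemma eventually_lt {ε : ℝ} (hε : 0 < ε) : ∀ᶠ t in small 𝒦, t.N < ε ∧ t.N' < ε := by
  filter_upwards [tendsto_size.eventually (eventually_lt_nhds hε)] with t ht
  exact ⟨((le_max_left _ _).trans (le_max_left _ _)).trans_lt ht,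
    ((le_max_right _ _).trans (le_max_left _ _)).trans_lt ht⟩

/-- In the limit jet `φ = ψ = 0`, so the relation `64 f³ = 27 φ⁴ψ²` or its mirror image fails there
if `f` or `g` is nonzero. The failure persists nearby. -/
lemma eventually_notMem_of_ne (hf : IsHolomorphicSection f) (hg : IsHolomorphicSection g) {x₀ : X}
    (hx₀ : ¬ (f x₀ = 0 ∧ g x₀ = 0)) :
    ∀ᶠ q in small 𝒦 ×ˢ 𝓝 x₀, (∀ y, RegularZ f g q.1.Φ q.1.Ψ y y) →
      q.2 ∉ singDelta f g q.1.Φ q.1.Ψ \ trivialSing f g q.1.Φ q.1.Ψ := by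
  refine eventually_of_chart (p := fun y t => (∀ y, RegularZ f g t.Φ t.Ψ y y) →
      y ∉ singDelta f g t.Φ t.Ψ \ trivialSing f g t.Φ t.Ψ) ?_
  have hx : x₀ ∈ coordDomain L₁ L₂ x₀ := mem_coordDomain x₀
  rw [← sqRep_eq_zero_iff f hx.2.1, ← sqRep_eq_zero_iff g hx.2.2] at hx₀
  have hc : ∀ᶠ j : Jet in 𝓝 ((sqRep f x₀ x₀, sqRep g x₀ x₀, 0, 0),
      (fderiv ℝ (locSq f x₀) (chartAt Model x₀ x₀),
        fderiv ℝ (locSq g x₀) (chartAt Model x₀ x₀), 0, 0)),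
      ¬ ∃ z w, IsCuspPoint j.1.1 j.1.2.1 j.1.2.2.1 j.1.2.2.2 z w := by
    rcases not_and_or.1 hx₀ with h | h
    · have c : Continuous fun j : Jet => 64 * j.1.1 ^ 3 - 27 * j.1.2.2.1 ^ 4 * j.1.2.2.2 ^ 2 := by
        fun_prop
      filter_upwards [c.continuousAt.eventually_ne (y := 0) (by simpa using h)] with j hj
      rintro ⟨z, w, hzw⟩
      exact hj (sub_eq_zero.2 hzw.cube_eq.1)
    · have c : Continuous fun j : Jet => 64 * j.1.2.1 ^ 3 - 27 * j.1.2.2.2 ^ 4 * j.1.2.2.1 ^ 2 := by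
        fun_prop
      filter_upwards [c.continuousAt.eventually_ne (y := 0) (by simpa using h)] with j hj
      rintro ⟨z, w, hzw⟩
      exact hj (sub_eq_zero.2 hzw.cube_eq.2)
  filter_upwards [(tendsto_jet (𝒦 := 𝒦) hf hg x₀).eventually hc] with q hq y hy hyq hr
  rw [(q.1.isSmoothData hf hg).mem_singDelta_diff_iff hr hy]
  rw [← hyq] at hq
  simpa only [jet, locSq, locHom, inChart_apply hy.1] using hq

/-- Off given neighbourhoods of the points of `M`, small perturbations are as simple as
possible. -/
theorem eventually_off [CompactSpace X] (hf : IsHolomorphicSection f)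
    (hg : IsHolomorphicSection g) (hfs : IsSmoothDivisor f) (hgs : IsSmoothDivisor g)
    {W : X → Set X} (hW : ∀ x, f x = 0 → g x = 0 → W x ∈ 𝓝 x) :
    ∀ᶠ t in small 𝒦, ∀ y, (∃ x, (f x = 0 ∧ g x = 0) ∧ y ∈ W x) ∨
      (RegularR f g t.Φ t.Ψ y y ∧ ((∀ y, RegularZ f g t.Φ t.Ψ y y) →
        y ∉ singDelta f g t.Φ t.Ψ \ trivialSing f g t.Φ t.Ψ)) := by
  refine eventually_forall (p := fun y t => (∃ x, (f x = 0 ∧ g x = 0) ∧ y ∈ W x) ∨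
      (RegularR f g t.Φ t.Ψ y y ∧ ((∀ y, RegularZ f g t.Φ t.Ψ y y) →
        y ∉ singDelta f g t.Φ t.Ψ \ trivialSing f g t.Φ t.Ψ))) fun x₀ => ?_
  by_cases hx₀ : f x₀ = 0 ∧ g x₀ = 0
  · filter_upwards [Filter.Eventually.prod_inr (hW x₀ hx₀.1 hx₀.2) (small 𝒦)] with q hq
    exact Or.inl ⟨x₀, hx₀, hq⟩
  · filter_upwards [eventually_regularR_of_ne hf hg hfs hgs hx₀,
      eventually_notMem_of_ne hf hg hx₀] with q h1 h2
    exact Or.inr ⟨h1, h2⟩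

/-- The sections of a perturbation are comparable to their norms near a point of `S`. -/
lemma exists_isTame (S : Set X) {c : ℝ} (hc : 0 < c) {x₀ : X} (hx₀ : x₀ ∈ S) :
    ∃ R C : ℝ, 0 < R ∧ 0 < C ∧ Metric.ball (chartAt Model x₀ x₀) R ⊆ coordTarget L₁ L₂ x₀ ∧
      ∀ t : Perturbation 𝒦, t.Φ x₀ ≠ 0 → t.Ψ x₀ ≠ 0 →
        𝒦.AbsGE (homRep t.Φ) S (c * t.N) → 𝒦.AbsGE (homRep t.Ψ) S (c * t.N') →
        IsTame (locHom t.Φ x₀) (chartAt Model x₀ x₀) R C t.N ∧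
        IsTame (locHom t.Ψ x₀) (chartAt Model x₀ x₀) R C t.N' := by
  have hx : x₀ ∈ coordDomain L₁ L₂ x₀ := mem_coordDomain x₀
  obtain ⟨C, hC, hb⟩ := exists_bounds 𝒦 x₀
  obtain ⟨c₁, hc₁, hl₁⟩ := exists_lower_bound_left (𝒦 := 𝒦) S hc hx₀
  obtain ⟨c₂, hc₂, hl₂⟩ := exists_lower_bound_right (𝒦 := 𝒦) S hc hx₀
  obtain ⟨R₀, hR₀, hball⟩ := Metric.eventually_nhds_iff_ball.1
    (hb.and ((isOpen_coordTarget (L₁ := L₁) (L₂ := L₂) x₀).mem_nhds (chart_mem_coordTarget hx)))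
  set d := min c₁ c₂ with hd
  have hd0 : 0 < d := lt_min hc₁ hc₂
  -- The radius is small enough for the variation of the sections to stay below half of their lower
  -- bound `d` at the centre.
  set R := min R₀ (d / (2 * C)) with hR
  have hRpos : 0 < R := by positivity
  have hRC : C * R ≤ d / 2 := by
    have : R ≤ d / (2 * C) := min_le_right _ _
    rw [le_div_iff₀ (by positivity)] at this
    linarith
  have hsub : Metric.ball (chartAt Model x₀ x₀) R ⊆ Metric.ball (chartAt Model x₀ x₀) R₀ :=
    Metric.ball_subset_ball (min_le_left _ _)
  refine ⟨R, max C (2 / d), hRpos, lt_max_of_lt_left hC, fun a ha => (hball a (hsub ha)).2,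
    fun t hΦ hΨ hg₁ hg₂ => ?_⟩
  have hbt := fun a ha => (hball a (hsub ha)).1 t
  have h0 := hbt _ (Metric.mem_ball_self hRpos)
  have e1 : locHom t.Φ x₀ (chartAt Model x₀ x₀) = homRep t.Φ x₀ x₀ := inChart_apply hx.1 _
  have e2 : locHom t.Ψ x₀ (chartAt Model x₀ x₀) = homRep t.Ψ x₀ x₀ := inChart_apply hx.1 _
  -- A norm bound `N = 0` would force the section to vanish at `x₀`.
  have hN : 0 < t.N := by
    refine lt_of_le_of_ne h0.1 fun h => ?_
    have := h0.2.2.1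
    rw [← h, mul_zero, norm_le_zero_iff, e1, homRep_eq_zero_iff t.Φ hx.2.1 hx.2.2] at this
    exact hΦ this
  have hN' : 0 < t.N' := by
    refine lt_of_le_of_ne h0.2.1 fun h => ?_
    have := h0.2.2.2.2.1
    rw [← h, mul_zero, norm_le_zero_iff, e2, homRep_eq_zero_iff t.Ψ hx.2.2 hx.2.1] at this
    exact hΨ this
  have hsm : ∀ a ∈ Metric.ball (chartAt Model x₀ x₀) R, ContDiffAt ℝ ∞ (locHom t.Φ x₀) a ∧
      ContDiffAt ℝ ∞ (locHom t.Ψ x₀) a := by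
    intro a ha
    have hat := (hball a (hsub ha)).2
    have hy := symm_mem_coordDomain hat
    have := (chartAt Model x₀).right_inv hat.1
    have h1 := contDiffAt_locHom_left t.smooth_left hy
    have h2 := contDiffAt_locHom_right t.smooth_right hy
    rw [this] at h1 h2
    exact ⟨h1, h2⟩
  constructor
  · refine isTame_of_bounds hC hd0 hN (fun a ha => (hsm a ha).1.contDiffWithinAt)
      (fun a ha => (hbt a ha).2.2.1) (fun a ha => (hbt a ha).2.2.2.1) ?_ hRC
    rw [e1]
    exact (mul_le_mul_of_nonneg_right (min_le_left _ _) hN.le).trans (hl₁ t hg₁)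
  · refine isTame_of_bounds hC hd0 hN' (fun a ha => (hsm a ha).2.contDiffWithinAt)
      (fun a ha => (hbt a ha).2.2.2.2.1) (fun a ha => (hbt a ha).2.2.2.2.2) ?_ hRC
    rw [e2]
    exact (mul_le_mul_of_nonneg_right (min_le_right _ _) hN'.le).trans (hl₂ t hg₂)

/-- Near a point of `M` the ramification curve is smooth and the branch curve has three cusps. -/
theorem exists_near (hf : IsHolomorphicSection f) (hg : IsHolomorphicSection g)
    (hfg : ∀ x, f x = 0 → g x = 0 → IsTransverseAt (sqRep f x) (sqRep g x) x)
    (S : Set X) {c : ℝ} (hc : 0 < c) {x₀ : X} (hx₀ : x₀ ∈ S) (hfx : f x₀ = 0) (hgx : g x₀ = 0)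
    {U : Set X} (hU : U ∈ 𝓝 x₀) :
    ∃ W ∈ 𝓝 x₀, W ⊆ U ∧ ∀ᶠ t in small 𝒦, (∀ y, RegularZ f g t.Φ t.Ψ y y) → t.Φ x₀ ≠ 0 →
      t.Ψ x₀ ≠ 0 → 𝒦.AbsGE (homRep t.Φ) S (c * t.N) → 𝒦.AbsGE (homRep t.Ψ) S (c * t.N') →
      (∀ y ∈ W, RegularR f g t.Φ t.Ψ y y) ∧
      (∀ y ∈ W, y ∈ singDelta f g t.Φ t.Ψ \ trivialSing f g t.Φ t.Ψ →
        HasCuspAt (deltaRep f g t.Φ t.Ψ y) y) ∧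
      ((singDelta f g t.Φ t.Ψ \ trivialSing f g t.Φ t.Ψ) ∩ W).encard = 3 := by
  have hx : x₀ ∈ coordDomain L₁ L₂ x₀ := mem_coordDomain x₀
  set a₀ := chartAt Model x₀ x₀ with ha₀
  have hf0 : sqRep f x₀ x₀ = 0 := (sqRep_eq_zero_iff f hx.2.1).2 hfx
  have hg0 : sqRep g x₀ x₀ = 0 := (sqRep_eq_zero_iff g hx.2.2).2 hgx
  have hb := bijective_fderiv hf hg hfg x₀ hf0 hg0
  have cF := contDiffAt_locSq_left (L₂ := L₂) hf hx
  have cG := contDiffAt_locSq_right (L₁ := L₁) hg hx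
  have hF0 : locSq f x₀ a₀ = 0 := (inChart_apply hx.1 _).trans hf0
  have hG0 : locSq g x₀ a₀ = 0 := (inChart_apply hx.1 _).trans hg0
  obtain ⟨R, C, hR, hC, hball, htame⟩ := exists_isTame (𝒦 := 𝒦) S hc hx₀
  obtain ⟨r₀, hr₀, hr₀R, hcount⟩ := exists_encard_cusps cF cG hF0 hG0 hb hR hC
  obtain ⟨-, κ₀, -, hκ₀, -, hκ₀v⟩ := exists_equiv_bound hb
  set κ := κ₀ / 2 with hκ
  have hκ0 : 0 < κ := half_pos hκ₀
  -- the derivative of `(f, g)` stays invertible near `x₀`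
  have cT : ContinuousAt (fun a => (fderiv ℝ (locSq f x₀) a).prod (fderiv ℝ (locSq g x₀) a)) a₀ := by
    have c1 := (cF.fderiv_right (m := 0) (by simp)).continuousAt
    have c2 := (cG.fderiv_right (m := 0) (by simp)).continuousAt
    have := (ContinuousLinearMap.prodₗᵢ ℝ (E := Model) (F := ℂ) (G := ℂ) (𝕜 := ℝ)).continuous
    exact this.continuousAt.comp (c1.prodMk c2)
  have evT : ∀ᶠ a in 𝓝 a₀, ∀ v, κ * ‖v‖ ≤
      ‖((fderiv ℝ (locSq f x₀) a).prod (fderiv ℝ (locSq g x₀) a)) v‖ := by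
    filter_upwards [Metric.tendsto_nhds.1 cT κ hκ0] with a ha v
    rw [dist_eq_norm] at ha
    have h1 := (((fderiv ℝ (locSq f x₀) a).prod (fderiv ℝ (locSq g x₀) a)) -
      ((fderiv ℝ (locSq f x₀) a₀).prod (fderiv ℝ (locSq g x₀) a₀))).le_opNorm v
    have h2 := h1.trans (mul_le_mul_of_nonneg_right ha.le (norm_nonneg v))
    rw [sub_apply] at h2
    have h3 := hκ₀v v
    have h4 := norm_sub_norm_le (((fderiv ℝ (locSq f x₀) a₀).prod (fderiv ℝ (locSq g x₀) a₀)) v)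
      (((fderiv ℝ (locSq f x₀) a).prod (fderiv ℝ (locSq g x₀) a)) v)
    rw [norm_sub_rev] at h4
    have : κ₀ * ‖v‖ = κ * ‖v‖ + κ * ‖v‖ := by rw [hκ]; ring
    linarith
  have evF : ∀ᶠ a in 𝓝 a₀, ‖locSq f x₀ a‖ ≤ 1 := by
    have := cF.continuousAt.norm
    exact this.eventually (eventually_le_nhds (by simp only; rw [← ha₀, hF0]; simp))
  have evG : ∀ᶠ a in 𝓝 a₀, ‖locSq g x₀ a‖ ≤ 1 := by
    have := cG.continuousAt.norm
    exact this.eventually (eventually_le_nhds (by simp only; rw [← ha₀, hG0]; simp))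
  have evU := eventually_chart (p := fun y => y ∈ U) hx.1 hU
  obtain ⟨r₁, hr₁, hall⟩ := Metric.eventually_nhds_iff_ball.1 (evT.and (evF.and (evG.and evU)))
  set r := min r₀ r₁ with hrdef
  have hr : 0 < r := lt_min hr₀ hr₁
  have hrR : r ≤ R := (min_le_left _ _).trans hr₀R
  have hrall := fun a (ha : a ∈ Metric.ball a₀ r) =>
    hall a (Metric.ball_subset_ball (min_le_right _ _) ha)
  have hrball : Metric.ball a₀ r ⊆ Metric.ball a₀ R := Metric.ball_subset_ball hrR
  obtain ⟨ε₁, hε₁, hcount'⟩ := hcount r hr (min_le_left _ _)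
  have hε₂ : ∃ ε : ℝ, 0 < ε ∧ C * ε ≤ 1 ∧ 4 * (C * ε) ≤ κ ∧ 16 * C ^ 3 * ε ≤ κ ∧
      2 * C ^ 4 * ε ^ 2 < κ := by
    have h1 : ∀ᶠ ε : ℝ in 𝓝 0, C * ε < 1 := by
      have : Continuous fun ε : ℝ => C * ε := by fun_prop
      exact this.continuousAt.eventually_lt continuousAt_const (by simp)
    have h2 : ∀ᶠ ε : ℝ in 𝓝 0, 4 * (C * ε) < κ := by
      have : Continuous fun ε : ℝ => 4 * (C * ε) := by fun_prop
      exact this.continuousAt.eventually_lt continuousAt_const (by simpa using hκ0)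
    have h3 : ∀ᶠ ε : ℝ in 𝓝 0, 16 * C ^ 3 * ε < κ := by
      have : Continuous fun ε : ℝ => 16 * C ^ 3 * ε := by fun_prop
      exact this.continuousAt.eventually_lt continuousAt_const (by simpa using hκ0)
    have h4 : ∀ᶠ ε : ℝ in 𝓝 0, 2 * C ^ 4 * ε ^ 2 < κ := by
      have : Continuous fun ε : ℝ => 2 * C ^ 4 * ε ^ 2 := by fun_prop
      exact this.continuousAt.eventually_lt continuousAt_const (by simpa using hκ0)
    have h5 : ∀ᶠ ε : ℝ in 𝓝[>] 0, 0 < ε := self_mem_nhdsWithin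
    obtain ⟨ε, ⟨k1, k2, k3, k4⟩, k0⟩ := ((Filter.Eventually.filter_mono nhdsWithin_le_nhds
      (h1.and (h2.and (h3.and h4)))).and h5).exists
    exact ⟨ε, k0, k1.le, k2.le, k3.le, k4⟩
  obtain ⟨ε₂, hε₂, b1, b2, b3, b4⟩ := hε₂
  set W : Set X := (chartAt Model x₀).symm '' Metric.ball a₀ r with hW
  have hcoord : ∀ a ∈ Metric.ball a₀ r, (chartAt Model x₀).symm a ∈ coordDomain L₁ L₂ x₀ ∧
      chartAt Model x₀ ((chartAt Model x₀).symm a) = a := fun a ha =>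
    ⟨symm_mem_coordDomain (hball (hrball ha)), (chartAt Model x₀).right_inv (hball (hrball ha)).1⟩
  refine ⟨W, ?_, ?_, ?_⟩
  · have h1 : (chartAt Model x₀).source ∩ chartAt Model x₀ ⁻¹' Metric.ball a₀ r ∈ 𝓝 x₀ :=
      ((chartAt Model x₀).isOpen_inter_preimage Metric.isOpen_ball).mem_nhds
        ⟨hx.1, Metric.mem_ball_self hr⟩
    filter_upwards [h1] with y hy
    exact ⟨_, hy.2, (chartAt Model x₀).left_inv hy.1⟩
  · rintro _ ⟨a, ha, rfl⟩
    exact (hrall a ha).2.2.2.1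
  filter_upwards [eventually_lt hε₁, eventually_lt hε₂] with t ht₁ ht₂ hreg hΦ hΨ hg₁ hg₂
  obtain ⟨tP, tQ⟩ := htame t hΦ hΨ hg₁ hg₂
  have hsd := t.isSmoothData hf hg
  have hle : ∀ a ∈ Metric.ball a₀ R, ‖locHom t.Φ x₀ a‖ ≤ C * ε₂ ∧ ‖locHom t.Ψ x₀ a‖ ≤ C * ε₂ :=
    fun a ha => ⟨(tP.norm_le a ha).trans (mul_le_mul_of_nonneg_left ht₂.1.le hC.le),
      (tQ.norm_le a ha).trans (mul_le_mul_of_nonneg_left ht₂.2.le hC.le)⟩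
  have hiff : ∀ a ∈ Metric.ball a₀ r, (chartAt Model x₀).symm a ∈ singDelta f g t.Φ t.Ψ \
      trivialSing f g t.Φ t.Ψ ↔ ∃ z w, IsCuspPoint (locSq f x₀ a) (locSq g x₀ a)
        (locHom t.Φ x₀ a) (locHom t.Ψ x₀ a) z w := fun a ha =>
    hsd.mem_singDelta_diff_iff hreg (hcoord a ha).1
  refine ⟨?_, ?_, ?_⟩
  · rintro _ ⟨a, ha, rfl⟩
    obtain ⟨hy, hya⟩ := hcoord a ha
    obtain ⟨hT, hFa, hGa, -⟩ := hrall a ha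
    have haR := hrball ha
    refine (t.regularR_of_jet hf hg hy fun u hu hur => ?_).change hsd (mem_coordDomain _) hy
    rw [hya] at hu hur ⊢
    -- All four coefficients of the fibre equations are at most `1` here, so the fibre coordinates
    -- are at most `2`.
    have hub := norm_le_of_mem_fibreSet hFa hGa ((hle a haR).1.trans b1) ((hle a haR).2.trans b1) hu
    have hn : (1 : ℝ) + 1 = 2 := by norm_num
    rw [hn] at hub
    exact derRam_surjective hκ0 hC tP.pos tQ.pos hT ((norm_fst_le u).trans hub)
      ((norm_snd_le u).trans hub) (tP.norm_le a haR) (tQ.norm_le a haR) (tP.norm_fderiv_le a haR)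
      (tQ.norm_fderiv_le a haR) (tP.le_norm a haR) (tQ.le_norm a haR) ht₂.1 ht₂.2 b1 b2 b3 hur
  · rintro _ ⟨a, ha, rfl⟩ hs
    obtain ⟨hy, hya⟩ := hcoord a ha
    have haR := hrball ha
    obtain ⟨z, w, hzw⟩ := (hiff a ha).1 hs
    have dF := (contDiffAt_locSq_left (L₂ := L₂) hf hy).differentiableAt (by simp)
    have dG := (contDiffAt_locSq_right (L₁ := L₁) hg hy).differentiableAt (by simp)
    rw [hya] at dF dG
    have hbij := hzw.bijective (hrall a ha).1 hC dF dG (tP.hasFDerivAt haR).differentiableAt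
      (tQ.hasFDerivAt haR).differentiableAt (tP.norm_fderiv_div_le hC haR)
      (tQ.norm_fderiv_div_le hC haR) (hle a haR).1 (hle a haR).2 b4
    refine IsSmoothData.hasNormalFormAt_deltaRep (mem_coordDomain _) hy ?_
    refine hasCuspAt_fibreDisc hy.1 (isOpen_baseSets (L₁ := L₁) (L₂ := L₂) x₀) hy.2
      (contMDiffOn_sqRep_left (L₂ := L₂) hf x₀) (contMDiffOn_sqRep_right (L₁ := L₁) hg x₀)
      (t.smooth_left x₀) ((t.smooth_right x₀).mono (inter_comm (baseSetAt L₁ x₀) _).subset)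
      hzw ?_
    rw [hya]
    exact hbij
  · rw [← hcount' _ _ _ _ tP tQ ht₁.1 ht₁.2]
    have himg : (singDelta f g t.Φ t.Ψ \ trivialSing f g t.Φ t.Ψ) ∩ W =
        (chartAt Model x₀).symm '' {a ∈ Metric.ball a₀ r | ∃ z w, IsCuspPoint (locSq f x₀ a)
          (locSq g x₀ a) (locHom t.Φ x₀ a) (locHom t.Ψ x₀ a) z w} := by
      ext y
      constructor
      · rintro ⟨hy, a, ha, rfl⟩
        exact ⟨a, ⟨ha, (hiff a ha).1 hy⟩, rfl⟩
      · rintro ⟨a, ⟨ha, hc⟩, rfl⟩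
        exact ⟨(hiff a ha).2 hc, a, ha, rfl⟩
    -- The chart is injective, so counting on the surface agrees with counting in the model.
    rw [himg, InjOn.encard_image]
    intro a ha b hb hab
    rw [← (hcoord a ha.1).2, hab, (hcoord b hb.1).2]

end Perturbation

end Cover

/-! ### Orientability of the ramification curve -/

section Det

/-- In a basis adapted to the product the matrix is block triangular, with diagonal blocks the
identity and `D`. -/
lemma det_eq_of_triangular {G Y : Type*} [AddCommGroup G] [Module ℝ G] [FiniteDimensional ℝ G]
    [AddCommGroup Y] [Module ℝ Y] [FiniteDimensional ℝ Y] (Q : G × Y →ₗ[ℝ] G × Y) (D : Y →ₗ[ℝ] Y)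
    (h₁ : ∀ v, (Q v).1 = v.1) (h₂ : ∀ y, (Q (0, y)).2 = D y) :
    LinearMap.det Q = LinearMap.det D := by
  let b := Module.finBasis ℝ G
  let b' := Module.finBasis ℝ Y
  have h : LinearMap.toMatrix (b.prod b') (b.prod b') Q =
      Matrix.fromBlocks 1 0 (LinearMap.toMatrix b b' (LinearMap.snd ℝ G Y ∘ₗ Q ∘ₗ LinearMap.inl ℝ G Y))
        (LinearMap.toMatrix b' b' D) := by
    ext (i | i) (k | k)
    · simp [LinearMap.toMatrix_apply, h₁, Matrix.one_apply, Finsupp.single_apply, eq_comm]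
    · simp [LinearMap.toMatrix_apply, h₁]
    · simp [LinearMap.toMatrix_apply]
    · simp [LinearMap.toMatrix_apply, h₂]
  rw [← LinearMap.det_toMatrix (b.prod b'), h, Matrix.det_fromBlocks_zero₁₂, Matrix.det_one, one_mul,
    LinearMap.det_toMatrix]

/-- A complex linear automorphism preserves the orientation. -/
lemma det_restrictScalars_pos {E : Type*} [AddCommGroup E] [Module ℂ E] [Module ℝ E]
    [IsScalarTower ℝ ℂ E] [FiniteDimensional ℂ E] {K : E →ₗ[ℂ] E} (hK : Function.Bijective K) :
    0 < LinearMap.det (K.restrictScalars ℝ) := by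
  have h0 : LinearMap.det K ≠ 0 :=
    ((LinearMap.isUnit_iff_isUnit_det K).1 ((Module.End.isUnit_iff K).2 hK)).ne_zero
  rw [LinearMap.det_restrictScalars, Algebra.norm_complex_apply]
  exact Complex.normSq_pos.2 h0

/-- The transition maps between charts of level sets which are defined by compatible orientations
preserve the orientation. -/
lemma det_transition_pos {E G Y : Type*} [AddCommGroup E] [Module ℝ E]
    [AddCommGroup G] [Module ℝ G] [FiniteDimensional ℝ G]
    [AddCommGroup Y] [Module ℝ Y] [FiniteDimensional ℝ Y] (j : (G × Y) ≃ₗ[ℝ] E)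
    {T₀ T₁ : E →ₗ[ℝ] G × Y} {K : E →ₗ[ℝ] E} {A : G →ₗ[ℝ] G} {S : Y →ₗ[ℝ] E} {D : Y →ₗ[ℝ] Y}
    (h₀ : 0 < LinearMap.det (T₀ ∘ₗ j.toLinearMap)) (h₁ : 0 < LinearMap.det (T₁ ∘ₗ j.toLinearMap))
    (hK : 0 < LinearMap.det K) (hA : 0 < LinearMap.det A)
    (hT : ∀ ξ, (T₀ ξ).1 = A (T₁ (K ξ)).1) (hS : ∀ y, T₀ (S y) = (0, y))
    (hD : ∀ y, (T₁ (K (S y))).2 = D y) : 0 < LinearMap.det D := by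
  have hu : Function.Bijective (T₀ ∘ₗ j.toLinearMap) :=
    (Module.End.isUnit_iff _).1 ((LinearMap.isUnit_iff_isUnit_det _).2 h₀.ne'.isUnit)
  let τ := LinearEquiv.ofBijective _ hu
  have hτ : ∀ v, T₀ (j (τ.symm v)) = v := fun v => τ.apply_symm_apply v
  have hτS : ∀ y, j (τ.symm (0, y)) = S y := by
    intro y
    have : τ (j.symm (S y)) = (0, y) := by
      change T₀ (j (j.symm (S y))) = _
      rw [j.apply_symm_apply, hS]
    rw [← this, τ.symm_apply_apply, j.apply_symm_apply]
  -- `Q` is `(A × id) T₁ K T₀⁻¹`. It preserves the `G`-component and restricts to `D` on `Y`, so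
  -- `det Q = det D`; the factorisation `hmul` computes the same determinant from factors of known
  -- sign.
  let Q : G × Y →ₗ[ℝ] G × Y := (A.prodMap LinearMap.id) ∘ₗ T₁ ∘ₗ K ∘ₗ j.toLinearMap ∘ₗ
    τ.symm.toLinearMap
  have hQ : LinearMap.det Q = LinearMap.det D := by
    refine det_eq_of_triangular Q D (fun v => ?_) fun y => ?_
    · change A (T₁ (K (j (τ.symm v)))).1 = v.1
      rw [← hT, hτ]
    · change (T₁ (K (j (τ.symm (0, y))))).2 = D y
      rw [hτS, hD]
  have hmul : Q ∘ₗ (T₀ ∘ₗ j.toLinearMap) = (A.prodMap LinearMap.id) ∘ₗ (T₁ ∘ₗ j.toLinearMap) ∘ₗ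
      (j.symm.toLinearMap ∘ₗ K ∘ₗ j.symm.symm.toLinearMap) := by
    ext1 <;> ext v <;>
    · have : ∀ v, τ.symm (T₀ (j v)) = v := fun v => τ.symm_apply_apply v
      simp [Q, this]
  have hdet := congrArg LinearMap.det hmul
  rw [LinearMap.det_comp Q, hQ, LinearMap.det_comp (A.prodMap (LinearMap.id : Y →ₗ[ℝ] Y)),
    LinearMap.det_comp (T₁ ∘ₗ j.toLinearMap), LinearMap.det_conj,
    LinearMap.det_prodMap, LinearMap.det_id, mul_one] at hdet
  have : 0 < LinearMap.det D * LinearMap.det (T₀ ∘ₗ j.toLinearMap) := by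
    rw [hdet]; positivity
  exact (pos_iff_pos_of_mul_pos this).2 h₀

/-- A surjective linear map extends to an orientation preserving isomorphism onto a product. -/
lemma exists_prod_det_pos {E G : Type*} [NormedAddCommGroup E] [NormedSpace ℝ E]
    [FiniteDimensional ℝ E] [NormedAddCommGroup G] [NormedSpace ℝ G] [FiniteDimensional ℝ G]
    (j : (G × EuclideanSpace ℝ (Fin 2)) ≃L[ℝ] E) {T : E →L[ℝ] G} (hT : Function.Surjective T) :
    ∃ B : E →L[ℝ] EuclideanSpace ℝ (Fin 2), Function.Bijective (T.prod B) ∧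
      0 < ((T.prod B).comp (j : G × EuclideanSpace ℝ (Fin 2) →L[ℝ] E)).det := by
  obtain ⟨B, hB⟩ := exists_bijective_prod (Y := EuclideanSpace ℝ (Fin 2)) (by
    rw [← j.toLinearEquiv.finrank_eq, Module.finrank_prod]) hT
  have key : ∀ B : E →L[ℝ] EuclideanSpace ℝ (Fin 2),
      ((T.prod B).comp (j : G × EuclideanSpace ℝ (Fin 2) →L[ℝ] E)).det ≠ 0 →
      Function.Bijective (T.prod B) := by
    intro B h
    have hu : Function.Bijective ((T.prod B).comp (j : G × EuclideanSpace ℝ (Fin 2) →L[ℝ] E)) :=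
      (Module.End.isUnit_iff _).1 ((LinearMap.isUnit_iff_isUnit_det _).2 (isUnit_iff_ne_zero.2 h))
    have : (T.prod B : E → _) = (T.prod B).comp (j : G × EuclideanSpace ℝ (Fin 2) →L[ℝ] E) ∘ j.symm := by
      funext v; simp
    rw [this]
    exact hu.comp j.symm.bijective
  have hne : ((T.prod B).comp (j : G × EuclideanSpace ℝ (Fin 2) →L[ℝ] E)).det ≠ 0 :=
    ((LinearMap.isUnit_iff_isUnit_det _).1 ((Module.End.isUnit_iff _).2
      (hB.comp j.bijective))).ne_zero
  rcases hne.lt_or_gt with hneg | hpos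
  · let ρ : EuclideanSpace ℝ (Fin 2) →ₗ[ℝ] EuclideanSpace ℝ (Fin 2) :=
      Matrix.toLin (EuclideanSpace.basisFun (Fin 2) ℝ).toBasis
        (EuclideanSpace.basisFun (Fin 2) ℝ).toBasis !![-1, 0; 0, 1]
    have hρ : LinearMap.det ρ = -1 := by
      rw [LinearMap.det_toLin, Matrix.det_fin_two]; norm_num
    have h : 0 < ((T.prod ((LinearMap.toContinuousLinearMap ρ).comp B)).comp
        (j : G × EuclideanSpace ℝ (Fin 2) →L[ℝ] E)).det := by
      have e : (((T.prod ((LinearMap.toContinuousLinearMap ρ).comp B)).comp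
          (j : G × EuclideanSpace ℝ (Fin 2) →L[ℝ] E)) : G × EuclideanSpace ℝ (Fin 2) →ₗ[ℝ] _) =
          (LinearMap.id.prodMap ρ) ∘ₗ
            ((T.prod B).comp (j : G × EuclideanSpace ℝ (Fin 2) →L[ℝ] E)).toLinearMap := rfl
      rw [ContinuousLinearMap.det, e, LinearMap.det_comp, LinearMap.det_prodMap, hρ,
        LinearMap.det_id]
      have : LinearMap.det ((T.prod B).comp
        (j : G × EuclideanSpace ℝ (Fin 2) →L[ℝ] E)).toLinearMap < 0 := hneg
      linarith
    exact ⟨_, key _ h.ne', h⟩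
  · exact ⟨B, hB, hpos⟩

end Det

/-! ### An oriented atlas of `R`. -/

section Cover

variable {X : Type*} [TopologicalSpace X] [T2Space X] [ChartedSpace Model X]
  [IsManifold 𝓘(ℂ, Model) ω X]
  {L₁ : X → Type*} [∀ x, AddCommGroup (L₁ x)] [∀ x, Module ℂ (L₁ x)]
  {L₂ : X → Type*} [∀ x, AddCommGroup (L₂ x)] [∀ x, Module ℂ (L₂ x)]
  [∀ x, TopologicalSpace (L₁ x)] [TopologicalSpace (TotalSpace ℂ L₁)] [FiberBundle ℂ L₁]
  [VectorBundle ℂ ℂ L₁]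
  [∀ x, TopologicalSpace (L₂ x)] [TopologicalSpace (TotalSpace ℂ L₂)] [FiberBundle ℂ L₂]
  [VectorBundle ℂ ℂ L₂]
  [ContMDiffVectorBundle ω ℂ L₁ 𝓘(ℂ, Model)] [ContMDiffVectorBundle ω ℂ L₂ 𝓘(ℂ, Model)]
  {f : ∀ x, L₁ x ⊗[ℂ] L₁ x} {g : ∀ x, L₂ x ⊗[ℂ] L₂ x}
  {Φ : ∀ x, L₂ x →ₗ[ℂ] L₁ x ⊗[ℂ] L₁ x} {Ψ : ∀ x, L₁ x →ₗ[ℂ] L₂ x ⊗[ℂ] L₂ x}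

/-- The diagonal linear map describing the change of the equations of `R`. -/
def ramScale (s t : ℂ) : (ℂ × ℂ) × ℂ →ₗ[ℂ] (ℂ × ℂ) × ℂ where
  toFun r := ((s ^ 2 * r.1.1, t ^ 2 * r.1.2), s * t * r.2)
  map_add' r r' := by simp [mul_add]
  map_smul' c r := by simp [mul_left_comm]

lemma ramScale_bijective {s t : ℂ} (hs : s ≠ 0) (ht : t ≠ 0) :
    Function.Bijective (ramScale s t) := by
  have : Function.Injective (ramScale s t) := by
    rw [injective_iff_map_eq_zero]
    intro r hr
    simpa [ramScale, Prod.ext_iff, hs, ht] using hr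
  exact ⟨this, (LinearMap.injective_iff_surjective (f := ramScale s t)).1 this⟩

variable (L₁ L₂) in
/-- The chart `φ` of a subset of the total space is given by the linear map `B` in the coordinates
around `x₀`, and is positively oriented with respect to the equations `H`. -/
def IsPositiveChart (j : (((ℂ × ℂ) × ℂ) × EuclideanSpace ℝ (Fin 2)) ≃L[ℝ] Model × (ℂ × ℂ))
    {S : Set (TotalV L₁ L₂)} (H : Model × (ℂ × ℂ) → (ℂ × ℂ) × ℂ) (x₀ : X)
    (B : Model × (ℂ × ℂ) →L[ℝ] EuclideanSpace ℝ (Fin 2))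
    (φ : OpenPartialHomeomorph S (EuclideanSpace ℝ (Fin 2))) : Prop :=
  ∀ q ∈ φ.source, q.1.proj ∈ coordDomain L₁ L₂ x₀ ∧ φ q = B (totalChart L₁ L₂ x₀ q) ∧
    0 < (((fderiv ℝ H (totalChart L₁ L₂ x₀ q)).prod B).comp
      (j : ((ℂ × ℂ) × ℂ) × EuclideanSpace ℝ (Fin 2) →L[ℝ] Model × (ℂ × ℂ))).det

/-- The linear map is chosen with the right sign at `p`. Positivity of the determinant is open, so
the local equation is restricted to the points where it holds before the chart is formed. -/
lemma IsSmoothData.exists_positiveChart (h : IsSmoothData f g Φ Ψ)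
    (hr : ∀ y, RegularR f g Φ Ψ y y)
    (j : (((ℂ × ℂ) × ℂ) × EuclideanSpace ℝ (Fin 2)) ≃L[ℝ] Model × (ℂ × ℂ))
    (p : ramificationR f g Φ Ψ) :
    ∃ φ : OpenPartialHomeomorph (ramificationR f g Φ Ψ) (EuclideanSpace ℝ (Fin 2)),
      p ∈ φ.source ∧ IsSubmanifoldChart modelV φ ∧
      ∃ B, IsPositiveChart L₁ L₂ j (locRam f g Φ Ψ p.1.proj) p.1.proj B φ := by
  have hp : p.1.proj ∈ coordDomain L₁ L₂ p.1.proj := mem_coordDomain _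
  have hsurj := (hr p.1.proj).surjective hp p.2
  obtain ⟨B, hB, hpos⟩ := exists_prod_det_pos j hsurj
  have heq := h.isLocalEquation_ramificationR p.1.proj
  set H := locRam f g Φ Ψ p.1.proj with hH
  set O := (totalChart L₁ L₂ p.1.proj).target with hO
  have hc : ContinuousOn (fun v => (((fderiv ℝ H v).prod B).comp
      (j : ((ℂ × ℂ) × ℂ) × EuclideanSpace ℝ (Fin 2) →L[ℝ] Model × (ℂ × ℂ))).det) O := by
    have h1 : ContinuousOn (fderiv ℝ H) O :=
      heq.contDiffOn.continuousOn_fderiv_of_isOpen heq.isOpen (by simp)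
    have h2 : Continuous fun T : Model × (ℂ × ℂ) →L[ℝ] (ℂ × ℂ) × ℂ => ((T.prod B).comp
        (j : ((ℂ × ℂ) × ℂ) × EuclideanSpace ℝ (Fin 2) →L[ℝ] Model × (ℂ × ℂ))).det := by
      have h3 : (fun T : Model × (ℂ × ℂ) →L[ℝ] (ℂ × ℂ) × ℂ => T.prod B) = fun T =>
          (ContinuousLinearMap.inl ℝ _ _).comp T + (ContinuousLinearMap.inr ℝ _ _).comp B := by
        funext T; ext <;> simp
      have h4 : Continuous fun T : Model × (ℂ × ℂ) →L[ℝ] (ℂ × ℂ) × ℂ => (T.prod B) := by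
        rw [h3]; fun_prop
      exact ContinuousLinearMap.continuous_det.comp (h4.clm_comp continuous_const)
    exact h2.comp_continuousOn h1
  have heq' : IsLocalEquation modelV (ramificationR f g Φ Ψ) (⟨p.1.proj, 0⟩ : TotalV L₁ L₂) H
      (O ∩ (fun v => (((fderiv ℝ H v).prod B).comp (j : ((ℂ × ℂ) × ℂ) × EuclideanSpace ℝ (Fin 2)
        →L[ℝ] Model × (ℂ × ℂ))).det) ⁻¹' Ioi 0) :=
    ⟨hc.isOpen_inter_preimage heq.isOpen isOpen_Ioi, inter_subset_left.trans heq.subset,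
      heq.contDiffOn.mono inter_subset_left, fun v hv => heq.mem_iff v hv.1⟩
  obtain ⟨φ, hpφ, hφ, hφB⟩ := heq'.exists_submanifoldChart B p (mem_totalChart_source.2 hp)
    ⟨(totalChart L₁ L₂ _).map_source (mem_totalChart_source.2 hp), hpos⟩ hB
  refine ⟨φ, hpφ, hφ, B, fun q hq => ?_⟩
  obtain ⟨h1, h2, h3, -⟩ := hφB q hq
  exact ⟨mem_totalChart_source.1 h1, h3, h2.2⟩

theorem isSmoothSubmanifold_ramificationR (h : IsSmoothData f g Φ Ψ)
    (hr : ∀ y, RegularR f g Φ Ψ y y) : IsSmoothSubmanifold modelV 2 (ramificationR f g Φ Ψ) := by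
  intro p
  obtain ⟨j⟩ : Nonempty ((((ℂ × ℂ) × ℂ) × EuclideanSpace ℝ (Fin 2)) ≃L[ℝ] Model × (ℂ × ℂ)) :=
    FiniteDimensional.nonempty_continuousLinearEquiv_of_finrank_eq (by
      rw [finrank_total]; simp [Module.finrank_prod, Complex.finrank_real_complex])
  obtain ⟨φ, hpφ, hφ, -⟩ := h.exists_positiveChart hr j p
  exact ⟨φ, hφ, hpφ⟩

/-- Two sign conventions are compared: the change of coordinates of the total space and the change
of the equations of `R` are complex linear at a point of `R`, hence both have positive real
determinant. The transition map of positive charts must then preserve orientation. -/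
lemma IsSmoothData.det_positiveChart (h : IsSmoothData f g Φ Ψ)
    {j : (((ℂ × ℂ) × ℂ) × EuclideanSpace ℝ (Fin 2)) ≃L[ℝ] Model × (ℂ × ℂ)} {x₀ x₁ : X}
    {B₀ B₁ : Model × (ℂ × ℂ) →L[ℝ] EuclideanSpace ℝ (Fin 2)}
    {φ ψ : OpenPartialHomeomorph (ramificationR f g Φ Ψ) (EuclideanSpace ℝ (Fin 2))}
    (hφs : IsSubmanifoldChart modelV φ)
    (hφ : IsPositiveChart L₁ L₂ j (locRam f g Φ Ψ x₀) x₀ B₀ φ)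
    (hψ : IsPositiveChart L₁ L₂ j (locRam f g Φ Ψ x₁) x₁ B₁ ψ)
    {p : ramificationR f g Φ Ψ} (hp : p ∈ φ.source ∩ ψ.source) :
    0 < (fderiv ℝ (fun a => ψ (φ.symm a)) (φ p)).det := by
  obtain ⟨h₀, hφp, hpos₀⟩ := hφ p hp.1
  obtain ⟨h₁, hψp, hpos₁⟩ := hψ p hp.2
  set a := φ p with ha
  have hat : a ∈ φ.target := φ.map_source hp.1
  have hsa : φ.symm a = p := φ.left_inv hp.1
  set σ : EuclideanSpace ℝ (Fin 2) → Model × (ℂ × ℂ) := fun b => totalChart L₁ L₂ x₀ (φ.symm b)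
    with hσ
  have hσa : σ a = totalChart L₁ L₂ x₀ p := by rw [hσ]; simp only [hsa]
  have hσd : DifferentiableAt ℝ σ a := by
    have h1 : MDifferentiableAt 𝓘(ℝ, EuclideanSpace ℝ (Fin 2)) modelV
        (fun b => (φ.symm b : TotalV L₁ L₂)) a :=
      ((hφs.1 a hat).contMDiffAt (φ.open_target.mem_nhds hat)).mdifferentiableAt (by simp)
    have hsrc : (φ.symm a : TotalV L₁ L₂) ∈
        (chartAt (ModelProd Model (ℂ × ℂ)) (⟨x₀, 0⟩ : TotalV L₁ L₂)).source := by
      rw [← extChartAt_source (I := modelV), hsa]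
      exact mem_totalChart_source.2 h₀
    have h2 : MDifferentiableAt modelV 𝓘(ℝ, Model × (ℂ × ℂ))
        (extChartAt modelV (⟨x₀, 0⟩ : TotalV L₁ L₂)) (φ.symm a : TotalV L₁ L₂) :=
      mdifferentiableAt_extChartAt hsrc
    exact mdifferentiableAt_iff_differentiableAt.1 (h2.comp a h1)
  have ev₀ : ∀ᶠ b in 𝓝 a, b ∈ φ.target := φ.open_target.mem_nhds hat
  have ev₁ : ∀ᶠ b in 𝓝 a, φ.symm b ∈ ψ.source := by
    refine (φ.symm.continuousAt hat).eventually_mem (ψ.open_source.mem_nhds ?_)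
    rw [hsa]; exact hp.2
  have hp₀ : totalChart L₁ L₂ x₀ p = (chartAt Model x₀ p.1.proj,
      (fibreCoord L₁ x₀ p.1.proj p.1.2.1, fibreCoord L₂ x₀ p.1.proj p.1.2.2)) := totalChart_apply h₀
  have hp₁ : totalChange L₁ L₂ x₀ x₁ (totalChart L₁ L₂ x₀ p) = totalChart L₁ L₂ x₁ p :=
    totalChange_totalChart h₀ h₁
  have dH : DifferentiableAt ℝ (locRam f g Φ Ψ x₀) (σ a) := by
    rw [hσa, hp₀]; exact (h.hasFDerivAt_locRam h₀ _).differentiableAt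
  have dκ : HasFDerivAt (totalChange L₁ L₂ x₀ x₁)
      ((fderiv ℂ (totalChange L₁ L₂ x₀ x₁) (totalChart L₁ L₂ x₀ p)).restrictScalars ℝ) (σ a) := by
    rw [hσa, hp₀]
    exact ((contDiffAt_totalChange h₀ h₁ _).differentiableAt (by simp)).hasFDerivAt.restrictScalars ℝ
  -- the derivatives of the equations along the chart
  have e1 : (fderiv ℝ (locRam f g Φ Ψ x₀) (totalChart L₁ L₂ x₀ p)).comp (fderiv ℝ σ a) = 0 := by
    have hz : (locRam f g Φ Ψ x₀ ∘ σ) =ᶠ[𝓝 a] fun _ => 0 := by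
      filter_upwards [ev₀] with b hb
      exact (mem_ramificationR_iff_locRam (hφ _ (φ.map_target hb)).1).1 (φ.symm b).2
    have := fderiv_comp (𝕜 := ℝ) a (g := locRam f g Φ Ψ x₀) (f := σ) dH hσd
    rw [hz.fderiv_eq, hσa] at this
    rw [← this]; simp
  have e2 : B₀.comp (fderiv ℝ σ a) = ContinuousLinearMap.id ℝ _ := by
    have hz : (B₀ ∘ σ) =ᶠ[𝓝 a] id := by
      filter_upwards [ev₀] with b hb
      have := (hφ _ (φ.map_target hb)).2.1
      rw [φ.right_inv hb] at this
      exact this.symm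
    have := fderiv_comp (𝕜 := ℝ) a (g := B₀) (f := σ) B₀.differentiableAt hσd
    rw [hz.fderiv_eq, B₀.fderiv, fderiv_id] at this
    exact this.symm
  have e3 : fderiv ℝ (fun b => ψ (φ.symm b)) a = B₁.comp
      (((fderiv ℂ (totalChange L₁ L₂ x₀ x₁) (totalChart L₁ L₂ x₀ p)).restrictScalars ℝ).comp
        (fderiv ℝ σ a)) := by
    have hz : (fun b => ψ (φ.symm b)) =ᶠ[𝓝 a] fun b => B₁ (totalChange L₁ L₂ x₀ x₁ (σ b)) := by
      filter_upwards [ev₀, ev₁] with b hb₀ hb₁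
      obtain ⟨k1, k2, -⟩ := hψ _ hb₁
      rw [k2, hσ]
      simp only
      rw [totalChange_totalChart (hφ _ (φ.map_target hb₀)).1 k1]
    rw [hz.fderiv_eq]
    exact (B₁.hasFDerivAt.comp a (dκ.comp a hσd.hasFDerivAt)).fderiv
  rw [e3]
  refine det_transition_pos j.toLinearEquiv
    (T₀ := ((fderiv ℝ (locRam f g Φ Ψ x₀) (totalChart L₁ L₂ x₀ p)).prod B₀).toLinearMap)
    (T₁ := ((fderiv ℝ (locRam f g Φ Ψ x₁) (totalChart L₁ L₂ x₁ p)).prod B₁).toLinearMap)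
    (K := (fderiv ℂ (totalChange L₁ L₂ x₀ x₁) (totalChart L₁ L₂ x₀ p)).toLinearMap.restrictScalars ℝ)
    (A := (ramScale (transition L₁ x₀ x₁ p.1.proj) (transition L₂ x₀ x₁ p.1.proj)).restrictScalars ℝ)
    (S := (fderiv ℝ σ a).toLinearMap) hpos₀ hpos₁
    (det_restrictScalars_pos ?_) (det_restrictScalars_pos (ramScale_bijective
      (transition_ne_zero h₀.2.1 h₁.2.1) (transition_ne_zero h₀.2.2 h₁.2.2)))
    (fun ξ => ?_) (fun y => ?_) (fun y => rfl)
  · rw [hp₀]; exact fderiv_totalChange_bijective h₀ h₁ _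
  · have hz : locRam f g Φ Ψ x₁ (totalChart L₁ L₂ x₁ p) = 0 :=
      (mem_ramificationR_iff_locRam h₁).1 p.2
    rw [← hp₁, hp₀] at hz
    have := h.fderiv_locRam_change h₀ h₁ _ hz ξ
    rw [← hp₀, hp₁] at this
    exact this
  · exact Prod.ext (DFunLike.congr_fun e1 y) (DFunLike.congr_fun e2 y)

theorem isOrientableSubmanifold_ramificationR (h : IsSmoothData f g Φ Ψ)
    (hr : ∀ y, RegularR f g Φ Ψ y y) :
    IsOrientableSubmanifold modelV 2 (ramificationR f g Φ Ψ) := by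
  -- Any fixed isomorphism serves as reference orientation of the model; only relative signs matter.
  obtain ⟨j⟩ : Nonempty ((((ℂ × ℂ) × ℂ) × EuclideanSpace ℝ (Fin 2)) ≃L[ℝ] Model × (ℂ × ℂ)) :=
    FiniteDimensional.nonempty_continuousLinearEquiv_of_finrank_eq (by
      rw [finrank_total]; simp [Module.finrank_prod, Complex.finrank_real_complex])
  refine ⟨{φ | IsSubmanifoldChart modelV φ ∧
    ∃ x₀ B, IsPositiveChart L₁ L₂ j (locRam f g Φ Ψ x₀) x₀ B φ}, fun φ hφ => hφ.1, fun p => ?_, ?_⟩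
  · obtain ⟨φ, hpφ, hφ, B, hB⟩ := h.exists_positiveChart hr j p
    exact ⟨φ, ⟨hφ, _, B, hB⟩, hpφ⟩
  · rintro φ ⟨hφs, x₀, B₀, hφ⟩ ψ ⟨-, x₁, B₁, hψ⟩ p hp
    exact h.det_positiveChart hφs hφ hψ hp

end Cover

end BidoubleCover

end

/-! ### Assembly of the global statement. -/

theorem mainTheorem8
    {X : Type*} [TopologicalSpace X] [T2Space X] [CompactSpace X]
    [ChartedSpace Model X] [IsManifold 𝓘(ℂ, Model) ω X]
    (L₁ : X → Type*) [∀ x, AddCommGroup (L₁ x)] [∀ x, Module ℂ (L₁ x)]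
    [∀ x, TopologicalSpace (L₁ x)] [TopologicalSpace (TotalSpace ℂ L₁)]
    [FiberBundle ℂ L₁] [VectorBundle ℂ ℂ L₁] [ContMDiffVectorBundle ω ℂ L₁ 𝓘(ℂ, Model)]
    (L₂ : X → Type*) [∀ x, AddCommGroup (L₂ x)] [∀ x, Module ℂ (L₂ x)]
    [∀ x, TopologicalSpace (L₂ x)] [TopologicalSpace (TotalSpace ℂ L₂)]
    [FiberBundle ℂ L₂] [VectorBundle ℂ ℂ L₂] [ContMDiffVectorBundle ω ℂ L₂ 𝓘(ℂ, Model)]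
    (f : ∀ x, L₁ x ⊗[ℂ] L₁ x) (hf : IsHolomorphicSection f) (hf_smooth : IsSmoothDivisor f)
    (g : ∀ x, L₂ x ⊗[ℂ] L₂ x) (hg : IsHolomorphicSection g) (hg_smooth : IsSmoothDivisor g)
    (M : Set X) (hM : M = {x | f x = 0 ∧ g x = 0})
    (hfg : ∀ x ∈ M, IsTransverseAt (sqRep f x) (sqRep g x) x)
    (m : ℕ) (hm : M.encard = m)
    (U : X → Set X) (hU : ∀ x ∈ M, IsOpen (U x) ∧ x ∈ U x) (hU_disj : M.PairwiseDisjoint U)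
    (𝒦 : C1Cover L₁ L₂) (c : ℝ) (hc : 0 < c) :
    ∃ ε : ℝ, 0 < ε ∧
      ∀ (Φ : ∀ x, L₂ x →ₗ[ℂ] L₁ x ⊗[ℂ] L₁ x) (Ψ : ∀ x, L₁ x →ₗ[ℂ] L₂ x ⊗[ℂ] L₂ x) (N N' : ℝ),
        IsSmoothSection Φ → IsSmoothSection Ψ → N < ε → N' < ε →
        𝒦.NormLE (homRep Φ) N → 𝒦.NormLE (homRep Ψ) N' →
        -- the covering
        IsSmoothSubmanifold modelV 4 (coverZ f g Φ Ψ) ∧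
        IsBranchedCoverOfDegreeFour f g Φ Ψ ∧
        criticalSetZ f g Φ Ψ = ramificationR f g Φ Ψ ∧
        (∀ x₀, ∀ y ∈ baseSetAt L₁ x₀ ∩ baseSetAt L₂ x₀,
          y ∈ branchDelta f g Φ Ψ ↔ deltaRep f g Φ Ψ x₀ y = 0) ∧
        (MildlyGeneral f g Φ Ψ →
          -- the trivial singularities
          trivialSing f g Φ Ψ ⊆ singDelta f g Φ Ψ ∧
          (∀ x, f x = 0 → Φ x = 0 → IsTransverseAt (sqRep f x) (homRep Φ x) x →
            HasNodeAt (deltaRep f g Φ Ψ x) x) ∧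
          (∀ x, g x = 0 → Ψ x = 0 → IsTransverseAt (sqRep g x) (homRep Ψ x) x →
            HasNodeAt (deltaRep f g Φ Ψ x) x) ∧
          -- the other singularities lie near `M`
          singDelta f g Φ Ψ \ trivialSing f g Φ Ψ ⊆ ⋃ x ∈ M, U x ∧
          -- smoothness of the ramification divisor, and the cusps
          (𝒦.AbsGE (homRep Φ) M (c * N) → 𝒦.AbsGE (homRep Ψ) M (c * N') →
            IsSmoothSubmanifold modelV 2 (ramificationR f g Φ Ψ) ∧
            IsOrientableSubmanifold modelV 2 (ramificationR f g Φ Ψ) ∧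
            (∀ x ∈ singDelta f g Φ Ψ \ trivialSing f g Φ Ψ, HasCuspAt (deltaRep f g Φ Ψ x) x) ∧
            (∀ x ∈ M, ((singDelta f g Φ Ψ \ trivialSing f g Φ Ψ) ∩ U x).encard = 3) ∧
            (singDelta f g Φ Ψ \ trivialSing f g Φ Ψ).encard = 3 * m)) := by
  have hfg' : ∀ x, f x = 0 → g x = 0 → IsTransverseAt (sqRep f x) (sqRep g x) x :=
    fun x h h' => hfg x (by rw [hM]; exact ⟨h, h'⟩)
  have hM' : ∀ x ∈ M, f x = 0 ∧ g x = 0 := fun x hx => by rw [hM] at hx; exact hx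
  have hMf : M.Finite := finite_of_encard_eq_coe hm
  -- Smaller neighbourhoods `W x ⊆ U x` carry the local analysis; outside `M` the set is irrelevant
  -- and taken empty.
  have hnear : ∀ x, ∃ W : Set X, x ∈ M → W ∈ 𝓝 x ∧ W ⊆ U x ∧
      ∀ᶠ t in Perturbation.small 𝒦, (∀ y, RegularZ f g t.Φ t.Ψ y y) → t.Φ x ≠ 0 →
        t.Ψ x ≠ 0 → 𝒦.AbsGE (homRep t.Φ) M (c * t.N) → 𝒦.AbsGE (homRep t.Ψ) M (c * t.N') →
        (∀ y ∈ W, RegularR f g t.Φ t.Ψ y y) ∧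
        (∀ y ∈ W, y ∈ singDelta f g t.Φ t.Ψ \ trivialSing f g t.Φ t.Ψ →
          HasCuspAt (deltaRep f g t.Φ t.Ψ y) y) ∧
        ((singDelta f g t.Φ t.Ψ \ trivialSing f g t.Φ t.Ψ) ∩ W).encard = 3 := by
    intro x
    by_cases hx : x ∈ M
    · obtain ⟨W, hW, hWU, hW'⟩ := Perturbation.exists_near (𝒦 := 𝒦) hf hg hfg' M hc hx
        (hM' x hx).1 (hM' x hx).2 ((hU x hx).1.mem_nhds (hU x hx).2)
      exact ⟨W, fun _ => ⟨hW, hWU, hW'⟩⟩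
    · exact ⟨∅, fun h => absurd h hx⟩
  choose W hW using hnear
  have hoff := Perturbation.eventually_off (𝒦 := 𝒦) hf hg hf_smooth hg_smooth (W := W)
    fun x h h' => (hW x (by rw [hM]; exact ⟨h, h'⟩)).1
  have hall := (Filter.eventually_all_finite hMf).2 fun x hx => (hW x hx).2.2
  obtain ⟨ε, hε, hp⟩ := Perturbation.exists_of_eventually
    ((Perturbation.eventually_regularZ 𝒦 hf hg hf_smooth hg_smooth hfg').and (hoff.and hall))
  refine ⟨ε, hε, fun Φ Ψ N N' hΦ hΨ hN hN' hΦN hΨN => ?_⟩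
  obtain ⟨hr, hoff, hall⟩ := hp ⟨Φ, Ψ, N, N', hΦ, hΨ, hΦN, hΨN⟩ hN hN'
  have h : IsSmoothData f g Φ Ψ := ⟨hf, hg, hΦ, hΨ⟩
  simp only at hr hoff hall
  have hloc : ∀ y ∈ singDelta f g Φ Ψ \ trivialSing f g Φ Ψ, ∃ x ∈ M, y ∈ W x := by
    intro y hy
    rcases hoff y with ⟨x, hx, hyx⟩ | h'
    · exact ⟨x, by rw [hM]; exact hx, hyx⟩
    · exact absurd hy (h'.2 hr)
  refine ⟨isSmoothSubmanifold_coverZ h hr, isBranchedCover 𝒦 h hr,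
    criticalSetZ_eq_ramificationR h hr, fun x₀ y hy => mem_branchDelta_iff h hr hy.1 hy.2,
    fun hmg => ⟨h.trivialSing_subset_singDelta hr,
      fun x h0 h0' ht => h.hasNodeAt_left h0 h0' ((hmg x).1 h0 h0').1 ht,
      fun x h0 h0' ht => h.hasNodeAt_right h0 h0' ((hmg x).2 h0 h0').1 ht, fun y hy => ?_,
      fun hA hA' => ?_⟩⟩
  · obtain ⟨x, hx, hyx⟩ := hloc y hy
    exact mem_biUnion hx ((hW x hx).2.1 hyx)
  have hloc' : ∀ x ∈ M, (∀ y ∈ W x, RegularR f g Φ Ψ y y) ∧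
      (∀ y ∈ W x, y ∈ singDelta f g Φ Ψ \ trivialSing f g Φ Ψ →
        HasCuspAt (deltaRep f g Φ Ψ y) y) ∧
      ((singDelta f g Φ Ψ \ trivialSing f g Φ Ψ) ∩ W x).encard = 3 := by
    intro x hx
    obtain ⟨h1, h2⟩ := hM' x hx
    -- Mild generality makes `Φ` and `Ψ` nonzero on `M`, where `f = g = 0`, as the local analysis
    -- requires.
    exact hall x hx hr (fun h0 => ((hmg x).1 h1 h0).1 h2) (fun h0 => ((hmg x).2 h2 h0).1 h1) hA hA'
  have hR : ∀ y, RegularR f g Φ Ψ y y := by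
    intro y
    rcases hoff y with ⟨x, hx, hyx⟩ | h'
    · exact (hloc' x (by rw [hM]; exact hx)).1 y hyx
    · exact h'.1
  -- A nontrivial singular point lies in some `W x' ⊆ U x'`; since the `U x` are disjoint, one lying
  -- in `U x` already lies in `W x`, and the count in `W x` is the count in `U x`.
  have hUW : ∀ x ∈ M, (singDelta f g Φ Ψ \ trivialSing f g Φ Ψ) ∩ U x =
      (singDelta f g Φ Ψ \ trivialSing f g Φ Ψ) ∩ W x := by
    intro x hx
    refine Subset.antisymm (fun y hy => ⟨hy.1, ?_⟩) (inter_subset_inter_right _ (hW x hx).2.1)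
    obtain ⟨x', hx', hyx'⟩ := hloc y hy.1
    have : x = x' := by
      by_contra hne
      exact disjoint_left.1 (hU_disj hx hx' hne) hy.2 ((hW x' hx').2.1 hyx')
    rw [this]; exact hyx'
  have hcard : ∀ x ∈ M, ((singDelta f g Φ Ψ \ trivialSing f g Φ Ψ) ∩ U x).encard = 3 :=
    fun x hx => by rw [hUW x hx]; exact (hloc' x hx).2.2
  refine ⟨isSmoothSubmanifold_ramificationR h hR, isOrientableSubmanifold_ramificationR h hR,
    fun y hy => ?_, hcard, ?_⟩
  · obtain ⟨x, hx, hyx⟩ := hloc y hy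
    exact (hloc' x hx).2.1 y hyx hy
  · have hcov : singDelta f g Φ Ψ \ trivialSing f g Φ Ψ =
        ⋃ x ∈ M, (singDelta f g Φ Ψ \ trivialSing f g Φ Ψ) ∩ U x := by
      ext y
      simp only [mem_iUnion, exists_prop]
      constructor
      · intro hy
        obtain ⟨x, hx, hyx⟩ := hloc y hy
        exact ⟨x, hx, hy, (hW x hx).2.1 hyx⟩
      · rintro ⟨x, -, hy, -⟩
        exact hy
    rw [hcov, hMf.encard_biUnion fun x hx x' hx' hne =>
      (hU_disj hx hx' hne).mono inter_subset_right inter_subset_right,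
      finsum_mem_eq_finite_toFinset_sum _ hMf,
      Finset.sum_congr rfl fun x hx => hcard x (hMf.mem_toFinset.1 hx), Finset.sum_const]
    rw [hMf.encard_eq_coe_toFinset_card] at hm
    have hm' : hMf.toFinset.card = m := by exact_mod_cast hm
    rw [hm', nsmul_eq_mul, mul_comm]
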